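/- **Conventions.** Let $V=\mathbb C^3$ with coordinates $x,y,z$, let $G\subset SL_3(\mathbb C)$ be a finite subgroup, $\mathbb C[V]^G$ its ring of invariants and $V/G$ its orbit space. For a homogeneous invariant $f$ of minimal positive degree let $\Omega_2$ be the contravariant metric given by the inverse of the Hessian of $f$; we say that $G$ *satisfies (F)* if for some such $f$ the Hessian is invertible and $\Omega_2$ is flat on a nonempty open set. Given algebraically independent invariants $u_1,u_2,u_3$, a vector field $X$ (either $\partial_{u_k}$ or $u_1^n\partial_{u_k}$), a function $\tau$ and a number $d$, we say that *Dubrovin's method yields a Frobenius structure* of charge $d$ on $V/G$ if there is a dense open $G$-stable $W\subset V$ on which $G$ acts freely such that on $W/G$: * $\Omega_2$ and $\Omega_1:=\mathcal L_X\Omega_2$ are flat nondegenerate metrics forming a flat pencil (for generic $\lambda$ the form $\Omega_2+\lambda\Omega_1$ is flat, with contravariant Christoffel symbols $\Gamma^{ij}_{2k}+\lambda\Gamma^{ij}_{1k}$) which is quasihomogeneous of degree $d$ and regular: with $E=\nabla_2\tau$ and $e=\nabla_1\tau=X$ one has $[e,E]=e$, $\mathcal L_E\Omega_2=(d-1)\Omega_2$,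 $\mathcal L_e\Omega_2=\Omega_1$, $\mathcal L_e\Omega_1=0$, and $R_i^j=\frac{d-1}{2}\delta_i^j+\nabla_{1i}E^j$ is invertible; * the metric $\Omega_1^{-1}$, the product on the tangent spaces dual under $\Omega_1$ to the product $\alpha\cdot\beta=\Delta(\alpha,R^{-1}\beta)$ of covectors, where $\Delta^{ijk}=\Omega_1^{jm}\Gamma_{2m}^{ik}-\Omega_2^{im}\Gamma_{1m}^{jk}$, the unity field $e$ and the Euler field $E$ form a Frobenius manifold of charge $d$ with intersection form $\Omega_2$. Two Frobenius manifolds are *locally equivalent* if a biholomorphism between nonempty open subsets multiplies the flat metric by a nonzero constant $c^2$ and its differential is an isomorphism of the algebras on the tangent spaces. A structure *is of type* $T$ if it has the charge of $T$ and is locally equivalent to $T$ by a map that also matches the Euler fields. The types are given by the following potentials $\mathbb F$ (with metric $\partial_e\partial_i\partial_j\mathbb F$), unity field $e$, degrees $(d_1,d_2,d_3)$ (so $E=\sum d_it_i\partial_{t_i}$) and charge $d$, on the open set where $\mathbb F$ is regular. In the first six $e=\partial_{t_3}$ and $\mathbb F=\frac12t_3^2t_1+\frac12t_2^2t_3+P$: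 * $A_3$: $P=\frac14t_1^2t_2^2+\frac1{60}t_1^5$; degrees $\frac12,\frac34,1$; $d=\frac12$. * $\widetilde A_3$: $P=\frac{t_2^4}{8t_1}+\frac{t_2^2}{4t_1^2}-\frac1{60t_1^3}$; degrees $-\frac12,\frac14,1$; $d=\frac32$. * $B_3$: $P=\frac16t_2^2t_1^3+\frac16t_2^3t_1+\frac1{210}t_1^7$; degrees $\frac13,\frac23,1$; $d=\frac23$. * $\widetilde B_3$: $P=\frac{t_2^4}{8t_1}+\frac{t_2^3}{6t_1^2}-\frac{t_2^2}{6t_1^3}-\frac1{210t_1^5}$; degrees $-\frac13,\frac13,1$; $d=\frac43$. * $H_3$: $P=\frac1{20}t_2^2t_1^5+\frac16t_2^3t_1^2+\frac1{3960}t_1^{11}$; degrees $\frac15,\frac35,1$; $d=\frac45$. * $\widetilde H_3$: $P=\frac{t_2^4}{8t_1}-\frac{t_2^3}{6t_1^3}-\frac{t_2^2}{20t_1^5}-\frac1{3960t_1^9}$; degrees $-\frac15,\frac25,1$; $d=\frac65$. * $B_3^1$: $\mathbb F=\frac12t_3^4+\frac32t_1t_2t_3+\frac18t_1^3+\frac1{16}\frac{t_2^3}{t_3}$;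 $e=\partial_{t_1}$; degrees $1,\frac54,\frac34$; $d=0$. * $T_3$: $\mathbb F=\frac12t_2^2t_1+\frac23t_1^3-t_2t_1^2+2t_3^2t_1-t_2t_3^2$; $e=\partial_{t_2}$; degrees $1,1,1$; $d=0$. **Theorem.** These eight are Frobenius manifolds, no two of which are locally equivalent. Let $G\subset SL_3(\mathbb C)$ be a finite subgroup whose ring of invariants is generated by one of the sets below (labels as in the list of Watanabe and Rotillon; all these rings are complete intersections). Then the following holds, where $p_n=x^n+y^n+z^n$, $e_2^{(n)}=x^ny^n+y^nz^n+z^nx^n$, $v_n=(x^n-y^n)(z^n-x^n)(y^n-z^n)$, each "type" is the type of the structure obtained from $f$ by Dubrovin's method with the stated $X$ and $\tau$, and the functions in brackets are local flat coordinates of $\Omega_1$, for suitable holomorphic branches of the powers. *Five structures for $n$:* $f=u_1=p_n$, $u_2=e_2^{(n)}$, $u_3=(xyz)^n$: $X=\partial_{u_3}$, $\tau=\frac{n-1}{3n}u_1$: type $B_3$, $[\frac{n-1}{3n}u_1,\ -\frac{u_1^2-4u_2}{6\sqrt2},\ \frac7{216}u_1^3-\frac16u_2u_1+u_3]$; $X=u_1^6\partial_{u_3}$,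 $\tau=-\frac{n-1}{3n}u_1$: type $\widetilde B_3$; $X=\partial_{u_2}$, $\tau=\frac{n-1}{2n}u_1$: type $A_3$, $[\frac{n-1}{2n}u_1,\ u_2-\frac18u_1^2,\ u_3^{1/2}]$; $X=u_1^4\partial_{u_2}$, $\tau=-\frac{n-1}{2n}u_1$: type $\widetilde A_3$; $X=\partial_{u_1}$, $\tau=\frac{n-1}nu_1$: type $B_3^1$, $[u_1,\ u_2u_3^{-1/4},\ \frac43u_3^{1/4}]$. *Trivial structure:* $f=u_1=p_2$, $u_2=z^2$, $u_3=x^2y^2$, $X=\partial_{u_2}$, $\tau=\frac12u_1$: type $T_3$, $[\frac12u_1,u_2,u_3^{1/2}]$. * **(1)** $x^m,y^m,z^m,xyz$ ($m>1$). $G$ satisfies (F) iff $m\le3$. For $m=2,3$ there are the five structures for $n=m$. For $m=2$ there is also the trivial structure; so this orbit space has six different structures, of types $A_3,\widetilde A_3,B_3,\widetilde B_3,B_3^1,T_3$. * **(2)** $x^{2m}+y^{2m},\ (xy)^2,\ xyz(x^{2m}-y^{2m}),\ z^2$ ($m\ge1$). $G$ satisfies (F) iff $m=1$; for $m=1$ there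 is the trivial structure. * **(9)** $xyz,\ p_m,\ e_2^{(m)},\ v_m$ ($m>1$). $G$ satisfies (F) iff $m\le3$; for $m=2,3$ there are the five structures for $n=m$. * **(11)** $u_1=p_m,\ u_2=(xyz)^2,\ u_3=e_2^{(m)},\ xyz\,v_m$ ($m>1$; $m$ is then necessarily even). $G$ satisfies (F) iff $m\le6$. For $m=2$ there are the five structures for $n=2$. For $3\le m\le6$, $f=u_1$: $X=\partial_{u_3}$, $\tau=\frac{m-1}{2m}u_1$: type $A_3$, $[\frac{m-1}{2m}u_1,\ u_2^{m/4},\ u_3-\frac18u_1^2]$; $X=u_1^4\partial_{u_3}$, $\tau=-\frac{m-1}{2m}u_1$: type $\widetilde A_3$; $X=\partial_{u_1}$, $\tau=\frac{m-1}mu_1$: type $B_3^1$, $[u_1,\ u_2^{m/8},\ u_3u_2^{-m/8}]$. * **(12)** $u_1=p_3^2-12e_2^{(3)}$, $u_2=(x^3-y^3)(y^3-z^3)(z^3-x^3)$, $u_3=p_3^4+216(xyz)^3p_3$, $(p_3^2-6xyz\,p_3-18(xyz)^2)^2$. $G$ satisfies (F), and with $f=u_1$: $X=\partial_{u_3}$,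 $\tau=\frac5{12}u_1$: type $A_3$, $[\frac5{12}u_1,\ 4\sqrt{10}\,i\,u_2,\ u_3-\frac58u_1^2]$; $X=u_1^4\partial_{u_3}$, $\tau=-\frac5{12}u_1$: type $\widetilde A_3$. * **(14)** $u_1=x^2+yz$, $u_2=8yzx^4-2y^2z^2x^2-(y^5+z^5)x+y^3z^3$, $u_3=y^{10}+6z^5y^5+20x^2z^4y^4-160x^4z^3y^3+320x^6z^2y^2+z^{10}-4x(y^5+z^5)(32x^4-20yzx^2+5y^2z^2)$, and the Jacobian determinant of $u_1,u_2,u_3$. $G$ satisfies (F), and with $f=u_1$: $X=\partial_{u_3}$, $\tau=\frac1{10}u_1$: type $H_3$, $[\frac1{10}u_1,\ \sqrt2u_2-\sqrt2u_1^3,\ 14u_1^5-20u_2u_1^2+u_3]$; $X=u_1^{10}\partial_{u_3}$, $\tau=-\frac1{10}u_1$: type $\widetilde H_3$. * **(18)** $x^{2pq}+y^{2pq},\ (xy)^{2q},\ (xyz)^2,\ (x^{2pq}-y^{2pq})xyz,\ z^{2q}$ ($p\ge1$, $q\ge2$). $G$ satisfies (F) iff $p=1$ and $q\in\{2,3\}$.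 In these cases put $f=u_1=p_{2q}$, $u_2=(xyz)^2$, $u_3=-2e_2^{(2q)}$: with $t_1=\frac{2q-1}{2q}u_1$, $t_2=\frac12z^{2q}$, $t_3=(xy)^q$, $X=\partial_{t_2}$, $\tau=t_1$: type $T_3$, $[t_1,t_2,t_3]$; with $t_1=\frac{2q-1}{2q}u_1$, $X=\partial_{t_1}$ (at fixed $u_2,u_3$), $\tau=t_1$: type $B_3^1$, $[t_1,\ u_2^{q/4},\ u_3u_2^{-q/4}]$; $X=\partial_{u_3}$, $\tau=\frac{2q-1}{4q}u_1$: type $A_3$, $[\frac{2q-1}{4q}u_1,\ \frac{2\sqrt{2q-1}}{\sqrt q}u_2^{q/2},\ u_3+\frac14u_1^2]$; $X=u_1^4\partial_{u_3}$, $\tau=-\frac{2q-1}{4q}u_1$: type $\widetilde A_3$. * **(26)** $p_{3m},\ (xyz)^2,\ x^{2m}y^m+x^my^{2m}+y^{2m}z^m+y^mz^{2m}+z^{2m}x^m+z^mx^{2m},\ xyz\,v_m,\ v_m^2$ ($m\ge2$ even). $G$ satisfies (F) iff $m=2$. For $m=2$ and $f=p_6$: with $s=p_{12}-\frac34p_6^2$,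 $X=\partial_s$ (at fixed $p_6$, $xyz$), $\tau=\frac5{12}p_6$: type $A_3$, $[\frac5{12}p_6,\ \sqrt{20/3}\,(xyz)^3,\ s]$; $X=p_6^4\partial_s$, $\tau=-\frac5{12}p_6$: type $\widetilde A_3$; with $t_1=\frac56p_6$, $X=\partial_{t_1}$ (at fixed $xyz$, $p_{12}-p_6^2$), $\tau=t_1$: type $B_3^1$, $[t_1,\ (xyz)^{3/2},\ -\frac56(xyz)^{-3/2}(p_{12}-p_6^2)]$. In total the eight types $A_3,B_3,H_3,B_3^1,T_3,\widetilde A_3,\widetilde B_3,\widetilde H_3$ occur. -/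

import Mathlib

noncomputable section

namespace FrobOrbit

open MvPolynomial Matrix

/-- The representation space `ℂ³`; it also serves as coordinate space. -/
abbrev V3 : Type := Fin 3 → ℂ

/-- Polynomial functions on `ℂ³`. -/
abbrev Poly : Type := MvPolynomial (Fin 3) ℂ

/-- `3 × 3` complex matrices. -/
abbrev Mat3 : Type := Matrix (Fin 3) (Fin 3) ℂ

/-- `SL₃(ℂ)`. -/
abbrev SL3 : Type := Matrix.SpecialLinearGroup (Fin 3) ℂ

/-- The polynomial function defined by `p`. -/
def ev (p : Poly) (x : V3) : ℂ := MvPolynomial.eval x p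

/-! ### Invariants -/

/-- The polynomial `x ↦ f (g x)`. -/
def subst (g : SL3) : Poly →ₐ[ℂ] Poly :=
  MvPolynomial.bind₁ fun i => ∑ j, MvPolynomial.C (g.1 i j) * MvPolynomial.X j

/-- The ring of `G`-invariant polynomials. -/
def invariantRing (G : Subgroup SL3) : Subalgebra ℂ Poly where
  carrier := {f | ∀ g ∈ G, subst g f = f}
  mul_mem' := fun ha hb g hg => by rw [map_mul, ha g hg, hb g hg]
  add_mem' := fun ha hb g hg => by rw [map_add, ha g hg, hb g hg]
  algebraMap_mem' := fun r g _ => (subst g).commutes r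

/-- `G` is a finite subgroup of `SL₃(ℂ)` whose ring of invariants is generated by `S`. -/
def FiniteWithInvariants (G : Subgroup SL3) (S : Set Poly) : Prop :=
  (G : Set SL3).Finite ∧ invariantRing G = Algebra.adjoin ℂ S

/-- `f` is a nonzero homogeneous invariant of minimal positive degree. -/
def IsMinimalDegreeInvariant (G : Subgroup SL3) (f : Poly) : Prop :=
  f ≠ 0 ∧ f ∈ invariantRing G ∧ ∃ n : ℕ, 0 < n ∧ f.IsHomogeneous n ∧
    ∀ (k : ℕ) (h : Poly), 0 < k → h ≠ 0 → h ∈ invariantRing G → h.IsHomogeneous k → n ≤ k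

/-! ### Tensor calculus in the linear coordinates of `ℂ³`

Matrix-valued functions represent tensors of rank two; all functions are holomorphic where they
are used. -/

/-- Partial derivative `∂ᵢ h`. -/
def pd (i : Fin 3) (h : V3 → ℂ) (x : V3) : ℂ := fderiv ℂ h x (Pi.single i 1)

/-- Jacobian matrix `∂ⱼ tⁱ`. -/
def jac (t : V3 → V3) (x : V3) : Mat3 := Matrix.of fun i j => pd j (fun y => t y i) x

/-- Christoffel symbols `Γᵏᵢⱼ` of a covariant metric `h`. -/
def christoffel (h : V3 → Mat3) (k i j : Fin 3) (x : V3) : ℂ :=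
  (1 / 2) * ∑ l, (h x)⁻¹ k l *
    (pd i (fun y => h y l j) x + pd j (fun y => h y l i) x - pd l (fun y => h y i j) x)

/-- Curvature tensor `Rˡₖᵢⱼ` of a covariant metric `h`. -/
def curvature (h : V3 → Mat3) (l k i j : Fin 3) (x : V3) : ℂ :=
  pd i (christoffel h l j k) x - pd j (christoffel h l i k) x
    + ∑ m, (christoffel h l i m x * christoffel h m j k x
      - christoffel h l j m x * christoffel h m i k x)

/-- The covariant metric inverse to a contravariant metric `g`. -/
def lower (g : V3 → Mat3) (x : V3) : Mat3 := (g x)⁻¹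

/-- Contravariant Christoffel symbols `Γⁱʲₖ = - gⁱᵐ Γʲₘₖ`. -/
def contraChristoffel (g : V3 → Mat3) (i j k : Fin 3) (x : V3) : ℂ :=
  - ∑ m, g x i m * christoffel (lower g) j m k x

/-- `g` is a nondegenerate holomorphic flat contravariant metric on `W`. -/
structure IsFlatContravariantMetric (W : Set V3) (g : V3 → Mat3) : Prop where
  holo : ∀ i j, DifferentiableOn ℂ (fun x => g x i j) W
  symm : ∀ x ∈ W, (g x).IsSymm
  nondeg : ∀ x ∈ W, (g x).det ≠ 0
  flat : ∀ x ∈ W, ∀ l k i j, curvature (lower g) l k i j x = 0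

/-- Lie bracket of vector fields. -/
def bracket (X Y : V3 → V3) (x : V3) : V3 := fun i =>
  ∑ m, (X x m * pd m (fun y => Y y i) x - Y x m * pd m (fun y => X y i) x)

/-- Lie derivative of a contravariant 2-tensor. -/
def lieContra (X : V3 → V3) (g : V3 → Mat3) (x : V3) : Mat3 := Matrix.of fun i j =>
  ∑ m, (X x m * pd m (fun y => g y i j) x
    - pd m (fun y => X y i) x * g x m j - g x i m * pd m (fun y => X y j) x)

/-- Lie derivative of a covariant 2-tensor. -/
def lieCo (X : V3 → V3) (h : V3 → Mat3) (x : V3) : Mat3 := Matrix.of fun i j =>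
  ∑ m, (X x m * pd m (fun y => h y i j) x
    + pd i (fun y => X y m) x * h x m j + h x i m * pd j (fun y => X y m) x)

/-- Gradient `gⁱʲ ∂ⱼ τ` with respect to a contravariant metric. -/
def grad (g : V3 → Mat3) (τ : V3 → ℂ) (x : V3) : V3 := fun i => ∑ j, g x i j * pd j τ x

/-- Covariant derivative `∇ᵢ Xʲ` for the Levi-Civita connection of the covariant metric `h`. -/
def covDeriv (h : V3 → Mat3) (X : V3 → V3) (i j : Fin 3) (x : V3) : ℂ :=
  pd i (fun y => X y j) x + ∑ m, christoffel h j i m x * X x m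

/-- Second covariant derivative `∇ₗ ∇ᵢ Xʲ`. -/
def covDeriv₂ (h : V3 → Mat3) (X : V3 → V3) (l i j : Fin 3) (x : V3) : ℂ :=
  pd l (covDeriv h X i j) x - ∑ m, christoffel h m l i x * covDeriv h X m j x
    + ∑ m, christoffel h j l m x * covDeriv h X i m x

/-! ### Flat pencils of metrics -/

/-- `Ω₂` and `Ω₁` form a flat pencil of metrics on `W`: for generic `s` the form `Ω₂ + s Ω₁` is
a flat metric (nondegenerate on a dense subset) and Christoffel symbols add up. -/
def IsFlatPencil (W : Set V3) (Ω₂ Ω₁ : V3 → Mat3) : Prop :=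
  IsFlatContravariantMetric W Ω₂ ∧ IsFlatContravariantMetric W Ω₁ ∧
  ∀ᶠ s : ℂ in Filter.cofinite,
    W ⊆ closure {x ∈ W | (Ω₂ x + s • Ω₁ x).det ≠ 0} ∧
    IsFlatContravariantMetric {x ∈ W | (Ω₂ x + s • Ω₁ x).det ≠ 0} (fun x => Ω₂ x + s • Ω₁ x) ∧
    ∀ x ∈ W, (Ω₂ x + s • Ω₁ x).det ≠ 0 → ∀ i j k,
      contraChristoffel (fun y => Ω₂ y + s • Ω₁ y) i j k x
        = contraChristoffel Ω₂ i j k x + s * contraChristoffel Ω₁ i j k x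

/-- The (1,1)-tensor `Rᵢʲ = (d - 1)/2 δᵢʲ + ∇₁ᵢ Eʲ`, with `E = ∇₂ τ`. -/
def regTensor (Ω₂ Ω₁ : V3 → Mat3) (τ : V3 → ℂ) (d : ℂ) (x : V3) : Mat3 := Matrix.of fun i j =>
  (if i = j then (d - 1) / 2 else 0) + covDeriv (lower Ω₁) (grad Ω₂ τ) i j x

/-- Regular quasihomogeneous flat pencil of metrics of degree `d` with function `τ`. -/
structure IsRegularQFPM (W : Set V3) (Ω₂ Ω₁ : V3 → Mat3) (τ : V3 → ℂ) (d : ℂ) : Prop where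
  pencil : IsFlatPencil W Ω₂ Ω₁
  holo : DifferentiableOn ℂ τ W
  bracket_eq : ∀ x ∈ W, bracket (grad Ω₁ τ) (grad Ω₂ τ) x = grad Ω₁ τ x
  lie_E : ∀ x ∈ W, lieContra (grad Ω₂ τ) Ω₂ x = (d - 1) • Ω₂ x
  lie_e : ∀ x ∈ W, lieContra (grad Ω₁ τ) Ω₂ x = Ω₁ x
  lie_e' : ∀ x ∈ W, lieContra (grad Ω₁ τ) Ω₁ x = 0
  regular : ∀ x ∈ W, (regTensor Ω₂ Ω₁ τ d x).det ≠ 0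

/-! ### Frobenius manifolds -/

/-- The tensors of a Frobenius manifold: flat metric, structure constants
(`mul x i j k` is the coefficient of `∂ₖ` in `∂ᵢ ∘ ∂ⱼ` at `x`), unity field, Euler field,
charge. -/
structure FrobData where
  metric : V3 → Mat3
  mul : V3 → Fin 3 → Fin 3 → Fin 3 → ℂ
  unity : V3 → V3
  euler : V3 → V3
  charge : ℂ

/-- The tensor `c(∂ᵢ, ∂ⱼ, ∂ₖ) = Π(∂ᵢ ∘ ∂ⱼ, ∂ₖ)`. -/
def FrobData.cub (M : FrobData) (i j k : Fin 3) (x : V3) : ℂ := ∑ m, M.mul x i j m * M.metric x m k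

/-- `∇ₗ c(∂ᵢ, ∂ⱼ, ∂ₖ)`. -/
def FrobData.covCub (M : FrobData) (l i j k : Fin 3) (x : V3) : ℂ :=
  pd l (M.cub i j k) x - ∑ m, (christoffel M.metric m l i x * M.cub m j k x
    + christoffel M.metric m l j x * M.cub i m k x + christoffel M.metric m l k x * M.cub i j m x)

/-- Lie derivative of the multiplication tensor along `X`. -/
def FrobData.lieMul (M : FrobData) (X : V3 → V3) (i j k : Fin 3) (x : V3) : ℂ :=
  ∑ m, (X x m * pd m (fun y => M.mul y i j k) x + pd i (fun y => X y m) x * M.mul x m j k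
    + pd j (fun y => X y m) x * M.mul x i m k - pd m (fun y => X y k) x * M.mul x i j m)

/-- `M` is a (complex) Frobenius manifold structure on the open set `W`. -/
structure IsFrobeniusManifold (W : Set V3) (M : FrobData) : Prop where
  isOpen : IsOpen W
  nonempty : W.Nonempty
  holo_metric : ∀ i j, DifferentiableOn ℂ (fun x => M.metric x i j) W
  holo_mul : ∀ i j k, DifferentiableOn ℂ (fun x => M.mul x i j k) W
  holo_unity : DifferentiableOn ℂ M.unity W
  holo_euler : DifferentiableOn ℂ M.euler W
  symm : ∀ x ∈ W, (M.metric x).IsSymm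
  nondeg : ∀ x ∈ W, (M.metric x).det ≠ 0
  flat : ∀ x ∈ W, ∀ l k i j, curvature M.metric l k i j x = 0
  mul_comm : ∀ x ∈ W, ∀ i j k, M.mul x i j k = M.mul x j i k
  mul_assoc : ∀ x ∈ W, ∀ i j k l,
    ∑ m, M.mul x i j m * M.mul x m k l = ∑ m, M.mul x j k m * M.mul x i m l
  unity_mul : ∀ x ∈ W, ∀ j k, ∑ i, M.unity x i * M.mul x i j k = if j = k then 1 else 0
  invariant : ∀ x ∈ W, ∀ i j k, M.cub i j k x = M.cub j k i x
  unity_flat : ∀ x ∈ W, ∀ i j, covDeriv M.metric M.unity i j x = 0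
  potential : ∀ x ∈ W, ∀ l i j k, M.covCub l i j k x = M.covCub i l j k x
  euler_affine : ∀ x ∈ W, ∀ l i j, covDeriv₂ M.metric M.euler l i j x = 0
  euler_unity : ∀ x ∈ W, bracket M.unity M.euler x = M.unity x
  euler_mul : ∀ x ∈ W, ∀ i j k, M.lieMul M.euler i j k x = M.mul x i j k
  euler_metric : ∀ x ∈ W, lieCo M.euler M.metric x = (2 - M.charge) • M.metric x

/-- Intersection form `(α, β) ↦ i_E (α · β)` on covectors. -/
def FrobData.intersectionForm (M : FrobData) (x : V3) : Mat3 := Matrix.of fun i j =>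
  ∑ k, ∑ a, M.euler x k * (M.metric x)⁻¹ i a * M.mul x a k j

/-- On `U`, the map `φ` is a biholomorphism onto its image that multiplies the flat metric by
`c²` and whose differential is an isomorphism of algebras. -/
def IsEquivalenceOn (U : Set V3) (φ : V3 → V3) (c : ℂ) (M M' : FrobData) : Prop :=
  DifferentiableOn ℂ φ U ∧ Set.InjOn φ U ∧ c ≠ 0 ∧ ∀ x ∈ U,
    (jac φ x).det ≠ 0 ∧
    (jac φ x)ᵀ * M'.metric (φ x) * jac φ x = c ^ 2 • M.metric x ∧
    ∀ i j k, ∑ m, jac φ x k m * M.mul x i j m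
      = ∑ a, ∑ b, jac φ x a i * jac φ x b j * M'.mul (φ x) a b k

/-- Local equivalence of the Frobenius manifolds `(W, M)` and `(W', M')`. -/
def LocallyEquivalent (W : Set V3) (M : FrobData) (W' : Set V3) (M' : FrobData) : Prop :=
  ∃ (U : Set V3) (φ : V3 → V3) (c : ℂ), IsOpen U ∧ U.Nonempty ∧ U ⊆ W ∧ Set.MapsTo φ U W' ∧
    IsEquivalenceOn U φ c M M'

/-- The Frobenius manifold with potential `F`, unity `∂ᵣ`, degrees `deg` and charge `d`. -/
def ofPotential (F : V3 → ℂ) (r : Fin 3) (deg : Fin 3 → ℂ) (d : ℂ) : FrobData where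
  metric := fun x => Matrix.of fun i j => pd r (pd i (pd j F)) x
  mul := fun x i j k =>
    ∑ p, (Matrix.of fun a b => pd r (pd a (pd b F)) x : Mat3)⁻¹ k p * pd p (pd i (pd j F)) x
  unity := fun _ => Pi.single r 1
  euler := fun x i => deg i * x i
  charge := d

/-- Names of the eight types; `A3d`, `B3d`, `H3d` are the duals of `A3`, `B3`, `H3`. -/
inductive FrobType
  | A3 | A3d | B3 | B3d | H3 | H3d | B31 | T3

/-- The potentials of the eight types, in flat coordinates `t 0, t 1, t 2`. -/
def FrobType.potential : FrobType → V3 → ℂ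
  | .A3, t => 1/2 * t 2 ^ 2 * t 0 + 1/2 * t 1 ^ 2 * t 2 + 1/4 * t 0 ^ 2 * t 1 ^ 2 + 1/60 * t 0 ^ 5
  | .A3d, t => 1/2 * t 2 ^ 2 * t 0 + 1/2 * t 1 ^ 2 * t 2 + t 1 ^ 4 / (8 * t 0)
      + t 1 ^ 2 / (4 * t 0 ^ 2) - 1 / (60 * t 0 ^ 3)
  | .B3, t => 1/2 * t 2 ^ 2 * t 0 + 1/2 * t 1 ^ 2 * t 2 + 1/6 * t 1 ^ 2 * t 0 ^ 3
      + 1/6 * t 1 ^ 3 * t 0 + 1/210 * t 0 ^ 7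
  | .B3d, t => 1/2 * t 2 ^ 2 * t 0 + 1/2 * t 1 ^ 2 * t 2 + t 1 ^ 4 / (8 * t 0)
      + t 1 ^ 3 / (6 * t 0 ^ 2) - t 1 ^ 2 / (6 * t 0 ^ 3) - 1 / (210 * t 0 ^ 5)
  | .H3, t => 1/2 * t 2 ^ 2 * t 0 + 1/2 * t 1 ^ 2 * t 2 + 1/20 * t 1 ^ 2 * t 0 ^ 5
      + 1/6 * t 1 ^ 3 * t 0 ^ 2 + 1/3960 * t 0 ^ 11
  | .H3d, t => 1/2 * t 2 ^ 2 * t 0 + 1/2 * t 1 ^ 2 * t 2 + t 1 ^ 4 / (8 * t 0)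
      - t 1 ^ 3 / (6 * t 0 ^ 3) - t 1 ^ 2 / (20 * t 0 ^ 5) - 1 / (3960 * t 0 ^ 9)
  | .B31, t => 1/2 * t 2 ^ 4 + 3/2 * t 0 * t 1 * t 2 + 1/8 * t 0 ^ 3 + 1/16 * (t 1 ^ 3 / t 2)
  | .T3, t => 1/2 * t 1 ^ 2 * t 0 + 2/3 * t 0 ^ 3 - t 1 * t 0 ^ 2 + 2 * t 2 ^ 2 * t 0
      - t 1 * t 2 ^ 2

/-- Index of the flat coordinate along the unity field. -/
def FrobType.unityIndex : FrobType → Fin 3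
  | .B31 => 0
  | .T3 => 1
  | _ => 2

/-- Degrees of the flat coordinates. -/
def FrobType.degrees : FrobType → Fin 3 → ℂ
  | .A3 => ![1/2, 3/4, 1]
  | .A3d => ![-1/2, 1/4, 1]
  | .B3 => ![1/3, 2/3, 1]
  | .B3d => ![-1/3, 1/3, 1]
  | .H3 => ![1/5, 3/5, 1]
  | .H3d => ![-1/5, 2/5, 1]
  | .B31 => ![1, 5/4, 3/4]
  | .T3 => ![1, 1, 1]

/-- Charges. -/
def FrobType.charge : FrobType → ℂ
  | .A3 => 1/2
  | .A3d => 3/2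
  | .B3 => 2/3
  | .B3d => 4/3
  | .H3 => 4/5
  | .H3d => 6/5
  | .B31 => 0
  | .T3 => 0

/-- The open subset of `ℂ³` on which the potential is holomorphic. -/
def FrobType.domain : FrobType → Set V3
  | .A3d | .B3d | .H3d => {t | t 0 ≠ 0}
  | .B31 => {t | t 2 ≠ 0}
  | _ => Set.univ

/-- The model Frobenius manifold of a type. -/
def FrobType.model (T : FrobType) : FrobData :=
  ofPotential T.potential T.unityIndex T.degrees T.charge

/-- `(W, M)` is of type `T`: it has the charge of the model and is locally equivalent to it,
by an equivalence that also matches the Euler fields (hence the degrees). -/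
def IsOfType (W : Set V3) (M : FrobData) (T : FrobType) : Prop :=
  M.charge = T.charge ∧
  ∃ (U : Set V3) (φ : V3 → V3) (c : ℂ), IsOpen U ∧ U.Nonempty ∧ U ⊆ W ∧
    Set.MapsTo φ U T.domain ∧ IsEquivalenceOn U φ c M T.model ∧
    ∀ x ∈ U, jac φ x *ᵥ M.euler x = T.model.euler (φ x)

/-! ### Dubrovin's method -/

/-- Hessian matrix of a polynomial. -/
def hessian (f : Poly) (x : V3) : Mat3 := Matrix.of fun i j => ev (pderiv i (pderiv j f)) x

/-- The contravariant metric defined by the inverse of the Hessian of `f`. -/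
def hessMetric (f : Poly) (x : V3) : Mat3 := (hessian f x)⁻¹

/-- Some invariant of minimal positive degree has a Hessian whose inverse is a flat contravariant
metric on a nonempty open set. -/
def HasFlatHessian (G : Subgroup SL3) : Prop :=
  ∃ f : Poly, IsMinimalDegreeInvariant G f ∧
    ∃ U : Set V3, IsOpen U ∧ U.Nonempty ∧ IsFlatContravariantMetric U (hessMetric f)

/-- The vector field `∂/∂uₖ` of the local coordinate system `u = (u₀, u₁, u₂)`. -/
def coordField (u : Fin 3 → Poly) (k : Fin 3) (x : V3) : V3 := fun i =>
  (Matrix.of fun a b => ev (pderiv b (u a)) x : Mat3)⁻¹ i k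

/-- The vector field `u₀ⁿ ∂/∂uₖ`, which is the unity field of the dual structure. -/
def dualField (u : Fin 3 → Poly) (k : Fin 3) (n : ℕ) (x : V3) : V3 :=
  ev (u 0) x ^ n • coordField u k x

/-- The tensor `Δⁱʲᵏ = Ω₁ʲᵐ Γ₂ⁱᵏₘ - Ω₂ⁱᵐ Γ₁ʲᵏₘ`. -/
def deltaTensor (Ω₂ Ω₁ : V3 → Mat3) (i j k : Fin 3) (x : V3) : ℂ :=
  ∑ m, (Ω₁ x j m * contraChristoffel Ω₂ i k m x - Ω₂ x i m * contraChristoffel Ω₁ j k m x)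

/-- The Frobenius structure of a regular quasihomogeneous flat pencil: the flat metric is the
inverse of `Ω₁`, the product is dual under `Ω₁` to the product `α · β = Δ(α, R⁻¹ β)` of
covectors, and unity and Euler field are the gradients of `τ`. -/
def pencilFrobenius (Ω₂ Ω₁ : V3 → Mat3) (τ : V3 → ℂ) (d : ℂ) : FrobData where
  metric := lower Ω₁
  mul := fun x a b i => ∑ j, ∑ k, deltaTensor Ω₂ Ω₁ i j k x * lower Ω₁ x j a *
    ((regTensor Ω₂ Ω₁ τ d x)⁻¹ * lower Ω₁ x) k b
  unity := grad Ω₁ τ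
  euler := grad Ω₂ τ
  charge := d

/-- `Ω₁ = L_X Ω₂`, where `Ω₂` is the inverse of the Hessian of `f`. -/
def flatMetric (f : Poly) (X : V3 → V3) : V3 → Mat3 := lieContra X (hessMetric f)

/-- The Frobenius structure obtained from `f`, the vector field `X` and the function `τ`. -/
def orbitFrobenius (f : Poly) (X : V3 → V3) (τ : V3 → ℂ) (d : ℂ) : FrobData :=
  pencilFrobenius (hessMetric f) (flatMetric f X) τ d

/-- The tensors of `M` are invariant under `G` on `W`, hence descend to `W/G`. -/
def IsInvariantUnder (G : Subgroup SL3) (W : Set V3) (M : FrobData) : Prop :=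
  ∀ g ∈ G, ∀ x ∈ W,
    g.1ᵀ * M.metric (g.1 *ᵥ x) * g.1 = M.metric x ∧
    (∀ i j k, ∑ m, g.1 k m * M.mul x i j m
      = ∑ a, ∑ b, g.1 a i * g.1 b j * M.mul (g.1 *ᵥ x) a b k) ∧
    M.unity (g.1 *ᵥ x) = g.1 *ᵥ M.unity x ∧
    M.euler (g.1 *ᵥ x) = g.1 *ᵥ M.euler x

/-- Dubrovin's method, applied to the minimal degree invariant `f`, the vector field `X` and the
function `τ`, yields a Frobenius structure of type `T` on the open subset `W/G` of the orbit
space. Here `W` is a `G`-stable dense open subset of `ℂ³` on which `G` acts freely, so that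
`W → W/G` is a local biholomorphism and tensors on `W/G` are `G`-invariant tensors on `W`. -/
structure DubrovinYields (G : Subgroup SL3) (f : Poly) (X : V3 → V3) (τ : V3 → ℂ) (T : FrobType)
    (W : Set V3) : Prop where
  minimal : IsMinimalDegreeInvariant G f
  isOpen : IsOpen W
  dense : Dense W
  stable : ∀ g ∈ G, ∀ x ∈ W, g.1 *ᵥ x ∈ W
  free : ∀ g ∈ G, g ≠ 1 → ∀ x ∈ W, g.1 *ᵥ x ≠ x
  pencil : IsRegularQFPM W (hessMetric f) (flatMetric f X) τ T.charge
  unity : ∀ x ∈ W, grad (flatMetric f X) τ x = X x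
  frobenius : IsFrobeniusManifold W (orbitFrobenius f X τ T.charge)
  intersection : ∀ x ∈ W,
    (orbitFrobenius f X τ T.charge).intersectionForm x = hessMetric f x
  invariant : IsInvariantUnder G W (orbitFrobenius f X τ T.charge)
  ofType : IsOfType W (orbitFrobenius f X τ T.charge) T

/-- `t` is a coordinate system on `N` in which the contravariant metric `g` is constant. -/
def IsFlatChart (N : Set V3) (g : V3 → Mat3) (t : V3 → V3) : Prop :=
  DifferentiableOn ℂ t N ∧ Set.InjOn t N ∧ (∀ x ∈ N, (jac t x).det ≠ 0) ∧
    ∃ A : Mat3, ∀ x ∈ N, jac t x * g x * (jac t x)ᵀ = A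

/-- Near every point of `W`, the functions `t` are flat coordinates of `g`. -/
def FlatCoordinates (W : Set V3) (g : V3 → Mat3) (t : V3 → V3) : Prop :=
  ∀ p ∈ W, ∃ N : Set V3, IsOpen N ∧ p ∈ N ∧ N ⊆ W ∧ IsFlatChart N g t

/-- Near every point of `W` there is a holomorphic branch `ℓ` of `log b` such that
`x ↦ t x (ℓ x)` are flat coordinates of `g`; powers `b ^ a` enter `t` as `exp (a ℓ)`. -/
def FlatCoordinatesLog (W : Set V3) (g : V3 → Mat3) (b : Poly) (t : V3 → ℂ → V3) : Prop :=
  ∀ p ∈ W, ∃ N : Set V3, IsOpen N ∧ p ∈ N ∧ N ⊆ W ∧ ∃ l : V3 → ℂ, DifferentiableOn ℂ l N ∧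
    (∀ x ∈ N, Complex.exp (l x) = ev b x) ∧ IsFlatChart N g (fun x => t x (l x))

/-- The method yields a structure of type `T` on the orbit space. -/
def Yields (G : Subgroup SL3) (f : Poly) (X : V3 → V3) (τ : V3 → ℂ) (T : FrobType) : Prop :=
  ∃ W : Set V3, DubrovinYields G f X τ T W

/-- The method yields a structure of type `T`, with flat coordinates `t`. -/
def YieldsFlat (G : Subgroup SL3) (f : Poly) (X : V3 → V3) (τ : V3 → ℂ) (T : FrobType)
    (t : V3 → V3) : Prop :=
  ∃ W : Set V3, DubrovinYields G f X τ T W ∧ FlatCoordinates W (flatMetric f X) t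

/-- The method yields a structure of type `T`, with flat coordinates `t` involving powers of
`b`. -/
def YieldsFlatLog (G : Subgroup SL3) (f : Poly) (X : V3 → V3) (τ : V3 → ℂ) (T : FrobType)
    (b : Poly) (t : V3 → ℂ → V3) : Prop :=
  ∃ W : Set V3, DubrovinYields G f X τ T W ∧ FlatCoordinatesLog W (flatMetric f X) b t

/-! ### Invariants of the individual groups -/

/-- `xᵐ + yᵐ + zᵐ`. -/
def e1 (m : ℕ) : Poly := X 0 ^ m + X 1 ^ m + X 2 ^ m

/-- `xᵐyᵐ + yᵐzᵐ + zᵐxᵐ`. -/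
def e2 (m : ℕ) : Poly := X 0 ^ m * X 1 ^ m + X 1 ^ m * X 2 ^ m + X 2 ^ m * X 0 ^ m

/-- `xyz`. -/
def xyz : Poly := X 0 * X 1 * X 2

/-- `(xᵐ - yᵐ)(zᵐ - xᵐ)(yᵐ - zᵐ)`. -/
def vdm (m : ℕ) : Poly :=
  (X 0 ^ m - X 1 ^ m) * (X 2 ^ m - X 0 ^ m) * (X 1 ^ m - X 2 ^ m)

/-- Elementary symmetric polynomials of `xᵐ, yᵐ, zᵐ`. -/
def symm3 (m : ℕ) : Fin 3 → Poly := ![e1 m, e2 m, xyz ^ m]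

/-- Generators of the invariant rings of family (1) of the Watanabe-Rotillon list. -/
def gens1 (m : ℕ) : Set Poly := {X 0 ^ m, X 1 ^ m, X 2 ^ m, xyz}

/-- Generators of the invariant rings of family (2) of the Watanabe-Rotillon list. -/
def gens2 (m : ℕ) : Set Poly :=
  {X 0 ^ (2 * m) + X 1 ^ (2 * m), (X 0 * X 1) ^ 2, xyz * (X 0 ^ (2 * m) - X 1 ^ (2 * m)), X 2 ^ 2}

/-- Generators of the invariant rings of family (9) of the Watanabe-Rotillon list. -/
def gens9 (m : ℕ) : Set Poly := {xyz, e1 m, e2 m, vdm m}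

/-- Generators of the invariant rings of family (11) of the Watanabe-Rotillon list. -/
def gens11 (m : ℕ) : Set Poly := {e1 m, xyz ^ 2, e2 m, xyz * vdm m}

/-- The first three basic invariants of group (12) of the Watanabe-Rotillon list. -/
def u12 : Fin 3 → Poly :=
  ![e1 3 ^ 2 - 12 * e2 3,
    (X 0 ^ 3 - X 1 ^ 3) * (X 1 ^ 3 - X 2 ^ 3) * (X 2 ^ 3 - X 0 ^ 3),
    e1 3 ^ 4 + 216 * xyz ^ 3 * e1 3]

/-- Generators of the invariant ring of group (12) of the Watanabe-Rotillon list. -/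
def gens12 : Set Poly :=
  {u12 0, u12 1, u12 2, (e1 3 ^ 2 - 6 * xyz * e1 3 - 18 * xyz ^ 2) ^ 2}

/-- The first three basic invariants of group (14) of the Watanabe-Rotillon list. -/
def u14 : Fin 3 → Poly :=
  ![X 0 ^ 2 + X 1 * X 2,
    8 * X 1 * X 2 * X 0 ^ 4 - 2 * X 1 ^ 2 * X 2 ^ 2 * X 0 ^ 2 - (X 1 ^ 5 + X 2 ^ 5) * X 0
      + X 1 ^ 3 * X 2 ^ 3,
    X 1 ^ 10 + 6 * X 2 ^ 5 * X 1 ^ 5 + 20 * X 0 ^ 2 * X 2 ^ 4 * X 1 ^ 4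
      - 160 * X 0 ^ 4 * X 2 ^ 3 * X 1 ^ 3 + 320 * X 0 ^ 6 * X 2 ^ 2 * X 1 ^ 2 + X 2 ^ 10
      - 4 * X 0 * (X 1 ^ 5 + X 2 ^ 5)
        * (32 * X 0 ^ 4 - 20 * X 1 * X 2 * X 0 ^ 2 + 5 * X 1 ^ 2 * X 2 ^ 2)]

/-- Generators of the invariant ring of group (14) of the Watanabe-Rotillon list; the last one, of degree 15, is the Jacobian
determinant of the other three. -/
def gens14 : Set Poly :=
  {u14 0, u14 1, u14 2, (Matrix.of fun i j => pderiv j (u14 i)).det}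

/-- Generators of the invariant rings of family (18) of the Watanabe-Rotillon list. -/
def gens18 (p q : ℕ) : Set Poly :=
  {X 0 ^ (2 * p * q) + X 1 ^ (2 * p * q), (X 0 * X 1) ^ (2 * q), xyz ^ 2,
    (X 0 ^ (2 * p * q) - X 1 ^ (2 * p * q)) * xyz, X 2 ^ (2 * q)}

/-- Generators of the invariant rings of family (26) of the Watanabe-Rotillon list. -/
def gens26 (m : ℕ) : Set Poly :=
  {e1 (3 * m), xyz ^ 2,
    X 0 ^ (2 * m) * X 1 ^ m + X 0 ^ m * X 1 ^ (2 * m) + X 1 ^ (2 * m) * X 2 ^ m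
      + X 1 ^ m * X 2 ^ (2 * m) + X 2 ^ (2 * m) * X 0 ^ m + X 2 ^ m * X 0 ^ (2 * m),
    xyz * vdm m, vdm m ^ 2}

/-- With `f = xᵐ + yᵐ + zᵐ` and `(u₁, u₂, u₃)` the elementary symmetric polynomials of
`xᵐ, yᵐ, zᵐ`: the fields `∂/∂u₃`, `∂/∂u₂`, `∂/∂u₁` yield the types `B₃`, `A₃`, `B₃¹`, with flat
coordinates, and `u₁⁶ ∂/∂u₃`, `u₁⁴ ∂/∂u₂` yield the duals of `B₃` and `A₃`. -/
def FiveStructures (G : Subgroup SL3) (m : ℕ) : Prop :=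
  YieldsFlat G (e1 m) (coordField (symm3 m) 2)
      (fun x => ((m : ℂ) - 1) / (3 * m) * ev (e1 m) x) .B3
      (fun x => ![((m : ℂ) - 1) / (3 * m) * ev (e1 m) x,
        -(ev (e1 m) x ^ 2 - 4 * ev (e2 m) x) / (6 * ((√2 : ℝ) : ℂ)),
        7 / 216 * ev (e1 m) x ^ 3 - 1 / 6 * ev (e2 m) x * ev (e1 m) x + ev (xyz ^ m) x]) ∧
  Yields G (e1 m) (dualField (symm3 m) 2 6)
      (fun x => -(((m : ℂ) - 1) / (3 * m) * ev (e1 m) x)) .B3d ∧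
  YieldsFlatLog G (e1 m) (coordField (symm3 m) 1)
      (fun x => ((m : ℂ) - 1) / (2 * m) * ev (e1 m) x) .A3 (xyz ^ m)
      (fun x l => ![((m : ℂ) - 1) / (2 * m) * ev (e1 m) x,
        ev (e2 m) x - 1 / 8 * ev (e1 m) x ^ 2, Complex.exp (1 / 2 * l)]) ∧
  Yields G (e1 m) (dualField (symm3 m) 1 4)
      (fun x => -(((m : ℂ) - 1) / (2 * m) * ev (e1 m) x)) .A3d ∧
  YieldsFlatLog G (e1 m) (coordField (symm3 m) 0)
      (fun x => ((m : ℂ) - 1) / m * ev (e1 m) x) .B31 (xyz ^ m)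
      (fun x l => ![ev (e1 m) x, ev (e2 m) x * Complex.exp (-1 / 4 * l),
        4 / 3 * Complex.exp (1 / 4 * l)])

/-- With `f = x² + y² + z²` and `(u₁, u₂, u₃) = (f, z², x²y²)`: the field `∂/∂u₂` yields the
trivial type `T₃`, with flat coordinates. -/
def TrivialStructure (G : Subgroup SL3) : Prop :=
  YieldsFlatLog G (e1 2) (coordField ![e1 2, X 2 ^ 2, X 0 ^ 2 * X 1 ^ 2] 1)
    (fun x => 1 / 2 * ev (e1 2) x) .T3 (X 0 ^ 2 * X 1 ^ 2)
    (fun x l => ![1 / 2 * ev (e1 2) x, x 2 ^ 2, Complex.exp (1 / 2 * l)])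

end FrobOrbit

end

open FrobOrbit MvPolynomial

noncomputable section

namespace FrobOrbit

open MvPolynomial Matrix
open scoped Topology
set_option linter.unusedSectionVars false
set_option linter.unusedSimpArgs false

/-! ### Calculus of partial derivatives -/

/-! Dubrovin's method is run backwards: a Frobenius structure is known in flat coordinates, and the
pencil built from the Hessian metric is recognised as its pullback. In flat coordinates the data are
a constant metric η, commuting multiplication matrices C_b and a diagonal Euler field. Let U be
multiplication by the Euler field and R = diag(deg) + (d-1)/2. Potentiality and homogeneity give ∂_b
U = C_b + [R, C_b], and the grading of η gives Rη + ηR = η. These identities show that the covariant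
metric η(U+s)⁻¹ has Levi-Civita connection form -R(U+s)⁻¹C_b (`FlatFrob.pencilConn_metric`) and that
this form has zero curvature (`FlatFrob.pencilConn_flat`). Raising an index multiplies by (U+s)η⁻¹
and cancels the inverse, so in flat coordinates the contravariant symbols do not depend on s. This
yields the flat pencil, and the surviving term R C_b is what the tensor Δ and the factor R⁻¹ turn
back into the product (`IsPencilChart.mul_eq`).

Coordinate changes act on connection forms by the gauge formula J⁻¹AJ + J⁻¹dJ, which preserves
torsion, compatibility and zero curvature (`chrM_pullback`, `gaugeForm_flat`). Hence one local
biholomorphism φ suffices, provided that it carries Ω₂ to κ times the intersection form of a model,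
X to its unity field and dτ to κ⁻¹ times the lowered unity field: this is `IsPencilChart`. All
claims of the method are local, so charts at the points off the zeros of a polynomial give the
structure on a dense free locus (`dubrovinYields_of_charts`). The models satisfy the axioms because
their potentials are quasihomogeneous Laurent polynomials obeying a single commutativity relation
(`FlatFrob.of_potential`).

It remains to exhibit charts. For f = p_n the functions xᵢⁿ turn the inverse Hessian into n/(n-1)
times a diagonal matrix of coordinates (`powV_metric`), so n plays almost no role, and A₃, B₃, B₃¹
arise from the elementary symmetric functions e₁, e₂ and a logarithm of xyz; T₃ arises from e₁, zⁿ
and a logarithm of xy. Groups (12) and (14) are explicit polynomial identities, from which A₃ and H₃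
are read off. The dual types come from an inversion of the flat coordinates
(`IsPencilChart.dual_of`).

Failure of (F) is algebraic: a flat Hessian metric forces Tᵢ adj(H) Tⱼ to be symmetric in i and j,
where Tᵢ = ∂ᵢH (`commute_of_flat`). This fails for multiples of xyz and for a z⁶ + b(xyz)² with b ≠
0, while powers of z have degenerate Hessian. Comparing degrees of generators shows that these are
the only minimal invariants in the excluded cases (`mem_span_of_isMinimal`).

Finally, B₃¹ is the only type with η(e,e) ≠ 0. The other seven are separated by the function
obtained by contracting the trace form of the tangent algebras with η⁻¹, together with the norm of
its differential: both are governed by powers of t₀ whose exponents an equivalence must preserve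
(`not_locallyEquivalent`). -/

theorem pd_congr {h k : V3 → ℂ} {x : V3} (e : h =ᶠ[𝓝 x] k) (i : Fin 3) : pd i h x = pd i k x := by
  unfold pd; rw [e.fderiv_eq]

theorem pd_const (c : ℂ) (i : Fin 3) (x : V3) : pd i (fun _ => c) x = 0 := by
  simp [pd]

theorem pd_add {h k : V3 → ℂ} {x : V3} (hh : DifferentiableAt ℂ h x) (hk : DifferentiableAt ℂ k x)
    (i : Fin 3) : pd i (fun y => h y + k y) x = pd i h x + pd i k x := by
  unfold pd; rw [fderiv_fun_add hh hk]; rfl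

theorem pd_sub {h k : V3 → ℂ} {x : V3} (hh : DifferentiableAt ℂ h x) (hk : DifferentiableAt ℂ k x)
    (i : Fin 3) : pd i (fun y => h y - k y) x = pd i h x - pd i k x := by
  unfold pd; rw [fderiv_fun_sub hh hk]; rfl

theorem pd_mul {h k : V3 → ℂ} {x : V3} (hh : DifferentiableAt ℂ h x) (hk : DifferentiableAt ℂ k x)
    (i : Fin 3) : pd i (fun y => h y * k y) x = pd i h x * k x + h x * pd i k x := by
  unfold pd; rw [fderiv_fun_mul hh hk]; simp; ring

theorem pd_const_mul {h : V3 → ℂ} {x : V3} (hh : DifferentiableAt ℂ h x) (c : ℂ) (i : Fin 3) :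
    pd i (fun y => c * h y) x = c * pd i h x := by
  rw [pd_mul (differentiableAt_const c) hh, pd_const]; ring

theorem pd_sum {ι : Type*} (s : Finset ι) {h : ι → V3 → ℂ} {x : V3}
    (hh : ∀ a ∈ s, DifferentiableAt ℂ (h a) x) (i : Fin 3) :
    pd i (fun y => ∑ a ∈ s, h a y) x = ∑ a ∈ s, pd i (h a) x := by
  unfold pd; rw [fderiv_fun_sum hh]; simp

theorem pd_coord (i j : Fin 3) (x : V3) : pd i (fun y => y j) x = if j = i then 1 else 0 := by
  have : fderiv ℂ (fun y : V3 => y j) x = ContinuousLinearMap.proj (R := ℂ) j := by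
    exact (ContinuousLinearMap.proj (R := ℂ) (φ := fun _ : Fin 3 => ℂ) j).fderiv
  unfold pd; rw [this]; simp [Pi.single_apply]

theorem fderiv_eq_sum_pd (h : V3 → ℂ) (x v : V3) : fderiv ℂ h x v = ∑ i, v i * pd i h x := by
  conv_lhs => rw [pi_eq_sum_univ' v]
  rw [map_sum]
  refine Finset.sum_congr rfl fun i _ => ?_
  rw [map_smul, smul_eq_mul]
  unfold pd
  congr 3

theorem pd_comp {h : V3 → ℂ} {φ : V3 → V3} {x : V3} (hh : DifferentiableAt ℂ h (φ x))
    (hφ : DifferentiableAt ℂ φ x) (i : Fin 3) :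
    pd i (fun y => h (φ y)) x = ∑ a, jac φ x a i * pd a h (φ x) := by
  have h1 : fderiv ℂ (fun y => h (φ y)) x = (fderiv ℂ h (φ x)).comp (fderiv ℂ φ x) :=
    fderiv_comp x hh hφ
  unfold pd at *
  rw [h1, ContinuousLinearMap.comp_apply, fderiv_eq_sum_pd]
  refine Finset.sum_congr rfl fun a _ => ?_
  congr 1
  simp only [jac, Matrix.of_apply, pd]
  rw [fderiv_pi (fun a => (differentiableAt_pi.1 hφ) a)]
  simp

theorem pd_comp₁ {g : ℂ → ℂ} {h : V3 → ℂ} {x : V3} {g' : ℂ} (hg : HasDerivAt g g' (h x))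
    (hh : DifferentiableAt ℂ h x) (i : Fin 3) : pd i (fun y => g (h y)) x = g' * pd i h x := by
  have := (hg.comp_hasFDerivAt x hh.hasFDerivAt).fderiv
  have e : fderiv ℂ (fun y => g (h y)) x = g' • fderiv ℂ h x := this
  simp [pd, e]

theorem pd_pow {h : V3 → ℂ} {x : V3} (hh : DifferentiableAt ℂ h x) (n : ℕ) (i : Fin 3) :
    pd i (fun y => h y ^ n) x = n * h x ^ (n - 1) * pd i h x :=
  pd_comp₁ (hasDerivAt_pow n (h x)) hh i

theorem pd_exp {h : V3 → ℂ} {x : V3} (hh : DifferentiableAt ℂ h x) (i : Fin 3) :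
    pd i (fun y => Complex.exp (h y)) x = Complex.exp (h x) * pd i h x :=
  pd_comp₁ (Complex.hasDerivAt_exp (h x)) hh i

theorem analyticAt_pd {h : V3 → ℂ} {x : V3} (hh : AnalyticAt ℂ h x) (i : Fin 3) :
    AnalyticAt ℂ (pd i h) x :=
  ((ContinuousLinearMap.apply ℂ ℂ (Pi.single i 1 : V3)).analyticAt _).comp hh.fderiv

theorem pd_comm {h : V3 → ℂ} {x : V3} (hh : AnalyticAt ℂ h x) (i j : Fin 3) :
    pd i (pd j h) x = pd j (pd i h) x := by
  have hs : IsSymmSndFDerivAt ℂ h x :=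
    (hh.contDiffAt (n := ⊤)).isSymmSndFDerivAt (by simp)
  have hd : DifferentiableAt ℂ (fderiv ℂ h) x := hh.fderiv.differentiableAt
  have key : ∀ a b : Fin 3, pd a (pd b h) x
      = fderiv ℂ (fderiv ℂ h) x (Pi.single a 1) (Pi.single b 1) := by
    intro a b
    unfold pd
    rw [fderiv_clm_apply hd (differentiableAt_const _)]
    simp
  rw [key, key]; exact hs _ _

/-- Matrix-valued functions with analytic entries. -/
def MAn (A : V3 → Mat3) (x : V3) : Prop := ∀ i j, AnalyticAt ℂ (fun y => A y i j) x

/-- Entrywise partial derivative. -/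
def mpd (i : Fin 3) (A : V3 → Mat3) (x : V3) : Mat3 := Matrix.of fun a b => pd i (fun y => A y a b) x

/-! ### Differential calculus of matrix-valued functions. -/

theorem MAn.const (A : Mat3) (x : V3) : MAn (fun _ => A) x := fun _ _ => analyticAt_const

theorem MAn.mul {A B : V3 → Mat3} {x : V3} (hA : MAn A x) (hB : MAn B x) :
    MAn (fun y => A y * B y) x := fun i j => by
  simp only [Matrix.mul_apply]
  exact Finset.analyticAt_fun_sum _ fun k _ => (hA i k).mul (hB k j)

theorem MAn.add {A B : V3 → Mat3} {x : V3} (hA : MAn A x) (hB : MAn B x) :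
    MAn (fun y => A y + B y) x := fun i j => (hA i j).add (hB i j)

theorem MAn.sum {ι : Type*} (s : Finset ι) {A : ι → V3 → Mat3} {x : V3} (hA : ∀ a, MAn (A a) x) :
    MAn (fun y => ∑ a ∈ s, A a y) x := fun i j => by
  simp only [Matrix.sum_apply]
  exact Finset.analyticAt_fun_sum _ fun k _ => hA k i j

theorem MAn.smul {c : V3 → ℂ} {A : V3 → Mat3} {x : V3} (hc : AnalyticAt ℂ c x) (hA : MAn A x) :
    MAn (fun y => c y • A y) x := fun i j => hc.mul (hA i j)

theorem MAn.transpose {A : V3 → Mat3} {x : V3} (hA : MAn A x) : MAn (fun y => (A y)ᵀ) x :=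
  fun i j => hA j i

theorem MAn.congr {A B : V3 → Mat3} {x : V3} (hA : MAn A x) (e : A =ᶠ[𝓝 x] B) : MAn B x :=
  fun i j => (hA i j).congr (e.mono fun y hy => by simp only [hy])

theorem MAn.det {A : V3 → Mat3} {x : V3} (hA : MAn A x) : AnalyticAt ℂ (fun y => (A y).det) x := by
  simp only [Matrix.det_fin_three]
  have := hA
  unfold MAn at this
  fun_prop (disch := simp_all)

theorem MAn.inv {A : V3 → Mat3} {x : V3} (hA : MAn A x) (hd : (A x).det ≠ 0) :
    MAn (fun y => (A y)⁻¹) x := by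
  have hdet := hA.det.inv hd
  intro i j
  simp only [Matrix.inv_def, Ring.inverse_eq_inv', Matrix.smul_apply, smul_eq_mul]
  refine hdet.mul ?_
  simp only [Matrix.adjugate_fin_three]
  unfold MAn at hA
  fin_cases i <;> fin_cases j <;> simp <;> fun_prop (disch := simp_all)

theorem MAn.comp {A : V3 → Mat3} {φ : V3 → V3} {x : V3} (hA : MAn A (φ x)) (hφ : AnalyticAt ℂ φ x) :
    MAn (fun y => A (φ y)) x := fun i j => (hA i j).comp hφ

theorem MAn.jac {φ : V3 → V3} {x : V3} (hφ : AnalyticAt ℂ φ x) : MAn (jac φ) x := fun i j =>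
  analyticAt_pd ((analyticAt_pi_iff.1 hφ) i) j

theorem MAn.mpd {A : V3 → Mat3} {x : V3} (hA : MAn A x) (i : Fin 3) : MAn (mpd i A) x :=
  fun a b => analyticAt_pd (hA a b) i

theorem MAn.eventually_det {A : V3 → Mat3} {x : V3} (hA : MAn A x) (hd : (A x).det ≠ 0) :
    ∀ᶠ y in 𝓝 x, (A y).det ≠ 0 := hA.det.continuousAt.eventually_ne hd

theorem mpd_congr {A B : V3 → Mat3} {x : V3} (e : A =ᶠ[𝓝 x] B) (i : Fin 3) :
    mpd i A x = mpd i B x := by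
  ext a b
  exact pd_congr (e.mono fun y hy => by simp only [hy]) i

theorem mpd_const (A : Mat3) (x : V3) (i : Fin 3) : mpd i (fun _ => A) x = 0 := by
  ext a b; exact pd_const _ _ _

theorem mpd_add {A B : V3 → Mat3} {x : V3} (hA : MAn A x) (hB : MAn B x) (i : Fin 3) :
    mpd i (fun y => A y + B y) x = mpd i A x + mpd i B x := by
  ext a b; exact pd_add (hA a b).differentiableAt (hB a b).differentiableAt i

theorem mpd_mul {A B : V3 → Mat3} {x : V3} (hA : MAn A x) (hB : MAn B x) (i : Fin 3) :
    mpd i (fun y => A y * B y) x = mpd i A x * B x + A x * mpd i B x := by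
  ext a b
  simp only [mpd, Matrix.of_apply, Matrix.mul_apply, Matrix.add_apply]
  rw [pd_sum (h := fun k y => A y a k * B y k b) _
    (fun k _ => ((hA a k).mul (hB k b)).differentiableAt), ← Finset.sum_add_distrib]
  exact Finset.sum_congr rfl fun k _ =>
    pd_mul (hA a k).differentiableAt (hB k b).differentiableAt i

theorem mpd_smul {c : V3 → ℂ} {A : V3 → Mat3} {x : V3} (hc : AnalyticAt ℂ c x) (hA : MAn A x)
    (i : Fin 3) : mpd i (fun y => c y • A y) x = pd i c x • A x + c x • mpd i A x := by
  ext a b; exact pd_mul hc.differentiableAt (hA a b).differentiableAt i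

theorem mpd_const_smul (c : ℂ) {A : V3 → Mat3} {x : V3} (hA : MAn A x)
    (i : Fin 3) : mpd i (fun y => c • A y) x = c • mpd i A x := by
  rw [mpd_smul analyticAt_const hA, pd_const]; simp

theorem mpd_sum {ι : Type*} (s : Finset ι) {A : ι → V3 → Mat3} {x : V3} (hA : ∀ a, MAn (A a) x)
    (i : Fin 3) : mpd i (fun y => ∑ a ∈ s, A a y) x = ∑ a ∈ s, mpd i (A a) x := by
  ext a b
  simp only [mpd, Matrix.of_apply, Matrix.sum_apply]
  exact pd_sum _ (fun k _ => (hA k a b).differentiableAt) i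

theorem mpd_transpose (A : V3 → Mat3) (x : V3) (i : Fin 3) :
    mpd i (fun y => (A y)ᵀ) x = (mpd i A x)ᵀ := rfl

theorem mpd_inv {A : V3 → Mat3} {x : V3} (hA : MAn A x) (hd : (A x).det ≠ 0) (i : Fin 3) :
    mpd i (fun y => (A y)⁻¹) x = -((A x)⁻¹ * mpd i A x * (A x)⁻¹) := by
  have h1 : mpd i (fun y => A y * (A y)⁻¹) x = 0 := by
    rw [mpd_congr (B := fun _ => 1), mpd_const]
    filter_upwards [hA.eventually_det hd] with y hy
    exact Matrix.mul_nonsing_inv _ (isUnit_iff_ne_zero.2 hy)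
  rw [mpd_mul hA (hA.inv hd)] at h1
  have hi : (A x)⁻¹ * A x = 1 := Matrix.nonsing_inv_mul _ (isUnit_iff_ne_zero.2 hd)
  have h2 : (A x)⁻¹ * (mpd i A x * (A x)⁻¹ + A x * mpd i (fun y => (A y)⁻¹) x) = 0 := by
    rw [h1, mul_zero]
  rw [mul_add, ← mul_assoc, ← mul_assoc, hi, one_mul] at h2
  rw [eq_neg_iff_add_eq_zero, add_comm]
  exact h2

theorem mpd_comp {A : V3 → Mat3} {φ : V3 → V3} {x : V3} (hA : MAn A (φ x)) (hφ : AnalyticAt ℂ φ x)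
    (i : Fin 3) : mpd i (fun y => A (φ y)) x = ∑ a, jac φ x a i • mpd a A (φ x) := by
  ext a b
  simp only [mpd, Matrix.of_apply, Matrix.sum_apply, Matrix.smul_apply, smul_eq_mul]
  exact pd_comp (hA a b).differentiableAt hφ.differentiableAt i

theorem mpd_comm {A : V3 → Mat3} {x : V3} (hA : MAn A x) (i j : Fin 3) :
    mpd i (mpd j A) x = mpd j (mpd i A) x := by
  ext a b; exact pd_comm (hA a b) i j

theorem mpd_jac_symm {φ : V3 → V3} {x : V3} (hφ : AnalyticAt ℂ φ x) (i j a : Fin 3) :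
    mpd i (jac φ) x a j = mpd j (jac φ) x a i :=
  pd_comm ((analyticAt_pi_iff.1 hφ) a) i j

/-! ### Levi-Civita connections -/

/-- The matrix `(k, j) ↦ Γᵏᵢⱼ`. -/
def chrM (h : V3 → Mat3) (i : Fin 3) (x : V3) : Mat3 := Matrix.of fun k j => christoffel h k i j x

/-- Uniqueness of the Levi-Civita connection. -/
theorem chrM_eq {h : V3 → Mat3} {x : V3} (hs : (h x).IsSymm) (hd : (h x).det ≠ 0)
    {B : Fin 3 → Mat3} (ht : ∀ i j k, B i k j = B j k i)
    (hm : ∀ i, mpd i h x = (B i)ᵀ * h x + h x * B i) (i : Fin 3) : chrM h i x = B i := by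
  have hi : (h x)⁻¹ * h x = 1 := Matrix.nonsing_inv_mul _ (isUnit_iff_ne_zero.2 hd)
  have hm' : ∀ i a b, pd i (fun y => h y a b) x = ∑ m, (B i m a * h x m b + h x a m * B i m b) := by
    intro i a b
    have := congrFun (congrFun (hm i) a) b
    simpa [mpd, Matrix.mul_apply, Finset.sum_add_distrib] using this
  have hsym : ∀ a b, h x a b = h x b a := fun a b => (hs.apply b a)
  have hB : B i = (h x)⁻¹ * (h x * B i) := by rw [← mul_assoc, hi, one_mul]
  ext k j
  rw [hB]
  simp only [chrM, Matrix.of_apply, christoffel, Matrix.mul_apply (M := (h x)⁻¹), Finset.mul_sum]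
  refine Finset.sum_congr rfl fun l _ => ?_
  -- Koszul's argument: of the six sums, four cancel by torsion-freeness and symmetry of `h`, and
  -- the other two coincide.
  rw [hm', hm', hm']
  simp only [Matrix.mul_apply, Fin.sum_univ_three]
  rw [ht j i, ht j i, ht j i, ht l i 0, ht l i 1, ht l i 2, ht l j 0, ht l j 1, ht l j 2,
    hsym 0 j, hsym 1 j, hsym 2 j, hsym 0 i, hsym 1 i, hsym 2 i]
  ring

/-- Written as ∂ᵢΓⱼ - ∂ⱼΓᵢ + [Γᵢ, Γⱼ] for matrix-valued forms, the curvature can be handled by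
noncommutative algebra instead of indices. -/
theorem curvature_eq (h : V3 → Mat3) (l k i j : Fin 3) (x : V3) :
    curvature h l k i j x = (mpd i (chrM h j) x - mpd j (chrM h i) x
      + (chrM h i x * chrM h j x - chrM h j x * chrM h i x)) l k := by
  simp only [curvature, Matrix.add_apply, Matrix.sub_apply, Matrix.mul_apply, mpd, chrM,
    Matrix.of_apply, Finset.sum_sub_distrib]

theorem covDeriv_eq (h : V3 → Mat3) (X : V3 → V3) (i j : Fin 3) (x : V3) :
    covDeriv h X i j x = pd i (fun y => X y j) x + (chrM h i x *ᵥ X x) j := by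
  simp only [covDeriv, chrM, Matrix.mulVec, dotProduct, Matrix.of_apply]

/-- The pullback of a matrix-valued one-form. -/
def pullForm (φ : V3 → V3) (A : Fin 3 → V3 → Mat3) (i : Fin 3) (x : V3) : Mat3 :=
  ∑ b, jac φ x b i • A b (φ x)

theorem MAn.pullForm {φ : V3 → V3} {A : Fin 3 → V3 → Mat3} {x : V3} (hφ : AnalyticAt ℂ φ x)
    (hA : ∀ b, MAn (A b) (φ x)) (i : Fin 3) : MAn (pullForm φ A i) x :=
  MAn.sum (A := fun b y => FrobOrbit.jac φ y b i • A b (φ y)) _ fun b =>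
    MAn.smul (MAn.jac hφ b i) ((hA b).comp hφ)

theorem mpd_pullForm {φ : V3 → V3} {A : Fin 3 → V3 → Mat3} {x : V3} (hφ : AnalyticAt ℂ φ x)
    (hA : ∀ b, MAn (A b) (φ x)) (i j : Fin 3) :
    mpd i (pullForm φ A j) x = ∑ b, mpd i (jac φ) x b j • A b (φ x)
      + ∑ b, ∑ a, (jac φ x a i * jac φ x b j) • mpd a (A b) (φ x) := by
  unfold pullForm
  rw [mpd_sum _ (A := fun b y => jac φ y b j • A b (φ y))
    (fun b => MAn.smul (MAn.jac hφ b j) ((hA b).comp hφ)), ← Finset.sum_add_distrib]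
  refine Finset.sum_congr rfl fun b _ => ?_
  rw [mpd_smul (MAn.jac hφ b j) ((hA b).comp hφ), mpd_comp (hA b) hφ, Finset.smul_sum]
  refine congrArg₂ _ rfl (Finset.sum_congr rfl fun a _ => ?_)
  rw [smul_smul, mul_comm]

/-- Pullback commutes with exterior derivative and wedge product: the second derivatives of φ are
symmetric and drop out of the antisymmetrised derivative, and what remains is the curvature at φ(x)
contracted with two columns of the Jacobian. -/
theorem pullForm_curv {φ : V3 → V3} {A : Fin 3 → V3 → Mat3} {x : V3} (hφ : AnalyticAt ℂ φ x)
    (hA : ∀ b, MAn (A b) (φ x))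
    (hflat : ∀ a b, mpd a (A b) (φ x) - mpd b (A a) (φ x)
      + (A a (φ x) * A b (φ x) - A b (φ x) * A a (φ x)) = 0) (i j : Fin 3) :
    mpd i (pullForm φ A j) x - mpd j (pullForm φ A i) x
      + (pullForm φ A i x * pullForm φ A j x - pullForm φ A j x * pullForm φ A i x) = 0 := by
  rw [mpd_pullForm hφ hA, mpd_pullForm hφ hA]
  have e1 : ∑ b, mpd i (jac φ) x b j • A b (φ x) = ∑ b, mpd j (jac φ) x b i • A b (φ x) :=
    Finset.sum_congr rfl fun b _ => by rw [mpd_jac_symm hφ]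
  have e2 : pullForm φ A i x * pullForm φ A j x
      = ∑ b, ∑ a, (jac φ x a i * jac φ x b j) • (A a (φ x) * A b (φ x)) := by
    simp only [pullForm, Finset.sum_mul_sum]
    rw [Finset.sum_comm]
    refine Finset.sum_congr rfl fun b _ => Finset.sum_congr rfl fun a _ => ?_
    rw [smul_mul_smul_comm]
  have e3 : pullForm φ A j x * pullForm φ A i x
      = ∑ b, ∑ a, (jac φ x a i * jac φ x b j) • (A b (φ x) * A a (φ x)) := by
    simp only [pullForm, Finset.sum_mul_sum]
    refine Finset.sum_congr rfl fun b _ => Finset.sum_congr rfl fun a _ => ?_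
    rw [smul_mul_smul_comm, mul_comm]
  have e4 : ∑ b, ∑ a, (jac φ x a j * jac φ x b i) • mpd a (A b) (φ x)
      = ∑ b, ∑ a, (jac φ x a i * jac φ x b j) • mpd b (A a) (φ x) := by
    rw [Finset.sum_comm]
    refine Finset.sum_congr rfl fun b _ => Finset.sum_congr rfl fun a _ => ?_
    rw [mul_comm]
  rw [e1, e2, e3, e4]
  have e5 : ∑ b, ∑ a, (jac φ x a i * jac φ x b j) • (mpd a (A b) (φ x) - mpd b (A a) (φ x)
      + (A a (φ x) * A b (φ x) - A b (φ x) * A a (φ x))) = 0 := by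
    simp only [hflat, smul_zero, Finset.sum_const_zero]
  simp only [smul_add, smul_sub, Finset.sum_add_distrib, Finset.sum_sub_distrib] at e5
  rw [← e5]; abel

/-- The connection form obtained from `A` by the coordinate change `φ`. -/
def gaugeForm (φ : V3 → V3) (A : Fin 3 → V3 → Mat3) (i : Fin 3) (x : V3) : Mat3 :=
  (jac φ x)⁻¹ * pullForm φ A i x * jac φ x + (jac φ x)⁻¹ * mpd i (jac φ) x

/-- Zero curvature is gauge covariant: the curvature of J⁻¹AJ + J⁻¹dJ is J⁻¹FJ, where F is the
curvature of the pulled back form. -/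
theorem gaugeForm_flat {φ : V3 → V3} {A : Fin 3 → V3 → Mat3} {x : V3} (hφ : AnalyticAt ℂ φ x)
    (hJ : (jac φ x).det ≠ 0) (hA : ∀ b, MAn (A b) (φ x))
    (hflat : ∀ a b, mpd a (A b) (φ x) - mpd b (A a) (φ x)
      + (A a (φ x) * A b (φ x) - A b (φ x) * A a (φ x)) = 0) (i j : Fin 3) :
    mpd i (gaugeForm φ A j) x - mpd j (gaugeForm φ A i) x
      + (gaugeForm φ A i x * gaugeForm φ A j x - gaugeForm φ A j x * gaugeForm φ A i x) = 0 := by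
  have hJa := MAn.jac hφ
  have hKa := hJa.inv hJ
  have hS := MAn.pullForm hφ hA
  have key : ∀ i j, mpd i (gaugeForm φ A j) x
      = -((jac φ x)⁻¹ * mpd i (jac φ) x * (jac φ x)⁻¹) * pullForm φ A j x * jac φ x
        + (jac φ x)⁻¹ * mpd i (pullForm φ A j) x * jac φ x
        + (jac φ x)⁻¹ * pullForm φ A j x * mpd i (jac φ) x
        - ((jac φ x)⁻¹ * mpd i (jac φ) x * (jac φ x)⁻¹) * mpd j (jac φ) x
        + (jac φ x)⁻¹ * mpd i (mpd j (jac φ)) x := by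
    intro i j
    unfold gaugeForm
    rw [mpd_add ((hKa.mul (hS j)).mul hJa) (hKa.mul (hJa.mpd j)), mpd_mul (hKa.mul (hS j)) hJa,
      mpd_mul hKa (hS j), mpd_mul hKa (hJa.mpd j), mpd_inv hJa hJ]
    noncomm_ring
  have hJK : ∀ M : Mat3, jac φ x * ((jac φ x)⁻¹ * M) = M := fun M => by
    rw [← mul_assoc, Matrix.mul_nonsing_inv _ (isUnit_iff_ne_zero.2 hJ), one_mul]
  have hc := pullForm_curv hφ hA hflat i j
  have hc' : (jac φ x)⁻¹ * (mpd i (pullForm φ A j) x - mpd j (pullForm φ A i) x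
      + (pullForm φ A i x * pullForm φ A j x - pullForm φ A j x * pullForm φ A i x)) * jac φ x
      = 0 := by rw [hc]; simp
  rw [key, key, ← hc', mpd_comm hJa j i]
  unfold gaugeForm
  simp only [mul_add, add_mul, mul_sub, sub_mul, mul_assoc, hJK, neg_mul]
  abel

/-- The Levi-Civita connection in the coordinates pulled back along `φ`. -/
theorem chrM_pullback {φ : V3 → V3} {h h' : V3 → Mat3} {x : V3} (hφ : AnalyticAt ℂ φ x)
    (hJ : (jac φ x).det ≠ 0) (hh' : MAn h' (φ x)) (hs : (h' (φ x)).IsSymm)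
    (hd : (h' (φ x)).det ≠ 0) {A : Fin 3 → V3 → Mat3}
    (hrel : ∀ᶠ y in 𝓝 x, h y = (jac φ y)ᵀ * h' (φ y) * jac φ y)
    (ht : ∀ a b k, A a (φ x) k b = A b (φ x) k a)
    (hm : ∀ a, mpd a h' (φ x) = (A a (φ x))ᵀ * h' (φ x) + h' (φ x) * A a (φ x)) (i : Fin 3) :
    chrM h i x = gaugeForm φ A i x := by
  have hJa := MAn.jac hφ
  have hx := hrel.self_of_nhds
  have hJK : ∀ M : Mat3, jac φ x * ((jac φ x)⁻¹ * M) = M := fun M => by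
    rw [← mul_assoc, Matrix.mul_nonsing_inv _ (isUnit_iff_ne_zero.2 hJ), one_mul]
  have hJK' : ∀ M : Mat3, (jac φ x)⁻¹ᵀ * ((jac φ x)ᵀ * M) = M := fun M => by
    rw [← mul_assoc, ← Matrix.transpose_mul, Matrix.mul_nonsing_inv _ (isUnit_iff_ne_zero.2 hJ),
      Matrix.transpose_one, one_mul]
  -- The gauge transform is tested against the two characterising properties of the Levi-Civita
  -- connection. Its torsion vanishes because second derivatives of φ are symmetric; compatibility
  -- is the product rule for JᵀhJ.
  refine chrM_eq ?_ ?_ (B := fun i => gaugeForm φ A i x) ?_ ?_ i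
  · rw [hx]
    unfold Matrix.IsSymm at *
    simp only [Matrix.transpose_mul, Matrix.transpose_transpose, hs, mul_assoc]
  · rw [hx]; simp [Matrix.det_mul, hJ, hd]
  · intro i j k
    have e : ∀ i j, gaugeForm φ A i x k j = ∑ a, (jac φ x)⁻¹ k a *
        (∑ b, ∑ c, jac φ x b i * A b (φ x) a c * jac φ x c j + mpd i (jac φ) x a j) := by
      intro i j
      simp only [gaugeForm, Matrix.add_apply, mul_assoc, Matrix.mul_apply (M := (jac φ x)⁻¹)]
      rw [← Finset.sum_add_distrib]
      refine Finset.sum_congr rfl fun a _ => ?_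
      rw [← mul_add]
      congr 2
      simp only [pullForm, Finset.sum_mul, Matrix.sum_apply, Matrix.smul_apply,
        Matrix.mul_apply, smul_eq_mul]
      rw [Finset.sum_comm]
      exact Finset.sum_congr rfl fun b _ => Finset.sum_congr rfl fun c _ => by ring
    rw [e, e]
    refine Finset.sum_congr rfl fun a _ => ?_
    rw [mpd_jac_symm hφ i j a, Finset.sum_comm]
    congr 2
    refine Finset.sum_congr rfl fun b _ => Finset.sum_congr rfl fun c _ => ?_
    rw [ht]; ring
  · intro i
    rw [mpd_congr hrel, mpd_mul (hJa.transpose.mul (hh'.comp hφ)) hJa,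
      mpd_mul hJa.transpose (hh'.comp hφ), mpd_transpose, mpd_comp hh' hφ, hx]
    have e : ∑ a, jac φ x a i • mpd a h' (φ x)
        = (pullForm φ A i x)ᵀ * h' (φ x) + h' (φ x) * pullForm φ A i x := by
      simp only [pullForm, hm, Matrix.transpose_sum, Finset.sum_mul, Finset.mul_sum,
        Matrix.transpose_smul, Matrix.smul_mul, Matrix.mul_smul, smul_add,
        Finset.sum_add_distrib]
    rw [e]
    simp only [gaugeForm, Matrix.transpose_add, Matrix.transpose_mul, mul_add, add_mul, mul_assoc,
      hJK, hJK']
    abel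

/-- The curvature differentiates the Christoffel symbols, so these have to agree with the gauge
transform near `x` and not only at `x`. -/
theorem curvature_eq_zero {φ : V3 → V3} {h : V3 → Mat3} {A : Fin 3 → V3 → Mat3} {x : V3}
    (hφ : AnalyticAt ℂ φ x)
    (hJ : (jac φ x).det ≠ 0) (hA : ∀ b, MAn (A b) (φ x))
    (hchr : ∀ i, chrM h i =ᶠ[𝓝 x] gaugeForm φ A i)
    (hflat : ∀ a b, mpd a (A b) (φ x) - mpd b (A a) (φ x)
      + (A a (φ x) * A b (φ x) - A b (φ x) * A a (φ x)) = 0) (l k i j : Fin 3) :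
    curvature h l k i j x = 0 := by
  rw [curvature_eq, mpd_congr (hchr j), mpd_congr (hchr i), (hchr i).eq_of_nhds,
    (hchr j).eq_of_nhds, gaugeForm_flat hφ hJ hA hflat]
  rfl

/-! ### Frobenius structures in flat coordinates -/

/-- The operator of multiplication by the Euler field `∑ degₘ tₘ ∂ₘ`. -/
def eulerOp (C : Fin 3 → V3 → Mat3) (deg : Fin 3 → ℂ) (t : V3) : Mat3 :=
  ∑ m, (deg m * t m) • C m t

/-- A Frobenius structure on `D ⊆ ℂ³` in flat coordinates: `η` is the constant metric, `C b` the
matrix of multiplication by `∂_b`, the unity field is `∂_r`, and the grading is regular. -/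
structure FlatFrob (D : Set V3) (η : Mat3) (C : Fin 3 → V3 → Mat3) (r : Fin 3) (deg : Fin 3 → ℂ)
    (d : ℂ) : Prop where
  isOpen : IsOpen D
  symm : η.IsSymm
  det : η.det ≠ 0
  an : ∀ t ∈ D, ∀ b, MAn (C b) t
  comm : ∀ t ∈ D, ∀ a b k, C a t k b = C b t k a
  mul_comm : ∀ t ∈ D, ∀ a b, C a t * C b t = C b t * C a t
  unit : ∀ t ∈ D, C r t = 1
  adj : ∀ t ∈ D, ∀ b, (C b t)ᵀ * η = η * C b t
  pot : ∀ t ∈ D, ∀ a b, mpd a (C b) t = mpd b (C a) t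
  hom : ∀ t ∈ D, ∀ b, ∑ m, (deg m * t m) • mpd m (C b) t
    = C b t + diagonal deg * C b t - C b t * diagonal deg - deg b • C b t
  metric_hom : diagonal deg * η + η * diagonal deg = (2 - d) • η
  deg_unit : deg r = 1
  reg : ∀ i, deg i + (d - 1) / 2 ≠ 0

/-- The matrix `(d - 1)/2 + diag(deg)`. -/
def regMat (deg : Fin 3 → ℂ) (d : ℂ) : Mat3 := diagonal fun i => deg i + (d - 1) / 2

theorem regMat_eq (deg : Fin 3 → ℂ) (d : ℂ) : regMat deg d = diagonal deg + ((d - 1) / 2) • 1 := by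
  rw [regMat, ← Matrix.diagonal_one, ← Matrix.diagonal_smul, Matrix.diagonal_add]
  congr 1; ext i; simp

/-- Connection forms of the pencil in flat coordinates. -/
def pencilConn (C : Fin 3 → V3 → Mat3) (deg : Fin 3 → ℂ) (d s : ℂ) (b : Fin 3) (t : V3) : Mat3 :=
  -(regMat deg d * (eulerOp C deg t + s • 1)⁻¹ * C b t)

/-! ### The Euler operator and the pencil of connections in flat coordinates. -/

namespace FlatFrob

variable {D : Set V3} {η : Mat3} {C : Fin 3 → V3 → Mat3} {r : Fin 3} {deg : Fin 3 → ℂ} {d : ℂ}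
  (H : FlatFrob D η C r deg d) {t : V3} (ht : t ∈ D)
include H

/-- Adding (d-1)/2 to each degree changes the weight 2-d of the metric to 1. Equivalently, R - 1/2
is skew for η; this is what makes the connection of the pencil metric. -/
theorem metric_reg : regMat deg d * η + η * regMat deg d = η := by
  have := H.metric_hom
  rw [regMat_eq]
  simp only [add_mul, mul_add, Matrix.smul_mul, Matrix.mul_smul, one_mul, mul_one]
  calc _ = (diagonal deg * η + η * diagonal deg) + (d - 1) • η := by module
    _ = _ := by rw [this]; module

theorem metric_hom_inv : diagonal deg * η⁻¹ + η⁻¹ * diagonal deg = (2 - d) • η⁻¹ := by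
  have h1 : η * η⁻¹ = 1 := Matrix.mul_nonsing_inv _ (isUnit_iff_ne_zero.2 H.det)
  have h2 : η⁻¹ * η = 1 := Matrix.nonsing_inv_mul _ (isUnit_iff_ne_zero.2 H.det)
  have := congrArg (fun M => η⁻¹ * M * η⁻¹) H.metric_hom
  simp only [mul_add, add_mul, Matrix.mul_smul, Matrix.smul_mul] at this
  rw [← mul_assoc η⁻¹ η, h2, one_mul, one_mul, mul_assoc η⁻¹, mul_assoc _ η, h1, mul_one,
    add_comm] at this
  exact this

theorem inv_symm : η⁻¹ᵀ = η⁻¹ := by rw [Matrix.transpose_nonsing_inv, H.symm]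

include ht

theorem an_eulerOp : MAn (eulerOp C deg) t :=
  MAn.sum (A := fun m y => (deg m * y m) • C m y) _ fun m => MAn.smul
    (analyticAt_const.mul ((ContinuousLinearMap.proj (R := ℂ) (φ := fun _ : Fin 3 => ℂ) m).analyticAt t))
    (H.an t ht m)

theorem eulerOp_comm (b : Fin 3) : eulerOp C deg t * C b t = C b t * eulerOp C deg t := by
  simp only [eulerOp, Finset.sum_mul, Finset.mul_sum, Matrix.smul_mul, Matrix.mul_smul,
    H.mul_comm t ht _ b]

theorem eulerOp_adj : (eulerOp C deg t)ᵀ * η = η * eulerOp C deg t := by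
  simp only [eulerOp, Matrix.transpose_sum, Finset.sum_mul, Finset.mul_sum, Matrix.smul_mul,
    Matrix.mul_smul, Matrix.transpose_smul, H.adj t ht]

theorem eulerOp_inv_metric : eulerOp C deg t * η⁻¹ = η⁻¹ * (eulerOp C deg t)ᵀ := by
  have h1 : η * η⁻¹ = 1 := Matrix.mul_nonsing_inv _ (isUnit_iff_ne_zero.2 H.det)
  have h2 : η⁻¹ * η = 1 := Matrix.nonsing_inv_mul _ (isUnit_iff_ne_zero.2 H.det)
  have := congrArg (fun M => η⁻¹ * M * η⁻¹) (H.eulerOp_adj ht)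
  simp only [mul_assoc, h1, mul_one] at this
  rw [this, ← mul_assoc, ← mul_assoc, h2, one_mul]

/-- Applying multiplication by E to the unity field returns E itself; the column of the unity field
therefore lists the components of E. -/
theorem eulerOp_unit (k : Fin 3) : eulerOp C deg t k r = deg k * t k := by
  simp only [eulerOp, Matrix.sum_apply, Matrix.smul_apply, smul_eq_mul, H.comm t ht _ r,
    H.unit t ht, Matrix.one_apply]
  simp

/-- By associativity the left side is multiplication by E∘∂ₙ, and the components of that vector form
column n of the Euler operator. It serves to cancel the factor U + s in the contravariant symbols.
-/
theorem eulerOp_mul (n : Fin 3) : eulerOp C deg t * C n t = ∑ b, eulerOp C deg t b n • C b t := by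
  have key : ∀ a, C a t * C n t = ∑ b, C a t b n • C b t := by
    intro a
    rw [H.mul_comm t ht]
    ext k j
    simp only [Matrix.sum_apply, Matrix.smul_apply, smul_eq_mul]
    have : (C n t * C a t) k j = (C n t * C j t) k a := by
      simp only [Matrix.mul_apply]
      exact Finset.sum_congr rfl fun m _ => by rw [H.comm t ht a j]
    rw [this, H.mul_comm t ht, Matrix.mul_apply]
    exact Finset.sum_congr rfl fun m _ => by
      rw [H.comm t ht j m, H.comm t ht n a]; ring
  simp only [eulerOp, Finset.sum_mul, Matrix.smul_mul, key, Matrix.sum_apply, Matrix.smul_apply,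
    Finset.smul_sum, smul_eq_mul, Finset.sum_smul, smul_smul]
  exact Finset.sum_comm

/-- Potentiality turns Σ deg_m t_m ∂_b C_m into the derivative of C_b along E, which homogeneity
evaluates; the terms deg_b C_b cancel. The scalar part of R commutes with everything, so R may
replace diag(deg) in the commutator. -/
theorem mpd_eulerOp (b : Fin 3) : mpd b (eulerOp C deg) t
    = C b t + regMat deg d * C b t - C b t * regMat deg d := by
  have hc : ∀ m, AnalyticAt ℂ (fun y : V3 => deg m * y m) t := fun m =>
    analyticAt_const.mul ((ContinuousLinearMap.proj (R := ℂ) (φ := fun _ : Fin 3 => ℂ) m).analyticAt t)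
  have hh := H.hom t ht b
  have e : mpd b (eulerOp C deg) t = deg b • C b t + ∑ m, (deg m * t m) • mpd m (C b) t := by
    unfold eulerOp
    rw [mpd_sum _ (A := fun m y => (deg m * y m) • C m y) (fun m => MAn.smul (hc m) (H.an t ht m))]
    simp only [fun m => mpd_smul (hc m) (H.an t ht m) b, Finset.sum_add_distrib]
    congr 1
    · rw [Finset.sum_eq_single b]
      · rw [pd_const_mul (h := fun y => y b) (by fun_prop), pd_coord]; simp
      · intro m _ hm
        rw [pd_const_mul (h := fun y => y m) (by fun_prop), pd_coord]; simp [hm]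
      · simp
    · exact Finset.sum_congr rfl fun m _ => by rw [H.pot t ht b m]
  rw [e, hh, regMat_eq]
  simp only [add_mul, mul_add, Matrix.smul_mul, Matrix.mul_smul, one_mul, mul_one]
  abel

variable {s : ℂ}

theorem an_shift : MAn (fun y => eulerOp C deg y + s • 1) t :=
  (H.an_eulerOp ht).add (MAn.const _ _)

theorem shift_comm (b : Fin 3) :
    (eulerOp C deg t + s • 1) * C b t = C b t * (eulerOp C deg t + s • 1) := by
  simp only [add_mul, mul_add, H.eulerOp_comm ht, Matrix.smul_mul, Matrix.mul_smul, one_mul,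
    mul_one]

variable (hs : (eulerOp C deg t + s • 1).det ≠ 0)
include hs

theorem shift_inv_comm (b : Fin 3) :
    (eulerOp C deg t + s • 1)⁻¹ * C b t = C b t * (eulerOp C deg t + s • 1)⁻¹ := by
  have h1 := Matrix.mul_nonsing_inv _ (isUnit_iff_ne_zero.2 hs)
  have h2 := Matrix.nonsing_inv_mul _ (isUnit_iff_ne_zero.2 hs)
  have h3 := H.shift_comm ht (s := s) b
  generalize eulerOp C deg t + s • 1 = M at *
  calc M⁻¹ * C b t = M⁻¹ * (C b t * M) * M⁻¹ := by rw [mul_assoc, mul_assoc, h1, mul_one]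
    _ = _ := by rw [← h3, ← mul_assoc, h2, one_mul]

theorem shift_inv_adj : ((eulerOp C deg t + s • 1)⁻¹)ᵀ * η = η * (eulerOp C deg t + s • 1)⁻¹ := by
  have h1 := Matrix.mul_nonsing_inv _ (isUnit_iff_ne_zero.2 hs)
  have h3 : (eulerOp C deg t + s • 1)ᵀ * η = η * (eulerOp C deg t + s • 1) := by
    simp only [Matrix.transpose_add, Matrix.transpose_smul, Matrix.transpose_one, add_mul, mul_add,
      H.eulerOp_adj ht, Matrix.smul_mul, Matrix.mul_smul, one_mul, mul_one]
  generalize eulerOp C deg t + s • 1 = M at *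
  have h4 : (M⁻¹)ᵀ * Mᵀ = 1 := by rw [← Matrix.transpose_mul, h1, Matrix.transpose_one]
  calc (M⁻¹)ᵀ * η = (M⁻¹)ᵀ * (η * M) * M⁻¹ := by rw [mul_assoc, mul_assoc, h1, mul_one]
    _ = _ := by rw [← h3, ← mul_assoc, h4, one_mul]

theorem mpd_shift_inv (b : Fin 3) : mpd b (fun y => (eulerOp C deg y + s • 1)⁻¹) t
    = -((eulerOp C deg t + s • 1)⁻¹ * (C b t + regMat deg d * C b t - C b t * regMat deg d)
      * (eulerOp C deg t + s • 1)⁻¹) := by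
  rw [mpd_inv (H.an_shift ht) hs, mpd_add (H.an_eulerOp ht) (MAn.const _ _), mpd_const, add_zero,
    H.mpd_eulerOp ht]

theorem an_pencilConn (b : Fin 3) : MAn (pencilConn C deg d s b) t := by
  have := ((MAn.const (regMat deg d) t).mul ((H.an_shift ht).inv hs)).mul (H.an t ht b)
  intro i j
  exact (this i j).neg

omit hs in
theorem pencilConn_symm (a b k : Fin 3) :
    pencilConn C deg d s a t k b = pencilConn C deg d s b t k a := by
  simp only [pencilConn, Matrix.neg_apply, Matrix.mul_apply (N := C _ t), H.comm t ht a b]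

/-- Put V = (U+s)⁻¹. Then ∂_b V = -V(C_b + [R, C_b])V, where V commutes with C_b and both are
self-adjoint for η. Moving R across η by Rη = η - ηR produces the extra term C_b, and the two sides
agree. -/
theorem pencilConn_metric (κ : ℂ) (b : Fin 3) :
    mpd b (fun y => κ • (η * (eulerOp C deg y + s • 1)⁻¹)) t
      = (pencilConn C deg d s b t)ᵀ * (κ • (η * (eulerOp C deg t + s • 1)⁻¹))
        + (κ • (η * (eulerOp C deg t + s • 1)⁻¹)) * pencilConn C deg d s b t := by
  have hV := (H.an_shift ht).inv hs
  rw [mpd_const_smul κ ((MAn.const η t).mul hV), mpd_mul (MAn.const η t) hV, mpd_const, zero_mul,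
    zero_add, H.mpd_shift_inv ht hs]
  have hR : (regMat deg d)ᵀ = regMat deg d := Matrix.diagonal_transpose _
  have h1 := H.shift_inv_comm ht hs b
  have h2 := H.shift_inv_adj ht hs
  have h3 := H.adj t ht b
  have h4 := H.metric_reg
  unfold pencilConn
  generalize (eulerOp C deg t + s • 1)⁻¹ = V at *
  simp only [Matrix.mul_smul, Matrix.smul_mul, ← smul_add]
  congr 1
  simp only [Matrix.transpose_neg, Matrix.transpose_mul, hR]
  have h5 : (C b t)ᵀ * (Vᵀ * regMat deg d) * (η * V) = η * C b t * V * (V - regMat deg d * V) := by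
    have : regMat deg d * η = η - η * regMat deg d := eq_sub_of_add_eq h4
    calc (C b t)ᵀ * (Vᵀ * regMat deg d) * (η * V) = (C b t)ᵀ * Vᵀ * (regMat deg d * η) * V := by
          simp only [mul_assoc]
      _ = (C b t)ᵀ * (Vᵀ * η) * (V - regMat deg d * V) := by
          rw [this]; simp only [mul_sub, sub_mul, mul_assoc]
      _ = _ := by rw [h2, ← mul_assoc, h3]
  rw [neg_mul, h5, mul_assoc η (C b t) V, ← h1]
  have h6 : η * V * -(regMat deg d * V * C b t) = - (η * V * regMat deg d * (C b t * V)) := by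
    rw [← h1]; simp only [mul_neg, mul_assoc]
  rw [h6]
  noncomm_ring

/-- With V = (U+s)⁻¹, differentiation of -RVC_b gives RV(C_a + RC_a - C_aR)VC_b - RV∂_aC_b. On
antisymmetrising, the terms ending in C_aVC_b and those with ∂_aC_b vanish by commutativity and
potentiality; the terms RVC_aRVC_b are cancelled by the commutator of the forms. -/
theorem pencilConn_flat (a b : Fin 3) :
    mpd a (pencilConn C deg d s b) t - mpd b (pencilConn C deg d s a) t
      + (pencilConn C deg d s a t * pencilConn C deg d s b t
        - pencilConn C deg d s b t * pencilConn C deg d s a t) = 0 := by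
  have hV := (H.an_shift ht).inv hs
  have key : ∀ a b, mpd a (pencilConn C deg d s b) t
      = -(regMat deg d * -((eulerOp C deg t + s • 1)⁻¹
        * (C a t + regMat deg d * C a t - C a t * regMat deg d) * (eulerOp C deg t + s • 1)⁻¹)
        * C b t + regMat deg d * (eulerOp C deg t + s • 1)⁻¹ * mpd a (C b) t) := by
    intro a b
    have e : pencilConn C deg d s b = fun y =>
        (-1 : ℂ) • (regMat deg d * (eulerOp C deg y + s • 1)⁻¹ * C b y) := by
      funext y; simp [pencilConn]
    rw [e, mpd_const_smul _ (((MAn.const _ t).mul hV).mul (H.an t ht b)),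
      mpd_mul ((MAn.const _ t).mul hV) (H.an t ht b), mpd_mul (MAn.const _ t) hV, mpd_const,
      H.mpd_shift_inv ht hs]
    simp [add_comm]
  rw [key, key, H.pot t ht b a]
  have h1 := H.shift_inv_comm ht hs
  have h2 := H.mul_comm t ht a b
  unfold pencilConn
  generalize (eulerOp C deg t + s • 1)⁻¹ = V at *
  have e1 : C a t * V * C b t = C b t * V * C a t := by
    rw [← h1, ← h1, mul_assoc, mul_assoc, h2]
  have e2 : C a t * (V * C b t) = C b t * (V * C a t) := by
    rw [← mul_assoc, e1, mul_assoc]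
  simp only [mul_add, add_mul, mul_sub, sub_mul, mul_assoc, neg_mul, mul_neg, e2]
  abel

end FlatFrob

/-! ### Pulling back a flat Frobenius structure -/

/-- `φ` is a local biholomorphism from the open set `N` to `D`. -/
structure IsLocalChart (D N : Set V3) (φ : V3 → V3) : Prop where
  isOpen : IsOpen N
  an : ∀ x ∈ N, AnalyticAt ℂ φ x
  maps : ∀ x ∈ N, φ x ∈ D
  det : ∀ x ∈ N, (jac φ x).det ≠ 0

/-- The matrix of multiplication by `∂ᵢ`. -/
def FrobData.mulM (M : FrobData) (i : Fin 3) (x : V3) : Mat3 := Matrix.of fun k j => M.mul x i j k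

/-- On `N`, the tensors of `M` are those of a flat Frobenius structure, pulled back along `φ`, with
the metric divided by `κ`. -/
structure IsPullback (N : Set V3) (φ : V3 → V3) (κ : ℂ) (η : Mat3) (C : Fin 3 → V3 → Mat3)
    (r : Fin 3) (deg : Fin 3 → ℂ) (d : ℂ) (M : FrobData) : Prop where
  metric : ∀ x ∈ N, M.metric x = κ⁻¹ • ((jac φ x)ᵀ * η * jac φ x)
  mulM : ∀ x ∈ N, ∀ i, M.mulM i x = (jac φ x)⁻¹ * pullForm φ C i x * jac φ x
  unity : ∀ x ∈ N, M.unity x = (jac φ x)⁻¹ *ᵥ Pi.single r 1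
  euler : ∀ x ∈ N, M.euler x = (jac φ x)⁻¹ *ᵥ fun i => deg i * φ x i
  charge : M.charge = d

theorem inv_mul_self_of {A : Mat3} (h : A.det ≠ 0) : A⁻¹ * A = 1 :=
  Matrix.nonsing_inv_mul _ (isUnit_iff_ne_zero.2 h)

theorem self_mul_inv_of {A : Mat3} (h : A.det ≠ 0) : A * A⁻¹ = 1 :=
  Matrix.mul_nonsing_inv _ (isUnit_iff_ne_zero.2 h)

/-- By symmetry of second derivatives, contracting the Hessian of φ with a vector in the direction
of differentiation or in the column index gives the same result. Every cancellation of second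
derivatives of φ below rests on this. -/
theorem sum_smul_mpd_jac {φ : V3 → V3} {x : V3} (hφ : AnalyticAt ℂ φ x) (v : V3) (a j : Fin 3) :
    (∑ m, v m • mpd m (jac φ) x) a j = (mpd j (jac φ) x *ᵥ v) a := by
  simp only [Matrix.sum_apply, Matrix.smul_apply, smul_eq_mul, Matrix.mulVec, dotProduct]
  exact Finset.sum_congr rfl fun m _ => by rw [mpd_jac_symm hφ m j]; ring

theorem analyticAt_mulVec {A : V3 → Mat3} {v : V3 → V3} {x : V3} (hA : MAn A x)
    (hv : AnalyticAt ℂ v x) : AnalyticAt ℂ (fun y => A y *ᵥ v y) x := by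
  rw [analyticAt_pi_iff]
  intro i
  simp only [Matrix.mulVec, dotProduct]
  exact Finset.analyticAt_fun_sum _ fun k _ => (hA i k).mul (analyticAt_pi_iff.1 hv k)

theorem jac_congr {X Y : V3 → V3} {x : V3} (e : X =ᶠ[𝓝 x] Y) : jac X x = jac Y x := by
  ext i j; exact pd_congr (e.mono fun y hy => by simp only [hy]) j

theorem jac_mulVec {A : V3 → Mat3} {v : V3 → V3} {x : V3} (hA : MAn A x) (hv : AnalyticAt ℂ v x)
    (k j : Fin 3) : jac (fun y => A y *ᵥ v y) x k j = (mpd j A x *ᵥ v x) k + (A x * jac v x) k j := by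
  simp only [jac, Matrix.of_apply, Matrix.mulVec, dotProduct, Matrix.mul_apply, mpd]
  rw [pd_sum (h := fun a y => A y k a * v y a) _ (fun a _ =>
    ((hA k a).mul (analyticAt_pi_iff.1 hv a)).differentiableAt), ← Finset.sum_add_distrib]
  exact Finset.sum_congr rfl fun a _ =>
    pd_mul (hA k a).differentiableAt (analyticAt_pi_iff.1 hv a).differentiableAt j

/-- The condition on `Y` says that the field is affine in the coordinates φ with linear part `Q`;
the unity field has Q = 0 and the Euler field Q = diag(deg). The correction term is the derivative
of J⁻¹, contracted with the field. -/
theorem jac_pullVec {φ X Y : V3 → V3} {x : V3} (hφ : AnalyticAt ℂ φ x) (hJ : (jac φ x).det ≠ 0)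
    (hY : AnalyticAt ℂ Y x) {Q : Mat3} (hQ : jac Y x = Q * jac φ x)
    (hX : ∀ᶠ y in 𝓝 x, X y = (jac φ y)⁻¹ *ᵥ Y y) :
    jac X x = (jac φ x)⁻¹ * Q * jac φ x - (jac φ x)⁻¹ * ∑ m, X x m • mpd m (jac φ) x := by
  have hJa := MAn.jac hφ
  rw [jac_congr hX]
  ext k j
  rw [jac_mulVec (hJa.inv hJ) hY, hQ, mpd_inv hJa hJ, Matrix.sub_apply]
  have : (-((jac φ x)⁻¹ * mpd j (jac φ) x * (jac φ x)⁻¹) *ᵥ Y x) k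
      = -((jac φ x)⁻¹ * ∑ m, X x m • mpd m (jac φ) x) k j := by
    rw [Matrix.neg_mulVec, ← Matrix.mulVec_mulVec, ← hX.self_of_nhds, ← Matrix.mulVec_mulVec,
      Matrix.mul_apply, Pi.neg_apply]
    simp only [sum_smul_mpd_jac hφ]
    rfl
  rw [this, mul_assoc]; ring

/-! ### The axioms of a Frobenius manifold for a pulled back structure. -/

namespace IsPullback

variable {D N : Set V3} {η : Mat3} {C : Fin 3 → V3 → Mat3} {r : Fin 3} {deg : Fin 3 → ℂ} {d : ℂ}
  {φ : V3 → V3} {κ : ℂ} {M : FrobData}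

theorem gaugeForm_zero (φ : V3 → V3) (i : Fin 3) (x : V3) :
    gaugeForm φ (fun _ _ => 0) i x = (jac φ x)⁻¹ * mpd i (jac φ) x := by
  simp [gaugeForm, pullForm]

/-- In the coordinates φ the metric is constant and its connection form is zero, so only the
inhomogeneous part J⁻¹dJ of the gauge transform is left. -/
theorem chrM_const (hφ : IsLocalChart D N φ) {h : V3 → Mat3} {η : Mat3} (hs : η.IsSymm)
    (hd : η.det ≠ 0) {κ : ℂ} (hκ : κ ≠ 0) (hh : ∀ x ∈ N, h x = κ • ((jac φ x)ᵀ * η * jac φ x))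
    {x : V3} (hx : x ∈ N) (i : Fin 3) : chrM h i x = gaugeForm φ (fun _ _ => 0) i x := by
  refine chrM_pullback (h' := fun _ => κ • η) (hφ.an x hx) (hφ.det x hx) (MAn.const _ _)
    (hs.smul κ) ?_ ?_ ?_ ?_ i
  · simp [hd, hκ]
  · filter_upwards [hφ.isOpen.eventually_mem hx] with y hy
    rw [hh y hy]; simp
  · intros; rfl
  · intro a; rw [mpd_const]; simp

theorem curvature_const (hφ : IsLocalChart D N φ) {h : V3 → Mat3} {η : Mat3} (hs : η.IsSymm)
    (hd : η.det ≠ 0) {κ : ℂ} (hκ : κ ≠ 0) (hh : ∀ x ∈ N, h x = κ • ((jac φ x)ᵀ * η * jac φ x))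
    {x : V3} (hx : x ∈ N) (l k i j : Fin 3) : curvature h l k i j x = 0 := by
  refine curvature_eq_zero (A := fun _ _ => 0) (hφ.an x hx) (hφ.det x hx) (fun _ => MAn.const _ _)
    (fun i => ?_) (fun a b => ?_) l k i j
  · filter_upwards [hφ.isOpen.eventually_mem hx] with y hy using chrM_const hφ hs hd hκ hh hy i
  · rw [mpd_const, mpd_const]; simp

/-- The Christoffel term J⁻¹dJ cancels the second derivatives of φ in the derivative of the field.
What remains is the constant linear part of an affine field, conjugated by the Jacobian. -/
theorem covDeriv_const (hφ : IsLocalChart D N φ) {h : V3 → Mat3} {η : Mat3} (hs : η.IsSymm)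
    (hd : η.det ≠ 0) {κ : ℂ} (hκ : κ ≠ 0) (hh : ∀ x ∈ N, h x = κ • ((jac φ x)ᵀ * η * jac φ x))
    {X Y : V3 → V3} (hX : ∀ x ∈ N, X x = (jac φ x)⁻¹ *ᵥ Y x) (hY : ∀ x ∈ N, AnalyticAt ℂ Y x)
    {Q : Mat3} (hQ : ∀ x ∈ N, jac Y x = Q * jac φ x)
    {x : V3} (hx : x ∈ N) (i j : Fin 3) :
    covDeriv h X i j x = ((jac φ x)⁻¹ * Q * jac φ x) j i := by
  rw [covDeriv_eq, chrM_const hφ hs hd hκ hh hx, gaugeForm_zero]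
  have h1 := jac_pullVec (hφ.an x hx) (hφ.det x hx) (hY x hx) (hQ x hx)
    ((hφ.isOpen.eventually_mem hx).mono fun y hy => hX y hy)
  have h2 : pd i (fun y => X y j) x = jac X x j i := rfl
  rw [h2, h1, Matrix.sub_apply, ← Matrix.mulVec_mulVec, Matrix.mul_apply (M := (jac φ x)⁻¹)
    (N := ∑ m, X x m • mpd m (jac φ) x)]
  simp only [sum_smul_mpd_jac (hφ.an x hx)]
  simp only [Matrix.mulVec, dotProduct]
  ring

/-- The first covariant derivative is a constant endomorphism in flat coordinates, hence parallel.
-/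
theorem covDeriv₂_const (hφ : IsLocalChart D N φ) {h : V3 → Mat3} {η : Mat3} (hs : η.IsSymm)
    (hd : η.det ≠ 0) {κ : ℂ} (hκ : κ ≠ 0) (hh : ∀ x ∈ N, h x = κ • ((jac φ x)ᵀ * η * jac φ x))
    {X Y : V3 → V3} (hX : ∀ x ∈ N, X x = (jac φ x)⁻¹ *ᵥ Y x) (hY : ∀ x ∈ N, AnalyticAt ℂ Y x)
    {Q : Mat3} (hQ : ∀ x ∈ N, jac Y x = Q * jac φ x)
    {x : V3} (hx : x ∈ N) (l i j : Fin 3) : covDeriv₂ h X l i j x = 0 := by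
  have hJa := MAn.jac (hφ.an x hx)
  have hJ := hφ.det x hx
  have hKa := hJa.inv hJ
  have hc := fun i j (y : V3) (hy : y ∈ N) => covDeriv_const hφ hs hd hκ hh hX hY hQ hy i j
  have h1 : pd l (covDeriv h X i j) x
      = mpd l (fun y => (jac φ y)⁻¹ * Q * jac φ y) x j i :=
    pd_congr ((hφ.isOpen.eventually_mem hx).mono fun y hy => hc i j y hy) l
  have e1 : ∑ m, christoffel h m l i x * covDeriv h X m j x
      = (((jac φ x)⁻¹ * Q * jac φ x) * chrM h l x) j i := by
    rw [Matrix.mul_apply]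
    exact Finset.sum_congr rfl fun m _ => by rw [hc m j x hx, mul_comm]; rfl
  have e2 : ∑ m, christoffel h j l m x * covDeriv h X i m x
      = (chrM h l x * ((jac φ x)⁻¹ * Q * jac φ x)) j i := by
    rw [Matrix.mul_apply]
    exact Finset.sum_congr rfl fun m _ => by rw [hc i m x hx]; rfl
  rw [covDeriv₂, h1, e1, e2, mpd_mul (hKa.mul (MAn.const Q x)) hJa,
    mpd_mul hKa (MAn.const Q x), mpd_const, mpd_inv hJa hJ, chrM_const hφ hs hd hκ hh hx,
    gaugeForm_zero, ← Matrix.sub_apply, ← Matrix.add_apply]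
  have hJK : ∀ M : Mat3, jac φ x * ((jac φ x)⁻¹ * M) = M := fun M => by
    rw [← mul_assoc, self_mul_inv_of hJ, one_mul]
  simp only [mul_assoc, hJK, neg_mul, add_mul, mul_zero, add_zero, zero_mul]
  simp

/-- The second derivatives of φ enter symmetrically in the two fields (`hZ`), so the bracket is that
of the two affine fields in flat coordinates. -/
theorem bracket_pull (hφ : IsLocalChart D N φ) {X Y X' Y' : V3 → V3}
    (hX : ∀ x ∈ N, X x = (jac φ x)⁻¹ *ᵥ X' x) (hX' : ∀ x ∈ N, AnalyticAt ℂ X' x)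
    (hY : ∀ x ∈ N, Y x = (jac φ x)⁻¹ *ᵥ Y' x) (hY' : ∀ x ∈ N, AnalyticAt ℂ Y' x)
    {P Q : Mat3} (hP : ∀ x ∈ N, jac X' x = P * jac φ x) (hQ : ∀ x ∈ N, jac Y' x = Q * jac φ x)
    {x : V3} (hx : x ∈ N) : bracket X Y x = (jac φ x)⁻¹ *ᵥ (Q *ᵥ X' x - P *ᵥ Y' x) := by
  have hJ := hφ.det x hx
  have hn := hφ.isOpen.eventually_mem hx
  have e : bracket X Y x = jac Y x *ᵥ X x - jac X x *ᵥ Y x := by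
    ext i
    simp only [bracket, Pi.sub_apply, Matrix.mulVec, dotProduct, jac, Matrix.of_apply,
      Finset.sum_sub_distrib]
    congr 1 <;> exact Finset.sum_congr rfl fun m _ => mul_comm _ _
  have hXx : jac φ x *ᵥ X x = X' x := by
    rw [hX x hx, Matrix.mulVec_mulVec, self_mul_inv_of hJ, Matrix.one_mulVec]
  have hYx : jac φ x *ᵥ Y x = Y' x := by
    rw [hY x hx, Matrix.mulVec_mulVec, self_mul_inv_of hJ, Matrix.one_mulVec]
  have hZ : (∑ m, Y x m • mpd m (jac φ) x) *ᵥ X x = (∑ m, X x m • mpd m (jac φ) x) *ᵥ Y x := by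
    ext a
    simp only [Matrix.mulVec, dotProduct, sum_smul_mpd_jac (hφ.an x hx)]
    simp only [Matrix.mulVec, dotProduct, Finset.sum_mul]
    rw [Finset.sum_comm]
    exact Finset.sum_congr rfl fun m _ => Finset.sum_congr rfl fun n _ => by
      rw [mpd_jac_symm (hφ.an x hx) n m]; ring
  rw [e, jac_pullVec (hφ.an x hx) hJ (hY' x hx) (hQ x hx) (hn.mono fun y hy => hY y hy),
    jac_pullVec (hφ.an x hx) hJ (hX' x hx) (hP x hx) (hn.mono fun y hy => hX y hy),
    Matrix.sub_mulVec, Matrix.sub_mulVec]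
  simp only [← Matrix.mulVec_mulVec, hXx, hYx, hZ, Matrix.mulVec_sub]
  abel

variable (H : FlatFrob D η C r deg d) (hφ : IsLocalChart D N φ) (hκ : κ ≠ 0)
  (hM : IsPullback N φ κ η C r deg d M)

theorem analyticAt_unity (r : Fin 3) (x : V3) :
    AnalyticAt ℂ (fun _ : V3 => (Pi.single r 1 : V3)) x := analyticAt_const

theorem jac_unity (r : Fin 3) (x : V3) :
    jac (fun _ : V3 => (Pi.single r 1 : V3)) x = 0 * jac φ x := by
  ext i j; simp [jac, pd_const]

include hφ in
theorem analyticAt_euler (deg : Fin 3 → ℂ) {x : V3} (hx : x ∈ N) :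
    AnalyticAt ℂ (fun y i => deg i * φ y i) x := by
  rw [analyticAt_pi_iff]
  exact fun i => analyticAt_const.mul (analyticAt_pi_iff.1 (hφ.an x hx) i)

include hφ in
theorem jac_euler (deg : Fin 3 → ℂ) {x : V3} (hx : x ∈ N) :
    jac (fun y i => deg i * φ y i) x = diagonal deg * jac φ x := by
  ext i j
  rw [Matrix.diagonal_mul]
  exact pd_const_mul (analyticAt_pi_iff.1 (hφ.an x hx) i).differentiableAt _ j

include H hφ hκ hM

theorem cub_eq {x : V3} (hx : x ∈ N) (i j k : Fin 3) :
    M.cub i j k x = (κ⁻¹ • ((jac φ x)ᵀ * (pullForm φ C i x)ᵀ * η * jac φ x)) j k := by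
  have hJ := hφ.det x hx
  have e : M.cub i j k x = ((M.mulM i x)ᵀ * M.metric x) j k := by
    rw [Matrix.mul_apply]; rfl
  have hJK' : ∀ B : Mat3, (jac φ x)⁻¹ᵀ * ((jac φ x)ᵀ * B) = B := fun B => by
    rw [← mul_assoc, ← Matrix.transpose_mul, self_mul_inv_of hJ, Matrix.transpose_one, one_mul]
  rw [e, hM.mulM x hx, hM.metric x hx]
  simp only [Matrix.transpose_mul, Matrix.mul_smul, mul_assoc, hJK']

theorem pullForm_adj {x : V3} (hx : x ∈ N) (i : Fin 3) :
    (pullForm φ C i x)ᵀ * η = η * pullForm φ C i x := by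
  simp only [pullForm, Matrix.transpose_sum, Matrix.transpose_smul, Finset.sum_mul, Finset.mul_sum,
    Matrix.smul_mul, Matrix.mul_smul, H.adj _ (hφ.maps x hx)]

theorem pullForm_symm {x : V3} (hx : x ∈ N) (i j k : Fin 3) :
    (pullForm φ C i x * jac φ x) k j = (pullForm φ C j x * jac φ x) k i := by
  have e : ∀ i j, (pullForm φ C i x * jac φ x) k j
      = ∑ b, ∑ c, jac φ x b i * C b (φ x) k c * jac φ x c j := by
    intro i j
    simp only [pullForm, Finset.sum_mul, Matrix.sum_apply, Matrix.smul_mul, Matrix.smul_apply,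
      Matrix.mul_apply, Finset.smul_sum, smul_eq_mul, mul_assoc]
    exact Finset.sum_comm
  rw [e, e, Finset.sum_comm]
  exact Finset.sum_congr rfl fun b _ => Finset.sum_congr rfl fun c _ => by
    rw [H.comm _ (hφ.maps x hx)]; ring

theorem mul_symm {x : V3} (hx : x ∈ N) (i j k : Fin 3) : M.mul x i j k = M.mul x j i k := by
  have h1 : M.mul x i j k = M.mulM i x k j := rfl
  have h2 : M.mul x j i k = M.mulM j x k i := rfl
  rw [h1, h2, hM.mulM x hx, hM.mulM x hx, mul_assoc, mul_assoc, Matrix.mul_apply, Matrix.mul_apply]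
  exact Finset.sum_congr rfl fun a _ => by rw [pullForm_symm H hφ hκ hM hx]

theorem mulM_comm {x : V3} (hx : x ∈ N) (i j : Fin 3) :
    M.mulM i x * M.mulM j x = M.mulM j x * M.mulM i x := by
  have hJ := hφ.det x hx
  have hJK : ∀ B : Mat3, jac φ x * ((jac φ x)⁻¹ * B) = B := fun B => by
    rw [← mul_assoc, self_mul_inv_of hJ, one_mul]
  have hS : pullForm φ C i x * pullForm φ C j x = pullForm φ C j x * pullForm φ C i x := by
    simp only [pullForm, Finset.sum_mul_sum]
    rw [Finset.sum_comm]
    exact Finset.sum_congr rfl fun b _ => Finset.sum_congr rfl fun c _ => by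
      rw [smul_mul_smul_comm, smul_mul_smul_comm, H.mul_comm _ (hφ.maps x hx), mul_comm (jac φ x c i)]
  rw [hM.mulM x hx, hM.mulM x hx]
  simp only [mul_assoc, hJK]
  rw [← mul_assoc (pullForm φ C i x), hS, mul_assoc]

/-- Contraction of the multiplication with a vector. -/
theorem sum_mulM {x : V3} (hx : x ∈ N) (v w : V3) (hv : v = (jac φ x)⁻¹ *ᵥ w) :
    ∑ i, v i • M.mulM i x = (jac φ x)⁻¹ * (∑ b, w b • C b (φ x)) * jac φ x := by
  have hw : ∀ b, w b = ∑ i, jac φ x b i * v i := by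
    intro b
    have : jac φ x *ᵥ v = w := by
      rw [hv, Matrix.mulVec_mulVec, self_mul_inv_of (hφ.det x hx), Matrix.one_mulVec]
    rw [← this]; rfl
  simp only [hM.mulM x hx, pullForm]
  simp only [hw, Finset.sum_smul, Finset.mul_sum, Finset.sum_mul, Matrix.mul_smul, Matrix.smul_mul,
    Finset.smul_sum, smul_smul]
  rw [Finset.sum_comm]
  exact Finset.sum_congr rfl fun b _ => Finset.sum_congr rfl fun c _ => by rw [mul_comm]

theorem an_mulM {x : V3} (hx : x ∈ N) (i : Fin 3) : MAn (M.mulM i) x := by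
  have hJa := MAn.jac (hφ.an x hx)
  refine (((hJa.inv (hφ.det x hx)).mul (MAn.pullForm (hφ.an x hx)
    (H.an _ (hφ.maps x hx)) i)).mul hJa).congr ?_
  filter_upwards [hφ.isOpen.eventually_mem hx] with y hy using (hM.mulM y hy i).symm

/-- The Christoffel symbols are J⁻¹dJ, so their three contributions remove exactly the derivatives
of the three Jacobian factors. Only derivatives of the matrices C_b survive, and the symmetry axiom
becomes potentiality. -/
theorem covCub_eq {x : V3} (hx : x ∈ N) (l i j k : Fin 3) :
    M.covCub l i j k x = (κ⁻¹ • ((jac φ x)ᵀ * (∑ b, ∑ a, (jac φ x a l * jac φ x b i) •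
      mpd a (C b) (φ x))ᵀ * η * jac φ x)) j k := by
  have hJ := hφ.det x hx
  have hJa := MAn.jac (hφ.an x hx)
  have hS := MAn.pullForm (hφ.an x hx) (H.an _ (hφ.maps x hx)) i
  have hJK : ∀ B : Mat3, jac φ x * ((jac φ x)⁻¹ * B) = B := fun B => by
    rw [← mul_assoc, self_mul_inv_of hJ, one_mul]
  have hJK' : ∀ B : Mat3, (jac φ x)⁻¹ᵀ * ((jac φ x)ᵀ * B) = B := fun B => by
    rw [← mul_assoc, ← Matrix.transpose_mul, self_mul_inv_of hJ, Matrix.transpose_one, one_mul]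
  have h1 : pd l (M.cub i j k) x = mpd l (fun y => κ⁻¹ • ((jac φ y)ᵀ * (pullForm φ C i y)ᵀ * η
      * jac φ y)) x j k :=
    pd_congr ((hφ.isOpen.eventually_mem hx).mono fun y hy => cub_eq H hφ hκ hM hy i j k) l
  have hc := fun l => chrM_const hφ H.symm H.det (inv_ne_zero hκ) hM.metric hx l
  have e0 : ∑ m, christoffel M.metric m l i x * M.cub m j k x
      = (κ⁻¹ • ((jac φ x)ᵀ * (∑ b, mpd l (jac φ) x b i • C b (φ x))ᵀ * η * jac φ x)) j k := by
    -- Here dJ = JΓ is used, which is the formula Γ = J⁻¹dJ read backwards.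
    have e : ∑ b, mpd l (jac φ) x b i • C b (φ x) = ∑ m, chrM M.metric l x m i • pullForm φ C m x := by
      have : ∀ b, mpd l (jac φ) x b i = ∑ m, jac φ x b m * chrM M.metric l x m i := by
        intro b
        rw [hc, gaugeForm_zero, ← Matrix.mul_apply, hJK]
      simp only [this, pullForm, Finset.sum_smul, Finset.smul_sum, smul_smul]
      rw [Finset.sum_comm]
      exact Finset.sum_congr rfl fun m _ => Finset.sum_congr rfl fun b _ => by rw [mul_comm]
    rw [e]
    simp only [Matrix.transpose_sum, Finset.mul_sum, Finset.sum_mul, Finset.smul_sum,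
      Matrix.transpose_smul, Matrix.mul_smul, Matrix.smul_mul, Matrix.sum_apply]
    refine Finset.sum_congr rfl fun m _ => ?_
    rw [cub_eq H hφ hκ hM hx, smul_comm, Matrix.smul_apply (chrM M.metric l x m i), smul_eq_mul]
    rfl
  have e1 : ∑ m, christoffel M.metric m l j x * M.cub i m k x
      = ((chrM M.metric l x)ᵀ * (κ⁻¹ • ((jac φ x)ᵀ * (pullForm φ C i x)ᵀ * η * jac φ x))) j k := by
    rw [Matrix.mul_apply]
    exact Finset.sum_congr rfl fun m _ => by rw [cub_eq H hφ hκ hM hx]; rfl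
  have e2 : ∑ m, christoffel M.metric m l k x * M.cub i j m x
      = ((κ⁻¹ • ((jac φ x)ᵀ * (pullForm φ C i x)ᵀ * η * jac φ x)) * chrM M.metric l x) j k := by
    rw [Matrix.mul_apply]
    exact Finset.sum_congr rfl fun m _ => by rw [cub_eq H hφ hκ hM hx, mul_comm]; rfl
  rw [FrobData.covCub, h1, Finset.sum_add_distrib, Finset.sum_add_distrib, e0, e1, e2,
    mpd_const_smul _ (((hJa.transpose.mul hS.transpose).mul (MAn.const η x)).mul hJa),
    mpd_mul ((hJa.transpose.mul hS.transpose).mul (MAn.const η x)) hJa,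
    mpd_mul (hJa.transpose.mul hS.transpose) (MAn.const η x), mpd_const,
    mpd_mul hJa.transpose hS.transpose, mpd_transpose, mpd_transpose,
    mpd_pullForm (hφ.an x hx) (H.an _ (hφ.maps x hx)), hc, gaugeForm_zero]
  rw [← Matrix.add_apply, ← Matrix.add_apply, ← Matrix.sub_apply]
  simp only [Matrix.transpose_add, Matrix.transpose_mul, mul_add, add_mul, mul_assoc, smul_add,
    Matrix.mul_smul, Matrix.smul_mul, hJK, hJK', mul_zero, add_zero]
  abel_nf
  simp

theorem lieCo_euler {x : V3} (hx : x ∈ N) : lieCo M.euler M.metric x = (2 - d) • M.metric x := by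
  have hJ := hφ.det x hx
  have hJa := MAn.jac (hφ.an x hx)
  have hn := hφ.isOpen.eventually_mem hx
  have e : lieCo M.euler M.metric x = ∑ m, M.euler x m • mpd m M.metric x
      + ((jac M.euler x)ᵀ * M.metric x + M.metric x * jac M.euler x) := by
    ext i j
    simp only [lieCo, Matrix.of_apply, Matrix.add_apply, Matrix.sum_apply, Matrix.smul_apply,
      smul_eq_mul, Matrix.mul_apply, jac, mpd, Matrix.transpose_apply, Finset.sum_add_distrib,
      add_assoc]
  have hJK : ∀ B : Mat3, jac φ x * ((jac φ x)⁻¹ * B) = B := fun B => by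
    rw [← mul_assoc, self_mul_inv_of hJ, one_mul]
  have hJK' : ∀ B : Mat3, (jac φ x)⁻¹ᵀ * ((jac φ x)ᵀ * B) = B := fun B => by
    rw [← mul_assoc, ← Matrix.transpose_mul, self_mul_inv_of hJ, Matrix.transpose_one, one_mul]
  have e1 : ∀ m, mpd m M.metric x = κ⁻¹ • ((mpd m (jac φ) x)ᵀ * (η * jac φ x)
      + (jac φ x)ᵀ * (η * mpd m (jac φ) x)) := by
    intro m
    rw [mpd_congr (hn.mono fun y hy => hM.metric y hy),
      mpd_const_smul _ ((hJa.transpose.mul (MAn.const η x)).mul hJa),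
      mpd_mul (hJa.transpose.mul (MAn.const η x)) hJa, mpd_mul hJa.transpose (MAn.const η x),
      mpd_const, mpd_transpose, mul_zero, add_zero, mul_assoc, mul_assoc]
  have e2 : ∑ m, M.euler x m • mpd m M.metric x
      = κ⁻¹ • ((∑ m, M.euler x m • mpd m (jac φ) x)ᵀ * (η * jac φ x)
      + (jac φ x)ᵀ * (η * ∑ m, M.euler x m • mpd m (jac φ) x)) := by
    simp only [e1, Matrix.transpose_sum, Finset.sum_mul, Finset.mul_sum, Matrix.transpose_smul,
      Matrix.smul_mul, Matrix.mul_smul, ← Finset.sum_add_distrib, Finset.smul_sum, ← smul_add,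
      smul_comm κ⁻¹]
  rw [e, e2, jac_pullVec (hφ.an x hx) hJ (analyticAt_euler hφ deg hx) (jac_euler hφ deg hx)
    (hn.mono fun y hy => hM.euler y hy), hM.metric x hx]
  generalize ∑ m, M.euler x m • mpd m (jac φ) x = Z
  simp only [Matrix.transpose_sub, Matrix.transpose_mul, Matrix.mul_smul, Matrix.smul_mul, mul_sub,
    sub_mul, mul_assoc, hJK, hJK', Matrix.diagonal_transpose]
  rw [smul_comm (2 - d) κ⁻¹]
  simp only [← smul_sub, ← smul_add]
  congr 1
  have := H.metric_hom
  calc _ = (jac φ x)ᵀ * (diagonal deg * η + η * diagonal deg) * jac φ x := by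
        simp only [mul_add, add_mul, mul_assoc]; abel
    _ = _ := by rw [this]; simp only [Matrix.mul_smul, Matrix.smul_mul, mul_assoc]

/-- The second derivatives of φ contracted with E (called Z) occur in the derivative of the product
and in the Jacobian of E with opposite signs. After they cancel, the identity is the homogeneity
axiom contracted with a column of the Jacobian. -/
theorem lieMul_euler {x : V3} (hx : x ∈ N) (i j k : Fin 3) :
    M.lieMul M.euler i j k x = M.mul x i j k := by
  have hJ := hφ.det x hx
  have hJa := MAn.jac (hφ.an x hx)
  have hKa := hJa.inv hJ
  have hS := MAn.pullForm (hφ.an x hx) (H.an _ (hφ.maps x hx)) i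
  have hn := hφ.isOpen.eventually_mem hx
  have hJK : ∀ B : Mat3, jac φ x * ((jac φ x)⁻¹ * B) = B := fun B => by
    rw [← mul_assoc, self_mul_inv_of hJ, one_mul]
  set E' : V3 := fun i => deg i * φ x i with hE'
  have hE : jac φ x *ᵥ M.euler x = E' := by
    rw [hM.euler x hx, Matrix.mulVec_mulVec, self_mul_inv_of hJ, Matrix.one_mulVec]
  have e : M.lieMul M.euler i j k x = (∑ m, M.euler x m • mpd m (M.mulM i) x
      + (∑ m, jac M.euler x m i • M.mulM m x + (M.mulM i x * jac M.euler x
      - jac M.euler x * M.mulM i x))) k j := by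
    simp only [FrobData.lieMul, Matrix.add_apply, Matrix.sub_apply, Matrix.sum_apply,
      Matrix.smul_apply, smul_eq_mul, Matrix.mul_apply, jac, mpd, FrobData.mulM, Matrix.of_apply,
      Finset.sum_add_distrib, Finset.sum_sub_distrib]
    rw [Finset.sum_congr rfl fun m _ => mul_comm (pd j (fun y => M.euler y m) x) (M.mul x i m k)]
    ring
  have e1 : ∀ m, mpd m (M.mulM i) x
      = -((jac φ x)⁻¹ * mpd m (jac φ) x * M.mulM i x)
        + (jac φ x)⁻¹ * mpd m (pullForm φ C i) x * jac φ x
        + M.mulM i x * ((jac φ x)⁻¹ * mpd m (jac φ) x) := by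
    intro m
    rw [mpd_congr (hn.mono fun y hy => hM.mulM y hy i), mpd_mul (hKa.mul hS) hJa,
      mpd_mul hKa hS, mpd_inv hJa hJ, hM.mulM x hx]
    simp only [mul_assoc, add_mul, neg_mul, hJK]
  have e2 : ∑ m, M.euler x m • mpd m (M.mulM i) x
      = -((jac φ x)⁻¹ * (∑ m, M.euler x m • mpd m (jac φ) x) * M.mulM i x)
        + (jac φ x)⁻¹ * (∑ m, M.euler x m • mpd m (pullForm φ C i) x) * jac φ x
        + M.mulM i x * ((jac φ x)⁻¹ * ∑ m, M.euler x m • mpd m (jac φ) x) := by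
    simp only [e1, smul_add, smul_neg, Finset.sum_add_distrib, Finset.sum_neg_distrib,
      Finset.mul_sum, Finset.sum_mul, Matrix.smul_mul, Matrix.mul_smul]
  have e3 : ∑ m, M.euler x m • mpd m (pullForm φ C i) x
      = ∑ b, (∑ m, M.euler x m • mpd m (jac φ) x) b i • C b (φ x)
        + ∑ b, jac φ x b i • ∑ a, E' a • mpd a (C b) (φ x) := by
    simp only [mpd_pullForm (hφ.an x hx) (H.an _ (hφ.maps x hx)), smul_add,
      Finset.sum_add_distrib, Matrix.sum_apply, Finset.sum_smul, Finset.smul_sum, smul_smul,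
      Matrix.smul_apply, smul_eq_mul]
    congr 1
    · rw [Finset.sum_comm]
    · rw [Finset.sum_comm]
      refine Finset.sum_congr rfl fun b _ => ?_
      rw [Finset.sum_comm]
      refine Finset.sum_congr rfl fun a _ => ?_
      rw [← hE, Matrix.mulVec, dotProduct, Finset.mul_sum, Finset.sum_smul]
      exact Finset.sum_congr rfl fun m _ => by congr 1; ring
  have hjac := jac_pullVec (hφ.an x hx) hJ (analyticAt_euler hφ deg hx) (jac_euler hφ deg hx)
    (hn.mono fun y hy => hM.euler y hy)
  have e4 : ∑ m, jac M.euler x m i • M.mulM m x = (jac φ x)⁻¹ * (∑ b, (diagonal deg * jac φ x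
      - ∑ m, M.euler x m • mpd m (jac φ) x) b i • C b (φ x)) * jac φ x := by
    refine sum_mulM H hφ hκ hM hx (fun m => jac M.euler x m i) _ ?_
    rw [hjac]
    ext m
    simp only [Matrix.sub_apply, Matrix.mulVec, dotProduct, mul_assoc]
    rw [Matrix.mul_apply, Matrix.mul_apply, ← Finset.sum_sub_distrib]
    exact Finset.sum_congr rfl fun a _ => by rw [mul_sub]
  have hmul : M.mul x i j k = M.mulM i x k j := rfl
  rw [e, hmul, e2, e3, e4, hjac]
  have hmm := hM.mulM x hx i
  have key : ∑ b, jac φ x b i • ∑ a, E' a • mpd a (C b) (φ x)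
      = pullForm φ C i x + diagonal deg * pullForm φ C i x - pullForm φ C i x * diagonal deg
        - ∑ b, (diagonal deg * jac φ x) b i • C b (φ x) := by
    simp only [hE', H.hom _ (hφ.maps x hx), pullForm, Finset.mul_sum, Finset.sum_mul,
      Matrix.smul_mul, Matrix.mul_smul, smul_sub, smul_add, Finset.sum_add_distrib,
      Finset.sum_sub_distrib, smul_smul, Matrix.diagonal_mul]
    congr 1
    exact Finset.sum_congr rfl fun b _ => by rw [mul_comm]
  rw [key]
  simp only [Matrix.sub_apply _ _ _ i, sub_smul, Finset.sum_sub_distrib]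
  generalize ∑ m, M.euler x m • mpd m (jac φ) x = Z
  generalize ∑ b, (diagonal deg * jac φ x) b i • C b (φ x) = S1
  generalize ∑ b, Z b i • C b (φ x) = S2
  refine congrFun (congrFun ?_ k) j
  rw [hmm]
  simp only [mul_add, add_mul, mul_sub, sub_mul, mul_assoc, hJK]
  abel

/-- The pullback of a flat Frobenius structure is a Frobenius manifold. -/
theorem isFrobeniusManifold (hne : N.Nonempty) : IsFrobeniusManifold N M where
  isOpen := hφ.isOpen
  nonempty := hne
  holo_metric i j x hx := by
    have hJa := MAn.jac (hφ.an x hx)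
    have : MAn M.metric x := ((MAn.smul analyticAt_const
      ((hJa.transpose.mul (MAn.const η x)).mul hJa))).congr
      ((hφ.isOpen.eventually_mem hx).mono fun y hy => (hM.metric y hy).symm)
    exact (this i j).differentiableAt.differentiableWithinAt
  holo_mul i j k x hx := (an_mulM H hφ hκ hM hx i k j).differentiableAt.differentiableWithinAt
  holo_unity x hx := by
    have hJa := MAn.jac (hφ.an x hx)
    exact ((analyticAt_mulVec (hJa.inv (hφ.det x hx)) analyticAt_const).congr
      ((hφ.isOpen.eventually_mem hx).mono fun y hy => (hM.unity y hy).symm)).differentiableAt.differentiableWithinAt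
  holo_euler x hx := by
    have hJa := MAn.jac (hφ.an x hx)
    exact ((analyticAt_mulVec (hJa.inv (hφ.det x hx)) (analyticAt_euler hφ deg hx)).congr
      ((hφ.isOpen.eventually_mem hx).mono fun y hy => (hM.euler y hy).symm)).differentiableAt.differentiableWithinAt
  symm x hx := by
    rw [hM.metric x hx]
    refine Matrix.IsSymm.smul ?_ _
    have := H.symm
    unfold Matrix.IsSymm at *
    simp only [Matrix.transpose_mul, Matrix.transpose_transpose, this, mul_assoc]
  nondeg x hx := by
    rw [hM.metric x hx]; simp [hκ, H.det, hφ.det x hx]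
  flat x hx := curvature_const hφ H.symm H.det (inv_ne_zero hκ) hM.metric hx
  mul_comm x hx := mul_symm H hφ hκ hM hx
  mul_assoc x hx i j k l := by
    -- For a commutative product, associativity means that the operators of multiplication by two
    -- vectors commute.
    have := congrFun (congrFun (mulM_comm H hφ hκ hM hx i k) l) j
    simp only [Matrix.mul_apply, FrobData.mulM, Matrix.of_apply] at this
    calc _ = ∑ m, M.mul x k m l * M.mul x i j m := Finset.sum_congr rfl fun m _ => by
          rw [mul_symm H hφ hκ hM hx m k l]; ring
      _ = _ := by
          rw [← this]
          exact Finset.sum_congr rfl fun m _ => by rw [mul_symm H hφ hκ hM hx k j m]; ring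
  unity_mul x hx j k := by
    have := sum_mulM H hφ hκ hM hx (M.unity x) _ (hM.unity x hx)
    have e : ∑ b, (Pi.single r 1 : V3) b • C b (φ x) = 1 := by
      rw [← H.unit _ (hφ.maps x hx), Finset.sum_eq_single r] <;> simp +contextual
    rw [e, mul_one, inv_mul_self_of (hφ.det x hx)] at this
    have := congrFun (congrFun this k) j
    simp only [Matrix.sum_apply, Matrix.smul_apply, FrobData.mulM, Matrix.of_apply, smul_eq_mul,
      Matrix.one_apply] at this
    rw [this]; simp only [eq_comm]
  invariant x hx i j k := by
    have h1 : ∀ i j k, M.cub i j k x = M.cub j i k x := fun i j k => by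
      simp only [FrobData.cub, mul_symm H hφ hκ hM hx i j]
    rw [h1 i j k, cub_eq H hφ hκ hM hx j i k, cub_eq H hφ hκ hM hx j k i]
    have : (κ⁻¹ • ((jac φ x)ᵀ * (pullForm φ C j x)ᵀ * η * jac φ x)).IsSymm := by
      refine Matrix.IsSymm.smul ?_ _
      have := H.symm
      have h2 := pullForm_adj H hφ hκ hM hx j
      unfold Matrix.IsSymm at *
      simp only [Matrix.transpose_mul, Matrix.transpose_transpose, this, mul_assoc]
      rw [← mul_assoc _ η (jac φ x), h2, mul_assoc]
    exact (this.apply k i)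
  unity_flat x hx i j := by
    rw [covDeriv_const hφ H.symm H.det (inv_ne_zero hκ) hM.metric hM.unity
      (fun x _ => analyticAt_unity r x) (fun x _ => jac_unity r x) hx]
    simp
  potential x hx l i j k := by
    rw [covCub_eq H hφ hκ hM hx, covCub_eq H hφ hκ hM hx]
    have : ∑ b, ∑ a, (jac φ x a l * jac φ x b i) • mpd a (C b) (φ x)
        = ∑ b, ∑ a, (jac φ x a i * jac φ x b l) • mpd a (C b) (φ x) := by
      rw [Finset.sum_comm]
      exact Finset.sum_congr rfl fun b _ => Finset.sum_congr rfl fun a _ => by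
        rw [H.pot _ (hφ.maps x hx), mul_comm]
    rw [this]
  euler_affine x hx := covDeriv₂_const hφ H.symm H.det (inv_ne_zero hκ) hM.metric hM.euler
    (fun x hx => analyticAt_euler hφ deg hx) (fun x hx => jac_euler hφ deg hx) hx
  euler_unity x hx := by
    rw [bracket_pull hφ hM.unity (fun x _ => analyticAt_unity r x) hM.euler
      (fun x hx => analyticAt_euler hφ deg hx) (fun x _ => jac_unity r x)
      (fun x hx => jac_euler hφ deg hx) hx, hM.unity x hx]
    congr 1
    ext a
    simp [Pi.single_apply, H.deg_unit]
  euler_mul x hx := lieMul_euler H hφ hκ hM hx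
  euler_metric x hx := by rw [hM.charge]; exact lieCo_euler H hφ hκ hM hx

end IsPullback

/-! ### Flat pencils in a chart -/

theorem lieContra_eq (X : V3 → V3) (g : V3 → Mat3) (x : V3) :
    lieContra X g x = ∑ m, X x m • mpd m g x - jac X x * g x - g x * (jac X x)ᵀ := by
  ext i j
  simp only [lieContra, Matrix.of_apply, Matrix.sub_apply, Matrix.sum_apply, Matrix.smul_apply,
    smul_eq_mul, Matrix.mul_apply, jac, mpd, Matrix.transpose_apply, Finset.sum_sub_distrib]

theorem grad_eq (g : V3 → Mat3) (τ : V3 → ℂ) (x : V3) :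
    grad g τ x = g x *ᵥ fun j => pd j τ x := rfl

section
variable {D N : Set V3} {φ : V3 → V3} {κ : ℂ}

theorem an_pullContra (hφ : IsLocalChart D N φ) {Ω g' : V3 → Mat3}
    (hΩ : ∀ x ∈ N, Ω x = κ • ((jac φ x)⁻¹ * g' (φ x) * ((jac φ x)⁻¹)ᵀ))
    (hg : ∀ x ∈ N, MAn g' (φ x)) {x : V3} (hx : x ∈ N) : MAn Ω x := by
  have hJa := MAn.jac (hφ.an x hx)
  have hKa := hJa.inv (hφ.det x hx)
  exact (MAn.smul analyticAt_const ((hKa.mul ((hg x hx).comp (hφ.an x hx))).mul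
    hKa.transpose)).congr ((hφ.isOpen.eventually_mem hx).mono fun y hy => (hΩ y hy).symm)

/-- Lie derivatives are natural under coordinate changes: the derivatives of J⁻¹ cancel the second
derivatives contained in the Jacobian of X. In the coordinates φ the Lie derivative along an affine
field has the displayed form. -/
theorem lieContra_pull (hφ : IsLocalChart D N φ) {Ω g' : V3 → Mat3}
    (hΩ : ∀ x ∈ N, Ω x = κ • ((jac φ x)⁻¹ * g' (φ x) * ((jac φ x)⁻¹)ᵀ))
    (hg : ∀ x ∈ N, MAn g' (φ x)) {X Y : V3 → V3}
    (hX : ∀ x ∈ N, X x = (jac φ x)⁻¹ *ᵥ Y x) (hY : ∀ x ∈ N, AnalyticAt ℂ Y x)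
    {Q : Mat3} (hQ : ∀ x ∈ N, jac Y x = Q * jac φ x) {x : V3} (hx : x ∈ N) :
    lieContra X Ω x = κ • ((jac φ x)⁻¹ * (∑ b, Y x b • mpd b g' (φ x) - Q * g' (φ x)
      - g' (φ x) * Qᵀ) * ((jac φ x)⁻¹)ᵀ) := by
  have hJ := hφ.det x hx
  have hJa := MAn.jac (hφ.an x hx)
  have hKa := hJa.inv hJ
  have hga := (hg x hx).comp (hφ.an x hx)
  have hn := hφ.isOpen.eventually_mem hx
  have hJK : ∀ B : Mat3, jac φ x * ((jac φ x)⁻¹ * B) = B := fun B => by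
    rw [← mul_assoc, self_mul_inv_of hJ, one_mul]
  have hJK' : ∀ B : Mat3, (jac φ x)⁻¹ᵀ * ((jac φ x)ᵀ * B) = B := fun B => by
    rw [← mul_assoc, ← Matrix.transpose_mul, self_mul_inv_of hJ, Matrix.transpose_one, one_mul]
  have hYX : ∀ b, Y x b = ∑ m, jac φ x b m * X x m := by
    intro b
    have : jac φ x *ᵥ X x = Y x := by
      rw [hX x hx, Matrix.mulVec_mulVec, self_mul_inv_of hJ, Matrix.one_mulVec]
    rw [← this]; rfl
  have e1 : ∀ m, mpd m Ω x = κ • (-((jac φ x)⁻¹ * mpd m (jac φ) x * (jac φ x)⁻¹) * g' (φ x)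
      * ((jac φ x)⁻¹)ᵀ + (jac φ x)⁻¹ * (∑ a, jac φ x a m • mpd a g' (φ x)) * ((jac φ x)⁻¹)ᵀ
      - (jac φ x)⁻¹ * g' (φ x) * ((jac φ x)⁻¹ * mpd m (jac φ) x * (jac φ x)⁻¹)ᵀ) := by
    intro m
    rw [mpd_congr (hn.mono fun y hy => hΩ y hy),
      mpd_const_smul _ ((hKa.mul hga).mul hKa.transpose), mpd_mul (hKa.mul hga) hKa.transpose,
      mpd_mul hKa hga, mpd_transpose, mpd_inv hJa hJ, mpd_comp (hg x hx) (hφ.an x hx)]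
    rw [add_mul, Matrix.transpose_neg, mul_neg, sub_eq_add_neg]
  have e2 : ∑ m, X x m • mpd m Ω x = κ • (-((jac φ x)⁻¹ * (∑ m, X x m • mpd m (jac φ) x)
      * (jac φ x)⁻¹) * g' (φ x) * ((jac φ x)⁻¹)ᵀ
      + (jac φ x)⁻¹ * (∑ b, Y x b • mpd b g' (φ x)) * ((jac φ x)⁻¹)ᵀ
      - (jac φ x)⁻¹ * g' (φ x) * ((jac φ x)⁻¹ * (∑ m, X x m • mpd m (jac φ) x)
        * (jac φ x)⁻¹)ᵀ) := by
    have e3 : ∑ b, Y x b • mpd b g' (φ x) = ∑ m, X x m • ∑ a, jac φ x a m • mpd a g' (φ x) := by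
      simp only [hYX, Finset.sum_smul, Finset.smul_sum, smul_smul]
      rw [Finset.sum_comm]
      exact Finset.sum_congr rfl fun m _ => Finset.sum_congr rfl fun b _ => by rw [mul_comm]
    rw [e3]
    simp only [e1, Finset.mul_sum, Finset.sum_mul, Matrix.mul_smul, Matrix.smul_mul,
      Matrix.transpose_sum, Matrix.transpose_smul, ← Finset.sum_neg_distrib, neg_mul,
      ← Finset.sum_add_distrib, ← Finset.sum_sub_distrib, Finset.smul_sum]
    refine Finset.sum_congr rfl fun m _ => ?_
    rw [smul_comm]
    congr 1
    simp only [smul_add, smul_sub, smul_neg, Finset.smul_sum]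
  rw [lieContra_eq, e2, jac_pullVec (hφ.an x hx) hJ (hY x hx) (hQ x hx)
    (hn.mono fun y hy => hX y hy), hΩ x hx]
  generalize ∑ m, X x m • mpd m (jac φ) x = Z
  generalize ∑ b, Y x b • mpd b g' (φ x) = S
  simp only [Matrix.mul_smul, Matrix.smul_mul, ← smul_sub]
  congr 1
  simp only [Matrix.transpose_mul, Matrix.transpose_sub, mul_add, add_mul, mul_sub, sub_mul,
    mul_assoc, hJK, hJK', neg_mul]
  abel

end

/-- On `N`, the map `φ` identifies the contravariant metric `Ω₂`, the vector field `X` and the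
function `τ` with `κ` times the intersection form of a flat Frobenius structure, its unity field
and `κ⁻¹` times the lowered unity field. -/
structure IsPencilChart (D : Set V3) (η : Mat3) (C : Fin 3 → V3 → Mat3) (r : Fin 3)
    (deg : Fin 3 → ℂ) (Ω₂ : V3 → Mat3) (X : V3 → V3) (τ : V3 → ℂ) (N : Set V3) (φ : V3 → V3)
    (κ : ℂ) : Prop extends IsLocalChart D N φ where
  ne_zero : κ ≠ 0
  nondeg : ∀ x ∈ N, (Ω₂ x).det ≠ 0
  metric : ∀ x ∈ N, jac φ x * Ω₂ x * (jac φ x)ᵀ = κ • (eulerOp C deg (φ x) * η⁻¹)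
  vec : ∀ x ∈ N, jac φ x *ᵥ X x = Pi.single r 1
  fn : ∀ x ∈ N, ∀ j, pd j τ x = κ⁻¹ * ∑ a, jac φ x a j * η a r
  fn_an : ∀ x ∈ N, AnalyticAt ℂ τ x

theorem fderiv_eq_jac_mulVec {φ : V3 → V3} {x : V3} (hd : DifferentiableAt ℂ φ x) (v : V3) :
    fderiv ℂ φ x v = jac φ x *ᵥ v := by
  ext i
  rw [fderiv_pi (fun a => (differentiableAt_pi.1 hd) a)]
  simp only [ContinuousLinearMap.coe_pi', fderiv_eq_sum_pd, Matrix.mulVec, dotProduct, jac,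
    Matrix.of_apply]
  exact Finset.sum_congr rfl fun j _ => mul_comm _ _

/-- The Euler operator changes by a scalar along the unity field. -/
theorem eulerOp_add_smul_unit {D : Set V3} {η : Mat3} {C : Fin 3 → V3 → Mat3} {r : Fin 3}
    {deg : Fin 3 → ℂ} {d : ℂ} (H : FlatFrob D η C r deg d) {t : V3} (ht : t ∈ D) :
    ∀ᶠ σ : ℂ in 𝓝 0, eulerOp C deg (t + σ • (Pi.single r 1 : V3)) = eulerOp C deg t + σ • 1 := by
  have hcont : Continuous fun σ : ℂ => t + σ • (Pi.single r 1 : V3) := by fun_prop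
  have hD : ∀ᶠ σ : ℂ in 𝓝 0, t + σ • (Pi.single r 1 : V3) ∈ D :=
    (hcont.tendsto' 0 t (by simp)) (H.isOpen.mem_nhds ht)
  obtain ⟨ε, hε, hball⟩ := Metric.eventually_nhds_iff_ball.1 hD
  filter_upwards [Metric.ball_mem_nhds 0 hε] with σ hσ
  ext i j
  -- Along the unity field the derivative of U is C_r + [R, C_r] = 1, so U - z is constant on the
  -- ball.
  have hder : ∀ z ∈ Metric.ball (0 : ℂ) ε, HasDerivAt
      (fun z : ℂ => eulerOp C deg (t + z • (Pi.single r 1 : V3)) i j - z * (1 : Mat3) i j) 0 z := by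
    intro z hz
    have ha := H.an_eulerOp (hball z hz) i j
    have hline : HasDerivAt (fun z : ℂ => t + z • (Pi.single r 1 : V3)) (Pi.single r 1 : V3) z := by
      simpa using ((hasDerivAt_id z).smul_const (Pi.single r 1 : V3)).const_add t
    have h1 := ha.differentiableAt.hasFDerivAt.comp_hasDerivAt z hline
    have h2 := (hasDerivAt_id z).mul_const ((1 : Mat3) i j)
    have h3 : fderiv ℂ (fun y => eulerOp C deg y i j) (t + z • (Pi.single r 1 : V3))
        (Pi.single r 1) = (1 : Mat3) i j := by
      have := congrFun (congrFun (H.mpd_eulerOp (hball z hz) r) i) j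
      rw [H.unit _ (hball z hz)] at this
      simpa [mpd, pd] using this
    have h4 := h1.sub h2
    simp only [h3, one_mul, sub_self] at h4
    exact h4
  have hc := Metric.isOpen_ball.is_const_of_deriv_eq_zero (convex_ball (0 : ℂ) ε).isPreconnected
    (fun z hz => (hder z hz).differentiableAt.differentiableWithinAt)
    (fun z hz => (hder z hz).deriv) hσ (Metric.mem_ball_self hε)
  simp only [zero_smul, add_zero, zero_mul, sub_zero] at hc
  rw [Matrix.add_apply, Matrix.smul_apply, smul_eq_mul, ← hc]
  ring

/-! ### The pencil, its connections and its product computed in a chart. -/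

namespace IsPencilChart

variable {D N : Set V3} {η : Mat3} {C : Fin 3 → V3 → Mat3} {r : Fin 3} {deg : Fin 3 → ℂ} {d : ℂ}
  {φ : V3 → V3} {κ : ℂ} {Ω₂ : V3 → Mat3} {X : V3 → V3} {τ : V3 → ℂ}
  (H : FlatFrob D η C r deg d) (hφ : IsPencilChart D η C r deg Ω₂ X τ N φ κ)
include H hφ

theorem contra_eq {x : V3} (hx : x ∈ N) :
    Ω₂ x = κ • ((jac φ x)⁻¹ * (eulerOp C deg (φ x) * η⁻¹) * ((jac φ x)⁻¹)ᵀ) := by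
  have hJ := hφ.det x hx
  have h1 := inv_mul_self_of hJ
  have h2 : (jac φ x)ᵀ * ((jac φ x)⁻¹)ᵀ = 1 := by
    rw [← Matrix.transpose_mul, h1, Matrix.transpose_one]
  rw [← Matrix.smul_mul, ← Matrix.mul_smul, ← hφ.metric x hx]
  simp only [mul_assoc, h2, mul_one]
  rw [← mul_assoc, h1, one_mul]

theorem eulerOp_det {x : V3} (hx : x ∈ N) : (eulerOp C deg (φ x)).det ≠ 0 := by
  have := hφ.nondeg x hx
  rw [contra_eq H hφ hx] at this
  intro h
  simp [Matrix.det_smul, h] at this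

theorem vec_eq {x : V3} (hx : x ∈ N) : X x = (jac φ x)⁻¹ *ᵥ Pi.single r 1 := by
  rw [← hφ.vec x hx, Matrix.mulVec_mulVec, inv_mul_self_of (hφ.det x hx), Matrix.one_mulVec]

theorem an_intersection {t : V3} (ht : t ∈ D) (s : ℂ) :
    MAn (fun t => (eulerOp C deg t + s • 1) * η⁻¹) t := (H.an_shift ht).mul (MAn.const _ _)

theorem mpd_intersection {t : V3} (ht : t ∈ D) (b : Fin 3) :
    mpd b (fun t => eulerOp C deg t * η⁻¹) t
      = (C b t + regMat deg d * C b t - C b t * regMat deg d) * η⁻¹ := by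
  rw [mpd_mul (H.an_eulerOp ht) (MAn.const _ _), mpd_const, H.mpd_eulerOp ht, mul_zero, add_zero]

/-- In the coordinates φ the field X is ∂_r and ∂_r U = 1, so the Lie derivative of the intersection
form Uη⁻¹ along X is the constant η⁻¹. -/
theorem flatMetric_eq {x : V3} (hx : x ∈ N) :
    lieContra X Ω₂ x = κ • ((jac φ x)⁻¹ * η⁻¹ * ((jac φ x)⁻¹)ᵀ) := by
  rw [lieContra_pull (g' := fun t => eulerOp C deg t * η⁻¹) hφ.toIsLocalChart
    (fun x hx => contra_eq H hφ hx)
    (fun x hx => (H.an_eulerOp (hφ.maps x hx)).mul (MAn.const _ _)) (fun x hx => vec_eq H hφ hx)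
    (fun x _ => IsPullback.analyticAt_unity r x) (fun x _ => IsPullback.jac_unity r x) hx]
  have : ∑ b, (Pi.single r 1 : V3) b • mpd b (fun t => eulerOp C deg t * η⁻¹) (φ x) = η⁻¹ := by
    rw [Finset.sum_eq_single r]
    · rw [mpd_intersection H hφ (hφ.maps x hx), H.unit _ (hφ.maps x hx)]; simp
    · intro b _ hb; simp [hb]
    · simp
  rw [this]; simp

theorem pencil_eq {x : V3} (hx : x ∈ N) (s : ℂ) : Ω₂ x + s • lieContra X Ω₂ x
    = κ • ((jac φ x)⁻¹ * ((eulerOp C deg (φ x) + s • 1) * η⁻¹) * ((jac φ x)⁻¹)ᵀ) := by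
  rw [flatMetric_eq H hφ hx]
  conv_lhs => rw [contra_eq H hφ hx]
  simp only [add_mul, mul_add, smul_add, Matrix.smul_mul, Matrix.mul_smul, one_mul]
  rw [smul_comm]

theorem det_pencil {x : V3} (hx : x ∈ N) (s : ℂ) :
    (Ω₂ x + s • lieContra X Ω₂ x).det ≠ 0 ↔ (eulerOp C deg (φ x) + s • 1).det ≠ 0 := by
  rw [pencil_eq H hφ hx]
  simp [Matrix.det_smul, hφ.ne_zero, H.det, hφ.det x hx, Matrix.det_nonsing_inv]

theorem lower_flat {x : V3} (hx : x ∈ N) :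
    lower (lieContra X Ω₂) x = κ⁻¹ • ((jac φ x)ᵀ * η * jac φ x) := by
  have hJ := hφ.det x hx
  rw [lower, flatMetric_eq H hφ hx]
  apply Matrix.inv_eq_right_inv
  have h2 : ∀ B, ((jac φ x)⁻¹)ᵀ * ((jac φ x)ᵀ * B) = B := fun B => by
    rw [← mul_assoc, ← Matrix.transpose_mul, self_mul_inv_of hJ, Matrix.transpose_one, one_mul]
  have h3 : ∀ B, η⁻¹ * (η * B) = B := fun B => by
    rw [← mul_assoc, inv_mul_self_of H.det, one_mul]
  simp only [Matrix.smul_mul, Matrix.mul_smul, mul_assoc, h2, h3, inv_mul_self_of hJ, smul_smul]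
  rw [inv_mul_cancel₀ hφ.ne_zero, one_smul]

section pencil

variable {Ω : V3 → Mat3} {s : ℂ}
  (hΩ : ∀ x ∈ N, Ω x = κ • ((jac φ x)⁻¹ * ((eulerOp C deg (φ x) + s • 1) * η⁻¹)
    * ((jac φ x)⁻¹)ᵀ)) {x : V3} (hx : x ∈ N) (hs : (eulerOp C deg (φ x) + s • 1).det ≠ 0)
include hΩ hx hs

theorem lower_pencil :
    lower Ω x = (jac φ x)ᵀ * (κ⁻¹ • (η * (eulerOp C deg (φ x) + s • 1)⁻¹)) * jac φ x := by
  have hJ := hφ.det x hx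
  rw [lower, hΩ x hx]
  apply Matrix.inv_eq_right_inv
  have h2 : ∀ B, ((jac φ x)⁻¹)ᵀ * ((jac φ x)ᵀ * B) = B := fun B => by
    rw [← mul_assoc, ← Matrix.transpose_mul, self_mul_inv_of hJ, Matrix.transpose_one, one_mul]
  have h3 : ∀ B, η⁻¹ * (η * B) = B := fun B => by
    rw [← mul_assoc, inv_mul_self_of H.det, one_mul]
  have h4 : ∀ B, (eulerOp C deg (φ x) + s • 1) * ((eulerOp C deg (φ x) + s • 1)⁻¹ * B) = B :=
    fun B => by rw [← mul_assoc, self_mul_inv_of hs, one_mul]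
  simp only [Matrix.smul_mul, Matrix.mul_smul, mul_assoc, h2, h3, h4, inv_mul_self_of hJ, smul_smul]
  rw [inv_mul_cancel₀ hφ.ne_zero, one_smul]

theorem eventually_det : ∀ᶠ y in 𝓝 x, y ∈ N ∧ (eulerOp C deg (φ y) + s • 1).det ≠ 0 := by
  have h1 := ((H.an_shift (hφ.maps x hx) (s := s)).comp (hφ.an x hx)).eventually_det hs
  filter_upwards [hφ.isOpen.eventually_mem hx, h1] with y h2 h3 using ⟨h2, h3⟩

/-- The connection form found in flat coordinates is carried to x by the gauge formula.
Nondegeneracy of U + s is an open condition, so the formula for the lowered metric holds near x, as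
needed for differentiation. -/
theorem chrM_pencil (i : Fin 3) : chrM (lower Ω) i x = gaugeForm φ (pencilConn C deg d s) i x := by
  have ht := hφ.maps x hx
  refine chrM_pullback (h' := fun t => κ⁻¹ • (η * (eulerOp C deg t + s • 1)⁻¹)) (hφ.an x hx)
    (hφ.det x hx) ?_ ?_ ?_ ?_ (fun a b k => H.pencilConn_symm ht a b k)
    (fun a => H.pencilConn_metric ht hs _ a) i
  · exact MAn.smul analyticAt_const ((MAn.const η _).mul ((H.an_shift ht).inv hs))
  · refine Matrix.IsSymm.smul ?_ _
    have := H.symm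
    unfold Matrix.IsSymm at *
    rw [Matrix.transpose_mul, this, H.shift_inv_adj ht hs]
  · simp [hφ.ne_zero, H.det, Matrix.det_nonsing_inv, hs]
  · filter_upwards [eventually_det H hφ hΩ hx hs] with y hy
      using lower_pencil H hφ hΩ hy.1 hy.2

theorem curvature_pencil (l k i j : Fin 3) : curvature (lower Ω) l k i j x = 0 := by
  have ht := hφ.maps x hx
  refine curvature_eq_zero (A := pencilConn C deg d s) (hφ.an x hx) (hφ.det x hx)
    (fun b => H.an_pencilConn ht hs b) (fun i => ?_) (fun a b => H.pencilConn_flat ht hs a b) l k i j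
  filter_upwards [eventually_det H hφ hΩ hx hs] with y hy using chrM_pencil H hφ hΩ hy.1 hy.2 i

/-- Raising an index multiplies the connection form -R(U+s)⁻¹C_b by U + s. The inverse cancels: the
first term does not depend on s, and the second is linear in Ω. Additivity of the symbols and the
formula for Δ both follow. -/
theorem contraChristoffel_pencil (i j k : Fin 3) : contraChristoffel Ω i j k x
    = κ * ∑ a, ∑ n, (jac φ x)⁻¹ i a * η⁻¹ a n
        * ((jac φ x)⁻¹ * (regMat deg d * C n (φ x)) * jac φ x) j k
      - ∑ m, Ω x i m * ((jac φ x)⁻¹ * mpd m (jac φ) x) j k := by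
  have ht := hφ.maps x hx
  have hJ := hφ.det x hx
  have e0 : contraChristoffel Ω i j k x = -∑ m, Ω x i m * chrM (lower Ω) m x j k := rfl
  simp only [e0, chrM_pencil H hφ hΩ hx hs, gaugeForm, Matrix.add_apply, mul_add,
    Finset.sum_add_distrib]
  rw [neg_add, ← sub_eq_add_neg]
  congr 1
  set U := eulerOp C deg (φ x) + s • 1 with hU
  have hUη : U * η⁻¹ = η⁻¹ * Uᵀ := by
    rw [hU, add_mul, Matrix.transpose_add, mul_add, H.eulerOp_inv_metric ht]
    simp
  -- Multiplication operators expand in the columns of the shifted Euler operator, so the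
  -- contraction with U assembles the product U⁻¹U.
  have hUC : ∀ n, U * C n (φ x) = ∑ b, U b n • C b (φ x) := by
    intro n
    simp only [hU, add_mul, H.eulerOp_mul ht, Matrix.add_apply, add_smul, Finset.sum_add_distrib,
      Matrix.smul_mul, one_mul, Matrix.smul_apply]
    congr 1
    rw [Finset.sum_eq_single n] <;> simp +contextual [Matrix.one_apply]
  have hΩJ : Ω x * (jac φ x)ᵀ = κ • ((jac φ x)⁻¹ * (η⁻¹ * Uᵀ)) := by
    rw [hΩ x hx, ← hUη, Matrix.smul_mul, mul_assoc, ← Matrix.transpose_mul, self_mul_inv_of hJ,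
      Matrix.transpose_one, mul_one]
  have e1 : ∀ m, ((jac φ x)⁻¹ * pullForm φ (pencilConn C deg d s) m x * jac φ x) j k
      = -∑ b, jac φ x b m * ((jac φ x)⁻¹ * (regMat deg d * U⁻¹ * C b (φ x)) * jac φ x) j k := by
    intro m
    simp only [pullForm, pencilConn, ← hU, Finset.mul_sum, Finset.sum_mul, Matrix.sum_apply,
      Matrix.mul_smul, Matrix.smul_mul, Matrix.smul_apply, smul_eq_mul, mul_neg, neg_mul,
      Matrix.neg_apply, ← Finset.sum_neg_distrib, smul_neg]
  calc -∑ m, Ω x i m * ((jac φ x)⁻¹ * pullForm φ (pencilConn C deg d s) m x * jac φ x) j k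
      = ∑ b, (Ω x * (jac φ x)ᵀ) i b
          * ((jac φ x)⁻¹ * (regMat deg d * U⁻¹ * C b (φ x)) * jac φ x) j k := by
        simp only [e1, mul_neg, Finset.sum_neg_distrib, neg_neg, Matrix.mul_apply (M := Ω x),
          Finset.sum_mul, Finset.mul_sum, Matrix.transpose_apply]
        rw [Finset.sum_comm]
        exact Finset.sum_congr rfl fun b _ => Finset.sum_congr rfl fun m _ => by ring
    _ = κ * ∑ a, ∑ n, (jac φ x)⁻¹ i a * η⁻¹ a n * ∑ b, U b n
          * ((jac φ x)⁻¹ * (regMat deg d * U⁻¹ * C b (φ x)) * jac φ x) j k := by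
        rw [hΩJ]
        simp only [Matrix.smul_apply, smul_eq_mul, Matrix.mul_apply (M := (jac φ x)⁻¹) (N := η⁻¹ * Uᵀ),
          Matrix.mul_apply (M := η⁻¹), Matrix.transpose_apply, Finset.mul_sum, Finset.sum_mul]
        rw [Finset.sum_comm]
        refine Finset.sum_congr rfl fun a _ => ?_
        rw [Finset.sum_comm]
        exact Finset.sum_congr rfl fun b _ => Finset.sum_congr rfl fun m _ => by ring
    _ = _ := by
        congr 1
        refine Finset.sum_congr rfl fun a _ => Finset.sum_congr rfl fun n _ => ?_
        congr 1
        have e2 : ∑ b, U b n • ((jac φ x)⁻¹ * (regMat deg d * U⁻¹ * C b (φ x)) * jac φ x)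
            = (jac φ x)⁻¹ * (regMat deg d * U⁻¹ * (∑ b, U b n • C b (φ x))) * jac φ x := by
          simp only [Finset.mul_sum, Finset.sum_mul, Matrix.mul_smul, Matrix.smul_mul]
        have e3 : regMat deg d * U⁻¹ * (U * C n (φ x)) = regMat deg d * C n (φ x) := by
          rw [mul_assoc, ← mul_assoc U⁻¹, inv_mul_self_of hs, one_mul]
        rw [← hUC, e3] at e2
        rw [← e2, Matrix.sum_apply]
        simp only [Matrix.smul_apply, smul_eq_mul]

end pencil

theorem contraChristoffel_flat {x : V3} (hx : x ∈ N) (i j k : Fin 3) :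
    contraChristoffel (lieContra X Ω₂) i j k x
      = -∑ m, lieContra X Ω₂ x i m * ((jac φ x)⁻¹ * mpd m (jac φ) x) j k := by
  have e0 : contraChristoffel (lieContra X Ω₂) i j k x
    = -∑ m, lieContra X Ω₂ x i m * chrM (lower (lieContra X Ω₂)) m x j k := rfl
  simp only [e0, IsPullback.chrM_const hφ.toIsLocalChart H.symm H.det (inv_ne_zero hφ.ne_zero)
    (fun x hx => lower_flat H hφ hx) hx, IsPullback.gaugeForm_zero]

theorem contra_eq_zero_shift : ∀ x ∈ N, Ω₂ x
    = κ • ((jac φ x)⁻¹ * ((eulerOp C deg (φ x) + (0 : ℂ) • 1) * η⁻¹) * ((jac φ x)⁻¹)ᵀ) := by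
  intro x hx
  rw [zero_smul, add_zero]; exact contra_eq H hφ hx

/-- The differential of τ is κ⁻¹Jᵀη applied to the unity vector, and the flat contravariant metric
contributes κη⁻¹; the factors κ and η cancel. -/
theorem grad_flat {x : V3} (hx : x ∈ N) : grad (lieContra X Ω₂) τ x
    = (jac φ x)⁻¹ *ᵥ Pi.single r 1 := by
  have hJ := hφ.det x hx
  have e : (fun j => pd j τ x) = κ⁻¹ • ((jac φ x)ᵀ *ᵥ (η *ᵥ Pi.single r 1)) := by
    ext j
    rw [hφ.fn x hx]
    simp [Matrix.mulVec, dotProduct]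
  have h2 : ((jac φ x)⁻¹)ᵀ * (jac φ x)ᵀ = 1 := by
    rw [← Matrix.transpose_mul, self_mul_inv_of hJ, Matrix.transpose_one]
  rw [grad_eq, e, flatMetric_eq H hφ hx, Matrix.smul_mulVec, Matrix.mulVec_smul, smul_smul,
    mul_inv_cancel₀ hφ.ne_zero, one_smul, Matrix.mulVec_mulVec, Matrix.mulVec_mulVec,
    mul_assoc _ ((jac φ x)⁻¹ᵀ), h2, mul_one, mul_assoc _ η⁻¹, inv_mul_self_of H.det, mul_one]

/-- As for the flat metric, except that Uη⁻¹ leaves U applied to the unity vector, which is the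
Euler field. -/
theorem grad_contra {x : V3} (hx : x ∈ N) : grad Ω₂ τ x
    = (jac φ x)⁻¹ *ᵥ fun i => deg i * φ x i := by
  have hJ := hφ.det x hx
  have e : (fun j => pd j τ x) = κ⁻¹ • ((jac φ x)ᵀ *ᵥ (η *ᵥ Pi.single r 1)) := by
    ext j
    rw [hφ.fn x hx]
    simp [Matrix.mulVec, dotProduct]
  have h2 : ((jac φ x)⁻¹)ᵀ * (jac φ x)ᵀ = 1 := by
    rw [← Matrix.transpose_mul, self_mul_inv_of hJ, Matrix.transpose_one]
  rw [grad_eq, e, contra_eq H hφ hx, Matrix.smul_mulVec, Matrix.mulVec_smul, smul_smul,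
    mul_inv_cancel₀ hφ.ne_zero, one_smul, Matrix.mulVec_mulVec, Matrix.mulVec_mulVec,
    ← mul_assoc, mul_assoc _ ((jac φ x)⁻¹ᵀ), h2, mul_one,
    mul_assoc _ η⁻¹, inv_mul_self_of H.det, mul_one,
    ← Matrix.mulVec_mulVec]
  congr 1
  ext k
  rw [← H.eulerOp_unit (hφ.maps x hx), Matrix.mulVec_single_one]
  rfl

/-- In flat coordinates the covariant derivative of E is diag(deg), so the tensor becomes R. The
transpose reflects that its first index is the covariant one. -/
theorem regTensor_eq {x : V3} (hx : x ∈ N) :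
    regTensor Ω₂ (lieContra X Ω₂) τ d x = ((jac φ x)⁻¹ * regMat deg d * jac φ x)ᵀ := by
  ext i j
  rw [regTensor, Matrix.of_apply, IsPullback.covDeriv_const hφ.toIsLocalChart H.symm H.det
    (inv_ne_zero hφ.ne_zero) (fun x hx => lower_flat H hφ hx) (fun x hx => grad_contra H hφ hx)
    (fun x hx => IsPullback.analyticAt_euler hφ.toIsLocalChart deg hx)
    (fun x hx => IsPullback.jac_euler hφ.toIsLocalChart deg hx) hx, Matrix.transpose_apply,
    regMat_eq, mul_add, add_mul, Matrix.mul_smul, Matrix.smul_mul, mul_one,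
    inv_mul_self_of (hφ.det x hx), Matrix.add_apply, Matrix.smul_apply, Matrix.one_apply, add_comm]
  simp [eq_comm]

theorem regMat_det : (regMat deg d).det ≠ 0 := by
  rw [regMat, Matrix.det_diagonal]
  exact Finset.prod_ne_zero_iff.2 fun i _ => H.reg i

/-- The inhomogeneous parts of the two families of symbols enter as Ω₁Ω₂ times second derivatives of
φ, symmetric in the summation indices, and cancel in the difference. Only the tensorial part R C_n
remains. -/
theorem deltaTensor_eq {x : V3} (hx : x ∈ N) (i j k : Fin 3) :
    deltaTensor Ω₂ (lieContra X Ω₂) i j k x = ∑ m, lieContra X Ω₂ x j m * (κ * ∑ a, ∑ n,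
      (jac φ x)⁻¹ i a * η⁻¹ a n * ((jac φ x)⁻¹ * (regMat deg d * C n (φ x)) * jac φ x) k m) := by
  have h2 := contraChristoffel_pencil H hφ (contra_eq_zero_shift H hφ) hx
    (by simpa using eulerOp_det H hφ hx)
  have h1 := contraChristoffel_flat H hφ hx
  simp only [deltaTensor, h1, h2, mul_sub, mul_neg, sub_neg_eq_add]
  rw [Finset.sum_add_distrib, Finset.sum_sub_distrib]
  rw [sub_add_eq_add_sub, add_sub_assoc, sub_eq_zero.2, add_zero]
  simp only [Finset.mul_sum]
  rw [Finset.sum_comm]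
  refine Finset.sum_congr rfl fun m _ => Finset.sum_congr rfl fun n _ => ?_
  have : ((jac φ x)⁻¹ * mpd n (jac φ) x) k m = ((jac φ x)⁻¹ * mpd m (jac φ) x) k n := by
    simp only [Matrix.mul_apply, mpd_jac_symm (hφ.an x hx) n m]
  rw [this]; ring

/-- Lowering an index with Ω₁⁻¹ removes the factor Ω₁ of Δ, and the inverse of the regularity tensor
removes R. The remaining expression in η⁻¹ and C_nᵀη is the multiplication, because the cubic form
ηC is totally symmetric. -/
theorem mul_eq {x : V3} (hx : x ∈ N) (a b i : Fin 3) :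
    (pencilFrobenius Ω₂ (lieContra X Ω₂) τ d).mul x a b i
      = ((jac φ x)⁻¹ * pullForm φ C a x * jac φ x) i b := by
  have hJ := hφ.det x hx
  have ht := hφ.maps x hx
  set Ω₁ := lieContra X Ω₂ with hΩ₁
  have hd1 : (Ω₁ x).det ≠ 0 := by
    rw [hΩ₁, flatMetric_eq H hφ hx]
    simp [Matrix.det_smul, hφ.ne_zero, H.det, hJ, Matrix.det_nonsing_inv]
  have hsymm : (Ω₁ x)ᵀ = Ω₁ x := by
    rw [hΩ₁, flatMetric_eq H hφ hx]
    simp [Matrix.transpose_smul, Matrix.transpose_mul, H.inv_symm, mul_assoc]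
  set T : Fin 3 → Mat3 := fun n => (jac φ x)⁻¹ * (regMat deg d * C n (φ x)) * jac φ x with hT
  set S : Mat3 := (regTensor Ω₂ Ω₁ τ d x)⁻¹ * lower Ω₁ x with hS
  have hR : (regMat deg d)ᵀ = regMat deg d := Matrix.diagonal_transpose _
  have hRd := regMat_det H hφ
  -- This is the cancellation of R against the inverse regularity tensor; R is diagonal and
  -- therefore equals its transpose.
  have hTS : ∀ n, (T n)ᵀ * S = κ⁻¹ • ((jac φ x)ᵀ * (C n (φ x))ᵀ * η * jac φ x) := by
    intro n
    have hri : (regTensor Ω₂ Ω₁ τ d x)⁻¹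
        = ((jac φ x)⁻¹ * (regMat deg d)⁻¹ * jac φ x)ᵀ := by
      rw [hΩ₁, regTensor_eq H hφ hx]
      apply Matrix.inv_eq_right_inv
      rw [← Matrix.transpose_mul]
      have : (jac φ x)⁻¹ * (regMat deg d)⁻¹ * jac φ x * ((jac φ x)⁻¹ * regMat deg d * jac φ x) = 1 := by
        calc _ = (jac φ x)⁻¹ * ((regMat deg d)⁻¹ * ((jac φ x * (jac φ x)⁻¹) * regMat deg d)) * jac φ x := by
              simp only [mul_assoc]
          _ = 1 := by rw [self_mul_inv_of hJ, one_mul, inv_mul_self_of hRd, mul_one, inv_mul_self_of hJ]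
      rw [this, Matrix.transpose_one]
    have hJK' : ∀ B : Mat3, (jac φ x)⁻¹ᵀ * ((jac φ x)ᵀ * B) = B := fun B => by
      rw [← mul_assoc, ← Matrix.transpose_mul, self_mul_inv_of hJ, Matrix.transpose_one, one_mul]
    have hRR : ∀ B : Mat3, regMat deg d * ((regMat deg d)⁻¹ᵀ * B) = B := fun B => by
      rw [Matrix.transpose_nonsing_inv, hR, ← mul_assoc, self_mul_inv_of hRd, one_mul]
    rw [hS, hri, hΩ₁, lower_flat H hφ hx, hT]
    simp only [Matrix.transpose_mul, Matrix.mul_smul, mul_assoc, hJK', hR, hRR]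
  have hL : ∀ m, ∑ j, Ω₁ x j m * lower Ω₁ x j a = if m = a then 1 else 0 := by
    intro m
    have : ((Ω₁ x)ᵀ * lower Ω₁ x) m a = (1 : Mat3) m a := by
      rw [hsymm, lower, self_mul_inv_of hd1]
    rw [Matrix.mul_apply, Matrix.one_apply] at this
    exact this
  calc (pencilFrobenius Ω₂ Ω₁ τ d).mul x a b i
      = ∑ j, ∑ k, deltaTensor Ω₂ Ω₁ i j k x * lower Ω₁ x j a * S k b := rfl
    _ = ∑ k, ∑ m, (∑ j, Ω₁ x j m * lower Ω₁ x j a) * (κ * ∑ a', ∑ n,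
          (jac φ x)⁻¹ i a' * η⁻¹ a' n * T n k m) * S k b := by
        rw [Finset.sum_comm]
        refine Finset.sum_congr rfl fun k _ => ?_
        simp only [hΩ₁, deltaTensor_eq H hφ hx]
        simp only [Finset.sum_mul (s := Finset.univ)]
        rw [Finset.sum_comm]
        refine Finset.sum_congr rfl fun m _ => Finset.sum_congr rfl fun j _ => ?_
        ring
    _ = ∑ k, (κ * ∑ a', ∑ n, (jac φ x)⁻¹ i a' * η⁻¹ a' n * T n k a) * S k b := by
        refine Finset.sum_congr rfl fun k _ => ?_
        simp only [hL]
        simp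
    _ = κ * ∑ a', ∑ n, (jac φ x)⁻¹ i a' * η⁻¹ a' n * ((T n)ᵀ * S) a b := by
        simp only [Matrix.mul_apply (M := (T _)ᵀ), Finset.mul_sum, Finset.sum_mul,
          Matrix.transpose_apply]
        rw [Finset.sum_comm]
        refine Finset.sum_congr rfl fun a' _ => ?_
        rw [Finset.sum_comm]
        exact Finset.sum_congr rfl fun n _ => Finset.sum_congr rfl fun k _ => by ring
    _ = ∑ a', (jac φ x)⁻¹ i a' * ∑ n, η⁻¹ a' n * ((jac φ x)ᵀ * (C n (φ x))ᵀ * η * jac φ x) a b := by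
        simp only [hTS, Matrix.smul_apply, smul_eq_mul, Finset.mul_sum]
        refine Finset.sum_congr rfl fun a' _ => Finset.sum_congr rfl fun n _ => ?_
        have := hφ.ne_zero
        field_simp
    _ = _ := by
        rw [mul_assoc, Matrix.mul_apply]
        refine Finset.sum_congr rfl fun a' _ => ?_
        congr 1
        -- Total symmetry of the cubic form moves the summation index n out of the multiplication
        -- matrix, so that η⁻¹ and η can cancel.
        have hsym : ∀ n α β, (C n (φ x))ᵀ * η = η * C n (φ x) → ((C n (φ x))ᵀ * η) α β
            = (η * C α (φ x)) n β := by
          intro n α β h0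
          have h1 : ((C n (φ x))ᵀ * η) α β = ((C α (φ x))ᵀ * η) n β := by
            simp only [Matrix.mul_apply, Matrix.transpose_apply, H.comm _ ht n α]
          rw [h1, H.adj _ ht]
        have e1 : ∀ n, ((jac φ x)ᵀ * (C n (φ x))ᵀ * η * jac φ x) a b
            = ∑ α, ∑ β, jac φ x α a * (η * C α (φ x)) n β * jac φ x β b := by
          intro n
          rw [mul_assoc ((jac φ x)ᵀ), Matrix.mul_apply]
          simp only [Matrix.mul_apply (M := (jac φ x)ᵀ), Matrix.transpose_apply, Finset.sum_mul]
          rw [Finset.sum_comm]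
          exact Finset.sum_congr rfl fun α _ => Finset.sum_congr rfl fun β _ => by
            rw [hsym n α β (H.adj _ ht n)]
        have e2 : (pullForm φ C a x * jac φ x) a' b
            = ∑ α, ∑ β, jac φ x α a * C α (φ x) a' β * jac φ x β b := by
          simp only [pullForm, Finset.sum_mul, Matrix.sum_apply, Matrix.smul_mul, Matrix.smul_apply,
            Matrix.mul_apply, Finset.smul_sum, smul_eq_mul]
          rw [Finset.sum_comm]
        have e3 : ∀ α, C α (φ x) = η⁻¹ * (η * C α (φ x)) := fun α => by
          rw [← mul_assoc, inv_mul_self_of H.det, one_mul]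
        rw [e2]
        simp only [e1, Finset.mul_sum]
        rw [Finset.sum_comm]
        refine Finset.sum_congr rfl fun α _ => ?_
        rw [Finset.sum_comm]
        refine Finset.sum_congr rfl fun β _ => ?_
        conv_rhs => rw [e3 α, Matrix.mul_apply (M := η⁻¹), Finset.mul_sum, Finset.sum_mul]
        exact Finset.sum_congr rfl fun n _ => by ring

/-- The Frobenius structure of the pencil is the pullback of the flat structure. -/
theorem isPullback :
    IsPullback N φ κ η C r deg d (pencilFrobenius Ω₂ (lieContra X Ω₂) τ d) where
  metric x hx := lower_flat H hφ hx
  mulM x hx i := by ext k j; exact mul_eq H hφ hx i j k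
  unity x hx := grad_flat H hφ hx
  euler x hx := grad_contra H hφ hx
  charge := rfl

theorem intersectionForm_eq {x : V3} (hx : x ∈ N) :
    (pencilFrobenius Ω₂ (lieContra X Ω₂) τ d).intersectionForm x = Ω₂ x := by
  have hP := isPullback H hφ
  have hJ := hφ.det x hx
  have ht := hφ.maps x hx
  set M := pencilFrobenius Ω₂ (lieContra X Ω₂) τ d with hMdef
  have e : M.intersectionForm x = (M.metric x)⁻¹ * (∑ k, M.euler x k • M.mulM k x)ᵀ := by
    ext i j
    simp only [FrobData.intersectionForm, Matrix.of_apply, Matrix.mul_apply, Matrix.transpose_apply,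
      Matrix.sum_apply, Matrix.smul_apply, FrobData.mulM, smul_eq_mul, Finset.mul_sum]
    rw [Finset.sum_comm]
    exact Finset.sum_congr rfl fun a _ => Finset.sum_congr rfl fun k _ => by
      rw [IsPullback.mul_symm H hφ.toIsLocalChart hφ.ne_zero hP hx a k j]; ring
  have hinv : (M.metric x)⁻¹ = lieContra X Ω₂ x := by
    have hd1 : (lieContra X Ω₂ x).det ≠ 0 := by
      rw [flatMetric_eq H hφ hx]
      simp [Matrix.det_smul, hφ.ne_zero, H.det, hJ, Matrix.det_nonsing_inv]
    exact Matrix.nonsing_inv_nonsing_inv _ (isUnit_iff_ne_zero.2 hd1)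
  rw [e, hinv, IsPullback.sum_mulM H hφ.toIsLocalChart hφ.ne_zero hP hx _ _ (hP.euler x hx),
    flatMetric_eq H hφ hx, contra_eq H hφ hx]
  have hJK' : ∀ B : Mat3, (jac φ x)⁻¹ᵀ * ((jac φ x)ᵀ * B) = B := fun B => by
    rw [← mul_assoc, ← Matrix.transpose_mul, self_mul_inv_of hJ, Matrix.transpose_one, one_mul]
  have : ∑ b, (deg b * φ x b) • C b (φ x) = eulerOp C deg (φ x) := rfl
  rw [this, H.eulerOp_inv_metric ht]
  simp only [Matrix.transpose_mul, Matrix.smul_mul, mul_assoc, hJK']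

/-- The intersection form changes along E by the homogeneity of U, which contributes weight 1, and
by the grading of η⁻¹, which contributes -(2-d). -/
theorem lieContra_euler {x : V3} (hx : x ∈ N) : lieContra (grad Ω₂ τ) Ω₂ x = (d - 1) • Ω₂ x := by
  have ht := hφ.maps x hx
  rw [lieContra_pull (g' := fun t => eulerOp C deg t * η⁻¹) hφ.toIsLocalChart
    (fun x hx => contra_eq H hφ hx)
    (fun x hx => (H.an_eulerOp (hφ.maps x hx)).mul (MAn.const _ _))
    (fun x hx => grad_contra H hφ hx)
    (fun x hx => IsPullback.analyticAt_euler hφ.toIsLocalChart deg hx)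
    (fun x hx => IsPullback.jac_euler hφ.toIsLocalChart deg hx) hx]
  conv_rhs => rw [contra_eq H hφ hx]
  have e1 : ∑ b, (deg b * φ x b) • mpd b (fun t => eulerOp C deg t * η⁻¹) (φ x)
      = (eulerOp C deg (φ x) + regMat deg d * eulerOp C deg (φ x)
        - eulerOp C deg (φ x) * regMat deg d) * η⁻¹ := by
    simp only [mpd_intersection H hφ ht]
    simp only [eulerOp, Finset.mul_sum, Finset.sum_mul, Matrix.smul_mul, Matrix.mul_smul, add_mul,
      sub_mul, smul_add, smul_sub, Finset.sum_add_distrib, Finset.sum_sub_distrib]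
  have h := H.metric_hom_inv
  have e2 : (eulerOp C deg (φ x) + regMat deg d * eulerOp C deg (φ x)
        - eulerOp C deg (φ x) * regMat deg d) * η⁻¹
      - diagonal deg * (eulerOp C deg (φ x) * η⁻¹)
      - eulerOp C deg (φ x) * η⁻¹ * (diagonal deg)ᵀ
      = (d - 1) • (eulerOp C deg (φ x) * η⁻¹) := by
    rw [regMat_eq, Matrix.diagonal_transpose]
    generalize eulerOp C deg (φ x) = U
    calc _ = U * η⁻¹ - U * (diagonal deg * η⁻¹ + η⁻¹ * diagonal deg) := by
          simp only [add_mul, mul_add, sub_mul, Matrix.smul_mul, Matrix.mul_smul, one_mul, mul_one,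
            mul_assoc]
          abel
      _ = _ := by rw [h, Matrix.mul_smul]; module
  rw [e1, e2, Matrix.mul_smul, Matrix.smul_mul, smul_comm]

theorem lieContra_unity {x : V3} (hx : x ∈ N) :
    lieContra (grad (lieContra X Ω₂) τ) Ω₂ x = lieContra X Ω₂ x := by
  have h1 : grad (lieContra X Ω₂) τ =ᶠ[𝓝 x] X := by
    filter_upwards [hφ.isOpen.eventually_mem hx] with y hy
    rw [grad_flat H hφ hy, vec_eq H hφ hy]
  rw [lieContra_eq, lieContra_eq, jac_congr h1, h1.eq_of_nhds]

theorem lieContra_unity_flat {x : V3} (hx : x ∈ N) :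
    lieContra (grad (lieContra X Ω₂) τ) (lieContra X Ω₂) x = 0 := by
  rw [lieContra_pull (g' := fun _ => η⁻¹) hφ.toIsLocalChart
    (fun x hx => flatMetric_eq H hφ hx) (fun x hx => MAn.const _ _)
    (fun x hx => grad_flat H hφ hx) (fun x _ => IsPullback.analyticAt_unity r x)
    (fun x _ => IsPullback.jac_unity r x) hx]
  simp [mpd_const]

theorem bracket_unity_euler {x : V3} (hx : x ∈ N) :
    bracket (grad (lieContra X Ω₂) τ) (grad Ω₂ τ) x = grad (lieContra X Ω₂) τ x :=
  (IsPullback.isFrobeniusManifold H hφ.toIsLocalChart hφ.ne_zero (isPullback H hφ)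
    ⟨x, hx⟩).euler_unity x hx

/-- The degenerate members of the pencil are degenerate on nowhere dense sets. -/
theorem mem_closure_det_ne_zero {W : Set V3} (hN : N ⊆ W) {x : V3} (hx : x ∈ N) (s : ℂ) :
    x ∈ closure {y ∈ W | (Ω₂ y + s • lieContra X Ω₂ y).det ≠ 0} := by
  have ht := hφ.maps x hx
  have hstrict : HasStrictFDerivAt φ (fderiv ℂ φ x) x := (hφ.an x hx).hasStrictFDerivAt
  have hmat := fderiv_eq_jac_mulVec (hφ.an x hx).differentiableAt
  have hsurj : Function.Surjective (fderiv ℂ φ x) := by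
    intro w
    refine ⟨(jac φ x)⁻¹ *ᵥ w, ?_⟩
    rw [hmat, Matrix.mulVec_mulVec, self_mul_inv_of (hφ.det x hx), Matrix.one_mulVec]
  have hmap : Filter.map φ (𝓝 x) = 𝓝 (φ x) :=
    hstrict.map_nhds_eq_of_surj (LinearMap.range_eq_top.2 hsurj)
  rw [mem_closure_iff_nhds]
  intro V hV
  have hVN : V ∩ N ∈ 𝓝 x := Filter.inter_mem hV (hφ.isOpen.mem_nhds hx)
  have himg : φ '' (V ∩ N) ∈ 𝓝 (φ x) := by
    rw [← hmap]; exact Filter.image_mem_map hVN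
  -- Moving by σ along the unity field in flat coordinates replaces U + s by U + s + σ. Since φ is
  -- open at x, these displaced points come from points near x.
  have hline : Filter.Tendsto (fun σ : ℂ => φ x + σ • (Pi.single r 1 : V3)) (𝓝 0) (𝓝 (φ x)) := by
    have : Continuous fun σ : ℂ => φ x + σ • (Pi.single r 1 : V3) := by fun_prop
    simpa using this.tendsto 0
  have hD : ∀ᶠ σ : ℂ in 𝓝 0, φ x + σ • (Pi.single r 1 : V3) ∈ φ '' (V ∩ N) := hline himg
  -- The determinant of U + s + σ is the characteristic polynomial of -(U + s) at σ. It has finitely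
  -- many roots, so small nonzero σ avoid them.
  have hfin := (Polynomial.rootSet_finite (-(eulerOp C deg (φ x) + s • 1)).charpoly ℂ)
  have hev : ∀ᶠ σ : ℂ in 𝓝[≠] 0,
      σ ∉ (-(eulerOp C deg (φ x) + s • 1)).charpoly.rootSet ℂ := by
    have h1 : IsClosed ((-(eulerOp C deg (φ x) + s • 1)).charpoly.rootSet ℂ \ {0}) :=
      (hfin.subset Set.sdiff_subset).isClosed
    have h2 : ∀ᶠ σ : ℂ in 𝓝 0,
        σ ∉ (-(eulerOp C deg (φ x) + s • 1)).charpoly.rootSet ℂ \ {0} :=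
      h1.isOpen_compl.eventually_mem (by simp)
    filter_upwards [nhdsWithin_le_nhds h2, self_mem_nhdsWithin] with σ h3 h4 h5
    exact h3 ⟨h5, h4⟩
  have hU := eulerOp_add_smul_unit H ht
  obtain ⟨σ, ⟨⟨y, ⟨hyV, hyN⟩, hy⟩, hσ⟩, hroot⟩ :=
    (((hD.and hU).filter_mono nhdsWithin_le_nhds).and hev).exists
  refine ⟨y, hyV, hN hyN, (det_pencil H hφ hyN s).2 ?_⟩
  rw [hy, hσ]
  intro h0
  apply hroot
  rw [Polynomial.mem_rootSet]
  refine ⟨(Matrix.charpoly_monic _).ne_zero, ?_⟩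
  rw [Polynomial.coe_aeval_eq_eval, Matrix.eval_charpoly, ← h0]
  congr 1
  rw [Matrix.scalar_apply, ← Matrix.smul_one_eq_diagonal]
  abel

end IsPencilChart

/-! ### From charts to global statements -/

theorem exists_injOn_nhd {φ : V3 → V3} {x : V3} (hφ : AnalyticAt ℂ φ x) (hJ : (jac φ x).det ≠ 0) :
    ∃ U : Set V3, IsOpen U ∧ x ∈ U ∧ Set.InjOn φ U := by
  have hmat := fderiv_eq_jac_mulVec hφ.differentiableAt
  have hinj : (fderiv ℂ φ x).ker = ⊥ := by
    rw [LinearMap.ker_eq_bot']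
    intro v hv
    have h1 : jac φ x *ᵥ v = 0 := by rw [← hmat]; exact hv
    have h2 := congrArg (fun w => (jac φ x)⁻¹ *ᵥ w) h1
    simpa [Matrix.mulVec_mulVec, inv_mul_self_of hJ] using h2
  have hsurj : (fderiv ℂ φ x).range = ⊤ := by
    refine LinearMap.range_eq_top.2 fun w => ⟨(jac φ x)⁻¹ *ᵥ w, ?_⟩
    show fderiv ℂ φ x _ = _
    rw [hmat, Matrix.mulVec_mulVec, self_mul_inv_of hJ, Matrix.one_mulVec]
  have hs : HasStrictFDerivAt φ
      ((ContinuousLinearEquiv.ofBijective (fderiv ℂ φ x) hinj hsurj : V3 ≃L[ℂ] V3) : V3 →L[ℂ] V3) x := by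
    rw [ContinuousLinearEquiv.coe_ofBijective]; exact hφ.hasStrictFDerivAt
  exact ⟨_, (hs.toOpenPartialHomeomorph φ).open_source, hs.mem_toOpenPartialHomeomorph_source,
    (hs.toOpenPartialHomeomorph φ).injOn⟩

theorem IsFrobeniusManifold.of_local {W : Set V3} {M : FrobData} (hne : W.Nonempty)
    (h : ∀ p ∈ W, ∃ N ⊆ W, p ∈ N ∧ IsFrobeniusManifold N M) : IsFrobeniusManifold W M := by
  have hd : ∀ {E : Type} [NormedAddCommGroup E] [NormedSpace ℂ E] (f : V3 → E),
      (∀ N, IsFrobeniusManifold N M → DifferentiableOn ℂ f N) → DifferentiableOn ℂ f W := by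
    intro E _ _ f hf x hx
    obtain ⟨N, _, hxN, hN⟩ := h x hx
    exact ((hf N hN).differentiableAt (hN.isOpen.mem_nhds hxN)).differentiableWithinAt
  have hp : ∀ {P : V3 → Prop}, (∀ N, IsFrobeniusManifold N M → ∀ x ∈ N, P x) → ∀ x ∈ W, P x := by
    intro P hP x hx
    obtain ⟨N, _, hxN, hN⟩ := h x hx
    exact hP N hN x hxN
  exact {
    isOpen := by
      rw [isOpen_iff_mem_nhds]
      intro x hx
      obtain ⟨N, hNW, hxN, hN⟩ := h x hx
      exact Filter.mem_of_superset (hN.isOpen.mem_nhds hxN) hNW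
    nonempty := hne
    holo_metric := fun i j => hd _ fun N hN => hN.holo_metric i j
    holo_mul := fun i j k => hd _ fun N hN => hN.holo_mul i j k
    holo_unity := hd _ fun N hN => hN.holo_unity
    holo_euler := hd _ fun N hN => hN.holo_euler
    symm := hp fun N hN => hN.symm
    nondeg := hp fun N hN => hN.nondeg
    flat := hp fun N hN => hN.flat
    mul_comm := hp fun N hN => hN.mul_comm
    mul_assoc := hp fun N hN => hN.mul_assoc
    unity_mul := hp fun N hN => hN.unity_mul
    invariant := hp fun N hN => hN.invariant
    unity_flat := hp fun N hN => hN.unity_flat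
    potential := hp fun N hN => hN.potential
    euler_affine := hp fun N hN => hN.euler_affine
    euler_unity := hp fun N hN => hN.euler_unity
    euler_mul := hp fun N hN => hN.euler_mul
    euler_metric := hp fun N hN => hN.euler_metric }

theorem IsPencilChart.mono {D : Set V3} {η : Mat3} {C : Fin 3 → V3 → Mat3} {r : Fin 3}
    {deg : Fin 3 → ℂ} {Ω₂ : V3 → Mat3} {X : V3 → V3} {τ : V3 → ℂ} {N N' : Set V3} {φ : V3 → V3}
    {κ : ℂ} (h : IsPencilChart D η C r deg Ω₂ X τ N φ κ) (hN : N' ⊆ N) (ho : IsOpen N') :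
    IsPencilChart D η C r deg Ω₂ X τ N' φ κ where
  isOpen := ho
  an x hx := h.an x (hN hx)
  maps x hx := h.maps x (hN hx)
  det x hx := h.det x (hN hx)
  ne_zero := h.ne_zero
  nondeg x hx := h.nondeg x (hN hx)
  metric x hx := h.metric x (hN hx)
  vec x hx := h.vec x (hN hx)
  fn x hx := h.fn x (hN hx)
  fn_an x hx := h.fn_an x (hN hx)

/-! ### Gluing: statements on W from charts around each of its points. -/

section
variable {D : Set V3} {η : Mat3} {C : Fin 3 → V3 → Mat3} {r : Fin 3} {deg : Fin 3 → ℂ} {d : ℂ}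
  {Ω₂ : V3 → Mat3} {X : V3 → V3} {τ : V3 → ℂ} {W : Set V3}
  (H : FlatFrob D η C r deg d)
  (hW : ∀ p ∈ W, ∃ N ⊆ W, p ∈ N ∧ ∃ φ κ, IsPencilChart D η C r deg Ω₂ X τ N φ κ)
include H hW

theorem isFlatContravariantMetric_pencil (s : ℂ) :
    IsFlatContravariantMetric {x ∈ W | (Ω₂ x + s • lieContra X Ω₂ x).det ≠ 0}
      (fun x => Ω₂ x + s • lieContra X Ω₂ x) := by
  constructor
  · rintro i j x ⟨hx, hd⟩
    obtain ⟨N, _, hxN, φ, κ, hφ⟩ := hW x hx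
    have := an_pullContra (g' := fun t => (eulerOp C deg t + s • 1) * η⁻¹) hφ.toIsLocalChart
      (fun x hx => IsPencilChart.pencil_eq H hφ hx s)
      (fun x hx => IsPencilChart.an_intersection H hφ (hφ.maps x hx) s) hxN
    exact (this i j).differentiableAt.differentiableWithinAt
  · rintro x ⟨hx, hd⟩
    obtain ⟨N, _, hxN, φ, κ, hφ⟩ := hW x hx
    rw [IsPencilChart.pencil_eq H hφ hxN s]
    refine Matrix.IsSymm.smul ?_ _
    unfold Matrix.IsSymm
    have hs : ((eulerOp C deg (φ x) + s • 1) * η⁻¹)ᵀ = (eulerOp C deg (φ x) + s • 1) * η⁻¹ := by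
      rw [Matrix.transpose_mul, H.inv_symm, add_mul, Matrix.transpose_add, mul_add,
        H.eulerOp_inv_metric (hφ.maps x hxN)]
      simp
    rw [Matrix.transpose_mul, Matrix.transpose_mul, hs, Matrix.transpose_transpose]
    simp only [mul_assoc]
  · exact fun x hx => hx.2
  · rintro x ⟨hx, hd⟩
    obtain ⟨N, _, hxN, φ, κ, hφ⟩ := hW x hx
    exact IsPencilChart.curvature_pencil H hφ (fun x hx => IsPencilChart.pencil_eq H hφ hx s) hxN
      ((IsPencilChart.det_pencil H hφ hxN s).1 hd)

theorem isFlatContravariantMetric_contra : IsFlatContravariantMetric W Ω₂ := by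
  have h := isFlatContravariantMetric_pencil H hW 0
  have hset : {x ∈ W | (Ω₂ x + (0 : ℂ) • lieContra X Ω₂ x).det ≠ 0} = W := by
    ext x
    simp only [zero_smul, add_zero, Set.mem_ofPred_eq, and_iff_left_iff_imp]
    intro hx
    obtain ⟨N, _, hxN, φ, κ, hφ⟩ := hW x hx
    exact hφ.nondeg x hxN
  rw [hset] at h
  simpa using h

theorem isFlatContravariantMetric_flat : IsFlatContravariantMetric W (lieContra X Ω₂) := by
  constructor
  · intro i j x hx
    obtain ⟨N, _, hxN, φ, κ, hφ⟩ := hW x hx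
    have := an_pullContra (g' := fun _ => η⁻¹) hφ.toIsLocalChart
      (fun x hx => IsPencilChart.flatMetric_eq H hφ hx) (fun x hx => MAn.const _ _) hxN
    exact (this i j).differentiableAt.differentiableWithinAt
  · intro x hx
    obtain ⟨N, _, hxN, φ, κ, hφ⟩ := hW x hx
    rw [IsPencilChart.flatMetric_eq H hφ hxN]
    refine Matrix.IsSymm.smul ?_ _
    unfold Matrix.IsSymm
    rw [Matrix.transpose_mul, Matrix.transpose_mul, H.inv_symm, Matrix.transpose_transpose,
      mul_assoc]
  · intro x hx
    obtain ⟨N, _, hxN, φ, κ, hφ⟩ := hW x hx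
    rw [IsPencilChart.flatMetric_eq H hφ hxN]
    simp [Matrix.det_smul, hφ.ne_zero, H.det, hφ.det x hxN, Matrix.det_nonsing_inv]
  · intro x hx
    obtain ⟨N, _, hxN, φ, κ, hφ⟩ := hW x hx
    exact IsPullback.curvature_const hφ.toIsLocalChart H.symm H.det (inv_ne_zero hφ.ne_zero)
      (fun x hx => IsPencilChart.lower_flat H hφ hx) hxN

theorem isRegularQFPM_of_charts : IsRegularQFPM W Ω₂ (lieContra X Ω₂) τ d := by
  have hp : ∀ {P : V3 → Prop}, (∀ N φ κ, IsPencilChart D η C r deg Ω₂ X τ N φ κ → ∀ x ∈ N, P x) →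
      ∀ x ∈ W, P x := by
    intro P hP x hx
    obtain ⟨N, _, hxN, φ, κ, hφ⟩ := hW x hx
    exact hP N φ κ hφ x hxN
  exact {
    pencil := by
      refine ⟨isFlatContravariantMetric_contra H hW, isFlatContravariantMetric_flat H hW,
        Filter.Eventually.of_forall fun s => ⟨?_, isFlatContravariantMetric_pencil H hW s, ?_⟩⟩
      · intro x hx
        obtain ⟨N, hNW, hxN, φ, κ, hφ⟩ := hW x hx
        exact IsPencilChart.mem_closure_det_ne_zero H hφ hNW hxN s
      · intro x hx hd i j k
        obtain ⟨N, hNW, hxN, φ, κ, hφ⟩ := hW x hx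
        rw [IsPencilChart.contraChristoffel_pencil H hφ
            (fun x hx => IsPencilChart.pencil_eq H hφ hx s) hxN
            ((IsPencilChart.det_pencil H hφ hxN s).1 hd),
          IsPencilChart.contraChristoffel_pencil H hφ (IsPencilChart.contra_eq_zero_shift H hφ) hxN
            (by simpa using IsPencilChart.eulerOp_det H hφ hxN),
          IsPencilChart.contraChristoffel_flat H hφ hxN]
        -- The tensorial terms of the pencil and of Ω₂ are the same; the rest is linear in the
        -- metric and splits as Ω₂ + sΩ₁.
        simp only [Matrix.add_apply, Matrix.smul_apply, smul_eq_mul, add_mul,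
          Finset.sum_add_distrib, mul_assoc, mul_neg, Finset.mul_sum]
        ring
    holo := fun x hx => by
      obtain ⟨N, _, hxN, φ, κ, hφ⟩ := hW x hx
      exact (hφ.fn_an x hxN).differentiableAt.differentiableWithinAt
    bracket_eq := hp fun N φ κ hφ x hx => IsPencilChart.bracket_unity_euler H hφ hx
    lie_E := hp fun N φ κ hφ x hx => IsPencilChart.lieContra_euler H hφ hx
    lie_e := hp fun N φ κ hφ x hx => IsPencilChart.lieContra_unity H hφ hx
    lie_e' := hp fun N φ κ hφ x hx => IsPencilChart.lieContra_unity_flat H hφ hx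
    regular := hp fun N φ κ hφ x hx => by
      rw [IsPencilChart.regTensor_eq H hφ hx]
      simp [hφ.det x hx, IsPencilChart.regMat_det H hφ, Matrix.det_nonsing_inv] }

theorem isFrobeniusManifold_of_charts (hne : W.Nonempty) :
    IsFrobeniusManifold W (pencilFrobenius Ω₂ (lieContra X Ω₂) τ d) := by
  refine IsFrobeniusManifold.of_local hne fun p hp => ?_
  obtain ⟨N, hNW, hpN, φ, κ, hφ⟩ := hW p hp
  exact ⟨N, hNW, hpN, IsPullback.isFrobeniusManifold H hφ.toIsLocalChart hφ.ne_zero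
    (IsPencilChart.isPullback H hφ) ⟨p, hpN⟩⟩

end

/-! ### Linear changes of coordinates -/

theorem jac_linear (g : Mat3) (x : V3) : jac (fun y => g *ᵥ y) x = g := by
  ext i j
  simp only [jac, Matrix.of_apply, Matrix.mulVec, dotProduct]
  rw [pd_sum (h := fun a y => g i a * y a) _ (fun a _ => by fun_prop)]
  simp only [fun a => pd_const_mul (h := fun y : V3 => y a) (x := x) (by fun_prop) (g i a) j,
    pd_coord]
  simp

theorem analyticAt_linear (g : Mat3) (x : V3) : AnalyticAt ℂ (fun y : V3 => g *ᵥ y) x :=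
  analyticAt_mulVec (MAn.const g x) analyticAt_id

theorem jac_comp {φ ψ : V3 → V3} {x : V3} (hφ : AnalyticAt ℂ φ (ψ x)) (hψ : AnalyticAt ℂ ψ x) :
    jac (fun y => φ (ψ y)) x = jac φ (ψ x) * jac ψ x := by
  ext i j
  rw [Matrix.mul_apply]
  exact (pd_comp (h := fun y => φ y i) (analyticAt_pi_iff.1 hφ i).differentiableAt
    hψ.differentiableAt j).trans (Finset.sum_congr rfl fun a _ => mul_comm _ _)

section
variable {D : Set V3} {η : Mat3} {C : Fin 3 → V3 → Mat3} {r : Fin 3} {deg : Fin 3 → ℂ} {d : ℂ}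
  {Ω₂ : V3 → Mat3} {X : V3 → V3} {τ : V3 → ℂ} {N : Set V3} {φ : V3 → V3} {κ : ℂ}

/-- Since Ω₂, X and τ are equivariant, a chart at gx composed with g is a chart at x. Comparing the
pullbacks along φ and φ∘g will give invariance of the Frobenius structure without recomputing its
tensors. -/
theorem IsPencilChart.comp_linear (h : IsPencilChart D η C r deg Ω₂ X τ N φ κ) {g : Mat3}
    (hg : g.det ≠ 0) (hΩ : ∀ x, Ω₂ (g *ᵥ x) = g * Ω₂ x * gᵀ) (hX : ∀ x, X (g *ᵥ x) = g *ᵥ X x)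
    (hτ : ∀ x, τ (g *ᵥ x) = τ x) :
    IsPencilChart D η C r deg Ω₂ X τ {x | g *ᵥ x ∈ N} (fun x => φ (g *ᵥ x)) κ := by
  have hj : ∀ x, g *ᵥ x ∈ N → jac (fun x => φ (g *ᵥ x)) x = jac φ (g *ᵥ x) * g := fun x hx => by
    rw [jac_comp (ψ := fun x => g *ᵥ x) (h.an _ hx) (analyticAt_linear g x), jac_linear]
  have hcont : Continuous fun x : V3 => g *ᵥ x := Continuous.matrix_mulVec continuous_const continuous_id
  exact {
    isOpen := h.isOpen.preimage hcont
    an := fun x hx => (h.an _ hx).comp (analyticAt_linear g x)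
    maps := fun x hx => h.maps _ hx
    det := fun x hx => by rw [hj x hx, Matrix.det_mul]; exact mul_ne_zero (h.det _ hx) hg
    ne_zero := h.ne_zero
    nondeg := fun x hx => by
      have := h.nondeg _ hx
      rw [hΩ, Matrix.det_mul, Matrix.det_mul] at this
      exact right_ne_zero_of_mul (left_ne_zero_of_mul this)
    metric := fun x hx => by
      rw [hj x hx, ← h.metric _ hx, hΩ, Matrix.transpose_mul]
      simp only [mul_assoc]
    vec := fun x hx => by rw [hj x hx, ← h.vec _ hx, hX, Matrix.mulVec_mulVec]
    fn := fun x hx j => by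
      have e : τ = fun x => τ (g *ᵥ x) := by funext x; rw [hτ]
      have e2 : pd j τ x = ∑ a, jac (fun x => g *ᵥ x) x a j * pd a τ (g *ᵥ x) := by
        conv_lhs => rw [e]
        exact pd_comp (φ := fun x => g *ᵥ x) (h.fn_an _ hx).differentiableAt
          (analyticAt_linear g x).differentiableAt j
      rw [e2, jac_linear, hj x hx]
      simp only [h.fn _ hx, Matrix.mul_apply, Finset.mul_sum, Finset.sum_mul]
      rw [Finset.sum_comm]
      exact Finset.sum_congr rfl fun a _ => Finset.sum_congr rfl fun b _ => by ring
    fn_an := fun x hx => by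
      have e : τ = fun x => τ (g *ᵥ x) := by funext x; rw [hτ]
      rw [e]
      exact (h.fn_an _ hx).comp (analyticAt_linear g x) }

/-- Two pullbacks along `φ` and `φ ∘ g` are related by `g`. -/
theorem IsPencilChart.invariant (H : FlatFrob D η C r deg d)
    (h : IsPencilChart D η C r deg Ω₂ X τ N φ κ) {g : Mat3}
    (hg : g.det ≠ 0) (hΩ : ∀ x, Ω₂ (g *ᵥ x) = g * Ω₂ x * gᵀ) (hX : ∀ x, X (g *ᵥ x) = g *ᵥ X x)
    (hτ : ∀ x, τ (g *ᵥ x) = τ x) {M : FrobData} (hM : M = pencilFrobenius Ω₂ (lieContra X Ω₂) τ d)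
    {x : V3} (hx : g *ᵥ x ∈ N) :
    gᵀ * M.metric (g *ᵥ x) * g = M.metric x ∧
    (∀ i j k, ∑ m, g k m * M.mul x i j m
      = ∑ a, ∑ b, g a i * g b j * M.mul (g *ᵥ x) a b k) ∧
    M.unity (g *ᵥ x) = g *ᵥ M.unity x ∧ M.euler (g *ᵥ x) = g *ᵥ M.euler x := by
  have h' := h.comp_linear hg hΩ hX hτ
  have P := IsPencilChart.isPullback H h
  have P' := IsPencilChart.isPullback H h'
  rw [← hM] at P P'
  have hj : jac (fun x => φ (g *ᵥ x)) x = jac φ (g *ᵥ x) * g := by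
    rw [jac_comp (ψ := fun x => g *ᵥ x) (h.an _ hx) (analyticAt_linear g x), jac_linear]
  have hJ := h.det _ hx
  have hgi : ∀ v : V3, g *ᵥ (g⁻¹ *ᵥ v) = v := fun v => by
    rw [Matrix.mulVec_mulVec, self_mul_inv_of hg, Matrix.one_mulVec]
  refine ⟨?_, ?_, ?_, ?_⟩
  · rw [P.metric _ hx, P'.metric x hx, hj, Matrix.transpose_mul]
    simp only [Matrix.mul_smul, Matrix.smul_mul, mul_assoc]
  · intro i j k
    have e1 : ∑ m, g k m * M.mul x i j m = (g * M.mulM i x) k j := by rw [Matrix.mul_apply]; rfl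
    have e2 : ∑ a, ∑ b, g a i * g b j * M.mul (g *ᵥ x) a b k
        = ((∑ a, g a i • M.mulM a (g *ᵥ x)) * g) k j := by
      simp only [Finset.sum_mul, Matrix.sum_apply, Matrix.smul_mul, Matrix.smul_apply,
        Matrix.mul_apply, smul_eq_mul, FrobData.mulM, Matrix.of_apply, Finset.mul_sum]
      rw [Finset.sum_comm]
      exact Finset.sum_congr rfl fun a _ => Finset.sum_congr rfl fun b _ => by ring
    rw [e1, e2, P'.mulM x hx]
    have e3 : pullForm (fun x => φ (g *ᵥ x)) C i x = ∑ a, g a i • pullForm φ C a (g *ᵥ x) := by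
      simp only [pullForm, hj, Matrix.mul_apply, Finset.sum_smul, Finset.smul_sum, smul_smul]
      rw [Finset.sum_comm]
      exact Finset.sum_congr rfl fun a _ => Finset.sum_congr rfl fun b _ => by rw [mul_comm]
    have e4 : ∑ a, g a i • M.mulM a (g *ᵥ x) = (jac φ (g *ᵥ x))⁻¹
        * (∑ a, g a i • pullForm φ C a (g *ᵥ x)) * jac φ (g *ᵥ x) := by
      simp only [P.mulM _ hx, Finset.mul_sum, Finset.sum_mul, Matrix.mul_smul, Matrix.smul_mul]
    rw [e3, e4, hj, Matrix.mul_inv_rev]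
    simp only [← mul_assoc, self_mul_inv_of hg, one_mul]
  · rw [P.unity _ hx, P'.unity x hx, hj, Matrix.mul_inv_rev, ← Matrix.mulVec_mulVec, hgi]
  · rw [P.euler _ hx, P'.euler x hx, hj, Matrix.mul_inv_rev, ← Matrix.mulVec_mulVec, hgi]

end

/-! ### The model types -/

/-- The flat metric of a type. -/
def FrobType.eta : FrobType → Mat3
  | .B31 => !![3/4, 0, 0; 0, 0, 3/2; 0, 3/2, 0]
  | .T3 => !![-2, 1, 0; 1, 0, 0; 0, 0, -2]
  | _ => !![0, 0, 1; 0, 1, 0; 1, 0, 0]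

/-- The multiplication matrices of a type. -/
abbrev FrobType.mulMat (T : FrobType) : Fin 3 → V3 → Mat3 := T.model.mulM

/-- A model is its own pullback along the identity with κ = 1, so the general theorem on pullbacks
also gives its Frobenius axioms. -/
theorem IsPullback.of_model {T : FrobType} (hη : ∀ t ∈ T.domain, T.model.metric t = T.eta) :
    IsPullback T.domain (fun t => t) 1 T.eta T.mulMat T.unityIndex T.degrees T.charge T.model := by
  have hj : ∀ x, jac (fun t : V3 => t) x = 1 := fun x => by
    have := jac_linear 1 x
    simpa using this
  refine ⟨fun x hx => ?_, fun x hx i => ?_, fun x hx => ?_, fun x hx => ?_, rfl⟩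
  · rw [hη x hx, hj]; simp
  · have : pullForm (fun t : V3 => t) T.mulMat i x = T.model.mulM i x := by
      simp only [pullForm, hj, Matrix.one_apply, ite_smul, one_smul, zero_smul]
      simp
    rw [this, hj]; simp
  · rw [hj, inv_one, Matrix.one_mulVec]; rfl
  · rw [hj, inv_one, Matrix.one_mulVec]; rfl

theorem isFrobeniusManifold_model {T : FrobType}
    (H : FlatFrob T.domain T.eta T.mulMat T.unityIndex T.degrees T.charge)
    (hη : ∀ t ∈ T.domain, T.model.metric t = T.eta) (hne : T.domain.Nonempty) :
    IsFrobeniusManifold T.domain T.model := by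
  have hj : ∀ x, jac (fun t : V3 => t) x = 1 := fun x => by
    have := jac_linear 1 x
    simpa using this
  exact IsPullback.isFrobeniusManifold (φ := fun t => t) H
    ⟨H.isOpen, fun x _ => analyticAt_id, fun x hx => hx, fun x _ => by rw [hj]; simp⟩ one_ne_zero
    (IsPullback.of_model hη) hne

/-- The chart itself is the equivalence, after shrinking it to be injective; the Euler field of the
pencil was shown to be the pullback of the Euler field of the model. -/
theorem isOfType_of_chart {T : FrobType}
    (H : FlatFrob T.domain T.eta T.mulMat T.unityIndex T.degrees T.charge)
    (hη : ∀ t ∈ T.domain, T.model.metric t = T.eta) {Ω₂ : V3 → Mat3} {X : V3 → V3} {τ : V3 → ℂ}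
    {N W : Set V3} {φ : V3 → V3} {κ : ℂ}
    (h : IsPencilChart T.domain T.eta T.mulMat T.unityIndex T.degrees Ω₂ X τ N φ κ) (hN : N ⊆ W)
    (hne : N.Nonempty) : IsOfType W (pencilFrobenius Ω₂ (lieContra X Ω₂) τ T.charge) T := by
  obtain ⟨p, hp⟩ := hne
  obtain ⟨U, hU, hpU, hinj⟩ := exists_injOn_nhd (h.an p hp) (h.det p hp)
  -- The pulled back metric carries the factor κ⁻¹, so the conformal constant has to be a square
  -- root of κ.
  obtain ⟨c, hc⟩ := IsAlgClosed.exists_pow_nat_eq κ two_pos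
  have P := IsPencilChart.isPullback H h
  have hc0 : c ≠ 0 := by rintro rfl; exact h.ne_zero (by rw [← hc]; simp)
  refine ⟨rfl, N ∩ U, φ, c, h.isOpen.inter hU, ⟨p, hp, hpU⟩, fun x hx => hN hx.1,
    fun x hx => h.maps x hx.1, ⟨?_, hinj.mono Set.inter_subset_right, hc0, ?_⟩, ?_⟩
  · exact fun x hx => (h.an x hx.1).differentiableAt.differentiableWithinAt
  · rintro x ⟨hx, -⟩
    refine ⟨h.det x hx, ?_, fun i j k => ?_⟩
    · rw [P.metric x hx, hη _ (h.maps x hx), hc, smul_smul, mul_inv_cancel₀ h.ne_zero, one_smul]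
    · have e1 : ∑ m, jac φ x k m * (pencilFrobenius Ω₂ (lieContra X Ω₂) τ T.charge).mul x i j m
          = (jac φ x * (pencilFrobenius Ω₂ (lieContra X Ω₂) τ T.charge).mulM i x) k j := by
        rw [Matrix.mul_apply]; rfl
      rw [e1, P.mulM x hx, ← mul_assoc, ← mul_assoc, self_mul_inv_of (h.det x hx), one_mul]
      simp only [pullForm, Finset.sum_mul, Matrix.sum_apply, Matrix.smul_mul, Matrix.smul_apply,
        Matrix.mul_apply, smul_eq_mul, FrobData.mulM, Matrix.of_apply, Finset.mul_sum]
      rw [Finset.sum_comm]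
      exact Finset.sum_congr rfl fun a _ => Finset.sum_congr rfl fun b _ => by ring
  · rintro x ⟨hx, -⟩
    rw [P.euler x hx, Matrix.mulVec_mulVec, self_mul_inv_of (h.det x hx), Matrix.one_mulVec]
    rfl

/-! ### Frobenius structures from a potential -/

theorem pd_eulerField {h : V3 → ℂ} {t : V3} (hh : AnalyticAt ℂ h t) (deg : Fin 3 → ℂ) (i : Fin 3) :
    pd i (fun y => ∑ m, deg m * y m * pd m h y) t
      = deg i * pd i h t + ∑ m, deg m * t m * pd m (pd i h) t := by
  have hc : ∀ m, AnalyticAt ℂ (fun y : V3 => y m) t := fun m =>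
    (ContinuousLinearMap.proj (R := ℂ) (φ := fun _ : Fin 3 => ℂ) m).analyticAt t
  have h1 : ∀ m, AnalyticAt ℂ (fun y : V3 => deg m * y m) t := fun m => analyticAt_const.mul (hc m)
  rw [pd_sum _ fun m _ => ((h1 m).fun_mul (analyticAt_pd hh m)).differentiableAt]
  have h2 : ∀ m, pd i (fun y => deg m * y m * pd m h y) t
      = (if m = i then deg i * pd i h t else 0) + deg m * t m * pd m (pd i h) t := fun m => by
    rw [pd_mul (h1 m).differentiableAt (analyticAt_pd hh m).differentiableAt,
      pd_const_mul (hc m).differentiableAt, pd_coord, pd_comm hh i m]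
    split_ifs with hm
    · subst hm; ring
    · ring
  simp only [h2, Finset.sum_add_distrib, Finset.sum_ite_eq', Finset.mem_univ, if_true]

/-- Differentiating Euler's relation by tᵢ lowers the weight by the degree of tᵢ. -/
theorem pd_homogeneous {D : Set V3} (hD : IsOpen D) {h : V3 → ℂ} (hh : ∀ t ∈ D, AnalyticAt ℂ h t)
    {deg : Fin 3 → ℂ} {w : ℂ} (hw : ∀ t ∈ D, ∑ m, deg m * t m * pd m h t = w * h t) (i : Fin 3) :
    ∀ t ∈ D, ∑ m, deg m * t m * pd m (pd i h) t = (w - deg i) * pd i h t := by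
  intro t ht
  have h1 := pd_congr (Filter.eventuallyEq_of_mem (hD.mem_nhds ht) hw) i
  rw [pd_eulerField (hh t ht), pd_const_mul (hh t ht).differentiableAt] at h1
  linear_combination h1

/-- The matrix of third derivatives `∂ₚ ∂_b ∂ⱼ F`. -/
def thirdM (F : V3 → ℂ) (b : Fin 3) (t : V3) : Mat3 := Matrix.of fun p j => pd p (pd b (pd j F)) t

theorem pd_swap_inner {F : V3 → ℂ} {t : V3} (hF : AnalyticAt ℂ F t) (i j k : Fin 3) :
    pd i (pd j (pd k F)) t = pd i (pd k (pd j F)) t :=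
  pd_congr (hF.eventually_analyticAt.mono fun _ hy => pd_comm hy j k) i

theorem thirdM_symm {F : V3 → ℂ} {t : V3} (hF : AnalyticAt ℂ F t) (b : Fin 3) :
    (thirdM F b t)ᵀ = thirdM F b t := by
  ext i j
  show pd j (pd b (pd i F)) t = pd i (pd b (pd j F)) t
  rw [pd_swap_inner hF j b i, pd_comm (analyticAt_pd hF b), pd_swap_inner hF i j b]

theorem thirdM_comm {F : V3 → ℂ} {t : V3} (hF : AnalyticAt ℂ F t) (a b p : Fin 3) :
    thirdM F a t p b = thirdM F b t p a := pd_swap_inner hF p a b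

theorem diagonal_mul_inv_add {η : Mat3} (hη : η.det ≠ 0) {deg : Fin 3 → ℂ} {w : ℂ}
    (h : diagonal deg * η + η * diagonal deg = w • η) :
    diagonal deg * η⁻¹ + η⁻¹ * diagonal deg = w • η⁻¹ := by
  have h1 := self_mul_inv_of hη
  have h2 := inv_mul_self_of hη
  have := congrArg (fun M => η⁻¹ * M * η⁻¹) h
  simp only [mul_add, add_mul, Matrix.mul_smul, Matrix.smul_mul] at this
  rw [← mul_assoc η⁻¹ η, h2, one_mul, one_mul, mul_assoc η⁻¹, mul_assoc _ η, h1, mul_one,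
    add_comm] at this
  exact this

section
variable {F : V3 → ℂ} {D : Set V3} {r : Fin 3} {deg : Fin 3 → ℂ} {d : ℂ} {η : Mat3}

theorem mulM_ofPotential (hmet : ∀ t ∈ D, ∀ i j, pd r (pd i (pd j F)) t = η i j) {t : V3}
    (ht : t ∈ D) (b : Fin 3) : (ofPotential F r deg d).mulM b t = η⁻¹ * thirdM F b t := by
  have e : (Matrix.of fun a b => pd r (pd a (pd b F)) t : Mat3) = η := by
    ext i j; exact hmet t ht i j
  ext k j
  simp only [FrobData.mulM, ofPotential, Matrix.of_apply, Matrix.mul_apply, e, thirdM]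

/-- Symmetry of third and fourth derivatives of F gives commutativity of the product,
self-adjointness and potentiality, and quasihomogeneity of F gives the grading. Associativity alone
is extra: in dimension three it is the commutation of the operators of the two non-unit coordinate
fields. -/
theorem FlatFrob.of_potential (hD : IsOpen D) (hF : ∀ t ∈ D, AnalyticAt ℂ F t) (hs : η.IsSymm)
    (hd : η.det ≠ 0) (hmet : ∀ t ∈ D, ∀ i j, pd r (pd i (pd j F)) t = η i j)
    (hhom : ∀ t ∈ D, ∑ m, deg m * t m * pd m F t = (3 - d) * F t)
    (hmh : diagonal deg * η + η * diagonal deg = (2 - d) • η) (hr : deg r = 1)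
    (hreg : ∀ i, deg i + (d - 1) / 2 ≠ 0)
    (hcomm : ∀ t ∈ D, ∀ a b, a ≠ r → b ≠ r → a < b →
      (ofPotential F r deg d).mulM a t * (ofPotential F r deg d).mulM b t
        = (ofPotential F r deg d).mulM b t * (ofPotential F r deg d).mulM a t) :
    FlatFrob D η (ofPotential F r deg d).mulM r deg d := by
  have hC : ∀ t ∈ D, ∀ b, (ofPotential F r deg d).mulM b t = η⁻¹ * thirdM F b t :=
    fun t ht b => mulM_ofPotential hmet ht b
  have hCe : ∀ t ∈ D, ∀ b, (ofPotential F r deg d).mulM b =ᶠ[𝓝 t] fun t => η⁻¹ * thirdM F b t :=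
    fun t ht b => Filter.eventuallyEq_of_mem (hD.mem_nhds ht) fun y hy => hC y hy b
  have hT : ∀ t ∈ D, ∀ b, MAn (thirdM F b) t := fun t ht b p j =>
    analyticAt_pd (analyticAt_pd (analyticAt_pd (hF t ht) j) b) p
  have hηs : η⁻¹ᵀ = η⁻¹ := by rw [Matrix.transpose_nonsing_inv, hs]
  have hmpd : ∀ t ∈ D, ∀ a b, mpd a ((ofPotential F r deg d).mulM b) t
      = η⁻¹ * mpd a (thirdM F b) t := fun t ht a b => by
    rw [mpd_congr (hCe t ht b), mpd_mul (MAn.const _ _) (hT t ht b), mpd_const, zero_mul, zero_add]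
  have hunit : ∀ t ∈ D, (ofPotential F r deg d).mulM r t = 1 := fun t ht => by
    have : thirdM F r t = η := by
      ext p j
      exact (pd_comm (analyticAt_pd (hF t ht) j) p r).trans (hmet t ht p j)
    rw [hC t ht, this, inv_mul_self_of hd]
  exact {
    isOpen := hD
    symm := hs
    det := hd
    an := fun t ht b => ((MAn.const _ _).mul (hT t ht b)).congr (hCe t ht b).symm
    comm := fun t ht a b k => by
      simp only [hC t ht, Matrix.mul_apply, thirdM_comm (hF t ht) a b]
    mul_comm := fun t ht a b => by
      by_cases ha : a = r
      · rw [ha, hunit t ht, one_mul, mul_one]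
      by_cases hb : b = r
      · rw [hb, hunit t ht, one_mul, mul_one]
      rcases lt_trichotomy a b with h | h | h
      · exact hcomm t ht a b ha hb h
      · rw [h]
      · exact (hcomm t ht b a hb ha h).symm
    unit := hunit
    adj := fun t ht b => by
      rw [hC t ht, Matrix.transpose_mul, thirdM_symm (hF t ht), hηs, mul_assoc,
        inv_mul_self_of hd, mul_one, ← mul_assoc, self_mul_inv_of hd, one_mul]
    pot := fun t ht a b => by
      rw [hmpd t ht, hmpd t ht]
      congr 1
      ext p j
      show pd a (pd p (pd b (pd j F))) t = pd b (pd p (pd a (pd j F))) t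
      rw [pd_swap_inner (analyticAt_pd (hF t ht) j) a p b,
        pd_comm (analyticAt_pd (analyticAt_pd (hF t ht) j) p),
        pd_swap_inner (analyticAt_pd (hF t ht) j) b a p]
    hom := fun t ht b => by
      -- Euler's relation is differentiated three times, so the entry with indices p, b, j has
      -- weight 3 - d - deg b - deg p - deg j; the last two degrees appear as multiplication by
      -- diag(deg) from either side.
      have h3 : ∑ m, (deg m * t m) • mpd m (thirdM F b) t
          = (3 - d - deg b) • thirdM F b t - diagonal deg * thirdM F b t
            - thirdM F b t * diagonal deg := by
        ext p j
        have e1 := pd_homogeneous hD hF hhom j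
        have e2 := pd_homogeneous hD (fun t ht => analyticAt_pd (hF t ht) j) e1 b
        have e3 := pd_homogeneous hD
          (fun t ht => analyticAt_pd (analyticAt_pd (hF t ht) j) b) e2 p t ht
        simp only [Matrix.sum_apply, Matrix.sub_apply, Matrix.smul_apply, smul_eq_mul,
          Matrix.diagonal_mul, Matrix.mul_diagonal]
        refine e3.trans ?_
        simp only [thirdM, Matrix.of_apply]
        ring
      have h4 := diagonal_mul_inv_add hd hmh
      have h5 : η⁻¹ * diagonal deg = (2 - d) • η⁻¹ - diagonal deg * η⁻¹ := by
        rw [← h4]; abel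
      simp only [hmpd t ht, hC t ht, ← Matrix.mul_smul, ← Finset.mul_sum, h3]
      rw [mul_sub, mul_sub, Matrix.mul_smul, ← mul_assoc η⁻¹ (diagonal deg), h5, sub_mul,
        Matrix.smul_mul]
      simp only [mul_assoc, Matrix.mul_smul]
      module
    metric_hom := hmh
    deg_unit := hr
    reg := hreg }
end

/-! ### Laurent polynomials -/

/-- The Laurent monomial `c t₀ᵖ t₁^q t₂ˢ`. -/
structure LMono where
  c : ℂ
  p : ℤ
  q : ℤ
  s : ℤ

namespace LMono

/-- Value of a Laurent monomial. -/
def ev (m : LMono) (t : V3) : ℂ := m.c * t 0 ^ m.p * t 1 ^ m.q * t 2 ^ m.s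

/-- Exponent of a variable. -/
def exponent (m : LMono) : Fin 3 → ℤ
  | 0 => m.p
  | 1 => m.q
  | 2 => m.s

/-- Partial derivative. -/
def deriv (m : LMono) : Fin 3 → LMono
  | 0 => ⟨m.c * m.p, m.p - 1, m.q, m.s⟩
  | 1 => ⟨m.c * m.q, m.p, m.q - 1, m.s⟩
  | 2 => ⟨m.c * m.s, m.p, m.q, m.s - 1⟩

/-- The monomial is holomorphic at `t`. -/
def Regular (m : LMono) (t : V3) : Prop := ∀ i, 0 ≤ m.exponent i ∨ t i ≠ 0

theorem analyticAt_zpow_coord {t : V3} {n : ℤ} {i : Fin 3} (h : 0 ≤ n ∨ t i ≠ 0) :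
    AnalyticAt ℂ (fun y : V3 => y i ^ n) t := by
  have hc : AnalyticAt ℂ (fun y : V3 => y i) t :=
    (ContinuousLinearMap.proj (R := ℂ) (φ := fun _ : Fin 3 => ℂ) i).analyticAt t
  rcases h with h | h
  · lift n to ℕ using h
    simpa using hc.fun_pow n
  · exact hc.zpow h

theorem pd_zpow_coord {t : V3} {n : ℤ} {i : Fin 3} (h : 0 ≤ n ∨ t i ≠ 0) (j : Fin 3) :
    pd j (fun y : V3 => y i ^ n) t = if i = j then n * t i ^ (n - 1) else 0 := by
  have hc : DifferentiableAt ℂ (fun y : V3 => y i) t := by fun_prop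
  have := pd_comp₁ (h := fun y : V3 => y i) (hasDerivAt_zpow n (t i) h.symm) hc j
  rw [this, pd_coord]
  split_ifs <;> simp

theorem analyticAt_ev {m : LMono} {t : V3} (h : m.Regular t) : AnalyticAt ℂ m.ev t :=
  ((analyticAt_const.mul (analyticAt_zpow_coord (h 0))).mul (analyticAt_zpow_coord (h 1))).mul
    (analyticAt_zpow_coord (h 2))

theorem pd_ev {m : LMono} {t : V3} (h : m.Regular t) (i : Fin 3) :
    pd i m.ev t = (m.deriv i).ev t := by
  have a0 := analyticAt_zpow_coord (h 0)
  have a1 := analyticAt_zpow_coord (h 1)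
  have a2 := analyticAt_zpow_coord (h 2)
  have hc : AnalyticAt ℂ (fun _ : V3 => m.c) t := analyticAt_const
  have e0 := fun j => pd_zpow_coord (h 0) j
  have e1 := fun j => pd_zpow_coord (h 1) j
  have e2 := fun j => pd_zpow_coord (h 2) j
  simp only [exponent] at a0 a1 a2 e0 e1 e2
  unfold ev
  rw [pd_mul ((hc.fun_mul a0).fun_mul a1).differentiableAt a2.differentiableAt,
    pd_mul (hc.fun_mul a0).differentiableAt a1.differentiableAt,
    pd_const_mul a0.differentiableAt, e0, e1, e2]
  fin_cases i <;> simp [deriv, -mul_eq_mul_right_iff, -mul_eq_mul_left_iff] <;> ring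

theorem Regular.deriv {m : LMono} {t : V3} (h : m.Regular t) {i : Fin 3} (hi : m.exponent i ≠ 0) :
    (m.deriv i).Regular t := by
  intro j
  have := h j
  by_cases hj : t j = 0
  · have h0 : 0 ≤ m.exponent j := by tauto
    left
    fin_cases i <;> fin_cases j <;> simp [exponent, LMono.deriv] at * <;> omega
  · exact Or.inr hj

end LMono

/-- Value of a list of monomials. -/
def evalL (L : List LMono) (t : V3) : ℂ := (L.map fun m => m.ev t).sum

/-- Partial derivative of a list of monomials, without the constant terms. -/
def derivL (i : Fin 3) (L : List LMono) : List LMono :=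
  (L.filter fun m => m.exponent i ≠ 0).map fun m => m.deriv i

theorem evalL_cons (m : LMono) (L : List LMono) : evalL (m :: L) = fun t => m.ev t + evalL L t := by
  funext t; simp [evalL]

theorem analyticAt_evalL {L : List LMono} {t : V3} (h : ∀ m ∈ L, m.Regular t) :
    AnalyticAt ℂ (evalL L) t := by
  induction L with
  | nil => exact analyticAt_const
  | cons m L ih =>
    rw [evalL_cons]
    exact (LMono.analyticAt_ev (h m (by simp))).add (ih fun m hm => h m (by simp [hm]))

theorem pd_evalL {L : List LMono} {t : V3} (h : ∀ m ∈ L, m.Regular t) (i : Fin 3) :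
    pd i (evalL L) t = evalL (derivL i L) t := by
  induction L with
  | nil => exact pd_const 0 i t
  | cons m L ih =>
    have hm := h m (by simp)
    have hL : ∀ m ∈ L, m.Regular t := fun m hm => h m (by simp [hm])
    rw [evalL_cons, pd_add (LMono.analyticAt_ev hm).differentiableAt
      (analyticAt_evalL hL).differentiableAt, ih hL, LMono.pd_ev hm]
    by_cases hi : m.exponent i = 0
    · have e1 : derivL i (m :: L) = derivL i L := by simp [derivL, hi]
      have e2 : (m.deriv i).ev t = 0 := by
        fin_cases i <;> simp_all [LMono.exponent, LMono.deriv, LMono.ev]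
      rw [e1, e2, zero_add]
    · have e1 : derivL i (m :: L) = m.deriv i :: derivL i L := by simp [derivL, hi]
      rw [e1, evalL_cons]

/-- Monomials free of the variable are discarded before differentiating; otherwise an exponent -1
with zero coefficient would appear and destroy regularity at zeros of that variable. -/
theorem regular_derivL {L : List LMono} {t : V3} (h : ∀ m ∈ L, m.Regular t) (i : Fin 3) :
    ∀ m ∈ derivL i L, m.Regular t := by
  intro m hm
  simp only [derivL, List.mem_map, List.mem_filter, decide_eq_true_eq] at hm
  obtain ⟨m', ⟨h1, h2⟩, rfl⟩ := hm
  exact (h m' h1).deriv h2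

/-- A formula for a function may be differentiated only if it holds near the point, so the agreement
is carried through each derivative on the whole open set. -/
theorem pd₃_evalL {D : Set V3} (hD : IsOpen D) {L : List LMono} (h : ∀ t ∈ D, ∀ m ∈ L, m.Regular t)
    {F : V3 → ℂ} (hF : ∀ t ∈ D, F t = evalL L t) {t : V3} (ht : t ∈ D) (i j k : Fin 3) :
    pd i (pd j (pd k F)) t = evalL (derivL i (derivL j (derivL k L))) t := by
  have e1 : ∀ t ∈ D, pd k F t = evalL (derivL k L) t := fun t ht => by
    rw [pd_congr (Filter.eventuallyEq_of_mem (hD.mem_nhds ht) hF), pd_evalL (h t ht)]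
  have e2 : ∀ t ∈ D, pd j (pd k F) t = evalL (derivL j (derivL k L)) t := fun t ht => by
    rw [pd_congr (Filter.eventuallyEq_of_mem (hD.mem_nhds ht) e1),
      pd_evalL (regular_derivL (h t ht) k)]
  rw [pd_congr (Filter.eventuallyEq_of_mem (hD.mem_nhds ht) e2),
    pd_evalL (regular_derivL (regular_derivL (h t ht) k) j)]

/-- A Laurent polynomial all of whose monomials have weight `w` is homogeneous. -/
theorem evalL_homogeneous {L : List LMono} {t : V3} {deg : Fin 3 → ℂ} {w : ℂ}
    (h : ∀ m ∈ L, m.Regular t)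
    (hw : ∀ m ∈ L, deg 0 * m.p + deg 1 * m.q + deg 2 * m.s = w) :
    ∑ i, deg i * t i * pd i (evalL L) t = w * evalL L t := by
  induction L with
  | nil =>
    have : ∀ i, pd i (evalL []) t = 0 := fun i => pd_const 0 i t
    simp [evalL, this]
  | cons m L ih =>
    have hm := h m (by simp)
    have hL : ∀ m ∈ L, m.Regular t := fun m hm => h m (by simp [hm])
    have ih := ih hL fun m hm => hw m (by simp [hm])
    -- The identity a·n aⁿ⁻¹ = n aⁿ also holds at a = 0, because regularity forces n ≥ 0 there.
    have hz : ∀ (a : ℂ) (n : ℤ), 0 ≤ n ∨ a ≠ 0 → a * (n * a ^ (n - 1)) = n * a ^ n := by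
      intro a n hn
      by_cases ha : a = 0
      · subst ha
        rcases eq_or_ne n 0 with rfl | h0
        · simp
        · rw [_root_.zero_zpow n h0]; simp
      · rw [zpow_sub_one₀ ha]; field_simp
    have e : ∑ i, deg i * t i * (m.deriv i).ev t = w * m.ev t := by
      rw [← hw m (by simp), Fin.sum_univ_three]
      have h0 := hz (t 0) m.p (hm 0)
      have h1 := hz (t 1) m.q (hm 1)
      have h2 := hz (t 2) m.s (hm 2)
      simp only [LMono.ev, LMono.deriv]
      linear_combination deg 0 * m.c * t 1 ^ m.q * t 2 ^ m.s * h0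
        + deg 1 * m.c * t 0 ^ m.p * t 2 ^ m.s * h1 + deg 2 * m.c * t 0 ^ m.p * t 1 ^ m.q * h2
    rw [evalL_cons]
    simp only [pd_add (LMono.analyticAt_ev hm).differentiableAt
      (analyticAt_evalL hL).differentiableAt, mul_add, Finset.sum_add_distrib, ih,
      LMono.pd_ev hm, e]

/-! ### The eight types -/

namespace FrobType

/-- The potentials as lists of Laurent monomials. -/
def laurent : FrobType → List LMono
  | .A3 => [⟨1/2, 1, 0, 2⟩, ⟨1/2, 0, 2, 1⟩, ⟨1/4, 2, 2, 0⟩, ⟨1/60, 5, 0, 0⟩]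
  | .A3d => [⟨1/2, 1, 0, 2⟩, ⟨1/2, 0, 2, 1⟩, ⟨1/8, -1, 4, 0⟩, ⟨1/4, -2, 2, 0⟩, ⟨-1/60, -3, 0, 0⟩]
  | .B3 => [⟨1/2, 1, 0, 2⟩, ⟨1/2, 0, 2, 1⟩, ⟨1/6, 3, 2, 0⟩, ⟨1/6, 1, 3, 0⟩, ⟨1/210, 7, 0, 0⟩]
  | .B3d => [⟨1/2, 1, 0, 2⟩, ⟨1/2, 0, 2, 1⟩, ⟨1/8, -1, 4, 0⟩, ⟨1/6, -2, 3, 0⟩, ⟨-1/6, -3, 2, 0⟩, ⟨-1/210, -5, 0, 0⟩]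
  | .H3 => [⟨1/2, 1, 0, 2⟩, ⟨1/2, 0, 2, 1⟩, ⟨1/20, 5, 2, 0⟩, ⟨1/6, 2, 3, 0⟩, ⟨1/3960, 11, 0, 0⟩]
  | .H3d => [⟨1/2, 1, 0, 2⟩, ⟨1/2, 0, 2, 1⟩, ⟨1/8, -1, 4, 0⟩, ⟨-1/6, -3, 3, 0⟩, ⟨-1/20, -5, 2, 0⟩, ⟨-1/3960, -9, 0, 0⟩]
  | .B31 => [⟨1/2, 0, 0, 4⟩, ⟨3/2, 1, 1, 1⟩, ⟨1/8, 3, 0, 0⟩, ⟨1/16, 0, 3, -1⟩]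
  | .T3 => [⟨1/2, 1, 2, 0⟩, ⟨2/3, 3, 0, 0⟩, ⟨-1, 2, 1, 0⟩, ⟨2, 1, 0, 2⟩, ⟨-1, 0, 1, 2⟩]

/-- The inverse of the flat metric of a type. -/
def etaInv : FrobType → Mat3
  | .B31 => !![4/3, 0, 0; 0, 0, 2/3; 0, 2/3, 0]
  | .T3 => !![0, 1, 0; 1, 2, 0; 0, 0, -1/2]
  | _ => !![0, 0, 1; 0, 1, 0; 1, 0, 0]

theorem etaInv_mul (T : FrobType) : T.etaInv * T.eta = 1 := by
  cases T <;> ext i j <;> fin_cases i <;> fin_cases j <;>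
    simp [etaInv, eta, Matrix.mul_apply, Fin.sum_univ_three]

theorem eta_det (T : FrobType) : T.eta.det ≠ 0 := fun h => by
  have := congrArg Matrix.det T.etaInv_mul
  rw [Matrix.det_mul, h, mul_zero, Matrix.det_one] at this
  exact zero_ne_one this

theorem eta_inv (T : FrobType) : T.eta⁻¹ = T.etaInv := Matrix.inv_eq_left_inv T.etaInv_mul

theorem eta_symm (T : FrobType) : T.eta.IsSymm := by
  cases T <;> ext i j <;> fin_cases i <;> fin_cases j <;> rfl

theorem isOpen_domain (T : FrobType) : IsOpen T.domain := by
  cases T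
  case A3d | B3d | H3d => exact isOpen_ne_fun (continuous_apply 0) continuous_const
  case B31 => exact isOpen_ne_fun (continuous_apply 2) continuous_const
  all_goals exact isOpen_univ

theorem one_mem_domain (T : FrobType) : (fun _ => 1 : V3) ∈ T.domain := by
  cases T <;> simp [domain]

theorem potential_eq (T : FrobType) {t : V3} (ht : t ∈ T.domain) :
    T.potential t = evalL T.laurent t := by
  cases T <;> simp [domain] at ht <;>
    simp [potential, laurent, evalL, LMono.ev, zpow_ofNat, _root_.zpow_neg] <;> field_simp <;> ring

theorem laurent_regular (T : FrobType) {t : V3} (ht : t ∈ T.domain) :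
    ∀ m ∈ T.laurent, m.Regular t := by
  intro m hm i
  cases T <;> simp [domain] at ht <;> simp only [laurent, List.mem_cons, List.not_mem_nil, or_false] at hm <;>
    rcases hm with h | h | h | h | h | h <;> (try subst h) <;> fin_cases i <;>
    simp [LMono.exponent, ht]

theorem laurent_weight (T : FrobType) : ∀ m ∈ T.laurent,
    T.degrees 0 * m.p + T.degrees 1 * m.q + T.degrees 2 * m.s = 3 - T.charge := by
  intro m hm
  cases T <;> simp only [laurent, List.mem_cons, List.not_mem_nil, or_false] at hm <;>
    rcases hm with h | h | h | h | h | h <;> (try subst h) <;>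
    simp [degrees, charge] <;> norm_num

theorem analyticAt_potential (T : FrobType) {t : V3} (ht : t ∈ T.domain) :
    AnalyticAt ℂ T.potential t :=
  (analyticAt_evalL (T.laurent_regular ht)).congr
    (Filter.eventuallyEq_of_mem (T.isOpen_domain.mem_nhds ht) fun _ hy => (T.potential_eq hy).symm)

theorem potential_homogeneous (T : FrobType) {t : V3} (ht : t ∈ T.domain) :
    ∑ m, T.degrees m * t m * pd m T.potential t = (3 - T.charge) * T.potential t := by
  rw [T.potential_eq ht, ← evalL_homogeneous (T.laurent_regular ht) T.laurent_weight]
  refine Finset.sum_congr rfl fun m _ => ?_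
  rw [pd_congr (Filter.eventuallyEq_of_mem (T.isOpen_domain.mem_nhds ht)
    fun _ hy => T.potential_eq hy)]

theorem third_eq (T : FrobType) {t : V3} (ht : t ∈ T.domain) (i j k : Fin 3) :
    pd i (pd j (pd k T.potential)) t = evalL (derivL i (derivL j (derivL k T.laurent))) t :=
  pd₃_evalL T.isOpen_domain (fun _ ht => T.laurent_regular ht) (fun _ ht => T.potential_eq ht) ht
    i j k

theorem model_metric (T : FrobType) {t : V3} (ht : t ∈ T.domain) (i j : Fin 3) :
    pd T.unityIndex (pd i (pd j T.potential)) t = T.eta i j := by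
  rw [T.third_eq ht]
  cases T <;> simp [domain] at ht <;> fin_cases i <;> fin_cases j <;>
    simp [unityIndex, laurent, derivL, LMono.exponent, LMono.deriv, evalL, LMono.ev, eta,
      List.filter_cons]
  all_goals norm_num

theorem mulMat_eq (T : FrobType) {t : V3} (ht : t ∈ T.domain) (b : Fin 3) :
    T.mulMat b t = T.etaInv * thirdM T.potential b t := by
  rw [← eta_inv]
  exact mulM_ofPotential (fun _ ht => T.model_metric ht) ht b

/-- Types whose potential is `½ t₂² t₀ + ½ t₁² t₂ + P(t₀, t₁)`. -/
def IsStandard (T : FrobType) : Prop :=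
  T.unityIndex = 2 ∧ T.eta = !![0, 0, 1; 0, 1, 0; 1, 0, 0] ∧
    T.etaInv = !![0, 0, 1; 0, 1, 0; 1, 0, 0]

/-- A third derivative involving the unity direction is an entry of η; hence only the four
derivatives in t₀ and t₁ carry information. -/
theorem IsStandard.third {T : FrobType} (hT : T.IsStandard) {t : V3} (ht : t ∈ T.domain)
    (i j : Fin 3) : pd i (pd j (pd 2 T.potential)) t = !![0, 0, 1; 0, 1, 0; 1, 0, 0] i j ∧
      pd i (pd 2 (pd j T.potential)) t = !![0, 0, 1; 0, 1, 0; 1, 0, 0] i j ∧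
      pd 2 (pd i (pd j T.potential)) t = !![0, 0, 1; 0, 1, 0; 1, 0, 0] i j := by
  have hF := T.analyticAt_potential ht
  have h1 := T.model_metric ht i j
  rw [hT.1, hT.2.1] at h1
  have h2 : pd i (pd 2 (pd j T.potential)) t = !![0, 0, 1; 0, 1, 0; 1, 0, 0] i j := by
    rw [pd_comm (analyticAt_pd hF j), h1]
  exact ⟨by rw [pd_swap_inner hF, h2], h2, h1⟩

theorem IsStandard.mulMat_zero {T : FrobType} (hT : T.IsStandard) {t : V3} (ht : t ∈ T.domain)
    {a b c : ℂ} (h000 : pd 0 (pd 0 (pd 0 T.potential)) t = c)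
    (h001 : pd 0 (pd 0 (pd 1 T.potential)) t = a) (h011 : pd 0 (pd 1 (pd 1 T.potential)) t = b) :
    T.mulMat 0 t = !![0, 0, 1; a, b, 0; c, a, 0] := by
  have hF := T.analyticAt_potential ht
  have h100 : pd 1 (pd 0 (pd 0 T.potential)) t = a := by
    rw [pd_comm (analyticAt_pd hF 0), pd_swap_inner hF, h001]
  have h101 : pd 1 (pd 0 (pd 1 T.potential)) t = b := by rw [pd_comm (analyticAt_pd hF 1), h011]
  rw [T.mulMat_eq ht, hT.2.2]
  ext i j
  fin_cases i <;> fin_cases j <;>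
    simp [Matrix.mul_apply, Fin.sum_univ_three, thirdM, hT.third ht, h000, h001, h101, h100]

theorem IsStandard.mulMat_one {T : FrobType} (hT : T.IsStandard) {t : V3} (ht : t ∈ T.domain)
    {a b c : ℂ} (h001 : pd 0 (pd 0 (pd 1 T.potential)) t = a)
    (h011 : pd 0 (pd 1 (pd 1 T.potential)) t = b) (h111 : pd 1 (pd 1 (pd 1 T.potential)) t = c) :
    T.mulMat 1 t = !![0, 1, 0; b, c, 1; a, b, 0] := by
  have hF := T.analyticAt_potential ht
  have h010 : pd 0 (pd 1 (pd 0 T.potential)) t = a := by rw [pd_swap_inner hF, h001]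
  have h110 : pd 1 (pd 1 (pd 0 T.potential)) t = b := by
    rw [pd_swap_inner hF, pd_comm (analyticAt_pd hF 1), h011]
  rw [T.mulMat_eq ht, hT.2.2]
  ext i j
  fin_cases i <;> fin_cases j <;>
    simp [Matrix.mul_apply, Fin.sum_univ_three, thirdM, hT.third ht, h010, h011, h110, h111]

/-! ### Third derivatives and multiplication matrices, type by type. -/

theorem isStandard_A3 : IsStandard .A3 := ⟨rfl, rfl, rfl⟩

theorem third_A3_000 (t : V3) :
    pd 0 (pd 0 (pd 0 (potential .A3))) t =
      t 0 ^ 2 := by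
  rw [third_eq _ (show t ∈ FrobType.A3.domain from trivial)]
  norm_num [laurent, derivL, LMono.exponent, LMono.deriv, evalL, LMono.ev, zpow_ofNat,
    _root_.zpow_neg, -mul_eq_mul_right_iff, -mul_eq_mul_left_iff]
  try ring

theorem third_A3_001 (t : V3) :
    pd 0 (pd 0 (pd 1 (potential .A3))) t =
      t 1 := by
  rw [third_eq _ (show t ∈ FrobType.A3.domain from trivial)]
  norm_num [laurent, derivL, LMono.exponent, LMono.deriv, evalL, LMono.ev, zpow_ofNat,
    _root_.zpow_neg, -mul_eq_mul_right_iff, -mul_eq_mul_left_iff]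
  try ring

theorem third_A3_011 (t : V3) :
    pd 0 (pd 1 (pd 1 (potential .A3))) t =
      t 0 := by
  rw [third_eq _ (show t ∈ FrobType.A3.domain from trivial)]
  norm_num [laurent, derivL, LMono.exponent, LMono.deriv, evalL, LMono.ev, zpow_ofNat,
    _root_.zpow_neg, -mul_eq_mul_right_iff, -mul_eq_mul_left_iff]
  try ring

theorem third_A3_111 (t : V3) :
    pd 1 (pd 1 (pd 1 (potential .A3))) t =
      0 := by
  rw [third_eq _ (show t ∈ FrobType.A3.domain from trivial)]
  norm_num [laurent, derivL, LMono.exponent, LMono.deriv, evalL, LMono.ev, zpow_ofNat,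
    _root_.zpow_neg, -mul_eq_mul_right_iff, -mul_eq_mul_left_iff]
  try ring

theorem mulMat_A3_0 (t : V3) :
    FrobType.A3.mulMat 0 t =
    !![0, 0, 1;
      t 1, t 0, 0;
      t 0 ^ 2, t 1, 0] :=
  isStandard_A3.mulMat_zero (show t ∈ FrobType.A3.domain from trivial) (third_A3_000 t) (third_A3_001 t) (third_A3_011 t)

theorem mulMat_A3_1 (t : V3) :
    FrobType.A3.mulMat 1 t =
    !![0, 1, 0;
      t 0, 0, 1;
      t 1, t 0, 0] :=
  isStandard_A3.mulMat_one (show t ∈ FrobType.A3.domain from trivial) (third_A3_001 t) (third_A3_011 t) (third_A3_111 t)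

theorem isStandard_A3d : IsStandard .A3d := ⟨rfl, rfl, rfl⟩

theorem third_A3d_000 {t : V3} (ht : t 0 ≠ 0) :
    pd 0 (pd 0 (pd 0 (potential .A3d))) t =
      -(3/4 * t 1 ^ 4 / t 0 ^ 4) - 6 * t 1 ^ 2 / t 0 ^ 5 + 1 / t 0 ^ 6 := by
  rw [third_eq _ (show t ∈ FrobType.A3d.domain from ht)]
  norm_num [laurent, derivL, LMono.exponent, LMono.deriv, evalL, LMono.ev, zpow_ofNat,
    _root_.zpow_neg, -mul_eq_mul_right_iff, -mul_eq_mul_left_iff]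
  try ring

theorem third_A3d_001 {t : V3} (ht : t 0 ≠ 0) :
    pd 0 (pd 0 (pd 1 (potential .A3d))) t =
      t 1 ^ 3 / t 0 ^ 3 + 3 * t 1 / t 0 ^ 4 := by
  rw [third_eq _ (show t ∈ FrobType.A3d.domain from ht)]
  norm_num [laurent, derivL, LMono.exponent, LMono.deriv, evalL, LMono.ev, zpow_ofNat,
    _root_.zpow_neg, -mul_eq_mul_right_iff, -mul_eq_mul_left_iff]
  try ring

theorem third_A3d_011 {t : V3} (ht : t 0 ≠ 0) :
    pd 0 (pd 1 (pd 1 (potential .A3d))) t =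
      -(3/2 * t 1 ^ 2 / t 0 ^ 2) - 1 / t 0 ^ 3 := by
  rw [third_eq _ (show t ∈ FrobType.A3d.domain from ht)]
  norm_num [laurent, derivL, LMono.exponent, LMono.deriv, evalL, LMono.ev, zpow_ofNat,
    _root_.zpow_neg, -mul_eq_mul_right_iff, -mul_eq_mul_left_iff]
  try ring

theorem third_A3d_111 {t : V3} (ht : t 0 ≠ 0) :
    pd 1 (pd 1 (pd 1 (potential .A3d))) t =
      3 * t 1 / t 0 := by
  rw [third_eq _ (show t ∈ FrobType.A3d.domain from ht)]
  norm_num [laurent, derivL, LMono.exponent, LMono.deriv, evalL, LMono.ev, zpow_ofNat,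
    _root_.zpow_neg, -mul_eq_mul_right_iff, -mul_eq_mul_left_iff]
  try ring

theorem mulMat_A3d_0 {t : V3} (ht : t 0 ≠ 0) :
    FrobType.A3d.mulMat 0 t =
    !![0, 0, 1;
      t 1 ^ 3 / t 0 ^ 3 + 3 * t 1 / t 0 ^ 4, -(3/2 * t 1 ^ 2 / t 0 ^ 2) - 1 / t 0 ^ 3, 0;
      -(3/4 * t 1 ^ 4 / t 0 ^ 4) - 6 * t 1 ^ 2 / t 0 ^ 5 + 1 / t 0 ^ 6, t 1 ^ 3 / t 0 ^ 3 + 3 * t 1 / t 0 ^ 4, 0] :=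
  isStandard_A3d.mulMat_zero (show t ∈ FrobType.A3d.domain from ht) (third_A3d_000 ht) (third_A3d_001 ht) (third_A3d_011 ht)

theorem mulMat_A3d_1 {t : V3} (ht : t 0 ≠ 0) :
    FrobType.A3d.mulMat 1 t =
    !![0, 1, 0;
      -(3/2 * t 1 ^ 2 / t 0 ^ 2) - 1 / t 0 ^ 3, 3 * t 1 / t 0, 1;
      t 1 ^ 3 / t 0 ^ 3 + 3 * t 1 / t 0 ^ 4, -(3/2 * t 1 ^ 2 / t 0 ^ 2) - 1 / t 0 ^ 3, 0] :=
  isStandard_A3d.mulMat_one (show t ∈ FrobType.A3d.domain from ht) (third_A3d_001 ht) (third_A3d_011 ht) (third_A3d_111 ht)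

theorem isStandard_B3 : IsStandard .B3 := ⟨rfl, rfl, rfl⟩

theorem third_B3_000 (t : V3) :
    pd 0 (pd 0 (pd 0 (potential .B3))) t =
      t 0 ^ 4 + t 1 ^ 2 := by
  rw [third_eq _ (show t ∈ FrobType.B3.domain from trivial)]
  norm_num [laurent, derivL, LMono.exponent, LMono.deriv, evalL, LMono.ev, zpow_ofNat,
    _root_.zpow_neg, -mul_eq_mul_right_iff, -mul_eq_mul_left_iff]
  try ring

theorem third_B3_001 (t : V3) :
    pd 0 (pd 0 (pd 1 (potential .B3))) t =
      2 * t 0 * t 1 := by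
  rw [third_eq _ (show t ∈ FrobType.B3.domain from trivial)]
  norm_num [laurent, derivL, LMono.exponent, LMono.deriv, evalL, LMono.ev, zpow_ofNat,
    _root_.zpow_neg, -mul_eq_mul_right_iff, -mul_eq_mul_left_iff]
  try ring

theorem third_B3_011 (t : V3) :
    pd 0 (pd 1 (pd 1 (potential .B3))) t =
      t 0 ^ 2 + t 1 := by
  rw [third_eq _ (show t ∈ FrobType.B3.domain from trivial)]
  norm_num [laurent, derivL, LMono.exponent, LMono.deriv, evalL, LMono.ev, zpow_ofNat,
    _root_.zpow_neg, -mul_eq_mul_right_iff, -mul_eq_mul_left_iff]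
  try ring

theorem third_B3_111 (t : V3) :
    pd 1 (pd 1 (pd 1 (potential .B3))) t =
      t 0 := by
  rw [third_eq _ (show t ∈ FrobType.B3.domain from trivial)]
  norm_num [laurent, derivL, LMono.exponent, LMono.deriv, evalL, LMono.ev, zpow_ofNat,
    _root_.zpow_neg, -mul_eq_mul_right_iff, -mul_eq_mul_left_iff]
  try ring

theorem mulMat_B3_0 (t : V3) :
    FrobType.B3.mulMat 0 t =
    !![0, 0, 1;
      2 * t 0 * t 1, t 0 ^ 2 + t 1, 0;
      t 0 ^ 4 + t 1 ^ 2, 2 * t 0 * t 1, 0] :=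
  isStandard_B3.mulMat_zero (show t ∈ FrobType.B3.domain from trivial) (third_B3_000 t) (third_B3_001 t) (third_B3_011 t)

theorem mulMat_B3_1 (t : V3) :
    FrobType.B3.mulMat 1 t =
    !![0, 1, 0;
      t 0 ^ 2 + t 1, t 0, 1;
      2 * t 0 * t 1, t 0 ^ 2 + t 1, 0] :=
  isStandard_B3.mulMat_one (show t ∈ FrobType.B3.domain from trivial) (third_B3_001 t) (third_B3_011 t) (third_B3_111 t)

theorem isStandard_B3d : IsStandard .B3d := ⟨rfl, rfl, rfl⟩

theorem third_B3d_000 {t : V3} (ht : t 0 ≠ 0) :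
    pd 0 (pd 0 (pd 0 (potential .B3d))) t =
      -(3/4 * t 1 ^ 4 / t 0 ^ 4) - 4 * t 1 ^ 3 / t 0 ^ 5 + 10 * t 1 ^ 2 / t 0 ^ 6 + 1 / t 0 ^ 8 := by
  rw [third_eq _ (show t ∈ FrobType.B3d.domain from ht)]
  norm_num [laurent, derivL, LMono.exponent, LMono.deriv, evalL, LMono.ev, zpow_ofNat,
    _root_.zpow_neg, -mul_eq_mul_right_iff, -mul_eq_mul_left_iff]
  try ring

theorem third_B3d_001 {t : V3} (ht : t 0 ≠ 0) :
    pd 0 (pd 0 (pd 1 (potential .B3d))) t =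
      t 1 ^ 3 / t 0 ^ 3 + 3 * t 1 ^ 2 / t 0 ^ 4 - 4 * t 1 / t 0 ^ 5 := by
  rw [third_eq _ (show t ∈ FrobType.B3d.domain from ht)]
  norm_num [laurent, derivL, LMono.exponent, LMono.deriv, evalL, LMono.ev, zpow_ofNat,
    _root_.zpow_neg, -mul_eq_mul_right_iff, -mul_eq_mul_left_iff]
  try ring

theorem third_B3d_011 {t : V3} (ht : t 0 ≠ 0) :
    pd 0 (pd 1 (pd 1 (potential .B3d))) t =
      -(3/2 * t 1 ^ 2 / t 0 ^ 2) - 2 * t 1 / t 0 ^ 3 + 1 / t 0 ^ 4 := by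
  rw [third_eq _ (show t ∈ FrobType.B3d.domain from ht)]
  norm_num [laurent, derivL, LMono.exponent, LMono.deriv, evalL, LMono.ev, zpow_ofNat,
    _root_.zpow_neg, -mul_eq_mul_right_iff, -mul_eq_mul_left_iff]
  try ring

theorem third_B3d_111 {t : V3} (ht : t 0 ≠ 0) :
    pd 1 (pd 1 (pd 1 (potential .B3d))) t =
      3 * t 1 / t 0 + 1 / t 0 ^ 2 := by
  rw [third_eq _ (show t ∈ FrobType.B3d.domain from ht)]
  norm_num [laurent, derivL, LMono.exponent, LMono.deriv, evalL, LMono.ev, zpow_ofNat,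
    _root_.zpow_neg, -mul_eq_mul_right_iff, -mul_eq_mul_left_iff]
  try ring

theorem mulMat_B3d_0 {t : V3} (ht : t 0 ≠ 0) :
    FrobType.B3d.mulMat 0 t =
    !![0, 0, 1;
      t 1 ^ 3 / t 0 ^ 3 + 3 * t 1 ^ 2 / t 0 ^ 4 - 4 * t 1 / t 0 ^ 5, -(3/2 * t 1 ^ 2 / t 0 ^ 2) - 2 * t 1 / t 0 ^ 3 + 1 / t 0 ^ 4, 0;
      -(3/4 * t 1 ^ 4 / t 0 ^ 4) - 4 * t 1 ^ 3 / t 0 ^ 5 + 10 * t 1 ^ 2 / t 0 ^ 6 + 1 / t 0 ^ 8, t 1 ^ 3 / t 0 ^ 3 + 3 * t 1 ^ 2 / t 0 ^ 4 - 4 * t 1 / t 0 ^ 5, 0] :=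
  isStandard_B3d.mulMat_zero (show t ∈ FrobType.B3d.domain from ht) (third_B3d_000 ht) (third_B3d_001 ht) (third_B3d_011 ht)

theorem mulMat_B3d_1 {t : V3} (ht : t 0 ≠ 0) :
    FrobType.B3d.mulMat 1 t =
    !![0, 1, 0;
      -(3/2 * t 1 ^ 2 / t 0 ^ 2) - 2 * t 1 / t 0 ^ 3 + 1 / t 0 ^ 4, 3 * t 1 / t 0 + 1 / t 0 ^ 2, 1;
      t 1 ^ 3 / t 0 ^ 3 + 3 * t 1 ^ 2 / t 0 ^ 4 - 4 * t 1 / t 0 ^ 5, -(3/2 * t 1 ^ 2 / t 0 ^ 2) - 2 * t 1 / t 0 ^ 3 + 1 / t 0 ^ 4, 0] :=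
  isStandard_B3d.mulMat_one (show t ∈ FrobType.B3d.domain from ht) (third_B3d_001 ht) (third_B3d_011 ht) (third_B3d_111 ht)

theorem isStandard_H3 : IsStandard .H3 := ⟨rfl, rfl, rfl⟩

theorem third_H3_000 (t : V3) :
    pd 0 (pd 0 (pd 0 (potential .H3))) t =
      1/4 * t 0 ^ 8 + 3 * t 0 ^ 2 * t 1 ^ 2 := by
  rw [third_eq _ (show t ∈ FrobType.H3.domain from trivial)]
  norm_num [laurent, derivL, LMono.exponent, LMono.deriv, evalL, LMono.ev, zpow_ofNat,
    _root_.zpow_neg, -mul_eq_mul_right_iff, -mul_eq_mul_left_iff]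
  try ring

theorem third_H3_001 (t : V3) :
    pd 0 (pd 0 (pd 1 (potential .H3))) t =
      2 * t 0 ^ 3 * t 1 + t 1 ^ 2 := by
  rw [third_eq _ (show t ∈ FrobType.H3.domain from trivial)]
  norm_num [laurent, derivL, LMono.exponent, LMono.deriv, evalL, LMono.ev, zpow_ofNat,
    _root_.zpow_neg, -mul_eq_mul_right_iff, -mul_eq_mul_left_iff]
  try ring

theorem third_H3_011 (t : V3) :
    pd 0 (pd 1 (pd 1 (potential .H3))) t =
      1/2 * t 0 ^ 4 + 2 * t 0 * t 1 := by
  rw [third_eq _ (show t ∈ FrobType.H3.domain from trivial)]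
  norm_num [laurent, derivL, LMono.exponent, LMono.deriv, evalL, LMono.ev, zpow_ofNat,
    _root_.zpow_neg, -mul_eq_mul_right_iff, -mul_eq_mul_left_iff]
  try ring

theorem third_H3_111 (t : V3) :
    pd 1 (pd 1 (pd 1 (potential .H3))) t =
      t 0 ^ 2 := by
  rw [third_eq _ (show t ∈ FrobType.H3.domain from trivial)]
  norm_num [laurent, derivL, LMono.exponent, LMono.deriv, evalL, LMono.ev, zpow_ofNat,
    _root_.zpow_neg, -mul_eq_mul_right_iff, -mul_eq_mul_left_iff]
  try ring

theorem mulMat_H3_0 (t : V3) :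
    FrobType.H3.mulMat 0 t =
    !![0, 0, 1;
      2 * t 0 ^ 3 * t 1 + t 1 ^ 2, 1/2 * t 0 ^ 4 + 2 * t 0 * t 1, 0;
      1/4 * t 0 ^ 8 + 3 * t 0 ^ 2 * t 1 ^ 2, 2 * t 0 ^ 3 * t 1 + t 1 ^ 2, 0] :=
  isStandard_H3.mulMat_zero (show t ∈ FrobType.H3.domain from trivial) (third_H3_000 t) (third_H3_001 t) (third_H3_011 t)

theorem mulMat_H3_1 (t : V3) :
    FrobType.H3.mulMat 1 t =
    !![0, 1, 0;
      1/2 * t 0 ^ 4 + 2 * t 0 * t 1, t 0 ^ 2, 1;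
      2 * t 0 ^ 3 * t 1 + t 1 ^ 2, 1/2 * t 0 ^ 4 + 2 * t 0 * t 1, 0] :=
  isStandard_H3.mulMat_one (show t ∈ FrobType.H3.domain from trivial) (third_H3_001 t) (third_H3_011 t) (third_H3_111 t)

theorem isStandard_H3d : IsStandard .H3d := ⟨rfl, rfl, rfl⟩

theorem third_H3d_000 {t : V3} (ht : t 0 ≠ 0) :
    pd 0 (pd 0 (pd 0 (potential .H3d))) t =
      -(3/4 * t 1 ^ 4 / t 0 ^ 4) + 10 * t 1 ^ 3 / t 0 ^ 6 + 21/2 * t 1 ^ 2 / t 0 ^ 8 + 1/4 / t 0 ^ 12 := by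
  rw [third_eq _ (show t ∈ FrobType.H3d.domain from ht)]
  norm_num [laurent, derivL, LMono.exponent, LMono.deriv, evalL, LMono.ev, zpow_ofNat,
    _root_.zpow_neg, -mul_eq_mul_right_iff, -mul_eq_mul_left_iff]
  try ring

theorem third_H3d_001 {t : V3} (ht : t 0 ≠ 0) :
    pd 0 (pd 0 (pd 1 (potential .H3d))) t =
      t 1 ^ 3 / t 0 ^ 3 - 6 * t 1 ^ 2 / t 0 ^ 5 - 3 * t 1 / t 0 ^ 7 := by
  rw [third_eq _ (show t ∈ FrobType.H3d.domain from ht)]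
  norm_num [laurent, derivL, LMono.exponent, LMono.deriv, evalL, LMono.ev, zpow_ofNat,
    _root_.zpow_neg, -mul_eq_mul_right_iff, -mul_eq_mul_left_iff]
  try ring

theorem third_H3d_011 {t : V3} (ht : t 0 ≠ 0) :
    pd 0 (pd 1 (pd 1 (potential .H3d))) t =
      -(3/2 * t 1 ^ 2 / t 0 ^ 2) + 3 * t 1 / t 0 ^ 4 + 1/2 / t 0 ^ 6 := by
  rw [third_eq _ (show t ∈ FrobType.H3d.domain from ht)]
  norm_num [laurent, derivL, LMono.exponent, LMono.deriv, evalL, LMono.ev, zpow_ofNat,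
    _root_.zpow_neg, -mul_eq_mul_right_iff, -mul_eq_mul_left_iff]
  try ring

theorem third_H3d_111 {t : V3} (ht : t 0 ≠ 0) :
    pd 1 (pd 1 (pd 1 (potential .H3d))) t =
      3 * t 1 / t 0 - 1 / t 0 ^ 3 := by
  rw [third_eq _ (show t ∈ FrobType.H3d.domain from ht)]
  norm_num [laurent, derivL, LMono.exponent, LMono.deriv, evalL, LMono.ev, zpow_ofNat,
    _root_.zpow_neg, -mul_eq_mul_right_iff, -mul_eq_mul_left_iff]
  try ring

theorem mulMat_H3d_0 {t : V3} (ht : t 0 ≠ 0) :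
    FrobType.H3d.mulMat 0 t =
    !![0, 0, 1;
      t 1 ^ 3 / t 0 ^ 3 - 6 * t 1 ^ 2 / t 0 ^ 5 - 3 * t 1 / t 0 ^ 7, -(3/2 * t 1 ^ 2 / t 0 ^ 2) + 3 * t 1 / t 0 ^ 4 + 1/2 / t 0 ^ 6, 0;
      -(3/4 * t 1 ^ 4 / t 0 ^ 4) + 10 * t 1 ^ 3 / t 0 ^ 6 + 21/2 * t 1 ^ 2 / t 0 ^ 8 + 1/4 / t 0 ^ 12, t 1 ^ 3 / t 0 ^ 3 - 6 * t 1 ^ 2 / t 0 ^ 5 - 3 * t 1 / t 0 ^ 7, 0] :=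
  isStandard_H3d.mulMat_zero (show t ∈ FrobType.H3d.domain from ht) (third_H3d_000 ht) (third_H3d_001 ht) (third_H3d_011 ht)

theorem mulMat_H3d_1 {t : V3} (ht : t 0 ≠ 0) :
    FrobType.H3d.mulMat 1 t =
    !![0, 1, 0;
      -(3/2 * t 1 ^ 2 / t 0 ^ 2) + 3 * t 1 / t 0 ^ 4 + 1/2 / t 0 ^ 6, 3 * t 1 / t 0 - 1 / t 0 ^ 3, 1;
      t 1 ^ 3 / t 0 ^ 3 - 6 * t 1 ^ 2 / t 0 ^ 5 - 3 * t 1 / t 0 ^ 7, -(3/2 * t 1 ^ 2 / t 0 ^ 2) + 3 * t 1 / t 0 ^ 4 + 1/2 / t 0 ^ 6, 0] :=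
  isStandard_H3d.mulMat_one (show t ∈ FrobType.H3d.domain from ht) (third_H3d_001 ht) (third_H3d_011 ht) (third_H3d_111 ht)

theorem mulMat_B31_1 {t : V3} (ht : t 2 ≠ 0) :
    FrobType.B31.mulMat 1 t =
    !![0, 0, 2;
      1, -(1/4 * t 1 / t 2 ^ 2), 1/4 * t 1 ^ 2 / t 2 ^ 3;
      0, 1/4 / t 2, -(1/4 * t 1 / t 2 ^ 2)] := by
  rw [mulMat_eq _ (show t ∈ FrobType.B31.domain from ht)]
  ext i j
  fin_cases i <;> fin_cases j <;> simp [thirdM, third_eq _ (show t ∈ FrobType.B31.domain from ht),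
    etaInv, Matrix.mul_apply, Fin.sum_univ_three, laurent, derivL, LMono.exponent, LMono.deriv,
    evalL, LMono.ev, zpow_ofNat, _root_.zpow_neg]
  all_goals try ring_nf

theorem mulMat_B31_2 {t : V3} (ht : t 2 ≠ 0) :
    FrobType.B31.mulMat 2 t =
    !![0, 2, 0;
      0, 1/4 * t 1 ^ 2 / t 2 ^ 3, -(1/4 * t 1 ^ 3 / t 2 ^ 4) + 8 * t 2;
      1, -(1/4 * t 1 / t 2 ^ 2), 1/4 * t 1 ^ 2 / t 2 ^ 3] := by
  rw [mulMat_eq _ (show t ∈ FrobType.B31.domain from ht)]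
  ext i j
  fin_cases i <;> fin_cases j <;> simp [thirdM, third_eq _ (show t ∈ FrobType.B31.domain from ht),
    etaInv, Matrix.mul_apply, Fin.sum_univ_three, laurent, derivL, LMono.exponent, LMono.deriv,
    evalL, LMono.ev, zpow_ofNat, _root_.zpow_neg]
  all_goals try ring_nf

theorem mulMat_T3_0 (t : V3) :
    FrobType.T3.mulMat 0 t =
    !![-(2), 1, 0;
      0, 0, 0;
      0, 0, -(2)] := by
  rw [mulMat_eq _ (show t ∈ FrobType.T3.domain from trivial)]
  ext i j
  fin_cases i <;> fin_cases j <;> simp [thirdM, third_eq _ (show t ∈ FrobType.T3.domain from trivial),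
    etaInv, Matrix.mul_apply, Fin.sum_univ_three, laurent, derivL, LMono.exponent, LMono.deriv,
    evalL, LMono.ev, zpow_ofNat, _root_.zpow_neg]
  all_goals try ring_nf

theorem mulMat_T3_2 (t : V3) :
    FrobType.T3.mulMat 2 t =
    !![0, 0, -(2);
      0, 0, 0;
      -(2), 1, 0] := by
  rw [mulMat_eq _ (show t ∈ FrobType.T3.domain from trivial)]
  ext i j
  fin_cases i <;> fin_cases j <;> simp [thirdM, third_eq _ (show t ∈ FrobType.T3.domain from trivial),
    etaInv, Matrix.mul_apply, Fin.sum_univ_three, laurent, derivL, LMono.exponent, LMono.deriv,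
    evalL, LMono.ev, zpow_ofNat, _root_.zpow_neg]
  all_goals try ring_nf

/-- With a = F₀₀₁, b = F₀₁₁, c = F₀₀₀ and e = F₁₁₁, all entries of the commutator vanish by the
single associativity equation b² = c + ae. -/
theorem IsStandard.mul_comm {a b c e : ℂ} (h : b ^ 2 = c + a * e) :
    (!![0, 0, 1; a, b, 0; c, a, 0] * !![0, 1, 0; b, e, 1; a, b, 0] : Mat3)
      = !![0, 1, 0; b, e, 1; a, b, 0] * !![0, 0, 1; a, b, 0; c, a, 0] := by
  ext i j
  fin_cases i <;> fin_cases j <;> simp [Matrix.mul_apply, Fin.sum_univ_three]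
  all_goals first | linear_combination h | linear_combination -h | ring

theorem mulMat_comm (T : FrobType) {t : V3} (ht : t ∈ T.domain) (a b : Fin 3)
    (ha : a ≠ T.unityIndex) (hb : b ≠ T.unityIndex) (hab : a < b) :
    T.mulMat a t * T.mulMat b t = T.mulMat b t * T.mulMat a t := by
  cases T
  case A3 | A3d | B3 | B3d | H3 | H3d =>
    obtain ⟨rfl, rfl⟩ : a = 0 ∧ b = 1 := by
      simp only [unityIndex] at ha hb
      omega
    first
      | rw [mulMat_A3_0, mulMat_A3_1]; exact IsStandard.mul_comm (by ring)
      | rw [mulMat_B3_0, mulMat_B3_1]; exact IsStandard.mul_comm (by ring)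
      | rw [mulMat_H3_0, mulMat_H3_1]; exact IsStandard.mul_comm (by ring)
      | rw [mulMat_A3d_0 ht, mulMat_A3d_1 ht]
        exact IsStandard.mul_comm (by have : t 0 ≠ 0 := ht; field_simp; ring)
      | rw [mulMat_B3d_0 ht, mulMat_B3d_1 ht]
        exact IsStandard.mul_comm (by have : t 0 ≠ 0 := ht; field_simp; ring)
      | rw [mulMat_H3d_0 ht, mulMat_H3d_1 ht]
        exact IsStandard.mul_comm (by have : t 0 ≠ 0 := ht; field_simp; ring)
  case B31 =>
    obtain ⟨rfl, rfl⟩ : a = 1 ∧ b = 2 := by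
      simp only [unityIndex] at ha hb
      omega
    have : t 2 ≠ 0 := ht
    rw [mulMat_B31_1 ht, mulMat_B31_2 ht]
    ext i j
    fin_cases i <;> fin_cases j <;> simp [Matrix.mul_apply, Fin.sum_univ_three] <;>
      field_simp <;> ring
  case T3 =>
    obtain ⟨rfl, rfl⟩ : a = 0 ∧ b = 2 := by
      simp only [unityIndex] at ha hb
      omega
    rw [mulMat_T3_0, mulMat_T3_2]
    ext i j
    fin_cases i <;> fin_cases j <;> simp [Matrix.mul_apply, Fin.sum_univ_three]

theorem flatFrob (T : FrobType) :
    FlatFrob T.domain T.eta T.mulMat T.unityIndex T.degrees T.charge := by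
  refine FlatFrob.of_potential T.isOpen_domain (fun _ ht => T.analyticAt_potential ht) T.eta_symm
    T.eta_det (fun _ ht => T.model_metric ht) (fun _ ht => T.potential_homogeneous ht) ?_ ?_ ?_
    (fun _ ht => T.mulMat_comm ht)
  · ext i j
    rw [Matrix.add_apply, Matrix.diagonal_mul, Matrix.mul_diagonal, Matrix.smul_apply]
    cases T <;> fin_cases i <;> fin_cases j <;> simp [degrees, eta, charge]
    all_goals norm_num
  · cases T <;> rfl
  · intro i
    cases T <;> fin_cases i <;> simp [degrees, charge] <;> norm_num

theorem metric_eq_eta (T : FrobType) : ∀ t ∈ T.domain, T.model.metric t = T.eta := fun t ht => by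
  ext i j; exact T.model_metric ht i j

theorem isFrobeniusManifold (T : FrobType) : IsFrobeniusManifold T.domain T.model :=
  isFrobeniusManifold_model T.flatFrob T.metric_eq_eta ⟨_, T.one_mem_domain⟩

end FrobType

/-! ### Polynomial functions -/

@[simp] theorem ev_C (c : ℂ) (x : V3) : ev (C c) x = c := by simp [ev]
@[simp] theorem ev_X (i : Fin 3) (x : V3) : ev (X i) x = x i := by simp [ev]
@[simp] theorem ev_add (p q : Poly) (x : V3) : ev (p + q) x = ev p x + ev q x := by simp [ev]
@[simp] theorem ev_sub (p q : Poly) (x : V3) : ev (p - q) x = ev p x - ev q x := by simp [ev]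
@[simp] theorem ev_neg (p : Poly) (x : V3) : ev (-p) x = -ev p x := by simp [ev]
@[simp] theorem ev_mul (p q : Poly) (x : V3) : ev (p * q) x = ev p x * ev q x := by simp [ev]
@[simp] theorem ev_pow (p : Poly) (n : ℕ) (x : V3) : ev (p ^ n) x = ev p x ^ n := by simp [ev]
@[simp] theorem ev_one (x : V3) : ev 1 x = 1 := by simp [ev]
@[simp] theorem ev_zero (x : V3) : ev 0 x = 0 := by simp [ev]
@[simp] theorem ev_ofNat (n : ℕ) [n.AtLeastTwo] (x : V3) :
    ev ofNat(n) x = ofNat(n) := by simp [ev]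

theorem analyticAt_ev (p : Poly) (x : V3) : AnalyticAt ℂ (ev p) x := by
  induction p using MvPolynomial.induction_on with
  | C a => exact analyticAt_const.congr (Filter.Eventually.of_forall fun y => (ev_C a y).symm)
  | add p q hp hq => exact (hp.add hq).congr (Filter.Eventually.of_forall fun y => (ev_add p q y).symm)
  | mul_X p i hp =>
    exact (hp.mul ((ContinuousLinearMap.proj (R := ℂ) (φ := fun _ : Fin 3 => ℂ) i).analyticAt x)).congr
      (Filter.Eventually.of_forall fun y => by simp)

theorem continuous_ev (p : Poly) : Continuous (ev p) :=
  continuous_iff_continuousAt.2 fun x => (analyticAt_ev p x).continuousAt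

theorem pd_ev (p : Poly) (i : Fin 3) (x : V3) : pd i (ev p) x = ev (pderiv i p) x := by
  induction p using MvPolynomial.induction_on with
  | C a =>
    rw [show ev (C a) = fun _ => a from funext fun y => ev_C a y, pd_const]
    simp
  | add p q hp hq =>
    rw [show ev (p + q) = fun y => ev p y + ev q y from funext fun y => ev_add p q y,
      pd_add (analyticAt_ev p x).differentiableAt (analyticAt_ev q x).differentiableAt, hp, hq]
    simp
  | mul_X p j hp =>
    rw [show ev (p * X j) = fun y => ev p y * y j from funext fun y => by simp,
      pd_mul (analyticAt_ev p x).differentiableAt (by fun_prop), hp, pd_coord]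
    simp [Derivation.leibniz, pderiv_X, Pi.single_apply, eq_comm]
    split_ifs <;> (try simp) <;> ring

theorem pd_ev_fun (p : Poly) (i : Fin 3) : pd i (ev p) = ev (pderiv i p) := funext (pd_ev p i)

theorem ev_subst (g : SL3) (p : Poly) (x : V3) : ev (subst g p) x = ev p (g.1 *ᵥ x) := by
  unfold ev subst
  rw [← MvPolynomial.coe_aeval_eq_eval, ← MvPolynomial.coe_aeval_eq_eval]
  show aeval x (bind₁ _ p) = aeval _ p
  rw [MvPolynomial.aeval_bind₁]
  congr 2
  funext i
  simp [Matrix.mulVec, dotProduct]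

theorem ev_injective {p q : Poly} (h : ∀ x, ev p x = ev q x) : p = q := MvPolynomial.funext h

theorem ev_invariant {G : Subgroup SL3} {f : Poly} (hf : f ∈ invariantRing G) {g : SL3}
    (hg : g ∈ G) (x : V3) : ev f (g.1 *ᵥ x) = ev f x := by
  rw [← ev_subst, hf g hg]

/-- A nonempty open set contains a product of three balls, which are infinite sets, and a polynomial
vanishing on such a product is zero. -/
theorem dense_ev_ne_zero {p : Poly} (hp : p ≠ 0) : Dense {x | ev p x ≠ 0} := by
  rw [dense_iff_inter_open]
  rintro U hU ⟨a, ha⟩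
  by_contra hne
  rw [Set.not_nonempty_iff_eq_empty] at hne
  obtain ⟨ε, hε, hb⟩ := Metric.isOpen_iff.1 hU a ha
  refine hp (MvPolynomial.funext_set (fun i => Metric.ball (a i) ε) (fun i => ?_) fun x hx => ?_)
  · exact infinite_of_mem_nhds (a i) (Metric.ball_mem_nhds _ hε)
  · by_contra h0
    have hxU : x ∈ U := hb (by
      rw [Metric.mem_ball, dist_pi_lt_iff hε]
      exact fun i => hx i (Set.mem_univ i))
    have : x ∈ U ∩ {x | ev p x ≠ 0} := ⟨hxU, by simpa [ev] using h0⟩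
    rw [hne] at this
    exact this

/-! ### Equivariance -/

theorem hessian_eq_pd (f : Poly) (x : V3) (i j : Fin 3) : hessian f x i j = pd i (pd j (ev f)) x := by
  rw [pd_ev_fun, pd_ev]; rfl

theorem hessian_equivariant {f : Poly} {g : Mat3} (hf : ∀ x, ev f (g *ᵥ x) = ev f x) (x : V3) :
    gᵀ * hessian f (g *ᵥ x) * g = hessian f x := by
  have e1 : ∀ j y, pd j (ev f) y = ∑ a, g a j * pd a (ev f) (g *ᵥ y) := fun j y => by
    conv_lhs => rw [show ev f = fun y => ev f (g *ᵥ y) from funext fun y => (hf y).symm]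
    rw [pd_comp (φ := fun y => g *ᵥ y) (analyticAt_ev f _).differentiableAt
      (analyticAt_linear g y).differentiableAt j]
    refine Finset.sum_congr rfl fun a _ => ?_
    rw [jac_linear]
  ext i j
  rw [hessian_eq_pd, show pd j (ev f) = fun y => ∑ a, g a j * pd a (ev f) (g *ᵥ y) from
    funext fun y => e1 j y]
  have hA : ∀ a, AnalyticAt ℂ (fun y => pd a (ev f) (g *ᵥ y)) x := fun a =>
    (analyticAt_pd (analyticAt_ev f _) a).comp (analyticAt_linear g x)
  rw [pd_sum _ fun a _ => ((analyticAt_const (v := g a j)).fun_mul (hA a)).differentiableAt]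
  have e2 : ∀ a, pd i (fun y => g a j * pd a (ev f) (g *ᵥ y)) x
      = ∑ b, g a j * (g b i * hessian f (g *ᵥ x) b a) := fun a => by
    rw [pd_const_mul (hA a).differentiableAt,
      pd_comp (h := pd a (ev f)) (φ := fun y => g *ᵥ y)
      (analyticAt_pd (analyticAt_ev f _) a).differentiableAt
      (analyticAt_linear g x).differentiableAt i, Finset.mul_sum]
    refine Finset.sum_congr rfl fun b _ => ?_
    rw [jac_linear, hessian_eq_pd]
  simp only [e2, Matrix.mul_apply, Matrix.transpose_apply, Finset.sum_mul]
  exact Finset.sum_congr rfl fun a _ => Finset.sum_congr rfl fun b _ => by ring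

theorem hessMetric_equivariant {f : Poly} {g : Mat3} (hg : g.det ≠ 0)
    (hf : ∀ x, ev f (g *ᵥ x) = ev f x) (x : V3) :
    hessMetric f (g *ᵥ x) = g * hessMetric f x * gᵀ := by
  unfold hessMetric
  rw [← hessian_equivariant hf x, Matrix.mul_inv_rev, Matrix.mul_inv_rev, ← mul_assoc,
    self_mul_inv_of hg, one_mul, mul_assoc, inv_mul_self_of (by rwa [Matrix.det_transpose]),
    mul_one]

/-- The Jacobian matrix of a triple of polynomials. -/
def polyJac (u : Fin 3 → Poly) (x : V3) : Mat3 := Matrix.of fun a b => ev (pderiv b (u a)) x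

theorem jac_ev (u : Fin 3 → Poly) (x : V3) : jac (fun y a => ev (u a) y) x = polyJac u x := by
  ext a b; exact pd_ev (u a) b x

theorem coordField_eq (u : Fin 3 → Poly) (k : Fin 3) (x : V3) :
    coordField u k x = (polyJac u x)⁻¹ *ᵥ Pi.single k 1 := by
  ext i; simp [coordField, polyJac, Matrix.mulVec_single_one, Matrix.col]

theorem polyJac_mulVec_coordField {u : Fin 3 → Poly} {x : V3} (h : (polyJac u x).det ≠ 0)
    (k : Fin 3) : polyJac u x *ᵥ coordField u k x = Pi.single k 1 := by
  rw [coordField_eq, Matrix.mulVec_mulVec, self_mul_inv_of h, Matrix.one_mulVec]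

theorem analyticAt_evs (u : Fin 3 → Poly) (x : V3) :
    AnalyticAt ℂ (fun (y : V3) (a : Fin 3) => ev (u a) y) x :=
  analyticAt_pi_iff.2 fun a => analyticAt_ev (u a) x

theorem polyJac_equivariant {u : Fin 3 → Poly} {g : Mat3}
    (hu : ∀ a x, ev (u a) (g *ᵥ x) = ev (u a) x) (x : V3) :
    polyJac u (g *ᵥ x) * g = polyJac u x := by
  have e : ∀ y, (fun a => ev (u a) y) = fun a => ev (u a) (g *ᵥ y) := fun y =>
    funext fun a => (hu a y).symm
  rw [← jac_ev u x, jac_congr (Filter.Eventually.of_forall e), ← jac_ev,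
    jac_comp (φ := fun (y : V3) a => ev (u a) y) (ψ := fun y => g *ᵥ y)
    (analyticAt_evs u _) (analyticAt_linear g x), jac_linear]

theorem coordField_equivariant {u : Fin 3 → Poly} {g : Mat3} (hg : g.det ≠ 0)
    (hu : ∀ a x, ev (u a) (g *ᵥ x) = ev (u a) x) (k : Fin 3) (x : V3) :
    coordField u k (g *ᵥ x) = g *ᵥ coordField u k x := by
  rw [coordField_eq, coordField_eq, ← polyJac_equivariant hu x, Matrix.mul_inv_rev,
    Matrix.mulVec_mulVec, ← mul_assoc, self_mul_inv_of hg, one_mul]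

theorem dualField_equivariant {u : Fin 3 → Poly} {g : Mat3} (hg : g.det ≠ 0)
    (hu : ∀ a x, ev (u a) (g *ᵥ x) = ev (u a) x) (k : Fin 3) (n : ℕ) (x : V3) :
    dualField u k n (g *ᵥ x) = g *ᵥ dualField u k n x := by
  rw [dualField, dualField, coordField_equivariant hg hu, hu, Matrix.mulVec_smul]

/-! ### The free locus -/

/-- The points whose orbit avoids the zeros of `D` and which have trivial stabilizer. -/
def freeLocus (G : Subgroup SL3) (D : Poly) : Set V3 :=
  {x | ∀ g ∈ G, ev D (g.1 *ᵥ x) ≠ 0 ∧ (g ≠ 1 → g.1 *ᵥ x ≠ x)}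

theorem freeLocus_ev {G : Subgroup SL3} {D : Poly} {x : V3} (hx : x ∈ freeLocus G D) :
    ev D x ≠ 0 := by simpa using (hx 1 G.one_mem).1

theorem continuous_mulVec (g : Mat3) : Continuous fun x : V3 => g *ᵥ x :=
  Continuous.matrix_mulVec continuous_const continuous_id

theorem isOpen_freeLocus {G : Subgroup SL3} (hG : (G : Set SL3).Finite) (D : Poly) :
    IsOpen (freeLocus G D) := by
  have : freeLocus G D = ⋂ g ∈ (G : Set SL3),
      {x | ev D (g.1 *ᵥ x) ≠ 0 ∧ (g ≠ 1 → g.1 *ᵥ x ≠ x)} := by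
    ext x; simp [freeLocus]
  rw [this]
  refine hG.isOpen_biInter fun g _ => ?_
  refine IsOpen.and (isOpen_ne_fun ((continuous_ev D).comp (continuous_mulVec g.1)) continuous_const) ?_
  by_cases h : g = 1
  · simp [h]
  · simpa [h] using isOpen_ne_fun (continuous_mulVec g.1) continuous_id

/-- For each group element both conditions contain the nonvanishing of a nonzero polynomial and are
open and dense; a finite group imposes only finitely many of them. -/
theorem dense_freeLocus {G : Subgroup SL3} (hG : (G : Set SL3).Finite) {D : Poly} (hD : D ≠ 0) :
    Dense (freeLocus G D) := by
  have : freeLocus G D = ⋂ g ∈ (G : Set SL3),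
      ({x | ev D (g.1 *ᵥ x) ≠ 0} ∩ {x | g ≠ 1 → g.1 *ᵥ x ≠ x}) := by
    ext x; simp [freeLocus]
  have ho1 : ∀ g : SL3, IsOpen {x | ev D (g.1 *ᵥ x) ≠ 0} := fun g =>
    isOpen_ne_fun ((continuous_ev D).comp (continuous_mulVec g.1)) continuous_const
  have ho2 : ∀ g : SL3, IsOpen {x : V3 | g ≠ 1 → g.1 *ᵥ x ≠ x} := fun g => by
    by_cases h : g = 1
    · simp [h]
    · simpa [h] using isOpen_ne_fun (continuous_mulVec g.1) continuous_id
  rw [this]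
  refine dense_biInter_of_isOpen (fun g _ => (ho1 g).inter (ho2 g)) hG.countable fun g _ =>
    Dense.inter_of_isOpen_left ?_ ?_ (ho1 g)
  · have hne : subst g D ≠ 0 := by
      intro h0
      refine hD (ev_injective fun x => ?_)
      have h1 := ev_subst g D (g⁻¹.1 *ᵥ x)
      have h2 : g.1 *ᵥ (g⁻¹.1 *ᵥ x) = x := by
        rw [Matrix.mulVec_mulVec, ← Matrix.SpecialLinearGroup.coe_mul, mul_inv_cancel,
          Matrix.SpecialLinearGroup.coe_one, Matrix.one_mulVec]
      rw [h0, h2] at h1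
      rw [← h1]; simp
    simpa only [ev_subst] using dense_ev_ne_zero hne
  · by_cases h : g = 1
    · simp [h, dense_univ]
    · have hrow : ∀ i x, ev (∑ j, C (g.1 i j) * X j) x = (g.1 *ᵥ x) i := fun i x => by
        simp [ev, Matrix.mulVec, dotProduct]
      -- If g ≠ 1, some component of gx - x is a nonzero linear form, and fixed points of g lie in
      -- its zero set.
      obtain ⟨i, hi⟩ : ∃ i, (∑ j, C (g.1 i j) * X j : Poly) ≠ X i := by
        by_contra hall
        push Not at hall
        refine h (Subtype.ext (Matrix.ext fun i j => ?_))
        have := hrow i (Pi.single j 1)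
        rw [hall i, ev_X, Matrix.mulVec_single_one] at this
        rw [show g.1 i j = g.1.col j i from rfl, ← this]
        simp [Matrix.one_apply, Pi.single_apply]
      refine (dense_ev_ne_zero (sub_ne_zero.2 hi)).mono fun x (hx : ev _ x ≠ 0) _ h0 => hx ?_
      rw [ev_sub, hrow, h0, ev_X, sub_self]

theorem freeLocus_stable {G : Subgroup SL3} {D : Poly} {g : SL3} (hg : g ∈ G) {x : V3}
    (hx : x ∈ freeLocus G D) : g.1 *ᵥ x ∈ freeLocus G D := by
  intro h hh
  have e : ∀ k : SL3, k.1 *ᵥ (g.1 *ᵥ x) = (k * g).1 *ᵥ x := fun k => by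
    rw [Matrix.mulVec_mulVec, ← Matrix.SpecialLinearGroup.coe_mul]
  refine ⟨by rw [e]; exact (hx _ (G.mul_mem hh hg)).1, fun h1 h0 => ?_⟩
  refine (hx (g⁻¹ * h * g) (G.mul_mem (G.mul_mem (G.inv_mem hg) hh) hg)).2 (fun hc => h1 ?_) ?_
  · have : h = g * (g⁻¹ * h * g) * g⁻¹ := by group
    rw [this, hc]; group
  · have e2 : (g⁻¹ * h * g).1 *ᵥ x = g⁻¹.1 *ᵥ (h.1 *ᵥ (g.1 *ᵥ x)) := by
      rw [e, Matrix.mulVec_mulVec, ← Matrix.SpecialLinearGroup.coe_mul, mul_assoc]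
    rw [e2, h0, Matrix.mulVec_mulVec, ← Matrix.SpecialLinearGroup.coe_mul, inv_mul_cancel,
      Matrix.SpecialLinearGroup.coe_one, Matrix.one_mulVec]

/-! ### Dubrovin's method from charts -/

/-- A chart of type `T` for the pencil defined by `f`, `X` and `τ`. -/
abbrev IsTypeChart (T : FrobType) (f : Poly) (X : V3 → V3) (τ : V3 → ℂ) (N : Set V3) (φ : V3 → V3)
    (κ : ℂ) : Prop :=
  IsPencilChart T.domain T.eta T.mulMat T.unityIndex T.degrees (hessMetric f) X τ N φ κ

section
variable {G : Subgroup SL3} (hG : (G : Set SL3).Finite) {f : Poly} (hmin : IsMinimalDegreeInvariant G f)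
  {X : V3 → V3} {τ : V3 → ℂ} {T : FrobType} {D : Poly} (hD : D ≠ 0)
  (hX : ∀ g ∈ G, ∀ x, X (g.1 *ᵥ x) = g.1 *ᵥ X x) (hτ : ∀ g ∈ G, ∀ x, τ (g.1 *ᵥ x) = τ x)
include hG hmin hD hX hτ

/-- The Frobenius data are determined by f, X and τ, and all required identities are local, so
charts at the points with D ≠ 0 suffice. Restricting to the free locus adds stability and freeness;
invariance follows from equivariance of the three inputs. -/
theorem dubrovinYields_of_charts
    (hc : ∀ p, ev D p ≠ 0 → ∃ N φ κ, p ∈ N ∧ IsTypeChart T f X τ N φ κ) :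
    DubrovinYields G f X τ T (freeLocus G D) := by
  have hW : ∀ p ∈ freeLocus G D, ∃ N ⊆ freeLocus G D, p ∈ N ∧ ∃ φ κ,
      IsTypeChart T f X τ N φ κ := fun p hp => by
    obtain ⟨N, φ, κ, hpN, h⟩ := hc p (freeLocus_ev hp)
    exact ⟨N ∩ freeLocus G D, Set.inter_subset_right, ⟨hpN, hp⟩, φ, κ,
      h.mono Set.inter_subset_left (h.isOpen.inter (isOpen_freeLocus hG D))⟩
  have hne : (freeLocus G D).Nonempty := (dense_freeLocus hG hD).nonempty
  have hdet : ∀ g : SL3, g.1.det ≠ 0 := fun g => by rw [g.2]; exact one_ne_zero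
  exact {
    minimal := hmin
    isOpen := isOpen_freeLocus hG D
    dense := dense_freeLocus hG hD
    stable := fun g hg x hx => freeLocus_stable hg hx
    free := fun g hg h1 x hx => (hx g hg).2 h1
    pencil := isRegularQFPM_of_charts T.flatFrob hW
    unity := fun x hx => by
      obtain ⟨N, _, hxN, φ, κ, h⟩ := hW x hx
      exact (IsPencilChart.grad_flat T.flatFrob h hxN).trans (IsPencilChart.vec_eq T.flatFrob h hxN).symm
    frobenius := isFrobeniusManifold_of_charts T.flatFrob hW hne
    intersection := fun x hx => by
      obtain ⟨N, _, hxN, φ, κ, h⟩ := hW x hx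
      exact IsPencilChart.intersectionForm_eq T.flatFrob h hxN
    invariant := fun g hg x hx => by
      obtain ⟨N, _, hxN, φ, κ, h⟩ := hW _ (freeLocus_stable hg hx)
      exact h.invariant T.flatFrob (hdet g)
        (hessMetric_equivariant (hdet g) fun x => ev_invariant hmin.2.1 hg x)
        (hX g hg) (hτ g hg) rfl hxN
    ofType := by
      obtain ⟨p, hp⟩ := hne
      obtain ⟨N, hN, hpN, φ, κ, h⟩ := hW p hp
      exact isOfType_of_chart T.flatFrob T.metric_eq_eta h hN ⟨p, hpN⟩ }

theorem yields_of_charts (hc : ∀ p, ev D p ≠ 0 → ∃ N φ κ, p ∈ N ∧ IsTypeChart T f X τ N φ κ) :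
    Yields G f X τ T :=
  ⟨_, dubrovinYields_of_charts hG hmin hD hX hτ hc⟩

-- An invertible linear change of the model coordinates leaves the flat metric constant. The listed
-- flat coordinates therefore need to agree with a chart only up to a matrix L, and their
-- normalisation is free.
omit hG hmin hD hX hτ in
theorem isFlatChart_of_chart {N : Set V3} {φ t : V3 → V3} {κ : ℂ} {L : Mat3}
    (h : IsTypeChart T f X τ N φ κ) (hL : L.det ≠ 0) (ht : ∀ x ∈ N, t x = L *ᵥ φ x) {p : V3}
    (hp : p ∈ N) : ∃ N' ⊆ N, IsOpen N' ∧ p ∈ N' ∧ IsFlatChart N' (flatMetric f X) t := by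
  obtain ⟨U, hU, hpU, hinj⟩ := exists_injOn_nhd (h.an p hp) (h.det p hp)
  have hte : ∀ x ∈ N, t =ᶠ[𝓝 x] fun x => L *ᵥ φ x := fun x hx =>
    Filter.eventuallyEq_of_mem (h.isOpen.mem_nhds hx) ht
  have hj : ∀ x ∈ N, jac t x = L * jac φ x := fun x hx => by
    rw [jac_congr (hte x hx), jac_comp (φ := fun y => L *ᵥ y) (analyticAt_linear L _) (h.an x hx),
      jac_linear]
  refine ⟨N ∩ U, Set.inter_subset_left, h.isOpen.inter hU, ⟨hp, hpU⟩, ?_, ?_, ?_,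
    κ • (L * T.eta⁻¹ * Lᵀ), ?_⟩
  · intro x hx
    exact (((analyticAt_linear L _).comp (h.an x hx.1)).congr (hte x hx.1).symm).differentiableAt.differentiableWithinAt
  · intro x hx y hy hxy
    rw [ht x hx.1, ht y hy.1] at hxy
    refine hinj hx.2 hy.2 ?_
    have := congrArg (fun v => L⁻¹ *ᵥ v) hxy
    simpa [Matrix.mulVec_mulVec, inv_mul_self_of hL] using this
  · intro x hx
    rw [hj x hx.1, Matrix.det_mul]
    exact mul_ne_zero hL (h.det x hx.1)
  · intro x hx
    have hJ := h.det x hx.1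
    have hJt : (jac φ x)ᵀ.det ≠ 0 := by rwa [Matrix.det_transpose]
    rw [flatMetric, IsPencilChart.flatMetric_eq T.flatFrob h hx.1, hj x hx.1, Matrix.transpose_mul,
      Matrix.mul_smul, Matrix.smul_mul]
    congr 1
    rw [Matrix.transpose_nonsing_inv]
    calc L * jac φ x * ((jac φ x)⁻¹ * T.eta⁻¹ * (jac φ x)ᵀ⁻¹) * ((jac φ x)ᵀ * Lᵀ)
        = L * (jac φ x * (jac φ x)⁻¹) * T.eta⁻¹ * ((jac φ x)ᵀ⁻¹ * (jac φ x)ᵀ) * Lᵀ := by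
          simp only [mul_assoc]
      _ = _ := by rw [self_mul_inv_of hJ, inv_mul_self_of hJt, mul_one, mul_one]

theorem yieldsFlat_of_charts {t : V3 → V3}
    (hc : ∀ p, ev D p ≠ 0 → ∃ N φ κ, p ∈ N ∧ IsTypeChart T f X τ N φ κ ∧
      ∃ L : Mat3, L.det ≠ 0 ∧ ∀ x ∈ N, t x = L *ᵥ φ x) :
    YieldsFlat G f X τ T t := by
  refine ⟨_, dubrovinYields_of_charts hG hmin hD hX hτ fun p hp => ?_, fun p hp => ?_⟩
  · obtain ⟨N, φ, κ, hpN, h, _⟩ := hc p hp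
    exact ⟨N, φ, κ, hpN, h⟩
  · obtain ⟨N, φ, κ, hpN, h, L, hL, ht⟩ := hc p (freeLocus_ev hp)
    have h' := h.mono (N' := N ∩ freeLocus G D) Set.inter_subset_left
      (h.isOpen.inter (isOpen_freeLocus hG D))
    obtain ⟨N', hN', ho, hp', hf⟩ := isFlatChart_of_chart h' hL (fun x hx => ht x hx.1)
      (p := p) ⟨hpN, hp⟩
    exact ⟨N', ho, hp', fun x hx => (hN' hx).2, hf⟩

theorem yieldsFlatLog_of_charts {b : Poly} {t : V3 → ℂ → V3}
    (hc : ∀ p, ev D p ≠ 0 → ∃ N φ κ, p ∈ N ∧ IsTypeChart T f X τ N φ κ ∧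
      ∃ (L : Mat3) (l : V3 → ℂ), L.det ≠ 0 ∧ (∀ x ∈ N, AnalyticAt ℂ l x) ∧
        (∀ x ∈ N, Complex.exp (l x) = ev b x) ∧ ∀ x ∈ N, t x (l x) = L *ᵥ φ x) :
    YieldsFlatLog G f X τ T b t := by
  refine ⟨_, dubrovinYields_of_charts hG hmin hD hX hτ fun p hp => ?_, fun p hp => ?_⟩
  · obtain ⟨N, φ, κ, hpN, h, _⟩ := hc p hp
    exact ⟨N, φ, κ, hpN, h⟩
  · obtain ⟨N, φ, κ, hpN, h, L, l, hL, hl, hb, ht⟩ := hc p (freeLocus_ev hp)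
    have h' := h.mono (N' := N ∩ freeLocus G D) Set.inter_subset_left
      (h.isOpen.inter (isOpen_freeLocus hG D))
    obtain ⟨N', hN', ho, hp', hf⟩ := isFlatChart_of_chart (t := fun x => t x (l x)) h' hL
      (fun x hx => ht x hx.1) (p := p) ⟨hpN, hp⟩
    exact ⟨N', ho, hp', fun x hx => (hN' hx).2, l,
      fun x hx => (hl x (hN' hx).1).differentiableAt.differentiableWithinAt,
      fun x hx => hb x (hN' hx).1, hf⟩

end

theorem Yields.hasFlatHessian {G : Subgroup SL3} {f : Poly} {X : V3 → V3} {τ : V3 → ℂ}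
    {T : FrobType} (h : Yields G f X τ T) : HasFlatHessian G := by
  obtain ⟨W, hW⟩ := h
  exact ⟨f, hW.minimal, W, hW.isOpen, hW.dense.nonempty, hW.pencil.pencil.1⟩

theorem YieldsFlatLog.yields {G : Subgroup SL3} {f : Poly} {X : V3 → V3} {τ : V3 → ℂ}
    {T : FrobType} {b : Poly} {t : V3 → ℂ → V3} (h : YieldsFlatLog G f X τ T b t) :
    Yields G f X τ T :=
  ⟨h.choose, h.choose_spec.1⟩

/-! ### Intersection forms of the types -/

namespace FrobType

theorem mulMat_unit (T : FrobType) {t : V3} (ht : t ∈ T.domain) : T.mulMat T.unityIndex t = 1 :=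
  T.flatFrob.unit t ht

/-- The intersection form of a type in flat coordinates. -/
def gform : FrobType → V3 → Mat3
  | .A3, t => !![1/2 * t 0, 3/4 * t 1, t 2;
      3/4 * t 1, 1/2 * t 0 ^ 2 + t 2, 5/4 * t 0 * t 1;
      t 2, 5/4 * t 0 * t 1, 1/2 * t 0 ^ 3 + 3/4 * t 1 ^ 2]
  | .A3d, t => !![-(1/2 * t 0), 1/4 * t 1, t 2;
      1/4 * t 1, t 2 + 3/2 * t 1 ^ 2 / t 0 + 1/2 / t 0 ^ 2, -(7/8 * t 1 ^ 3 / t 0 ^ 2) - 7/4 * t 1 / t 0 ^ 3;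
      t 2, -(7/8 * t 1 ^ 3 / t 0 ^ 2) - 7/4 * t 1 / t 0 ^ 3, 5/8 * t 1 ^ 4 / t 0 ^ 3 + 15/4 * t 1 ^ 2 / t 0 ^ 4 - 1/2 / t 0 ^ 5]
  | .B3, t => !![1/3 * t 0, 2/3 * t 1, t 2;
      2/3 * t 1, 1/3 * t 0 ^ 3 + t 0 * t 1 + t 2, 4/3 * t 0 ^ 2 * t 1 + 2/3 * t 1 ^ 2;
      t 2, 4/3 * t 0 ^ 2 * t 1 + 2/3 * t 1 ^ 2, 1/3 * t 0 ^ 5 + 5/3 * t 0 * t 1 ^ 2]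
  | .B3d, t => !![-(1/3 * t 0), 1/3 * t 1, t 2;
      1/3 * t 1, t 2 + 3/2 * t 1 ^ 2 / t 0 + t 1 / t 0 ^ 2 - 1/3 / t 0 ^ 3, -(5/6 * t 1 ^ 3 / t 0 ^ 2) - 5/3 * t 1 ^ 2 / t 0 ^ 3 + 5/3 * t 1 / t 0 ^ 4;
      t 2, -(5/6 * t 1 ^ 3 / t 0 ^ 2) - 5/3 * t 1 ^ 2 / t 0 ^ 3 + 5/3 * t 1 / t 0 ^ 4, 7/12 * t 1 ^ 4 / t 0 ^ 3 + 7/3 * t 1 ^ 3 / t 0 ^ 4 - 14/3 * t 1 ^ 2 / t 0 ^ 5 - 1/3 / t 0 ^ 7]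
  | .H3, t => !![1/5 * t 0, 3/5 * t 1, t 2;
      3/5 * t 1, 1/10 * t 0 ^ 5 + t 0 ^ 2 * t 1 + t 2, 7/10 * t 0 ^ 4 * t 1 + 7/5 * t 0 * t 1 ^ 2;
      t 2, 7/10 * t 0 ^ 4 * t 1 + 7/5 * t 0 * t 1 ^ 2, 1/20 * t 0 ^ 9 + 9/5 * t 0 ^ 3 * t 1 ^ 2 + 3/5 * t 1 ^ 3]
  | .H3d, t => !![-(1/5 * t 0), 2/5 * t 1, t 2;
      2/5 * t 1, t 2 + 3/2 * t 1 ^ 2 / t 0 - t 1 / t 0 ^ 3 - 1/10 / t 0 ^ 5, -(4/5 * t 1 ^ 3 / t 0 ^ 2) + 12/5 * t 1 ^ 2 / t 0 ^ 4 + 4/5 * t 1 / t 0 ^ 6;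
      t 2, -(4/5 * t 1 ^ 3 / t 0 ^ 2) + 12/5 * t 1 ^ 2 / t 0 ^ 4 + 4/5 * t 1 / t 0 ^ 6, 11/20 * t 1 ^ 4 / t 0 ^ 3 - 22/5 * t 1 ^ 3 / t 0 ^ 5 - 33/10 * t 1 ^ 2 / t 0 ^ 7 - 1/20 / t 0 ^ 11]
  | .B31, t => !![4/3 * t 0, 5/3 * t 1, t 2;
      5/3 * t 1, 1/12 * t 1 ^ 3 / t 2 ^ 3 + 4 * t 2 ^ 2, 2/3 * t 0 - 1/12 * t 1 ^ 2 / t 2 ^ 2;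
      t 2, 2/3 * t 0 - 1/12 * t 1 ^ 2 / t 2 ^ 2, 1/12 * t 1 / t 2]
  | .T3, t => !![t 0, t 1, t 2;
      t 1, 2 * t 1, 0;
      t 2, 0, t 0 - 1/2 * t 1]

theorem eulerOp_A3 {t : V3} (ht : t ∈ domain .A3) :
    eulerOp (mulMat .A3) (degrees .A3) t * (eta .A3)⁻¹ = gform .A3 t := by
  have h1 : mulMat .A3 2 t = 1 := mulMat_unit .A3 ht
  rw [eta_inv, eulerOp, Fin.sum_univ_three, h1, mulMat_A3_0, mulMat_A3_1]
  ext i j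
  fin_cases i <;> fin_cases j <;>
    simp [Matrix.mul_apply, Fin.sum_univ_three, etaInv, gform, degrees, Matrix.one_apply]
  all_goals try field_simp
  all_goals try ring

theorem eulerOp_A3d {t : V3} (ht : t ∈ domain .A3d) :
    eulerOp (mulMat .A3d) (degrees .A3d) t * (eta .A3d)⁻¹ = gform .A3d t := by
  have h1 : mulMat .A3d 2 t = 1 := mulMat_unit .A3d ht
  have h0 : t 0 ≠ 0 := ht
  rw [eta_inv, eulerOp, Fin.sum_univ_three, h1, mulMat_A3d_0 ht, mulMat_A3d_1 ht]
  ext i j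
  fin_cases i <;> fin_cases j <;>
    simp [Matrix.mul_apply, Fin.sum_univ_three, etaInv, gform, degrees, Matrix.one_apply]
  all_goals try field_simp
  all_goals try ring

theorem eulerOp_B3 {t : V3} (ht : t ∈ domain .B3) :
    eulerOp (mulMat .B3) (degrees .B3) t * (eta .B3)⁻¹ = gform .B3 t := by
  have h1 : mulMat .B3 2 t = 1 := mulMat_unit .B3 ht
  rw [eta_inv, eulerOp, Fin.sum_univ_three, h1, mulMat_B3_0, mulMat_B3_1]
  ext i j
  fin_cases i <;> fin_cases j <;>
    simp [Matrix.mul_apply, Fin.sum_univ_three, etaInv, gform, degrees, Matrix.one_apply]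
  all_goals try field_simp
  all_goals try ring

theorem eulerOp_B3d {t : V3} (ht : t ∈ domain .B3d) :
    eulerOp (mulMat .B3d) (degrees .B3d) t * (eta .B3d)⁻¹ = gform .B3d t := by
  have h1 : mulMat .B3d 2 t = 1 := mulMat_unit .B3d ht
  have h0 : t 0 ≠ 0 := ht
  rw [eta_inv, eulerOp, Fin.sum_univ_three, h1, mulMat_B3d_0 ht, mulMat_B3d_1 ht]
  ext i j
  fin_cases i <;> fin_cases j <;>
    simp [Matrix.mul_apply, Fin.sum_univ_three, etaInv, gform, degrees, Matrix.one_apply]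
  all_goals try field_simp
  all_goals try ring

theorem eulerOp_H3 {t : V3} (ht : t ∈ domain .H3) :
    eulerOp (mulMat .H3) (degrees .H3) t * (eta .H3)⁻¹ = gform .H3 t := by
  have h1 : mulMat .H3 2 t = 1 := mulMat_unit .H3 ht
  rw [eta_inv, eulerOp, Fin.sum_univ_three, h1, mulMat_H3_0, mulMat_H3_1]
  ext i j
  fin_cases i <;> fin_cases j <;>
    simp [Matrix.mul_apply, Fin.sum_univ_three, etaInv, gform, degrees, Matrix.one_apply]
  all_goals try field_simp
  all_goals try ring

theorem eulerOp_H3d {t : V3} (ht : t ∈ domain .H3d) :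
    eulerOp (mulMat .H3d) (degrees .H3d) t * (eta .H3d)⁻¹ = gform .H3d t := by
  have h1 : mulMat .H3d 2 t = 1 := mulMat_unit .H3d ht
  have h0 : t 0 ≠ 0 := ht
  rw [eta_inv, eulerOp, Fin.sum_univ_three, h1, mulMat_H3d_0 ht, mulMat_H3d_1 ht]
  ext i j
  fin_cases i <;> fin_cases j <;>
    simp [Matrix.mul_apply, Fin.sum_univ_three, etaInv, gform, degrees, Matrix.one_apply]
  all_goals try field_simp
  all_goals try ring

theorem eulerOp_B31 {t : V3} (ht : t ∈ domain .B31) :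
    eulerOp (mulMat .B31) (degrees .B31) t * (eta .B31)⁻¹ = gform .B31 t := by
  have h1 : mulMat .B31 0 t = 1 := mulMat_unit .B31 ht
  have h0 : t 2 ≠ 0 := ht
  rw [eta_inv, eulerOp, Fin.sum_univ_three, h1, mulMat_B31_1 ht, mulMat_B31_2 ht]
  ext i j
  fin_cases i <;> fin_cases j <;>
    simp [Matrix.mul_apply, Fin.sum_univ_three, etaInv, gform, degrees, Matrix.one_apply]
  all_goals try field_simp
  all_goals try ring

theorem eulerOp_T3 {t : V3} (ht : t ∈ domain .T3) :
    eulerOp (mulMat .T3) (degrees .T3) t * (eta .T3)⁻¹ = gform .T3 t := by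
  have h1 : mulMat .T3 1 t = 1 := mulMat_unit .T3 ht
  rw [eta_inv, eulerOp, Fin.sum_univ_three, h1, mulMat_T3_0, mulMat_T3_2]
  ext i j
  fin_cases i <;> fin_cases j <;>
    simp [Matrix.mul_apply, Fin.sum_univ_three, etaInv, gform, degrees, Matrix.one_apply]
  all_goals try field_simp
  all_goals try ring

theorem eulerOp_mul_inv (T : FrobType) {t : V3} (ht : t ∈ T.domain) :
    eulerOp T.mulMat T.degrees t * T.eta⁻¹ = T.gform t := by
  cases T
  · exact eulerOp_A3 ht
  · exact eulerOp_A3d ht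
  · exact eulerOp_B3 ht
  · exact eulerOp_B3d ht
  · exact eulerOp_H3 ht
  · exact eulerOp_H3d ht
  · exact eulerOp_B31 ht
  · exact eulerOp_T3 ht

end FrobType

/-! ### Gradients relative to a coordinate system -/

/-- `h` is holomorphic at `x` and `dh = ∑ c_b dv_b` there. -/
structure HasGrad (v : V3 → V3) (h : V3 → ℂ) (c : V3) (x : V3) : Prop where
  an : AnalyticAt ℂ h x
  eq : ∀ j, pd j h x = ∑ b, c b * jac v x b j

namespace HasGrad
variable {v : V3 → V3} {h k : V3 → ℂ} {c d : V3} {x : V3}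

theorem coord (hv : AnalyticAt ℂ v x) (b : Fin 3) : HasGrad v (fun y => v y b) (Pi.single b 1) x :=
  ⟨analyticAt_pi_iff.1 hv b, fun j => by simp [Pi.single_apply, jac]⟩

theorem add (hh : HasGrad v h c x) (hk : HasGrad v k d x) :
    HasGrad v (fun y => h y + k y) (c + d) x :=
  ⟨hh.an.add hk.an, fun j => by
    rw [pd_add hh.an.differentiableAt hk.an.differentiableAt, hh.eq, hk.eq]
    simp only [Pi.add_apply, add_mul, Finset.sum_add_distrib]⟩

theorem sub (hh : HasGrad v h c x) (hk : HasGrad v k d x) :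
    HasGrad v (fun y => h y - k y) (c - d) x :=
  ⟨hh.an.sub hk.an, fun j => by
    rw [pd_sub hh.an.differentiableAt hk.an.differentiableAt, hh.eq, hk.eq]
    simp only [Pi.sub_apply, sub_mul, Finset.sum_sub_distrib]⟩

theorem mul (hh : HasGrad v h c x) (hk : HasGrad v k d x) :
    HasGrad v (fun y => h y * k y) (k x • c + h x • d) x :=
  ⟨hh.an.mul hk.an, fun j => by
    rw [pd_mul hh.an.differentiableAt hk.an.differentiableAt, hh.eq, hk.eq]
    simp only [Pi.add_apply, Pi.smul_apply, smul_eq_mul, Fin.sum_univ_three]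
    ring⟩

theorem const_mul (hh : HasGrad v h c x) (a : ℂ) : HasGrad v (fun y => a * h y) (a • c) x :=
  ⟨analyticAt_const.mul hh.an, fun j => by
    rw [pd_const_mul hh.an.differentiableAt, hh.eq, Finset.mul_sum]
    simp only [Pi.smul_apply, smul_eq_mul, mul_assoc]⟩

theorem comp₁ (hh : HasGrad v h c x) {g : ℂ → ℂ} {g' : ℂ} (hg : HasDerivAt g g' (h x))
    (hga : AnalyticAt ℂ g (h x)) : HasGrad v (fun y => g (h y)) (g' • c) x :=
  ⟨hga.comp hh.an, fun j => by
    rw [pd_comp₁ hg hh.an.differentiableAt, hh.eq, Finset.mul_sum]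
    simp only [Pi.smul_apply, smul_eq_mul, mul_assoc]⟩

theorem pow (hh : HasGrad v h c x) (n : ℕ) :
    HasGrad v (fun y => h y ^ n) ((n * h x ^ (n - 1)) • c) x :=
  hh.comp₁ (g := fun z => z ^ n) (hasDerivAt_pow n (h x)) (analyticAt_id.pow n)

theorem exp (hh : HasGrad v h c x) :
    HasGrad v (fun y => Complex.exp (h y)) (Complex.exp (h x) • c) x :=
  hh.comp₁ (Complex.hasDerivAt_exp _) analyticAt_cexp

theorem inv (hh : HasGrad v h c x) (h0 : h x ≠ 0) :
    HasGrad v (fun y => (h y)⁻¹) (-(h x ^ 2)⁻¹ • c) x :=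
  hh.comp₁ (hasDerivAt_inv h0) (analyticAt_inv h0)

theorem congr (hh : HasGrad v h c x) (e : h =ᶠ[𝓝 x] k) : HasGrad v k c x :=
  ⟨hh.an.congr e, fun j => by rw [← pd_congr e, hh.eq]⟩

theorem congr_grad (hh : HasGrad v h c x) (e : c = d) : HasGrad v h d x := e ▸ hh

end HasGrad

theorem jac_of_hasGrad {v φ : V3 → V3} {A : Mat3} {x : V3}
    (h : ∀ i, HasGrad v (fun y => φ y i) (A i) x) : jac φ x = A * jac v x := by
  ext i j
  rw [Matrix.mul_apply]
  exact (h i).eq j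

theorem analyticAt_of_hasGrad {v φ : V3 → V3} {A : Mat3} {x : V3}
    (h : ∀ i, HasGrad v (fun y => φ y i) (A i) x) : AnalyticAt ℂ φ x :=
  analyticAt_pi_iff.2 fun i => (h i).an

/-- Lowering the unity field gives a multiple of dt₀ in every type. For this reason τ has to be a
multiple of the first flat coordinate. -/
theorem FrobType.eta_unityIndex (T : FrobType) (a : Fin 3) :
    T.eta a T.unityIndex = if a = 0 then T.eta 0 T.unityIndex else 0 := by
  cases T <;> fin_cases a <;> simp [FrobType.eta, FrobType.unityIndex]

/-- A coordinate system `v` in which the contravariant metric, the vector field and the flat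
coordinates `φ` are known gives a chart. -/
theorem isPencilChart_of_grad {T : FrobType} {Ω : V3 → Mat3} {X : V3 → V3} {τ : V3 → ℂ} {N : Set V3}
    {φ v : V3 → V3} {κ : ℂ} {A P : V3 → Mat3} {y : V3 → V3} (hN : IsOpen N) (hκ : κ ≠ 0)
    (hΩ : ∀ x ∈ N, (Ω x).det ≠ 0) (hv : ∀ x ∈ N, (jac v x).det ≠ 0)
    (hP : ∀ x ∈ N, jac v x * Ω x * (jac v x)ᵀ = P x) (hX : ∀ x ∈ N, jac v x *ᵥ X x = y x)
    (hφ : ∀ x ∈ N, ∀ i, HasGrad v (fun y => φ y i) (A x i) x)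
    (hmaps : ∀ x ∈ N, φ x ∈ T.domain) (hA : ∀ x ∈ N, (A x).det ≠ 0)
    (hmet : ∀ x ∈ N, A x * P x * (A x)ᵀ = κ • T.gform (φ x))
    (hvec : ∀ x ∈ N, A x *ᵥ y x = Pi.single T.unityIndex 1)
    (hτa : ∀ x ∈ N, AnalyticAt ℂ τ x)
    (hτ : ∀ x ∈ N, ∀ j, pd j τ x = κ⁻¹ * T.eta 0 T.unityIndex * jac φ x 0 j) :
    IsPencilChart T.domain T.eta T.mulMat T.unityIndex T.degrees Ω X τ N φ κ where
  isOpen := hN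
  an x hx := analyticAt_of_hasGrad (hφ x hx)
  maps x hx := hmaps x hx
  det x hx := by
    rw [jac_of_hasGrad (hφ x hx), Matrix.det_mul]
    exact mul_ne_zero (hA x hx) (hv x hx)
  ne_zero := hκ
  nondeg := hΩ
  metric x hx := by
    rw [jac_of_hasGrad (hφ x hx), Matrix.transpose_mul, T.eulerOp_mul_inv (hmaps x hx),
      ← hmet x hx, ← hP x hx]
    simp only [mul_assoc]
  vec x hx := by
    rw [jac_of_hasGrad (hφ x hx), ← Matrix.mulVec_mulVec, hX x hx, hvec x hx]
  fn x hx j := by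
    have e : ∀ a, jac φ x a j * T.eta a T.unityIndex
        = if a = 0 then jac φ x 0 j * T.eta 0 T.unityIndex else 0 := fun a => by
      rw [T.eta_unityIndex a]
      split_ifs with h
      · rw [h]
      · rw [mul_zero]
    rw [hτ x hx, Finset.sum_congr rfl fun a _ => e a, Finset.sum_ite_eq']
    simp only [Finset.mem_univ, if_true]
    ring
  fn_an := hτa

theorem pd_eq_of_eq_coord {τ : V3 → ℂ} {N : Set V3} (hN : IsOpen N) {φ : V3 → V3} {c : ℂ}
    (hφ : ∀ x ∈ N, AnalyticAt ℂ φ x) (h : ∀ x ∈ N, τ x = c * φ x 0) :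
    (∀ x ∈ N, AnalyticAt ℂ τ x) ∧ ∀ x ∈ N, ∀ j, pd j τ x = c * jac φ x 0 j :=
  ⟨fun x hx => (analyticAt_const.mul (analyticAt_pi_iff.1 (hφ x hx) 0)).congr
    (Filter.eventuallyEq_of_mem (hN.mem_nhds hx) fun y hy => (h y hy).symm), fun x hx j => by
    rw [pd_congr (Filter.eventuallyEq_of_mem (hN.mem_nhds hx) h),
      pd_const_mul (analyticAt_pi_iff.1 (hφ x hx) 0).differentiableAt]
    rfl⟩

/-! ### Duality -/

section
variable {Ω : V3 → Mat3} {X : V3 → V3} {τ u : V3 → ℂ} {N : Set V3} {φ : V3 → V3} {κ α : ℂ}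

/-- The inversion relating the flat coordinates of a type and of its dual. -/
def invert (α : ℂ) (a : ℕ) (t : V3) : V3 :=
  ![-(α ^ 2)⁻¹ * t 0, α ^ (a - 1) * (t 1 * (t 0 ^ a)⁻¹),
    α ^ (2 * a) * (t 2 * (t 0 ^ (2 * a))⁻¹ + 1 / 2 * (t 1 ^ 2 * (t 0 ^ (2 * a + 1))⁻¹))]

/-- The Jacobian matrix of the inversion. -/
def invertJac (α : ℂ) (a : ℕ) (t : V3) : Mat3 :=
  !![-(α ^ 2)⁻¹, 0, 0;
    -(α ^ (a - 1) * a * t 1 / t 0 ^ (a + 1)), α ^ (a - 1) / t 0 ^ a, 0;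
    -(α ^ (2 * a) * (2 * a * t 2 / t 0 ^ (2 * a + 1)
      + 1 / 2 * (2 * a + 1) * t 1 ^ 2 / t 0 ^ (2 * a + 2))),
    α ^ (2 * a) * t 1 / t 0 ^ (2 * a + 1), α ^ (2 * a) / t 0 ^ (2 * a)]

theorem hasGrad_invert {φ : V3 → V3} {x : V3} (hφ : AnalyticAt ℂ φ x) (h0 : φ x 0 ≠ 0) (α : ℂ)
    {a : ℕ} (ha : 0 < a) (i : Fin 3) :
    HasGrad φ (fun y => invert α a (φ y) i) (invertJac α a (φ x) i) x := by
  have c0 := HasGrad.coord hφ 0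
  have c1 := HasGrad.coord hφ 1
  have c2 := HasGrad.coord hφ 2
  obtain ⟨a, rfl⟩ : ∃ b, a = b + 1 := ⟨a - 1, by omega⟩
  have hp : ∀ n, φ x 0 ^ n ≠ 0 := fun n => pow_ne_zero n h0
  have e2 : 2 * (a + 1) - 1 = 2 * a + 1 := by omega
  fin_cases i
  · refine (c0.const_mul _).congr_grad ?_
    ext j; fin_cases j <;> simp [invertJac]
  · refine ((c1.mul ((c0.pow _).inv (hp _))).const_mul _).congr_grad ?_
    ext j; fin_cases j <;> simp [invertJac] <;> field_simp
    ring
  · refine ((((c2.mul ((c0.pow _).inv (hp _))).add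
      (((c1.pow 2).mul ((c0.pow _).inv (hp _))).const_mul _)).const_mul _)).congr_grad ?_
    ext j; fin_cases j <;> simp [invertJac, e2] <;> field_simp
    ring

/-- Dubrovin's inversion preserves the intersection form up to a scalar. Since τ changes sign, so
does the Euler field; in the applications a = 1/deg t₀, and the degrees become -1/a, 1 - deg t₁ and
1. The scaling α²ᵃ of the third coordinate makes u²ᵃX the new unity field, where αu is the first old
coordinate. -/
theorem IsPencilChart.dual_of {T S : FrobType} {a : ℕ} (ha : 0 < a)
    (h : IsPencilChart T.domain T.eta T.mulMat T.unityIndex T.degrees Ω X τ N φ κ)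
    (hT : T.IsStandard) (hS : S.IsStandard) (hSd : S.domain = {t | t 0 ≠ 0})
    (hα : α ≠ 0) (hu : ∀ x ∈ N, φ x 0 = α * u x) (hu0 : ∀ x ∈ N, u x ≠ 0)
    (hg : ∀ t : V3, t 0 ≠ 0 → invertJac α a t * T.gform t * (invertJac α a t)ᵀ
      = (α ^ 2)⁻¹ • S.gform (invert α a t)) :
    IsPencilChart S.domain S.eta S.mulMat S.unityIndex S.degrees Ω (fun x => u x ^ (2 * a) • X x)
      (fun x => -τ x) N (fun x => invert α a (φ x)) (κ * (α ^ 2)⁻¹) := by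
  have h0 : ∀ x ∈ N, φ x 0 ≠ 0 := fun x hx => by
    rw [hu x hx]; exact mul_ne_zero hα (hu0 x hx)
  refine isPencilChart_of_grad (v := φ) (A := fun x => invertJac α a (φ x))
    (P := fun x => κ • T.gform (φ x)) (y := fun x => u x ^ (2 * a) • Pi.single 2 1) h.isOpen
    (mul_ne_zero h.ne_zero (inv_ne_zero (pow_ne_zero 2 hα))) h.nondeg h.det
    (fun x hx => ?_) (fun x hx => ?_) (fun x hx i => hasGrad_invert (h.an x hx) (h0 x hx) α ha i)
    (fun x hx => ?_) (fun x hx => ?_) (fun x hx => ?_) (fun x hx => ?_) (fun x hx => ?_)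
    (fun x hx j => ?_)
  · rw [h.metric x hx, T.eulerOp_mul_inv (h.maps x hx)]
  · rw [Matrix.mulVec_smul, h.vec x hx, hT.1]
  · rw [hSd]
    show invert α a (φ x) 0 ≠ 0
    simp [invert, hα, h0 x hx]
  · rw [Matrix.det_fin_three]
    simp [invertJac, hα, h0 x hx]
  · rw [Matrix.mul_smul, Matrix.smul_mul, hg _ (h0 x hx), smul_smul]
  · rw [hS.1, Matrix.mulVec_smul, Matrix.mulVec_single_one]
    ext i
    have := hu0 x hx
    fin_cases i <;> simp [invertJac, Matrix.col, hu x hx]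
    field_simp
    ring
  · exact (h.fn_an x hx).neg
  · rw [hS.1, hS.2.1, jac_of_hasGrad fun i => hasGrad_invert (h.an x hx) (h0 x hx) α ha i]
    have e1 : pd j (fun x => -τ x) x = -pd j τ x := by
      simpa using pd_const_mul (h.fn_an x hx).differentiableAt (-1) j
    rw [e1, h.fn x hx, hT.1, hT.2.1]
    simp [Matrix.mul_apply, Fin.sum_univ_three, invertJac]
    field_simp

theorem gform_invert_A3 (hα : α ≠ 0) {t : V3} (h0 : t 0 ≠ 0) :
    invertJac α 2 t * FrobType.A3.gform t * (invertJac α 2 t)ᵀ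
      = (α ^ 2)⁻¹ • FrobType.A3d.gform (invert α 2 t) := by
  ext i j
  fin_cases i <;> fin_cases j <;>
    simp [Matrix.mul_apply, Fin.sum_univ_three, invertJac, invert, FrobType.gform]
  all_goals try field_simp
  all_goals try ring

theorem IsPencilChart.dual_A3
    (h : IsPencilChart (FrobType.domain .A3) (FrobType.eta .A3) (FrobType.mulMat .A3)
      (FrobType.unityIndex .A3) (FrobType.degrees .A3) Ω X τ N φ κ)
    (hα : α ≠ 0) (hu : ∀ x ∈ N, φ x 0 = α * u x) (hu0 : ∀ x ∈ N, u x ≠ 0) :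
    IsPencilChart (FrobType.domain .A3d) (FrobType.eta .A3d) (FrobType.mulMat .A3d)
      (FrobType.unityIndex .A3d) (FrobType.degrees .A3d) Ω (fun x => u x ^ 4 • X x)
      (fun x => -τ x) N (fun x => invert α 2 (φ x)) (κ * (α ^ 2)⁻¹) :=
  h.dual_of (by norm_num) FrobType.isStandard_A3 FrobType.isStandard_A3d rfl hα hu hu0
    fun _ => gform_invert_A3 hα

theorem gform_invert_B3 (hα : α ≠ 0) {t : V3} (h0 : t 0 ≠ 0) :
    invertJac α 3 t * FrobType.B3.gform t * (invertJac α 3 t)ᵀ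
      = (α ^ 2)⁻¹ • FrobType.B3d.gform (invert α 3 t) := by
  ext i j
  fin_cases i <;> fin_cases j <;>
    simp [Matrix.mul_apply, Fin.sum_univ_three, invertJac, invert, FrobType.gform]
  all_goals try field_simp
  all_goals try ring

theorem IsPencilChart.dual_B3
    (h : IsPencilChart (FrobType.domain .B3) (FrobType.eta .B3) (FrobType.mulMat .B3)
      (FrobType.unityIndex .B3) (FrobType.degrees .B3) Ω X τ N φ κ)
    (hα : α ≠ 0) (hu : ∀ x ∈ N, φ x 0 = α * u x) (hu0 : ∀ x ∈ N, u x ≠ 0) :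
    IsPencilChart (FrobType.domain .B3d) (FrobType.eta .B3d) (FrobType.mulMat .B3d)
      (FrobType.unityIndex .B3d) (FrobType.degrees .B3d) Ω (fun x => u x ^ 6 • X x)
      (fun x => -τ x) N (fun x => invert α 3 (φ x)) (κ * (α ^ 2)⁻¹) :=
  h.dual_of (by norm_num) FrobType.isStandard_B3 FrobType.isStandard_B3d rfl hα hu hu0
    fun _ => gform_invert_B3 hα

theorem gform_invert_H3 (hα : α ≠ 0) {t : V3} (h0 : t 0 ≠ 0) :
    invertJac α 5 t * FrobType.H3.gform t * (invertJac α 5 t)ᵀ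
      = (α ^ 2)⁻¹ • FrobType.H3d.gform (invert α 5 t) := by
  ext i j
  fin_cases i <;> fin_cases j <;>
    simp [Matrix.mul_apply, Fin.sum_univ_three, invertJac, invert, FrobType.gform]
  all_goals try field_simp
  all_goals try ring

theorem IsPencilChart.dual_H3
    (h : IsPencilChart (FrobType.domain .H3) (FrobType.eta .H3) (FrobType.mulMat .H3)
      (FrobType.unityIndex .H3) (FrobType.degrees .H3) Ω X τ N φ κ)
    (hα : α ≠ 0) (hu : ∀ x ∈ N, φ x 0 = α * u x) (hu0 : ∀ x ∈ N, u x ≠ 0) :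
    IsPencilChart (FrobType.domain .H3d) (FrobType.eta .H3d) (FrobType.mulMat .H3d)
      (FrobType.unityIndex .H3d) (FrobType.degrees .H3d) Ω (fun x => u x ^ 10 • X x)
      (fun x => -τ x) N (fun x => invert α 5 (φ x)) (κ * (α ^ 2)⁻¹) :=
  h.dual_of (by norm_num) FrobType.isStandard_H3 FrobType.isStandard_H3d rfl hα hu hu0
    fun _ => gform_invert_H3 hα
end

/-! ### Power sums: the metric in the coordinates `xᵢᵐ` -/

/-- The map `x ↦ (xᵢᵐ)`. -/
def powV (m : ℕ) (x : V3) : V3 := fun i => x i ^ m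

theorem analyticAt_coord (i : Fin 3) (x : V3) : AnalyticAt ℂ (fun y : V3 => y i) x :=
  (ContinuousLinearMap.proj (R := ℂ) (φ := fun _ : Fin 3 => ℂ) i).analyticAt x

theorem analyticAt_powV (m : ℕ) (x : V3) : AnalyticAt ℂ (powV m) x :=
  analyticAt_pi_iff.2 fun i => (analyticAt_coord i x).fun_pow m

theorem jac_powV (m : ℕ) (x : V3) : jac (powV m) x = diagonal fun i => (m : ℂ) * x i ^ (m - 1) := by
  ext i j
  simp only [jac, powV, Matrix.of_apply]
  rw [pd_pow (analyticAt_coord i x).differentiableAt, pd_coord, Matrix.diagonal_apply]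
  split_ifs <;> simp

theorem hessian_e1 (m : ℕ) (x : V3) :
    hessian (e1 m) x = diagonal fun i => (m : ℂ) * (m - 1 : ℕ) * x i ^ (m - 2) := by
  ext i j
  simp only [hessian, Matrix.of_apply, e1, Matrix.diagonal_apply]
  fin_cases i <;> fin_cases j <;>
    simp [ev, pderiv_pow, pderiv_X, Pi.single_apply, Derivation.leibniz, Nat.sub_sub] <;> ring

theorem det_hessMetric_e1 {m : ℕ} (hm : 1 < m) {x : V3} (hx : ∀ i, x i ≠ 0) :
    (hessMetric (e1 m) x).det ≠ 0 := by
  have h1 : (m : ℂ) ≠ 0 := by norm_cast; omega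
  have h2 : ((m - 1 : ℕ) : ℂ) ≠ 0 := by norm_cast; omega
  rw [hessMetric, Matrix.det_nonsing_inv, Ring.inverse_eq_inv', hessian_e1, Matrix.det_diagonal]
  refine inv_ne_zero (Finset.prod_ne_zero_iff.2 fun i _ => ?_)
  exact mul_ne_zero (mul_ne_zero h1 h2) (pow_ne_zero _ (hx i))

/-- In w = (xᵢᵐ) the Jacobian factors m xᵢᵐ⁻¹, used twice, meet the inverse second derivative
1/(m(m-1)xᵢᵐ⁻²), leaving m/(m-1) wᵢ. Up to a scalar the metric is the same for all m, which is why
one computation serves all power sums. -/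
theorem powV_metric {m : ℕ} (hm : 1 < m) {x : V3} (hx : ∀ i, x i ≠ 0) :
    jac (powV m) x * hessMetric (e1 m) x * (jac (powV m) x)ᵀ
      = ((m : ℂ) / (m - 1)) • diagonal (powV m x) := by
  obtain ⟨n, rfl⟩ : ∃ n, m = n + 2 := ⟨m - 2, by omega⟩
  have h1 : ((n : ℂ) + 2) ≠ 0 := by norm_cast
  have h2 : ((n : ℂ) + 1) ≠ 0 := by norm_cast
  have hd : (hessian (e1 (n + 2)) x).det ≠ 0 := by
    have := det_hessMetric_e1 hm hx
    rw [hessMetric, Matrix.det_nonsing_inv] at this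
    exact fun h0 => this (by rw [h0]; simp)
  have hinv : hessMetric (e1 (n + 2)) x
      = diagonal fun i => (((n : ℂ) + 2) * (n + 1) * x i ^ n)⁻¹ := by
    refine Matrix.inv_eq_left_inv ?_
    rw [hessian_e1, Matrix.diagonal_mul_diagonal, ← Matrix.diagonal_one]
    congr 1
    funext i
    have := pow_ne_zero n (hx i)
    simp
    field_simp
  rw [hinv, jac_powV, Matrix.diagonal_mul_diagonal, Matrix.diagonal_transpose,
    Matrix.diagonal_mul_diagonal, ← Matrix.diagonal_smul]
  congr 1
  funext i
  have := hx i
  simp [powV]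
  rw [show (n : ℂ) + 2 - 1 = n + 1 by ring]
  field_simp
  ring

theorem powV_det {m : ℕ} (hm : 1 < m) {x : V3} (hx : ∀ i, x i ≠ 0) : (jac (powV m) x).det ≠ 0 := by
  rw [jac_powV, Matrix.det_diagonal]
  refine Finset.prod_ne_zero_iff.2 fun i _ => mul_ne_zero ?_ (pow_ne_zero _ (hx i))
  norm_cast; omega

/-- Multiplying the derivatives by xⱼ replaces the truncated exponent m - 1 by m and makes
logarithmic derivatives easy to insert. -/
theorem hasGrad_powV_of_pd {m : ℕ} (hm : 1 < m) {x : V3} (hx : ∀ i, x i ≠ 0) {h : V3 → ℂ}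
    (ha : AnalyticAt ℂ h x) {c : V3} (hc : ∀ j, x j * pd j h x = m * x j ^ m * c j) :
    HasGrad (powV m) h c x := by
  refine ⟨ha, fun j => ?_⟩
  rw [jac_powV]
  simp only [Matrix.diagonal_apply, mul_ite, mul_zero, Finset.sum_ite_eq', Finset.mem_univ, if_true]
  refine mul_left_cancel₀ (hx j) ((hc j).trans ?_)
  obtain ⟨n, rfl⟩ : ∃ n, m = n + 1 := ⟨m - 1, by omega⟩
  simp only [Nat.add_sub_cancel]
  ring

/-- If `dv = K dw` then the metric transforms by `K`. -/
theorem metric_of_hasGrad {v w : V3 → V3} {K P Ω : Mat3} {x : V3}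
    (h : ∀ i, HasGrad w (fun y => v y i) (K i) x) (hP : jac w x * Ω * (jac w x)ᵀ = P) :
    jac v x * Ω * (jac v x)ᵀ = K * P * Kᵀ := by
  rw [jac_of_hasGrad h, Matrix.transpose_mul, ← hP]
  simp only [mul_assoc]

/-- Components of a coordinate field in another coordinate system. -/
theorem jac_mulVec_coordField {v : V3 → V3} {u : Fin 3 → Poly} {B : Mat3} {k : Fin 3} {x y : V3}
    (hv : (jac v x).det ≠ 0) (h : ∀ a, HasGrad v (ev (u a)) (B a) x) (hB : B.det ≠ 0)
    (hy : B *ᵥ y = Pi.single k 1) : jac v x *ᵥ coordField u k x = y := by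
  have e : polyJac u x = B * jac v x := by
    rw [← jac_ev]; exact jac_of_hasGrad (φ := fun y a => ev (u a) y) h
  rw [coordField_eq, e, Matrix.mul_inv_rev, Matrix.mulVec_mulVec, ← mul_assoc, self_mul_inv_of hv,
    one_mul, ← hy, Matrix.mulVec_mulVec, inv_mul_self_of hB, Matrix.one_mulVec]

/-- Near p the quotient q/q(p) is close to 1 and lies in the slit plane, so its principal logarithm
plus a constant is a holomorphic branch. -/
theorem exists_log {q : V3 → ℂ} (hq : ∀ x, AnalyticAt ℂ q x) {p : V3} (hp : q p ≠ 0) :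
    ∃ (N : Set V3) (s : V3 → ℂ), IsOpen N ∧ p ∈ N ∧ (∀ x ∈ N, AnalyticAt ℂ s x) ∧
      ∀ x ∈ N, Complex.exp (s x) = q x := by
  have hc : Continuous q := continuous_iff_continuousAt.2 fun x => (hq x).continuousAt
  refine ⟨{x | q x / q p ∈ Complex.slitPlane},
    fun x => Complex.log (q x / q p) + Complex.log (q p),
    Complex.isOpen_slitPlane.preimage (hc.div_const _), ?_, fun x hx => ?_, fun x hx => ?_⟩
  · show q p / q p ∈ Complex.slitPlane
    rw [div_self hp]; exact Complex.one_mem_slitPlane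
  · exact (((hq x).div analyticAt_const hp).clog hx).add analyticAt_const
  · have h0 : q x / q p ≠ 0 := Complex.slitPlane_ne_zero hx
    rw [Complex.exp_add, Complex.exp_log h0, Complex.exp_log hp, div_mul_cancel₀ _ hp]

theorem pd_log {q s : V3 → ℂ} {N : Set V3} (hN : IsOpen N) (hs : ∀ x ∈ N, AnalyticAt ℂ s x)
    (he : ∀ x ∈ N, Complex.exp (s x) = q x) {x : V3} (hx : x ∈ N) (j : Fin 3) :
    q x * pd j s x = pd j q x := by
  rw [← he x hx, ← pd_exp (hs x hx).differentiableAt]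
  exact pd_congr (Filter.eventuallyEq_of_mem (hN.mem_nhds hx) he) j

/-! ### Coordinates `(e₁, e₂, log xyz)` -/

/-- `s` is a branch of `log (xyz)` on the open set `N`, where `xᵐ, yᵐ, zᵐ` are distinct. -/
structure SymNhd (m : ℕ) (N : Set V3) (s : V3 → ℂ) : Prop where
  isOpen : IsOpen N
  an : ∀ x ∈ N, AnalyticAt ℂ s x
  exp : ∀ x ∈ N, Complex.exp (s x) = ev xyz x
  ne : ∀ x ∈ N, ev (vdm m) x ≠ 0

/-- The coordinates `(e₁, e₂, log xyz)`. -/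
def symV (m : ℕ) (s : V3 → ℂ) (x : V3) : V3 := ![ev (e1 m) x, ev (e2 m) x, s x]

/-- The metric in the coordinates `(e₁, e₂, log xyz)`, as a function of `e₁, e₂, e₃`. -/
def symP (m : ℕ) (a b c : ℂ) : Mat3 :=
  ((m : ℂ) / (m - 1)) • !![a, 2 * b, 3 / m; 2 * b, a * b + 3 * c, 2 * a / m;
    3 / m, 2 * a / m, b / (c * m ^ 2)]

theorem ev_e1 (m : ℕ) (x : V3) : ev (e1 m) x = x 0 ^ m + x 1 ^ m + x 2 ^ m := by simp [e1]
theorem ev_e2 (m : ℕ) (x : V3) :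
    ev (e2 m) x = x 0 ^ m * x 1 ^ m + x 1 ^ m * x 2 ^ m + x 2 ^ m * x 0 ^ m := by simp [e2]
theorem ev_xyz (x : V3) : ev xyz x = x 0 * x 1 * x 2 := by simp [xyz]
theorem ev_vdm (m : ℕ) (x : V3) : ev (vdm m) x
    = (x 0 ^ m - x 1 ^ m) * (x 2 ^ m - x 0 ^ m) * (x 1 ^ m - x 2 ^ m) := by simp [vdm]

theorem hasGrad_e1 {m : ℕ} (x : V3) :
    HasGrad (powV m) (ev (e1 m)) ![1, 1, 1] x := by
  have h := ((HasGrad.coord (analyticAt_powV m x) 0).add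
    (HasGrad.coord (analyticAt_powV m x) 1)).add (HasGrad.coord (analyticAt_powV m x) 2)
  refine (h.congr (Filter.Eventually.of_forall fun y => (ev_e1 m y).symm)).congr_grad ?_
  ext j; fin_cases j <;> simp

theorem hasGrad_e2 {m : ℕ} (x : V3) :
    HasGrad (powV m) (ev (e2 m)) ![x 1 ^ m + x 2 ^ m, x 0 ^ m + x 2 ^ m, x 0 ^ m + x 1 ^ m] x := by
  have c := HasGrad.coord (analyticAt_powV m x)
  have h := (((c 0).mul (c 1)).add ((c 1).mul (c 2))).add ((c 2).mul (c 0))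
  refine (h.congr (Filter.Eventually.of_forall fun y => (ev_e2 m y).symm)).congr_grad ?_
  ext j; fin_cases j <;> simp [powV] <;> ring

namespace SymNhd
variable {m : ℕ} {N : Set V3} {s : V3 → ℂ} (h : SymNhd m N s) (hm : 1 < m) {x : V3} (hx : x ∈ N)
include h hx

theorem ne_zero (i : Fin 3) : x i ≠ 0 := by
  have h1 : ev xyz x ≠ 0 := by rw [← h.exp x hx]; exact Complex.exp_ne_zero _
  rw [ev_xyz] at h1
  fin_cases i
  · exact left_ne_zero_of_mul (left_ne_zero_of_mul h1)
  · exact right_ne_zero_of_mul (left_ne_zero_of_mul h1)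
  · exact right_ne_zero_of_mul h1

theorem exp_nsmul (n : ℕ) : Complex.exp (n * s x) = ev xyz x ^ n := by
  rw [Complex.exp_nat_mul, h.exp x hx]

theorem exp_m : Complex.exp (m * s x) = x 0 ^ m * x 1 ^ m * x 2 ^ m := by
  rw [h.exp_nsmul hx, ev_xyz, mul_pow, mul_pow]

include hm

theorem hasGrad_log : HasGrad (powV m) s
    ![1 / (m * x 0 ^ m), 1 / (m * x 1 ^ m), 1 / (m * x 2 ^ m)] x := by
  have hm0 : (m : ℂ) ≠ 0 := by norm_cast; omega
  have hne := fun i => h.ne_zero hx i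
  have hpow := fun i => pow_ne_zero m (hne i)
  refine hasGrad_powV_of_pd hm hne (h.an x hx) fun j => ?_
  have h1 := pd_log h.isOpen h.an h.exp hx j
  rw [pd_ev, ev_xyz] at h1
  have h2 : x j * ev (pderiv j xyz) x = x 0 * x 1 * x 2 := by
    fin_cases j <;> simp [xyz, ev, pderiv_X, Pi.single_apply, Derivation.leibniz] <;> ring
  have h3 : x j * pd j s x = 1 := by
    have h4 : x 0 * x 1 * x 2 ≠ 0 := mul_ne_zero (mul_ne_zero (hne 0) (hne 1)) (hne 2)
    apply mul_left_cancel₀ h4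
    linear_combination x j * h1 + h2
  rw [h3]
  have h0 := hpow 0
  have h1 := hpow 1
  have h2 := hpow 2
  fin_cases j <;> simp <;> field_simp

/-- Jacobian of `(e₁, e₂, log xyz)` relative to `(xᵐ, yᵐ, zᵐ)`. -/
theorem hasGrad_symV (i : Fin 3) : HasGrad (powV m) (fun y => symV m s y i)
    ((!![1, 1, 1; x 1 ^ m + x 2 ^ m, x 0 ^ m + x 2 ^ m, x 0 ^ m + x 1 ^ m;
      1 / (m * x 0 ^ m), 1 / (m * x 1 ^ m), 1 / (m * x 2 ^ m)] : Mat3) i) x := by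
  fin_cases i
  · exact hasGrad_e1 x
  · exact hasGrad_e2 x
  · exact h.hasGrad_log hm hx

theorem an_symV : AnalyticAt ℂ (symV m s) x := analyticAt_of_hasGrad (h.hasGrad_symV hm hx)

/-- Relative to the xᵢᵐ, the Jacobian determinant multiplied by m(xyz)ᵐ is minus the Vandermonde
product; this is nonzero on a `SymNhd`. -/
theorem det_symV : (jac (symV m s) x).det ≠ 0 := by
  have hm0 : (m : ℂ) ≠ 0 := by norm_cast; omega
  have hne := fun i => h.ne_zero hx i
  have h0 := pow_ne_zero m (hne 0)
  have h1 := pow_ne_zero m (hne 1)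
  have h2 := pow_ne_zero m (hne 2)
  rw [jac_of_hasGrad (h.hasGrad_symV hm hx), Matrix.det_mul]
  refine mul_ne_zero ?_ (powV_det hm hne)
  have hv := h.ne x hx
  rw [ev_vdm] at hv
  have e : (!![1, 1, 1; x 1 ^ m + x 2 ^ m, x 0 ^ m + x 2 ^ m, x 0 ^ m + x 1 ^ m;
      1 / (m * x 0 ^ m), 1 / (m * x 1 ^ m), 1 / (m * x 2 ^ m)] : Mat3).det
      * (m * x 0 ^ m * x 1 ^ m * x 2 ^ m)
      = -((x 0 ^ m - x 1 ^ m) * (x 2 ^ m - x 0 ^ m) * (x 1 ^ m - x 2 ^ m)) := by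
    rw [Matrix.det_fin_three]
    simp
    field_simp
    ring
  intro h0
  rw [h0, zero_mul, eq_comm, neg_eq_zero] at e
  exact hv e

theorem metric_symV : jac (symV m s) x * hessMetric (e1 m) x * (jac (symV m s) x)ᵀ
    = symP m (ev (e1 m) x) (ev (e2 m) x) (Complex.exp (m * s x)) := by
  have hm0 : (m : ℂ) ≠ 0 := by norm_cast; omega
  have hne := fun i => h.ne_zero hx i
  have h0 := pow_ne_zero m (hne 0)
  have h1 := pow_ne_zero m (hne 1)
  have h2 := pow_ne_zero m (hne 2)
  rw [metric_of_hasGrad (h.hasGrad_symV hm hx) (powV_metric hm hne), Matrix.mul_smul,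
    Matrix.smul_mul, symP, h.exp_m hx, ev_e1, ev_e2]
  congr 1
  ext i j
  rw [Matrix.mul_apply]
  simp only [Matrix.mul_diagonal, Fin.sum_univ_three, Matrix.transpose_apply]
  fin_cases i <;> fin_cases j <;> simp [powV]
  all_goals try field_simp
  all_goals try ring

theorem hasGrad_coord (i : Fin 3) :
    HasGrad (symV m s) (fun y => symV m s y i) (Pi.single i 1) x :=
  HasGrad.coord (h.an_symV hm hx) i

theorem hasGrad_sym_e1 : HasGrad (symV m s) (ev (e1 m)) (Pi.single 0 1) x :=
  h.hasGrad_coord hm hx 0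

theorem hasGrad_sym_e2 : HasGrad (symV m s) (ev (e2 m)) (Pi.single 1 1) x :=
  h.hasGrad_coord hm hx 1

theorem hasGrad_sym_log : HasGrad (symV m s) s (Pi.single 2 1) x :=
  h.hasGrad_coord hm hx 2

theorem hasGrad_xyz_pow (n : ℕ) :
    HasGrad (symV m s) (ev (xyz ^ n)) (Pi.single 2 (n * ev xyz x ^ n)) x := by
  have h1 := ((h.hasGrad_sym_log hm hx).const_mul n).exp
  refine (h1.congr (Filter.eventuallyEq_of_mem (h.isOpen.mem_nhds hx) fun y hy => ?_)).congr_grad ?_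
  · simp [h.exp_nsmul hy]
  · rw [h.exp_nsmul hx]
    ext j; fin_cases j <;> simp <;> ring

end SymNhd

theorem exists_symNhd (m : ℕ) {p : V3} (h1 : ev xyz p ≠ 0) (h2 : ev (vdm m) p ≠ 0) {D : Poly}
    (hD : ev D p ≠ 0) :
    ∃ N s, SymNhd m N s ∧ p ∈ N ∧ ∀ x ∈ N, ev D x ≠ 0 := by
  obtain ⟨N, s, hN, hpN, hs, he⟩ := exists_log (analyticAt_ev xyz) h1
  have ho : ∀ q : Poly, IsOpen {x | ev q x ≠ 0} := fun q =>
    isOpen_ne_fun (continuous_ev q) continuous_const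
  exact ⟨N ∩ {x | ev (vdm m) x ≠ 0} ∩ {x | ev D x ≠ 0}, s,
    ⟨(hN.inter (ho _)).inter (ho _), fun x hx => hs x hx.1.1, fun x hx => he x hx.1.1,
      fun x hx => hx.1.2⟩, ⟨⟨hpN, h2⟩, hD⟩, fun x hx => hx.2⟩

/-! ### Flat coordinates for power sums -/

/-- Flat coordinates of type `A₃`. -/
def flatA3 (m : ℕ) (ρ : ℂ) (s : V3 → ℂ) (x : V3) : V3 :=
  ![1 / 2 * ρ ^ 2 * ev (e1 m) x, 2 * ρ ^ 3 * Complex.exp (m / 2 * s x),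
    ρ ^ 4 * (ev (e2 m) x - 1 / 8 * ev (e1 m) x ^ 2)]

/-- Flat coordinates of type `B₃`. -/
def flatB3 (m : ℕ) (α : ℂ) (s : V3 → ℂ) (x : V3) : V3 :=
  ![α * ev (e1 m) x, 3 / 2 * α ^ 2 * (ev (e1 m) x ^ 2 - 4 * ev (e2 m) x),
    7 / 216 * ev (e1 m) x ^ 3 - 1 / 6 * (ev (e2 m) x * ev (e1 m) x) + Complex.exp (m * s x)]

/-- Flat coordinates of type `B₃¹`. -/
def flatB31 (m : ℕ) (ρ : ℂ) (s : V3 → ℂ) (x : V3) : V3 :=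
  ![ρ ^ 4 * ev (e1 m) x, ρ ^ 5 * (ev (e2 m) x * Complex.exp (-(m / 4) * s x)),
    ρ ^ 3 * Complex.exp (m / 4 * s x)]

namespace SymNhd
variable {m : ℕ} {N : Set V3} {s : V3 → ℂ} (h : SymNhd m N s) (hm : 1 < m) {X : V3 → V3}
  {τ : V3 → ℂ}
include h hm

/-- The powers ρ², ρ³, ρ⁴ are proportional to the degrees 1/2, 3/4, 1 of A₃, so ρ acts by the flow
of the Euler field and merely rescales the unity field. This freedom covers invariants a·e₂ with any
a = ρ⁴ ≠ 0. The second coordinate is a square root of e₃ = (xyz)ᵐ, written with the logarithm. -/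
theorem chart_A3 {ρ : ℂ} (hρ : ρ ≠ 0)
    (hX : ∀ x ∈ N, jac (symV m s) x *ᵥ X x = Pi.single 1 (ρ ^ 4)⁻¹)
    (hτ : ∀ x ∈ N, τ x = ((m : ℂ) - 1) / (2 * m) * ev (e1 m) x) :
    IsTypeChart .A3 (e1 m) X τ N (flatA3 m ρ s) (m / (m - 1) * ρ ^ 2) := by
  have hm0 : (m : ℂ) ≠ 0 := by norm_cast; omega
  have hm1 : (m : ℂ) - 1 ≠ 0 := by
    rw [sub_ne_zero]; norm_cast; omega
  have hφ : ∀ x ∈ N, ∀ i, HasGrad (symV m s) (fun y => flatA3 m ρ s y i)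
      ((!![1 / 2 * ρ ^ 2, 0, 0; 0, 0, ρ ^ 3 * m * Complex.exp (m / 2 * s x);
        -(ρ ^ 4 * ev (e1 m) x / 4), ρ ^ 4, 0] : Mat3) i) x := fun x hx i => by
    have c0 := h.hasGrad_sym_e1 hm hx
    have c1 := h.hasGrad_sym_e2 hm hx
    have c2 := h.hasGrad_sym_log hm hx
    fin_cases i
    · refine (c0.const_mul _).congr_grad ?_
      ext j; fin_cases j <;> simp
    · refine (((c2.const_mul _).exp).const_mul _).congr_grad ?_
      ext j; fin_cases j <;> simp
      ring
    · refine ((c1.sub ((c0.pow 2).const_mul _)).const_mul _).congr_grad ?_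
      ext j; fin_cases j <;> simp
      ring
  have hτ' := pd_eq_of_eq_coord (τ := τ) (φ := flatA3 m ρ s)
    (c := (m / (m - 1) * ρ ^ 2)⁻¹ * FrobType.A3.eta 0 FrobType.A3.unityIndex) h.isOpen
    (fun x hx => analyticAt_of_hasGrad (hφ x hx)) fun x hx => by
      rw [hτ x hx]
      simp [flatA3, FrobType.eta, FrobType.unityIndex]
      field_simp
  refine isPencilChart_of_grad h.isOpen (mul_ne_zero (div_ne_zero hm0 hm1) (pow_ne_zero _ hρ))
    (fun x hx => det_hessMetric_e1 hm fun i => h.ne_zero hx i)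
    (fun x hx => h.det_symV hm hx) (fun x hx => h.metric_symV hm hx) hX hφ
    (fun x hx => trivial) (fun x hx => ?_) (fun x hx => ?_) (fun x hx => ?_) hτ'.1 hτ'.2
  · rw [Matrix.det_fin_three]
    simp [hρ, hm0, Complex.exp_ne_zero]
  · have hE : Complex.exp (m * s x) = Complex.exp (m / 2 * s x) ^ 2 := by
      rw [← Complex.exp_nat_mul]; congr 1; push_cast; ring
    have hE0 := Complex.exp_ne_zero (m / 2 * s x)
    rw [hE]
    ext i j
    fin_cases i <;> fin_cases j <;>
      simp [Matrix.mul_apply, Fin.sum_univ_three, symP, FrobType.gform, flatA3]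
    all_goals try field_simp
    all_goals try ring
  · ext i
    fin_cases i <;> simp [Matrix.mulVec, dotProduct, Fin.sum_univ_three, FrobType.unityIndex, hρ]

/-- The (0,0) entry fixes κ = 3α·m/(m-1). Comparing the coefficient of e₃ in the (1,1) entry then
gives 108α⁴ = 3α, whence α³ = 1/36. -/
theorem chart_B3 {α : ℂ} (hα : α ^ 3 = 1 / 36)
    (hX : ∀ x ∈ N, jac (symV m s) x *ᵥ X x = Pi.single 2 (m * Complex.exp (m * s x))⁻¹)
    (hτ : ∀ x ∈ N, τ x = ((m : ℂ) - 1) / (3 * m) * ev (e1 m) x) :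
    IsTypeChart .B3 (e1 m) X τ N (flatB3 m α s) (3 * (m / (m - 1)) * α) := by
  have hm0 : (m : ℂ) ≠ 0 := by norm_cast; omega
  have hm1 : (m : ℂ) - 1 ≠ 0 := by
    rw [sub_ne_zero]; norm_cast; omega
  have hα0 : α ≠ 0 := by rintro rfl; norm_num at hα
  have hφ : ∀ x ∈ N, ∀ i, HasGrad (symV m s) (fun y => flatB3 m α s y i)
      ((!![α, 0, 0; 3 * α ^ 2 * ev (e1 m) x, -(6 * α ^ 2), 0;
        7 / 72 * ev (e1 m) x ^ 2 - 1 / 6 * ev (e2 m) x, -(1 / 6 * ev (e1 m) x),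
        m * Complex.exp (m * s x)] : Mat3) i) x := fun x hx i => by
    have c0 := h.hasGrad_sym_e1 hm hx
    have c1 := h.hasGrad_sym_e2 hm hx
    have c2 := h.hasGrad_sym_log hm hx
    fin_cases i
    · refine (c0.const_mul _).congr_grad ?_
      ext j; fin_cases j <;> simp
    · refine (((c0.pow 2).sub (c1.const_mul _)).const_mul _).congr_grad ?_
      ext j; fin_cases j <;> simp <;> ring
    · refine ((((c0.pow 3).const_mul _).sub ((c1.mul c0).const_mul _)).add
        ((c2.const_mul _).exp)).congr_grad ?_
      ext j; fin_cases j <;> simp <;> ring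
  have hτ' := pd_eq_of_eq_coord (τ := τ) (φ := flatB3 m α s)
    (c := (3 * (m / (m - 1)) * α)⁻¹ * FrobType.B3.eta 0 FrobType.B3.unityIndex) h.isOpen
    (fun x hx => analyticAt_of_hasGrad (hφ x hx)) fun x hx => by
      rw [hτ x hx]
      simp [flatB3, FrobType.eta, FrobType.unityIndex]
      field_simp
  refine isPencilChart_of_grad h.isOpen
    (mul_ne_zero (mul_ne_zero three_ne_zero (div_ne_zero hm0 hm1)) hα0)
    (fun x hx => det_hessMetric_e1 hm fun i => h.ne_zero hx i)
    (fun x hx => h.det_symV hm hx) (fun x hx => h.metric_symV hm hx) hX hφ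
    (fun x hx => trivial) (fun x hx => ?_) (fun x hx => ?_) (fun x hx => ?_) hτ'.1 hτ'.2
  · rw [Matrix.det_fin_three]
    simp [hα0, hm0, Complex.exp_ne_zero]
  · have hE0 := Complex.exp_ne_zero (m * s x)
    ext i j
    fin_cases i <;> fin_cases j <;>
      simp [Matrix.mul_apply, Fin.sum_univ_three, symP, FrobType.gform, flatB3]
    all_goals try field_simp
    all_goals try grind
  · ext i
    fin_cases i <;> simp [Matrix.mulVec, dotProduct, Fin.sum_univ_three, FrobType.unityIndex]
    have := Complex.exp_ne_zero (m * s x)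
    field_simp

/-- The exponents 4, 5, 3 of ρ are four times the degrees 1, 5/4, 3/4, so ρ again only rescales the
unity field. The third coordinate is a fourth root of e₃ and never vanishes, as the domain of B₃¹
requires. -/
theorem chart_B31 {ρ : ℂ} (hρ : ρ ≠ 0)
    (hX : ∀ x ∈ N, jac (symV m s) x *ᵥ X x = Pi.single 0 (ρ ^ 4)⁻¹)
    (hτ : ∀ x ∈ N, τ x = ((m : ℂ) - 1) / m * ev (e1 m) x) :
    IsTypeChart .B31 (e1 m) X τ N (flatB31 m ρ s) (3 / 4 * (m / (m - 1)) * ρ ^ 4) := by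
  have hm0 : (m : ℂ) ≠ 0 := by norm_cast; omega
  have hm1 : (m : ℂ) - 1 ≠ 0 := by
    rw [sub_ne_zero]; norm_cast; omega
  have hneg : ∀ x, Complex.exp (-(m / 4) * s x) = (Complex.exp (m / 4 * s x))⁻¹ := fun x => by
    rw [neg_mul, Complex.exp_neg]
  have hφ : ∀ x ∈ N, ∀ i, HasGrad (symV m s) (fun y => flatB31 m ρ s y i)
      ((!![ρ ^ 4, 0, 0; 0, ρ ^ 5 / Complex.exp (m / 4 * s x),
          -(ρ ^ 5 * ev (e2 m) x * (m / 4) / Complex.exp (m / 4 * s x));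
        0, 0, ρ ^ 3 * (m / 4) * Complex.exp (m / 4 * s x)] : Mat3) i) x := fun x hx i => by
    have c0 := h.hasGrad_sym_e1 hm hx
    have c1 := h.hasGrad_sym_e2 hm hx
    have c2 := h.hasGrad_sym_log hm hx
    fin_cases i
    · refine (c0.const_mul _).congr_grad ?_
      ext j; fin_cases j <;> simp
    · refine ((c1.mul (c2.const_mul _).exp).const_mul _).congr_grad ?_
      ext j; fin_cases j <;> simp only [hneg] <;> simp <;> ring
    · refine (((c2.const_mul _).exp).const_mul _).congr_grad ?_
      ext j; fin_cases j <;> simp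
      ring
  have hτ' := pd_eq_of_eq_coord (τ := τ) (φ := flatB31 m ρ s)
    (c := (3 / 4 * (m / (m - 1)) * ρ ^ 4)⁻¹ * FrobType.B31.eta 0 FrobType.B31.unityIndex) h.isOpen
    (fun x hx => analyticAt_of_hasGrad (hφ x hx)) fun x hx => by
      rw [hτ x hx]
      simp [flatB31, FrobType.eta, FrobType.unityIndex]
      field_simp
  refine isPencilChart_of_grad h.isOpen
    (mul_ne_zero (mul_ne_zero (by norm_num) (div_ne_zero hm0 hm1)) (pow_ne_zero _ hρ))
    (fun x hx => det_hessMetric_e1 hm fun i => h.ne_zero hx i)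
    (fun x hx => h.det_symV hm hx) (fun x hx => h.metric_symV hm hx) hX hφ
    (fun x hx => ?_) (fun x hx => ?_) (fun x hx => ?_) (fun x hx => ?_) hτ'.1 hτ'.2
  · show flatB31 m ρ s x 2 ≠ 0
    simp [flatB31, hρ, Complex.exp_ne_zero]
  · rw [Matrix.det_fin_three]
    simp [hρ, hm0, Complex.exp_ne_zero]
  · have hE : Complex.exp (m * s x) = Complex.exp (m / 4 * s x) ^ 4 := by
      rw [← Complex.exp_nat_mul]; congr 1; push_cast; ring
    have hE0 := Complex.exp_ne_zero (m / 4 * s x)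
    rw [hE]
    ext i j
    fin_cases i <;> fin_cases j <;>
      simp [Matrix.mul_apply, Fin.sum_univ_three, symP, FrobType.gform, flatB31, ← neg_mul, hneg]
    all_goals try field_simp
    all_goals try ring
  · ext i
    fin_cases i <;> simp [Matrix.mulVec, dotProduct, Fin.sum_univ_three, FrobType.unityIndex, hρ]

end SymNhd

/-! ### Coordinates `(e₁, zᵐ, log xy)` -/

/-- `s` is a branch of `log (xy)` on the open set `N`, where `z ≠ 0` and `xᵐ ≠ yᵐ`. -/
structure PairNhd (m : ℕ) (N : Set V3) (s : V3 → ℂ) : Prop where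
  isOpen : IsOpen N
  an : ∀ x ∈ N, AnalyticAt ℂ s x
  exp : ∀ x ∈ N, Complex.exp (s x) = ev (X 0 * X 1) x
  ne : ∀ x ∈ N, ev (X 2 * (X 0 ^ m - X 1 ^ m)) x ≠ 0

/-- The coordinates `(e₁, zᵐ, log xy)`. -/
def pairV (m : ℕ) (s : V3 → ℂ) (x : V3) : V3 := ![ev (e1 m) x, x 2 ^ m, s x]

/-- Flat coordinates of type `T₃`. -/
def flatT3 (m : ℕ) (k : ℂ) (s : V3 → ℂ) (x : V3) : V3 :=
  ![(2 * k)⁻¹ * ev (e1 m) x, k⁻¹ * x 2 ^ m, k⁻¹ * Complex.exp (m / 2 * s x)]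

namespace PairNhd
variable {m : ℕ} {N : Set V3} {s : V3 → ℂ} (h : PairNhd m N s) (hm : 1 < m) {x : V3} (hx : x ∈ N)
include h hx

theorem ne_zero (i : Fin 3) : x i ≠ 0 := by
  have h1 : ev (X 0 * X 1) x ≠ 0 := by rw [← h.exp x hx]; exact Complex.exp_ne_zero _
  have h2 := h.ne x hx
  simp only [ev_mul, ev_X] at h1 h2
  fin_cases i
  · exact left_ne_zero_of_mul h1
  · exact right_ne_zero_of_mul h1
  · exact left_ne_zero_of_mul h2

theorem exp_nsmul (n : ℕ) : Complex.exp (n * s x) = (x 0 * x 1) ^ n := by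
  rw [Complex.exp_nat_mul, h.exp x hx]; simp

include hm

theorem hasGrad_log : HasGrad (powV m) s ![1 / (m * x 0 ^ m), 1 / (m * x 1 ^ m), 0] x := by
  have hm0 : (m : ℂ) ≠ 0 := by norm_cast; omega
  have hne := fun i => h.ne_zero hx i
  have hpow := fun i => pow_ne_zero m (hne i)
  refine hasGrad_powV_of_pd hm hne (h.an x hx) fun j => ?_
  have h1 := pd_log h.isOpen h.an h.exp hx j
  rw [pd_ev] at h1
  have h4 : x 0 * x 1 ≠ 0 := mul_ne_zero (hne 0) (hne 1)
  have h0 := hpow 0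
  have h2 := hpow 1
  have n0 := hne 0
  have n1 := hne 1
  fin_cases j <;> simp [ev, pderiv_X, Pi.single_apply, Derivation.leibniz] at h1 ⊢
  · field_simp
    exact mul_left_cancel₀ n1 (by linear_combination h1)
  · field_simp
    exact mul_left_cancel₀ n0 (by linear_combination h1)
  · exact Or.inr (h1.resolve_left (by simp [hne]))

theorem hasGrad_pairV (i : Fin 3) : HasGrad (powV m) (fun y => pairV m s y i)
    ((!![1, 1, 1; 0, 0, 1; 1 / (m * x 0 ^ m), 1 / (m * x 1 ^ m), 0] : Mat3) i) x := by
  fin_cases i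
  · exact hasGrad_e1 x
  · refine (HasGrad.coord (analyticAt_powV m x) 2).congr_grad ?_
    ext j; fin_cases j <;> simp
  · exact h.hasGrad_log hm hx

theorem an_pairV : AnalyticAt ℂ (pairV m s) x := analyticAt_of_hasGrad (h.hasGrad_pairV hm hx)

theorem det_pairV : (jac (pairV m s) x).det ≠ 0 := by
  have hm0 : (m : ℂ) ≠ 0 := by norm_cast; omega
  have hne := fun i => h.ne_zero hx i
  have h0 := pow_ne_zero m (hne 0)
  have h1 := pow_ne_zero m (hne 1)
  rw [jac_of_hasGrad (h.hasGrad_pairV hm hx), Matrix.det_mul]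
  refine mul_ne_zero ?_ (powV_det hm hne)
  have hv := h.ne x hx
  simp only [ev_mul, ev_X, ev_sub, ev_pow] at hv
  have hv := right_ne_zero_of_mul hv
  have e : (!![1, 1, 1; 0, 0, 1; 1 / (m * x 0 ^ m), 1 / (m * x 1 ^ m), 0] : Mat3).det
      * (m * x 0 ^ m * x 1 ^ m) = -(x 0 ^ m - x 1 ^ m) := by
    rw [Matrix.det_fin_three]
    simp
    field_simp
    ring
  intro h0
  rw [h0, zero_mul, eq_comm, neg_eq_zero] at e
  exact hv e

theorem metric_pairV : jac (pairV m s) x * hessMetric (e1 m) x * (jac (pairV m s) x)ᵀ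
    = ((m : ℂ) / (m - 1)) • !![ev (e1 m) x, x 2 ^ m, 2 / m; x 2 ^ m, x 2 ^ m, 0;
      2 / m, 0, (ev (e1 m) x - x 2 ^ m) / (Complex.exp (m * s x) * m ^ 2)] := by
  have hm0 : (m : ℂ) ≠ 0 := by norm_cast; omega
  have hne := fun i => h.ne_zero hx i
  have h0 := pow_ne_zero m (hne 0)
  have h1 := pow_ne_zero m (hne 1)
  rw [metric_of_hasGrad (h.hasGrad_pairV hm hx) (powV_metric hm hne), Matrix.mul_smul,
    Matrix.smul_mul, h.exp_nsmul hx, ev_e1, mul_pow]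
  congr 1
  ext i j
  rw [Matrix.mul_apply]
  simp only [Matrix.mul_diagonal, Fin.sum_univ_three, Matrix.transpose_apply]
  fin_cases i <;> fin_cases j <;> simp [powV]
  all_goals try field_simp
  all_goals try ring

-- The power sum splits off zᵐ, and the remaining block depends on xᵐ + yᵐ and log xy only. All
-- degrees of T₃ equal 1, so a unity field rescaled by k divides all three flat coordinates by k.
omit hx in
theorem chart_T3 {Y : V3 → V3} {τ : V3 → ℂ} {k : ℂ} (hk : k ≠ 0)
    (hX : ∀ x ∈ N, jac (pairV m s) x *ᵥ Y x = Pi.single 1 k)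
    (hτ : ∀ x ∈ N, τ x = ((m : ℂ) - 1) / m * ev (e1 m) x) :
    IsTypeChart .T3 (e1 m) Y τ N (flatT3 m k s) (m / (m - 1) / (2 * k)) := by
  have hm0 : (m : ℂ) ≠ 0 := by norm_cast; omega
  have hm1 : (m : ℂ) - 1 ≠ 0 := by
    rw [sub_ne_zero]; norm_cast; omega
  have hφ : ∀ x ∈ N, ∀ i, HasGrad (pairV m s) (fun y => flatT3 m k s y i)
      ((!![(2 * k)⁻¹, 0, 0; 0, k⁻¹, 0; 0, 0, k⁻¹ * (m / 2) * Complex.exp (m / 2 * s x)] : Mat3) i)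
      x := fun x hx i => by
    have c := HasGrad.coord (h.an_pairV hm hx)
    fin_cases i
    · refine ((c 0).const_mul _).congr_grad ?_
      ext j; fin_cases j <;> simp
    · refine ((c 1).const_mul _).congr_grad ?_
      ext j; fin_cases j <;> simp
    · refine ((((c 2).const_mul _).exp).const_mul _).congr_grad ?_
      ext j; fin_cases j <;> simp [pairV]
      ring
  have hτ' := pd_eq_of_eq_coord (τ := τ) (φ := flatT3 m k s)
    (c := (m / (m - 1) / (2 * k))⁻¹ * FrobType.T3.eta 0 FrobType.T3.unityIndex) h.isOpen
    (fun x hx => analyticAt_of_hasGrad (hφ x hx)) fun x hx => by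
      rw [hτ x hx]
      simp [flatT3, FrobType.eta, FrobType.unityIndex]
      field_simp
  refine isPencilChart_of_grad h.isOpen
    (div_ne_zero (div_ne_zero hm0 hm1) (mul_ne_zero two_ne_zero hk))
    (fun x hx => det_hessMetric_e1 hm fun i => h.ne_zero hx i)
    (fun x hx => h.det_pairV hm hx) (fun x hx => h.metric_pairV hm hx) hX hφ
    (fun x hx => trivial) (fun x hx => ?_) (fun x hx => ?_) (fun x hx => ?_) hτ'.1 hτ'.2
  · rw [Matrix.det_fin_three]
    simp [hk, hm0, Complex.exp_ne_zero]
  · have hE : Complex.exp (m * s x) = Complex.exp (m / 2 * s x) ^ 2 := by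
      rw [← Complex.exp_nat_mul]; congr 1; push_cast; ring
    have hE0 := Complex.exp_ne_zero (m / 2 * s x)
    rw [hE]
    ext i j
    fin_cases i <;> fin_cases j <;>
      simp [Matrix.mul_apply, Fin.sum_univ_three, FrobType.gform, flatT3]
    all_goals try field_simp
  · ext i
    fin_cases i <;> simp [Matrix.mulVec, dotProduct, Fin.sum_univ_three, FrobType.unityIndex, hk]

end PairNhd

theorem exists_pairNhd (m : ℕ) {p : V3} (hp : ev (X 0 * X 1 * (X 2 * (X 0 ^ m - X 1 ^ m))) p ≠ 0) :
    ∃ N s, PairNhd m N s ∧ p ∈ N := by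
  rw [ev_mul] at hp
  obtain ⟨N, s, hN, hpN, hs, he⟩ := exists_log (analyticAt_ev _) (left_ne_zero_of_mul hp)
  exact ⟨N ∩ {x | ev (X 2 * (X 0 ^ m - X 1 ^ m)) x ≠ 0}, s,
    ⟨hN.inter (isOpen_ne_fun (continuous_ev _) continuous_const), fun x hx => hs x hx.1,
      fun x hx => he x hx.1, fun x hx => hx.2⟩, hpN, right_ne_zero_of_mul hp⟩

/-! ### Structures for power sums -/

theorem ne_zero_of_ev {p : Poly} {x : V3} (h : ev p x ≠ 0) : p ≠ 0 := by
  rintro rfl; simp at h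

theorem xyz_ne_zero : xyz ≠ 0 := ne_zero_of_ev (x := fun _ => 1) (by simp [ev_xyz])

theorem e1_ne_zero (m : ℕ) (hm : m ≠ 0) : e1 m ≠ 0 :=
  ne_zero_of_ev (x := ![1, 0, 0]) (by simp [ev_e1, hm])

theorem vdm_ne_zero (m : ℕ) (hm : m ≠ 0) : vdm m ≠ 0 := by
  refine mul_ne_zero (mul_ne_zero ?_ ?_) ?_
  · exact ne_zero_of_ev (x := ![1, 0, 0]) (by simp [hm])
  · exact ne_zero_of_ev (x := ![0, 0, 1]) (by simp [hm])
  · exact ne_zero_of_ev (x := ![0, 1, 0]) (by simp [hm])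

section
variable {G : Subgroup SL3} (hG : (G : Set SL3).Finite) {m : ℕ} (hm : 1 < m)
  (hmin : IsMinimalDegreeInvariant G (e1 m))
  {Y : V3 → V3} {τ : V3 → ℂ} {T : FrobType}
  (hX : ∀ g ∈ G, ∀ x, Y (g.1 *ᵥ x) = g.1 *ᵥ Y x) (hτ : ∀ g ∈ G, ∀ x, τ (g.1 *ᵥ x) = τ x)
include hG hm hmin hX hτ

/-- The factor e₁ in the polynomial D is there for the dual structures, whose field and inversion
degenerate where u₁ = 0. -/
theorem yields_of_symNhd
    (hc : ∀ N s, SymNhd m N s → (∀ x ∈ N, ev (e1 m) x ≠ 0) → ∃ φ κ, IsTypeChart T (e1 m) Y τ N φ κ) :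
    Yields G (e1 m) Y τ T := by
  refine yields_of_charts hG hmin (D := xyz * vdm m * e1 m)
    (mul_ne_zero (mul_ne_zero xyz_ne_zero (vdm_ne_zero m (by omega))) (e1_ne_zero m (by omega)))
    hX hτ fun p hp => ?_
  simp only [ev_mul] at hp
  obtain ⟨N, s, hs, hpN, hD⟩ := exists_symNhd m (left_ne_zero_of_mul (left_ne_zero_of_mul hp))
    (right_ne_zero_of_mul (left_ne_zero_of_mul hp)) (right_ne_zero_of_mul hp)
  obtain ⟨φ, κ, h⟩ := hc N s hs hD
  exact ⟨N, φ, κ, hpN, h⟩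

theorem yieldsFlat_of_symNhd {t : V3 → V3}
    (hc : ∀ N s, SymNhd m N s → ∃ φ κ, IsTypeChart T (e1 m) Y τ N φ κ ∧
      ∃ L : Mat3, L.det ≠ 0 ∧ ∀ x ∈ N, t x = L *ᵥ φ x) :
    YieldsFlat G (e1 m) Y τ T t := by
  refine yieldsFlat_of_charts hG hmin (D := xyz * vdm m)
    (mul_ne_zero xyz_ne_zero (vdm_ne_zero m (by omega))) hX hτ fun p hp => ?_
  have hp' := hp
  rw [ev_mul] at hp
  obtain ⟨N, s, hs, hpN, hD⟩ := exists_symNhd m (left_ne_zero_of_mul hp)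
    (right_ne_zero_of_mul hp) hp'
  obtain ⟨φ, κ, h, L, hL⟩ := hc N s hs
  exact ⟨N, φ, κ, hpN, h, L, hL⟩

theorem yieldsFlatLog_of_symNhd {b : Poly} {n : ℕ} (hb : ∀ x, ev b x = ev xyz x ^ n)
    {t : V3 → ℂ → V3}
    (hc : ∀ N s, SymNhd m N s → ∃ φ κ, IsTypeChart T (e1 m) Y τ N φ κ ∧
      ∃ L : Mat3, L.det ≠ 0 ∧ ∀ x ∈ N, t x (n * s x) = L *ᵥ φ x) :
    YieldsFlatLog G (e1 m) Y τ T b t := by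
  refine yieldsFlatLog_of_charts hG hmin (D := xyz * vdm m)
    (mul_ne_zero xyz_ne_zero (vdm_ne_zero m (by omega))) hX hτ fun p hp => ?_
  have hp' := hp
  rw [ev_mul] at hp
  obtain ⟨N, s, hs, hpN, hD⟩ := exists_symNhd m (left_ne_zero_of_mul hp)
    (right_ne_zero_of_mul hp) hp'
  obtain ⟨φ, κ, h, L, hL, ht⟩ := hc N s hs
  exact ⟨N, φ, κ, hpN, h, L, fun x => n * s x, hL, fun x hx => analyticAt_const.mul (hs.an x hx),
    fun x hx => by rw [hs.exp_nsmul hx, hb], ht⟩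

end

/-- Equivariance of coordinate fields of invariants. -/
theorem coordField_invariant {G : Subgroup SL3} {u : Fin 3 → Poly}
    (hu : ∀ a, u a ∈ invariantRing G) (k : Fin 3) :
    ∀ g ∈ G, ∀ x, coordField u k (g.1 *ᵥ x) = g.1 *ᵥ coordField u k x := fun g hg =>
  coordField_equivariant (by rw [g.2]; exact one_ne_zero) (fun a => ev_invariant (hu a) hg) k

theorem dualField_invariant {G : Subgroup SL3} {u : Fin 3 → Poly}
    (hu : ∀ a, u a ∈ invariantRing G) (k : Fin 3) (n : ℕ) :
    ∀ g ∈ G, ∀ x, dualField u k n (g.1 *ᵥ x) = g.1 *ᵥ dualField u k n x := fun g hg =>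
  dualField_equivariant (by rw [g.2]; exact one_ne_zero) (fun a => ev_invariant (hu a) hg) k n

theorem const_mul_invariant {G : Subgroup SL3} {f : Poly} (hf : f ∈ invariantRing G) (c : ℂ) :
    ∀ g ∈ G, ∀ x : V3, c * ev f (g.1 *ᵥ x) = c * ev f x := fun g hg x => by
  rw [ev_invariant hf hg]

theorem neg_const_mul_invariant {G : Subgroup SL3} {f : Poly} (hf : f ∈ invariantRing G) (c : ℂ) :
    ∀ g ∈ G, ∀ x : V3, -(c * ev f (g.1 *ᵥ x)) = -(c * ev f x) := fun g hg x => by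
  rw [ev_invariant hf hg]

namespace SymNhd
variable {m : ℕ} {N : Set V3} {s : V3 → ℂ} (h : SymNhd m N s) (hm : 1 < m) {x : V3} (hx : x ∈ N)
include h hx

theorem ev_xyz_ne_zero : ev xyz x ≠ 0 := by
  rw [← h.exp x hx]; exact Complex.exp_ne_zero _

include hm

/-- Coordinate fields of `(e₁, e₂, (xyz)ⁿ)`. -/
theorem hasGrad_symm3 (a : Fin 3) : HasGrad (symV m s) (ev (symm3 m a))
    ((!![1, 0, 0; 0, 1, 0; 0, 0, m * ev xyz x ^ m] : Mat3) a) x := by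
  fin_cases a
  · refine (h.hasGrad_sym_e1 hm hx).congr_grad ?_
    ext j; fin_cases j <;> simp
  · refine (h.hasGrad_sym_e2 hm hx).congr_grad ?_
    ext j; fin_cases j <;> simp
  · refine (h.hasGrad_xyz_pow hm hx m).congr_grad ?_
    ext j; fin_cases j <;> simp

theorem coordField_symm3_zero :
    jac (symV m s) x *ᵥ coordField (symm3 m) 0 x = Pi.single 0 1 := by
  have hm0 : (m : ℂ) ≠ 0 := by norm_cast; omega
  refine jac_mulVec_coordField (h.det_symV hm hx) (h.hasGrad_symm3 hm hx) ?_ ?_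
  · simp [Matrix.det_fin_three, hm0, h.ev_xyz_ne_zero hx]
  · ext i; fin_cases i <;> simp [Matrix.mulVec, dotProduct, Fin.sum_univ_three]

theorem coordField_symm3_one :
    jac (symV m s) x *ᵥ coordField (symm3 m) 1 x = Pi.single 1 1 := by
  have hm0 : (m : ℂ) ≠ 0 := by norm_cast; omega
  refine jac_mulVec_coordField (h.det_symV hm hx) (h.hasGrad_symm3 hm hx) ?_ ?_
  · simp [Matrix.det_fin_three, hm0, h.ev_xyz_ne_zero hx]
  · ext i; fin_cases i <;> simp [Matrix.mulVec, dotProduct, Fin.sum_univ_three]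

theorem coordField_symm3_two :
    jac (symV m s) x *ᵥ coordField (symm3 m) 2 x
      = Pi.single 2 (m * Complex.exp (m * s x))⁻¹ := by
  have hm0 : (m : ℂ) ≠ 0 := by norm_cast; omega
  have h0 := pow_ne_zero m (h.ev_xyz_ne_zero hx)
  refine jac_mulVec_coordField (h.det_symV hm hx) (h.hasGrad_symm3 hm hx) ?_ ?_
  · simp [Matrix.det_fin_three, hm0, h.ev_xyz_ne_zero hx]
  · rw [h.exp_nsmul hx]
    ext i; fin_cases i <;> simp [Matrix.mulVec, dotProduct, Fin.sum_univ_three]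
    field_simp

/-- Coordinate fields of `(c e₁, (xyz)², a e₂ + b e₁²)`. -/
theorem hasGrad_triple {u : Fin 3 → Poly} {c a b : ℂ} (h0 : ∀ y, ev (u 0) y = c * ev (e1 m) y)
    (h1 : u 1 = xyz ^ 2) (h2 : ∀ y, ev (u 2) y = a * ev (e2 m) y + b * ev (e1 m) y ^ 2) (i : Fin 3) :
    HasGrad (symV m s) (ev (u i)) ((!![c, 0, 0; 0, 0, 2 * ev xyz x ^ 2;
      2 * b * ev (e1 m) x, a, 0] : Mat3) i) x := by
  fin_cases i
  · refine (((h.hasGrad_sym_e1 hm hx).const_mul c).congr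
      (Filter.Eventually.of_forall fun y => (h0 y).symm)).congr_grad ?_
    ext j; fin_cases j <;> simp
  · have := h.hasGrad_xyz_pow hm hx 2
    rw [← h1] at this
    refine this.congr_grad ?_
    ext j; fin_cases j <;> simp
  · refine ((((h.hasGrad_sym_e2 hm hx).const_mul a).add
      (((h.hasGrad_sym_e1 hm hx).pow 2).const_mul b)).congr
      (Filter.Eventually.of_forall fun y => (h2 y).symm)).congr_grad ?_
    ext j; fin_cases j <;> simp
    ring

theorem coordField_triple_zero {u : Fin 3 → Poly} {c a : ℂ} (hc : c ≠ 0) (ha : a ≠ 0)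
    (h0 : ∀ y, ev (u 0) y = c * ev (e1 m) y) (h1 : u 1 = xyz ^ 2)
    (h2 : ∀ y, ev (u 2) y = a * ev (e2 m) y) :
    jac (symV m s) x *ᵥ coordField u 0 x = Pi.single 0 c⁻¹ := by
  refine jac_mulVec_coordField (h.det_symV hm hx)
    (h.hasGrad_triple hm hx h0 h1 (b := 0) (by simpa using h2)) ?_ ?_
  · simp [Matrix.det_fin_three, hc, ha, h.ev_xyz_ne_zero hx]
  · ext i; fin_cases i <;> simp [Matrix.mulVec, dotProduct, Fin.sum_univ_three, hc]

/-- The summand b·e₁² does not matter: e₁ is held fixed when differentiating by the third function,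
so the field is ∂/∂e₂ divided by a. For the derivative by the first function the summand has to be
absent. -/
theorem coordField_triple_two {u : Fin 3 → Poly} {c a b : ℂ} (hc : c ≠ 0) (ha : a ≠ 0)
    (h0 : ∀ y, ev (u 0) y = c * ev (e1 m) y) (h1 : u 1 = xyz ^ 2)
    (h2 : ∀ y, ev (u 2) y = a * ev (e2 m) y + b * ev (e1 m) y ^ 2) :
    jac (symV m s) x *ᵥ coordField u 2 x = Pi.single 1 a⁻¹ := by
  refine jac_mulVec_coordField (h.det_symV hm hx) (h.hasGrad_triple hm hx h0 h1 h2) ?_ ?_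
  · simp [Matrix.det_fin_three, hc, ha, h.ev_xyz_ne_zero hx]
  · ext i; fin_cases i <;> simp [Matrix.mulVec, dotProduct, Fin.sum_univ_three, ha]

end SymNhd

theorem exists_root (z : ℂ) {n : ℕ} (hn : 0 < n) : ∃ w : ℂ, w ^ n = z :=
  IsAlgClosed.exists_pow_nat_eq z hn

section
variable {G : Subgroup SL3} (hG : (G : Set SL3).Finite) {m : ℕ} (hm : 1 < m)
  (hmin : IsMinimalDegreeInvariant G (e1 m))
include hG hm hmin

/-- The three coordinate fields of e₁, e₂, e₃ = (xyz)ᵐ are the unity fields of B₃¹, A₃ and B₃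
charts, and the remaining two structures are inversions of the A₃ and B₃ charts. -/
theorem fiveStructures (hu : ∀ i, symm3 m i ∈ invariantRing G) : FiveStructures G m := by
  have hm0 : (m : ℂ) ≠ 0 := by norm_cast; omega
  have hm1 : (m : ℂ) - 1 ≠ 0 := by
    rw [sub_ne_zero]; norm_cast; omega
  obtain ⟨α, hα⟩ := exists_root (1 / 36) (n := 3) (by norm_num)
  have hα0 : α ≠ 0 := by rintro rfl; norm_num at hα
  have h2 : ((√2 : ℝ) : ℂ) ≠ 0 := by simp
  refine ⟨?_, ?_, ?_, ?_, ?_⟩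
  -- The diagonal matrix is the ratio of the listed flat coordinates to those of the model chart; in
  -- the second entry -1/(6√2) is divided by (3/2)α².
  · refine yieldsFlat_of_symNhd hG hm hmin (coordField_invariant hu 2)
      (const_mul_invariant (hu 0) _) fun N s hs => ⟨_, _,
      hs.chart_B3 hm hα (fun x hx => hs.coordField_symm3_two hm hx) (fun x _ => rfl),
      diagonal ![((m : ℂ) - 1) / (3 * m * α), -(9 * ((√2 : ℝ) : ℂ) * α ^ 2)⁻¹, 1], ?_,
      fun x hx => ?_⟩
    · rw [Matrix.det_diagonal, Fin.prod_univ_three]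
      simp [hm0, hm1, hα0]
    · ext i
      rw [Matrix.mulVec_diagonal]
      fin_cases i <;> simp [flatB3, hs.exp_nsmul hx]
      · field_simp
      · field_simp
        ring
      · ring
  · refine yields_of_symNhd hG hm hmin (dualField_invariant hu 2 6)
      (neg_const_mul_invariant (hu 0) _) fun N s hs h0 => ⟨_, _,
      (hs.chart_B3 hm hα (fun x hx => hs.coordField_symm3_two hm hx) (fun x _ => rfl)).dual_B3
      hα0 (u := ev (e1 m)) (fun x _ => rfl) h0⟩
  · refine yieldsFlatLog_of_symNhd hG hm hmin (coordField_invariant hu 1)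
      (const_mul_invariant (hu 0) _) (n := m) (fun x => ev_pow _ _ _) fun N s hs => ⟨_, _,
      hs.chart_A3 hm one_ne_zero (fun x hx => by simpa using hs.coordField_symm3_one hm hx)
        (fun x _ => rfl), !![((m : ℂ) - 1) / m, 0, 0; 0, 0, 1; 0, 1 / 2, 0], ?_, fun x hx => ?_⟩
    · simp [Matrix.det_fin_three, hm0, hm1]
    · have e : (2⁻¹ * (m * s x) : ℂ) = m / 2 * s x := by ring
      ext i
      fin_cases i <;> simp [flatA3, Matrix.mulVec, dotProduct, Fin.sum_univ_three, e]
      field_simp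
  · refine yields_of_symNhd hG hm hmin (dualField_invariant hu 1 4)
      (neg_const_mul_invariant (hu 0) _) fun N s hs h0 => ⟨_, _,
      (hs.chart_A3 hm one_ne_zero (fun x hx => by simpa using hs.coordField_symm3_one hm hx)
        (fun x _ => rfl)).dual_A3 (α := 1 / 2 * 1 ^ 2) (by norm_num)
        (u := ev (e1 m)) (fun x _ => rfl) h0⟩
  · refine yieldsFlatLog_of_symNhd hG hm hmin (coordField_invariant hu 0)
      (const_mul_invariant (hu 0) _) (n := m) (fun x => ev_pow _ _ _) fun N s hs => ⟨_, _,
      hs.chart_B31 hm one_ne_zero (fun x hx => by simpa using hs.coordField_symm3_zero hm hx)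
        (fun x _ => rfl), diagonal ![1, 1, 4 / 3], ?_, fun x hx => ?_⟩
    · rw [Matrix.det_diagonal, Fin.prod_univ_three]
      simp
    · have e : (4⁻¹ * (m * s x) : ℂ) = m / 4 * s x := by ring
      ext i
      rw [Matrix.mulVec_diagonal]
      fin_cases i <;> simp [flatB31, e, neg_div]

/-- A fourth root ρ of a normalises ∂/∂u₂, which is ∂/∂e₂ divided by a, to the unity field of an A₃
chart, and that chart is then inverted. -/
theorem yields_A3d_triple {u : Fin 3 → Poly} (hu : ∀ i, u i ∈ invariantRing G) {a b : ℂ}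
    (ha : a ≠ 0) (h0 : u 0 = e1 m) (h1 : u 1 = xyz ^ 2)
    (h2 : ∀ y, ev (u 2) y = a * ev (e2 m) y + b * ev (e1 m) y ^ 2) :
    Yields G (e1 m) (dualField u 2 4) (fun x => -(((m : ℂ) - 1) / (2 * m) * ev (e1 m) x)) .A3d := by
  obtain ⟨ρ, hρ⟩ := exists_root a (n := 4) (by norm_num)
  have hρ0 : ρ ≠ 0 := by rintro rfl; exact ha (by rw [← hρ]; simp)
  refine yields_of_symNhd hG hm hmin (dualField_invariant hu 2 4)
    (neg_const_mul_invariant hmin.2.1 _) fun N s hs hne => ?_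
  have := (hs.chart_A3 hm hρ0 (X := coordField u 2) (fun x hx => by
    rw [hρ]
    exact hs.coordField_triple_two hm hx one_ne_zero ha (by simp [h0]) h1 h2)
    (fun x _ => rfl)).dual_A3 (α := 1 / 2 * ρ ^ 2) (by simp [hρ0]) (u := ev (u 0))
      (fun x _ => by rw [h0]; rfl) (by rw [h0]; exact hne)
  exact ⟨_, _, this⟩

theorem yieldsFlatLog_A3_triple {u : Fin 3 → Poly} (hu : ∀ i, u i ∈ invariantRing G) {a b : ℂ}
    (ha : a ≠ 0) (h0 : u 0 = e1 m) (h1 : u 1 = xyz ^ 2)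
    (h2 : ∀ y, ev (u 2) y = a * ev (e2 m) y + b * ev (e1 m) y ^ 2) {τ : V3 → ℂ}
    (hτ : ∀ x, τ x = ((m : ℂ) - 1) / (2 * m) * ev (e1 m) x) {t : V3 → ℂ → V3} {c : ℂ} (hc : c ≠ 0)
    (ht0 : ∀ x l, t x l 0 = ((m : ℂ) - 1) / (2 * m) * ev (e1 m) x)
    (ht1 : ∀ x l, t x (2 * l) 1 = c * Complex.exp (m / 2 * l))
    (ht2 : ∀ x l, t x l 2 = a * (ev (e2 m) x - 1 / 8 * ev (e1 m) x ^ 2)) :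
    YieldsFlatLog G (e1 m) (coordField u 2) τ .A3 (xyz ^ 2) t := by
  have hm0 : (m : ℂ) ≠ 0 := by norm_cast; omega
  have hm1 : (m : ℂ) - 1 ≠ 0 := by
    rw [sub_ne_zero]; norm_cast; omega
  obtain ⟨ρ, hρ⟩ := exists_root a (n := 4) (by norm_num)
  have hρ0 : ρ ≠ 0 := by rintro rfl; exact ha (by rw [← hρ]; simp)
  refine yieldsFlatLog_of_symNhd hG hm hmin (coordField_invariant hu 2)
    (fun g hg x => by rw [hτ, hτ, ev_invariant hmin.2.1 hg]) (n := 2) (fun x => ev_pow _ _ _)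
    fun N s hs => ⟨_, _, hs.chart_A3 hm hρ0 (fun x hx => by
    rw [hρ]
    exact hs.coordField_triple_two hm hx one_ne_zero ha (by simp [h0]) h1 h2)
    (fun x _ => hτ x), diagonal ![((m : ℂ) - 1) / (m * ρ ^ 2), c / (2 * ρ ^ 3), 1], ?_,
    fun x hx => ?_⟩
  · rw [Matrix.det_diagonal, Fin.prod_univ_three]
    simp [hm0, hm1, hρ0, hc]
  · ext i
    rw [Matrix.mulVec_diagonal]
    fin_cases i
    · refine (ht0 _ _).trans ?_
      simp [flatA3]; field_simp
    · refine Eq.trans (by push_cast; rfl) ((ht1 x (s x)).trans ?_)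
      simp [flatA3]; field_simp
    · refine (ht2 _ _).trans ?_
      simp [flatA3, hρ]

theorem yieldsFlatLog_B31_triple {u : Fin 3 → Poly} (hu : ∀ i, u i ∈ invariantRing G) {c a : ℂ}
    (hc : c ≠ 0) (ha : a ≠ 0) (h0 : ∀ y, ev (u 0) y = c * ev (e1 m) y) (h1 : u 1 = xyz ^ 2)
    (h2 : ∀ y, ev (u 2) y = a * ev (e2 m) y) {τ : V3 → ℂ}
    (hτ : ∀ x, τ x = ((m : ℂ) - 1) / m * ev (e1 m) x) {b : Poly} {n : ℕ}
    (hb : ∀ x, ev b x = ev xyz x ^ n) {t : V3 → ℂ → V3} {b0 b2 : ℂ} (hb0 : b0 ≠ 0) (hb2 : b2 ≠ 0)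
    (ht0 : ∀ x l, t x l 0 = b0 * ev (e1 m) x)
    (ht1 : ∀ x l, t x (n * l) 1 = Complex.exp (m / 4 * l))
    (ht2 : ∀ x l, t x (n * l) 2 = b2 * (ev (e2 m) x * Complex.exp (-(m / 4) * l))) :
    YieldsFlatLog G (e1 m) (coordField u 0) τ .B31 b t := by
  obtain ⟨ρ, hρ⟩ := exists_root c (n := 4) (by norm_num)
  have hρ0 : ρ ≠ 0 := by rintro rfl; exact hc (by rw [← hρ]; simp)
  refine yieldsFlatLog_of_symNhd hG hm hmin (coordField_invariant hu 0)
    (fun g hg x => by rw [hτ, hτ, ev_invariant hmin.2.1 hg]) (n := n) hb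
    fun N s hs => ⟨_, _, hs.chart_B31 hm hρ0 (fun x hx => by
    rw [hρ]
    exact hs.coordField_triple_zero hm hx hc ha h0 h1 h2)
    (fun x _ => hτ x), !![b0 / ρ ^ 4, 0, 0; 0, 0, (ρ ^ 3)⁻¹; 0, b2 / ρ ^ 5, 0], ?_,
    fun x hx => ?_⟩
  · simp [Matrix.det_fin_three, hρ0, hb0, hb2]
  · ext i
    fin_cases i
    · refine (ht0 _ _).trans ?_
      simp [flatB31, Matrix.mulVec, dotProduct, Fin.sum_univ_three]; field_simp
    · refine (ht1 _ _).trans ?_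
      simp [flatB31, Matrix.mulVec, dotProduct, Fin.sum_univ_three]; field_simp
    · refine (ht2 _ _).trans ?_
      simp [flatB31, Matrix.mulVec, dotProduct, Fin.sum_univ_three]; field_simp

omit hmin hG in
theorem PairNhd.coordField_triple {N : Set V3} {s : V3 → ℂ} (h : PairNhd m N s) {x : V3}
    (hx : x ∈ N) {u : Fin 3 → Poly} {a b : ℂ} (ha : a ≠ 0) (hb : b ≠ 0)
    (h0 : ∀ y, ev (u 0) y = a * ev (e1 m) y) (h1 : ∀ y, ev (u 1) y = b * y 2 ^ m)
    (h2 : ∀ y, ev (u 2) y = (y 0 * y 1) ^ m) :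
    jac (pairV m s) x *ᵥ coordField u 1 x = Pi.single 1 b⁻¹ := by
  have hm0 : (m : ℂ) ≠ 0 := by norm_cast; omega
  have c := HasGrad.coord (h.an_pairV hm hx)
  have h01 : x 0 * x 1 ≠ 0 := mul_ne_zero (h.ne_zero hx 0) (h.ne_zero hx 1)
  refine jac_mulVec_coordField (B := !![a, 0, 0; 0, b, 0; 0, 0, m * (x 0 * x 1) ^ m])
    (h.det_pairV hm hx) (fun i => ?_) ?_ ?_
  · fin_cases i
    · refine (((c 0).const_mul a).congr
        (Filter.Eventually.of_forall fun y => (h0 y).symm)).congr_grad ?_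
      ext j; fin_cases j <;> simp
    · refine (((c 1).const_mul b).congr
        (Filter.Eventually.of_forall fun y => (h1 y).symm)).congr_grad ?_
      ext j; fin_cases j <;> simp
    · refine ((((c 2).const_mul m).exp).congr
        (Filter.eventuallyEq_of_mem (h.isOpen.mem_nhds hx) fun y hy => ?_)).congr_grad ?_
      · exact (h.exp_nsmul hy m).trans (h2 y).symm
      · have e : Complex.exp (m * pairV m s x 2) = (x 0 * x 1) ^ m := h.exp_nsmul hx m
        rw [e]
        ext j; fin_cases j <;> simp
        ring
  · rw [Matrix.det_fin_three]
    simp [ha, hb, hm0, h.ne_zero hx 0, h.ne_zero hx 1]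
  · ext i; fin_cases i <;> simp [Matrix.mulVec, dotProduct, Fin.sum_univ_three, hb]

omit hm hmin hG in
theorem pairPoly_ne_zero (hm : m ≠ 0) :
    (X 0 * X 1 * (X 2 * (X 0 ^ m - X 1 ^ m)) : Poly) ≠ 0 :=
  mul_ne_zero (mul_ne_zero (X_ne_zero _) (X_ne_zero _)) (mul_ne_zero (X_ne_zero _)
    (ne_zero_of_ev (x := ![1, 0, 0]) (by simp [hm])))

/-- Since m = 2q, the exponential of (m/2) log xy is the polynomial (xy)^q, so no branch has to be
chosen. -/
theorem yieldsFlat_T3 {u : Fin 3 → Poly} (hu : ∀ i, u i ∈ invariantRing G) {a b : ℂ} (ha : a ≠ 0)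
    (hb : b ≠ 0)
    (h0 : ∀ y, ev (u 0) y = a * ev (e1 m) y) (h1 : ∀ y, ev (u 1) y = b * y 2 ^ m)
    (h2 : ∀ y, ev (u 2) y = (y 0 * y 1) ^ m) {τ : V3 → ℂ}
    (hτ : ∀ x, τ x = ((m : ℂ) - 1) / m * ev (e1 m) x) {t : V3 → V3} {q : ℕ} (hq : m = 2 * q)
    {c : Fin 3 → ℂ} (hc : ∀ i, c i ≠ 0) (ht0 : ∀ x, t x 0 = c 0 * ev (e1 m) x)
    (ht1 : ∀ x, t x 1 = c 1 * x 2 ^ m) (ht2 : ∀ x, t x 2 = c 2 * (x 0 * x 1) ^ q) :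
    YieldsFlat G (e1 m) (coordField u 1) τ .T3 t := by
  refine yieldsFlat_of_charts hG hmin (pairPoly_ne_zero (m := m) (by omega))
    (coordField_invariant hu 1) (fun g hg x => by rw [hτ, hτ, ev_invariant hmin.2.1 hg])
    fun p hp => ?_
  obtain ⟨N, s, hs, hpN⟩ := exists_pairNhd m hp
  refine ⟨N, _, _, hpN, hs.chart_T3 hm (inv_ne_zero hb)
    (fun x hx => hs.coordField_triple hm hx ha hb h0 h1 h2) (fun x _ => hτ x),
    diagonal ![2 * b⁻¹ * c 0, b⁻¹ * c 1, b⁻¹ * c 2], ?_, fun x hx => ?_⟩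
  · rw [Matrix.det_diagonal, Fin.prod_univ_three]
    simp [hb, hc]
  · have e : Complex.exp (m / 2 * s x) = (x 0 * x 1) ^ q := by
      rw [← hs.exp_nsmul hx, hq]; congr 1; push_cast; ring
    ext i
    rw [Matrix.mulVec_diagonal]
    fin_cases i
    · refine (ht0 _).trans ?_
      simp [flatT3]; field_simp
    · refine (ht1 _).trans ?_
      simp [flatT3]; field_simp
    · refine (ht2 _).trans ?_
      simp [flatT3, e]; field_simp

omit hm hmin in
theorem trivialStructure (hmin : IsMinimalDegreeInvariant G (e1 2))
    (h1 : (X 2 ^ 2 : Poly) ∈ invariantRing G) (h2 : (X 0 ^ 2 * X 1 ^ 2 : Poly) ∈ invariantRing G) :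
    TrivialStructure G := by
  have hu : ∀ i, (![e1 2, X 2 ^ 2, X 0 ^ 2 * X 1 ^ 2] : Fin 3 → Poly) i ∈ invariantRing G := by
    intro i; fin_cases i
    · exact hmin.2.1
    · exact h1
    · exact h2
  refine yieldsFlatLog_of_charts hG hmin (pairPoly_ne_zero (m := 2) (by norm_num))
    (coordField_invariant hu 1) (const_mul_invariant hmin.2.1 _) fun p hp => ?_
  obtain ⟨N, s, hs, hpN⟩ := exists_pairNhd 2 hp
  refine ⟨N, _, _, hpN, hs.chart_T3 one_lt_two one_ne_zero
    (fun x hx => by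
      simpa using hs.coordField_triple one_lt_two hx (a := 1) (b := 1) one_ne_zero one_ne_zero
        (u := ![e1 2, X 2 ^ 2, X 0 ^ 2 * X 1 ^ 2]) (by simp) (by simp) (by simp [mul_pow]))
    (fun x _ => by norm_num), 1, fun x => 2 * s x, by simp,
    fun x hx => analyticAt_const.mul (hs.an x hx), fun x hx => ?_, fun x hx => ?_⟩
  · have := hs.exp_nsmul hx 2
    push_cast at this
    rw [this]; simp [mul_pow]
  · rw [Matrix.one_mulVec]
    ext i
    fin_cases i <;> simp [flatT3]

end

/-! ### Polynomial flat coordinates -/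

theorem pderiv_ofNat (i : Fin 3) (n : ℕ) [n.AtLeastTwo] :
    pderiv i (ofNat(n) : Poly) = 0 := by
  rw [← map_ofNat C n, pderiv_C]

/-- Jacobian determinant times Hessian determinant times the first polynomial. -/
def critPoly (u : Fin 3 → Poly) : Poly :=
  (Matrix.of fun a b => pderiv b (u a)).det * (Matrix.of fun i j => pderiv i (pderiv j (u 0))).det
    * u 0

theorem ev_det (A : Matrix (Fin 3) (Fin 3) Poly) (x : V3) :
    ev A.det x = (Matrix.of fun i j => ev (A i j) x : Mat3).det := by
  rw [ev, RingHom.map_det]; rfl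

theorem ev_critPoly (u : Fin 3 → Poly) (x : V3) :
    ev (critPoly u) x = (polyJac u x).det * (hessian (u 0) x).det * ev (u 0) x := by
  rw [critPoly, ev_mul, ev_mul, ev_det, ev_det]; rfl

/-- A polynomial matrix K with H K = Jᵀ plays the role of H⁻¹Jᵀ. Its columns are the gradients of
the invariants, so the metric in these coordinates is JK and no Hessian has to be inverted
symbolically. -/
theorem chart_poly {T : FrobType} {u : Fin 3 → Poly} {φ : V3 → V3} {κ α c : ℂ} {A K P : V3 → Mat3}
    (hκ : κ ≠ 0) (hK : ∀ x, hessian (u 0) x * K x = (polyJac u x)ᵀ)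
    (hP : ∀ x, polyJac u x * K x = P x)
    (hφ : ∀ x i, HasGrad (fun y a => ev (u a) y) (fun y => φ y i) (A x i) x)
    (hdom : T.domain = Set.univ) (hA : ∀ x, (A x).det ≠ 0)
    (hmet : ∀ x, A x * P x * (A x)ᵀ = κ • T.gform (φ x))
    (hvec : ∀ x, A x *ᵥ Pi.single 2 1 = Pi.single T.unityIndex 1)
    (h0 : ∀ x, φ x 0 = α * ev (u 0) x) (hα : c = κ⁻¹ * T.eta 0 T.unityIndex * α) :
    IsTypeChart T (u 0) (coordField u 2) (fun x => c * ev (u 0) x) {x | ev (critPoly u) x ≠ 0}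
      φ κ := by
  have hne : ∀ x ∈ {x | ev (critPoly u) x ≠ 0}, (polyJac u x).det ≠ 0 ∧
      (hessian (u 0) x).det ≠ 0 := fun x hx => by
    rw [Set.mem_ofPred_eq, ev_critPoly] at hx
    exact ⟨left_ne_zero_of_mul (left_ne_zero_of_mul hx),
      right_ne_zero_of_mul (left_ne_zero_of_mul hx)⟩
  have hN : IsOpen {x | ev (critPoly u) x ≠ 0} := isOpen_ne_fun (continuous_ev _) continuous_const
  have hτ := pd_eq_of_eq_coord (τ := fun x => c * ev (u 0) x) (φ := φ)
    (c := κ⁻¹ * T.eta 0 T.unityIndex) hN (fun x _ => analyticAt_of_hasGrad (hφ x))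
    fun x _ => by rw [h0, hα]; ring
  refine isPencilChart_of_grad (v := fun y a => ev (u a) y) (P := P) (A := A)
    (y := fun _ => Pi.single 2 1) hN hκ
    (fun x hx => ?_) (fun x hx => ?_) (fun x hx => ?_) (fun x hx => ?_) (fun x _ => hφ x)
    (fun x _ => by rw [hdom]; trivial) (fun x _ => hA x) (fun x _ => hmet x) (fun x _ => hvec x)
    hτ.1 hτ.2
  · rw [hessMetric, Matrix.det_nonsing_inv, Ring.inverse_eq_inv']
    exact inv_ne_zero (hne x hx).2
  · rw [jac_ev]; exact (hne x hx).1
  · rw [jac_ev, mul_assoc, ← hK, hessMetric, ← mul_assoc (hessian (u 0) x)⁻¹,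
      inv_mul_self_of (hne x hx).2, one_mul, hP]
  · rw [jac_ev]; exact polyJac_mulVec_coordField (hne x hx).1 2

/-! ### Explicit Jacobians, Hessians and metrics for the groups (12) and (14). -/

theorem polyJac_u12 (x : V3) : polyJac u12 x =
    !![6 * x 0 ^ 2 * (x 0 ^ 3 - 5 * x 1 ^ 3 - 5 * x 2 ^ 3),
       6 * x 1 ^ 2 * (x 1 ^ 3 - 5 * x 2 ^ 3 - 5 * x 0 ^ 3),
       6 * x 2 ^ 2 * (x 2 ^ 3 - 5 * x 0 ^ 3 - 5 * x 1 ^ 3);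
       3 * x 0 ^ 2 * ((x 1 ^ 3 - x 2 ^ 3) * (x 1 ^ 3 + x 2 ^ 3 - 2 * x 0 ^ 3)),
       3 * x 1 ^ 2 * ((x 2 ^ 3 - x 0 ^ 3) * (x 2 ^ 3 + x 0 ^ 3 - 2 * x 1 ^ 3)),
       3 * x 2 ^ 2 * ((x 0 ^ 3 - x 1 ^ 3) * (x 0 ^ 3 + x 1 ^ 3 - 2 * x 2 ^ 3));
       3 * x 0 ^ 2 * (4 * ev (e1 3) x ^ 3 + 216 * (x 0 * x 1 * x 2) ^ 3
         + 216 * (x 1 * x 2) ^ 3 * ev (e1 3) x),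
       3 * x 1 ^ 2 * (4 * ev (e1 3) x ^ 3 + 216 * (x 0 * x 1 * x 2) ^ 3
         + 216 * (x 2 * x 0) ^ 3 * ev (e1 3) x),
       3 * x 2 ^ 2 * (4 * ev (e1 3) x ^ 3 + 216 * (x 0 * x 1 * x 2) ^ 3
         + 216 * (x 0 * x 1) ^ 3 * ev (e1 3) x)] := by
  ext i j
  fin_cases i <;> fin_cases j <;>
    simp [polyJac, u12, e1, e2, xyz, pderiv_ofNat, pderiv_pow, pderiv_X, Pi.single_apply,
      Derivation.leibniz] <;> ring

theorem hessian_u12 (x : V3) : hessian (u12 0) x =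
    !![30 * x 0 ^ 4 - 60 * x 0 * (x 1 ^ 3 + x 2 ^ 3), -90 * x 0 ^ 2 * x 1 ^ 2,
        -90 * x 0 ^ 2 * x 2 ^ 2;
      -90 * x 0 ^ 2 * x 1 ^ 2, 30 * x 1 ^ 4 - 60 * x 1 * (x 0 ^ 3 + x 2 ^ 3),
        -90 * x 1 ^ 2 * x 2 ^ 2;
      -90 * x 0 ^ 2 * x 2 ^ 2, -90 * x 1 ^ 2 * x 2 ^ 2,
        30 * x 2 ^ 4 - 60 * x 2 * (x 0 ^ 3 + x 1 ^ 3)] := by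
  ext i j
  fin_cases i <;> fin_cases j <;>
    simp [hessian, u12, e1, e2, xyz, pderiv_ofNat, pderiv_pow, pderiv_X, Pi.single_apply,
      Derivation.leibniz] <;> ring

theorem polyJac_u14 (x : V3) : polyJac u14 x =
    !![2 * x 0, x 2, x 1;
      32 * x 1 * x 2 * x 0 ^ 3 - 4 * x 1 ^ 2 * x 2 ^ 2 * x 0 - (x 1 ^ 5 + x 2 ^ 5),
      8 * x 2 * x 0 ^ 4 - 4 * x 1 * x 2 ^ 2 * x 0 ^ 2 - 5 * x 1 ^ 4 * x 0 + 3 * x 1 ^ 2 * x 2 ^ 3,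
      8 * x 1 * x 0 ^ 4 - 4 * x 2 * x 1 ^ 2 * x 0 ^ 2 - 5 * x 2 ^ 4 * x 0 + 3 * x 2 ^ 2 * x 1 ^ 3;
      40 * x 0 * x 2 ^ 4 * x 1 ^ 4 - 640 * x 0 ^ 3 * x 2 ^ 3 * x 1 ^ 3
        + 1920 * x 0 ^ 5 * x 2 ^ 2 * x 1 ^ 2
        - 4 * (x 1 ^ 5 + x 2 ^ 5) * (160 * x 0 ^ 4 - 60 * x 1 * x 2 * x 0 ^ 2
          + 5 * x 1 ^ 2 * x 2 ^ 2),
      10 * x 1 ^ 9 + 30 * x 2 ^ 5 * x 1 ^ 4 + 80 * x 0 ^ 2 * x 2 ^ 4 * x 1 ^ 3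
        - 480 * x 0 ^ 4 * x 2 ^ 3 * x 1 ^ 2 + 640 * x 0 ^ 6 * x 2 ^ 2 * x 1
        - 20 * x 0 * x 1 ^ 4 * (32 * x 0 ^ 4 - 20 * x 1 * x 2 * x 0 ^ 2 + 5 * x 1 ^ 2 * x 2 ^ 2)
        - 4 * x 0 * (x 1 ^ 5 + x 2 ^ 5) * (10 * x 1 * x 2 ^ 2 - 20 * x 2 * x 0 ^ 2),
      10 * x 2 ^ 9 + 30 * x 1 ^ 5 * x 2 ^ 4 + 80 * x 0 ^ 2 * x 1 ^ 4 * x 2 ^ 3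
        - 480 * x 0 ^ 4 * x 1 ^ 3 * x 2 ^ 2 + 640 * x 0 ^ 6 * x 1 ^ 2 * x 2
        - 20 * x 0 * x 2 ^ 4 * (32 * x 0 ^ 4 - 20 * x 1 * x 2 * x 0 ^ 2 + 5 * x 1 ^ 2 * x 2 ^ 2)
        - 4 * x 0 * (x 1 ^ 5 + x 2 ^ 5) * (10 * x 2 * x 1 ^ 2 - 20 * x 1 * x 0 ^ 2)] := by
  ext i j
  fin_cases i <;> fin_cases j <;>
    simp [polyJac, u14, pderiv_ofNat, pderiv_pow, pderiv_X, Pi.single_apply,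
      Derivation.leibniz] <;> ring

theorem hessian_u14 (x : V3) : hessian (u14 0) x = !![2, 0, 0; 0, 0, 1; 0, 1, 0] := by
  ext i j
  fin_cases i <;> fin_cases j <;>
    simp [hessian, u14, pderiv_ofNat, pderiv_pow, pderiv_X, Pi.single_apply,
      Derivation.leibniz]

theorem critPoly_u12_ne_zero : critPoly u12 ≠ 0 := by
  -- It is enough to find one point where the Jacobian determinant, the Hessian determinant and the
  -- first invariant are all nonzero.
  refine ne_zero_of_ev (x := ![1, -1, 2]) ?_
  rw [ev_critPoly, polyJac_u12, hessian_u12, Matrix.det_fin_three, Matrix.det_fin_three]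
  simp [u12, e1, e2, xyz]
  norm_num

theorem critPoly_u14_ne_zero : critPoly u14 ≠ 0 := by
  refine ne_zero_of_ev (x := ![1, 1, 0]) ?_
  rw [ev_critPoly, polyJac_u14, hessian_u14, Matrix.det_fin_three, Matrix.det_fin_three]
  simp [u14]
  norm_num

/-- The matrix whose columns are the gradients of `u12` for the Hessian metric. -/
def grad12 (x : V3) : Mat3 :=
  !![x 0 / 5, x 0 * (x 2 ^ 3 - x 1 ^ 3) / 20,
      2 / 5 * x 0 * (x 0 ^ 6 - x 0 ^ 3 * (x 1 ^ 3 + x 2 ^ 3) - 2 * x 1 ^ 6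
        - 22 * x 1 ^ 3 * x 2 ^ 3 - 2 * x 2 ^ 6);
    x 1 / 5, x 1 * (x 0 ^ 3 - x 2 ^ 3) / 20,
      2 / 5 * x 1 * (x 1 ^ 6 - x 1 ^ 3 * (x 2 ^ 3 + x 0 ^ 3) - 2 * x 2 ^ 6
        - 22 * x 2 ^ 3 * x 0 ^ 3 - 2 * x 0 ^ 6);
    x 2 / 5, x 2 * (x 1 ^ 3 - x 0 ^ 3) / 20,
      2 / 5 * x 2 * (x 2 ^ 6 - x 2 ^ 3 * (x 0 ^ 3 + x 1 ^ 3) - 2 * x 0 ^ 6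
        - 22 * x 0 ^ 3 * x 1 ^ 3 - 2 * x 1 ^ 6)]

theorem hessian_mul_grad12 (x : V3) : hessian (u12 0) x * grad12 x = (polyJac u12 x)ᵀ := by
  rw [hessian_u12, polyJac_u12, ev_e1, grad12]
  ext i j
  fin_cases i <;> fin_cases j <;> simp [Matrix.mul_apply, Fin.sum_univ_three] <;> ring

/-- Inner products of gradients are invariants of degree deg uᵢ + deg uⱼ - 6, here polynomials in u.
In the first row H⁻¹∇f = x/5, so Euler's relation gives the factors 6/5, 9/5, 12/5. -/
theorem polyJac_mul_grad12 (x : V3) : polyJac u12 x * grad12 x =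
    !![6 / 5 * ev (u12 0) x, 9 / 5 * ev (u12 1) x, 12 / 5 * ev (u12 2) x;
      9 / 5 * ev (u12 1) x, (ev (u12 0) x ^ 2 - ev (u12 2) x) / 160, 0;
      12 / 5 * ev (u12 2) x, 0, 2592 / 5 * ev (u12 1) x ^ 2 + 6 * ev (u12 0) x * ev (u12 2) x
        - 6 / 5 * ev (u12 0) x ^ 3] := by
  rw [polyJac_u12, ev_e1, grad12]
  ext i j
  fin_cases i <;> fin_cases j <;>
    simp [Matrix.mul_apply, Fin.sum_univ_three, u12, ev_e1, ev_e2, ev_xyz] <;> ring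

/-- The matrix whose columns are the gradients of `u14` for the Hessian metric. -/
def grad14 (x : V3) : Mat3 :=
  Matrix.of ![fun j => 1 / 2 * polyJac u14 x j 0, fun j => polyJac u14 x j 2,
    fun j => polyJac u14 x j 1]

theorem hessian_mul_grad14 (x : V3) : hessian (u14 0) x * grad14 x = (polyJac u14 x)ᵀ := by
  rw [hessian_u14, grad14]
  ext i j
  fin_cases i <;> simp [Matrix.mul_apply, Fin.sum_univ_three]

/-- The Hessian is constant: its inverse halves the first component of a gradient and exchanges the
other two. The first row is Euler's relation with degrees 2, 6, 10. -/
theorem polyJac_mul_grad14 (x : V3) : polyJac u14 x * grad14 x =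
    !![2 * ev (u14 0) x, 6 * ev (u14 1) x, 10 * ev (u14 2) x;
      6 * ev (u14 1) x, 1 / 2 * ev (u14 2) x + 16 * ev (u14 0) x ^ 2 * ev (u14 1) x,
        -40 * ev (u14 0) x * ev (u14 1) x ^ 2 + 40 * ev (u14 0) x ^ 2 * ev (u14 2) x;
      10 * ev (u14 2) x, -40 * ev (u14 0) x * ev (u14 1) x ^ 2 + 40 * ev (u14 0) x ^ 2 * ev (u14 2) x,
        -2400 * ev (u14 1) x ^ 3 + 800 * ev (u14 0) x * ev (u14 1) x * ev (u14 2) x] := by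
  rw [grad14, polyJac_u14]
  ext i j
  fin_cases i <;> fin_cases j <;>
    simp [Matrix.mul_apply, Fin.sum_univ_three, u14] <;> ring

/-- The (0,0) entry forces κ = 12α/5. In the (1,1) entry the coefficient of u₃ gives -β²/160 = κ,
that is β² = -384α, and the coefficient of u₁² gives -1 = α²/2 - 5/8, that is α² = -3/4. -/
theorem chart_A3_u12 {α β : ℂ} (hα : α ^ 2 = -3 / 4) (hβ : β ^ 2 = -384 * α) :
    IsTypeChart .A3 (u12 0) (coordField u12 2) (fun x => 5 / 12 * ev (u12 0) x)
      {x | ev (critPoly u12) x ≠ 0}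
      (fun x => ![α * ev (u12 0) x, β * ev (u12 1) x, ev (u12 2) x - 5 / 8 * ev (u12 0) x ^ 2])
      (12 / 5 * α) := by
  have hα0 : α ≠ 0 := by rintro rfl; norm_num at hα
  have hβ0 : β ≠ 0 := by rintro rfl; simp [hα0] at hβ
  refine chart_poly (α := α)
    (A := fun x => !![α, 0, 0; 0, β, 0; -(5 / 4 * ev (u12 0) x), 0, 1])
    (mul_ne_zero (by norm_num) hα0) hessian_mul_grad12
    polyJac_mul_grad12 (fun x i => ?_) rfl (fun x => ?_) (fun x => ?_) (fun x => ?_)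
    (fun x => rfl) ?_
  · have c := HasGrad.coord (analyticAt_evs u12 x)
    fin_cases i
    · refine ((c 0).const_mul α).congr_grad ?_
      ext j; fin_cases j <;> simp
    · refine ((c 1).const_mul β).congr_grad ?_
      ext j; fin_cases j <;> simp
    · refine ((c 2).sub (((c 0).pow 2).const_mul (5 / 8))).congr_grad ?_
      ext j; fin_cases j <;> simp
      ring
  · simp [Matrix.det_fin_three, hα0, hβ0]
  · ext i j
    fin_cases i <;> fin_cases j <;>
      simp [Matrix.mul_apply, Fin.sum_univ_three, FrobType.gform] <;> grind
  · ext i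
    fin_cases i <;> simp [Matrix.mulVec, dotProduct, Fin.sum_univ_three, FrobType.unityIndex]
  · simp [FrobType.eta, FrobType.unityIndex]
    field_simp

/-- The (0,0) entry forces κ = 10α; the coefficient of u₃ in the (1,1) entry gives α⁶/2 = κ, hence
α⁵ = 20. -/
theorem chart_H3_u14 {α : ℂ} (hα : α ^ 5 = 20) :
    IsTypeChart .H3 (u14 0) (coordField u14 2) (fun x => 1 / 10 * ev (u14 0) x)
      {x | ev (critPoly u14) x ≠ 0}
      (fun x => ![α * ev (u14 0) x, -α ^ 3 * (ev (u14 1) x - ev (u14 0) x ^ 3),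
        ev (u14 2) x - 20 * (ev (u14 0) x ^ 2 * ev (u14 1) x) + 14 * ev (u14 0) x ^ 5])
      (10 * α) := by
  have hα0 : α ≠ 0 := by rintro rfl; norm_num at hα
  refine chart_poly (α := α)
    (A := fun x => !![α, 0, 0; 3 * α ^ 3 * ev (u14 0) x ^ 2, -α ^ 3, 0;
      -(40 * (ev (u14 0) x * ev (u14 1) x)) + 70 * ev (u14 0) x ^ 4, -(20 * ev (u14 0) x ^ 2), 1])
    (mul_ne_zero (by norm_num) hα0) hessian_mul_grad14
    polyJac_mul_grad14 (fun x i => ?_) rfl (fun x => ?_) (fun x => ?_) (fun x => ?_)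
    (fun x => rfl) ?_
  · have c := HasGrad.coord (analyticAt_evs u14 x)
    fin_cases i
    · refine ((c 0).const_mul α).congr_grad ?_
      ext j; fin_cases j <;> simp
    · refine (((c 1).sub ((c 0).pow 3)).const_mul (-α ^ 3)).congr_grad ?_
      ext j; fin_cases j <;> simp
      ring
    · refine (((c 2).sub ((((c 0).pow 2).mul (c 1)).const_mul 20)).add
        (((c 0).pow 5).const_mul 14)).congr_grad ?_
      ext j; fin_cases j <;> simp <;> ring
  · simp [Matrix.det_fin_three, hα0]
  · ext i j
    fin_cases i <;> fin_cases j <;>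
      simp [Matrix.mul_apply, Fin.sum_univ_three, FrobType.gform] <;> grind
  · ext i
    fin_cases i <;> simp [Matrix.mulVec, dotProduct, Fin.sum_univ_three, FrobType.unityIndex]
  · simp [FrobType.eta, FrobType.unityIndex]
    field_simp

section
variable {G : Subgroup SL3} (hG : (G : Set SL3).Finite)
include hG

theorem yieldsFlat_A3_u12 (hu : ∀ i, u12 i ∈ invariantRing G)
    (hmin : IsMinimalDegreeInvariant G (u12 0)) :
    YieldsFlat G (u12 0) (coordField u12 2) (fun x => 5 / 12 * ev (u12 0) x) .A3
        (fun x => ![5 / 12 * ev (u12 0) x, 4 * ((√10 : ℝ) : ℂ) * Complex.I * ev (u12 1) x,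
          ev (u12 2) x - 5 / 8 * ev (u12 0) x ^ 2]) ∧
      Yields G (u12 0) (dualField u12 2 4) (fun x => -(5 / 12 * ev (u12 0) x)) .A3d := by
  obtain ⟨α, hα⟩ := exists_root (-3 / 4) (n := 2) (by norm_num)
  obtain ⟨β, hβ⟩ := exists_root (-384 * α) (n := 2) (by norm_num)
  have hα0 : α ≠ 0 := by rintro rfl; norm_num at hα
  have hβ0 : β ≠ 0 := by rintro rfl; simp [hα0] at hβ
  constructor
  · refine yieldsFlat_of_charts hG hmin critPoly_u12_ne_zero (coordField_invariant hu 2)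
      (const_mul_invariant (hu 0) _) fun p hp => ⟨_, _, _, hp, chart_A3_u12 hα hβ,
      diagonal ![5 / (12 * α), 4 * ((√10 : ℝ) : ℂ) * Complex.I / β, 1], ?_, fun x hx => ?_⟩
    · rw [Matrix.det_diagonal, Fin.prod_univ_three]
      simp [hα0, hβ0]
    · ext i
      rw [Matrix.mulVec_diagonal]
      fin_cases i <;> simp <;> field_simp
  · refine yields_of_charts hG hmin critPoly_u12_ne_zero (dualField_invariant hu 2 4)
      (neg_const_mul_invariant (hu 0) _) fun p hp => ⟨_, _, _, hp, (chart_A3_u12 hα hβ).dual_A3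
      hα0 (u := ev (u12 0)) (fun x _ => rfl) fun x hx => ?_⟩
    rw [Set.mem_ofPred_eq, ev_critPoly] at hx
    exact right_ne_zero_of_mul hx

theorem yieldsFlat_H3_u14 (hu : ∀ i, u14 i ∈ invariantRing G)
    (hmin : IsMinimalDegreeInvariant G (u14 0)) :
    YieldsFlat G (u14 0) (coordField u14 2) (fun x => 1 / 10 * ev (u14 0) x) .H3
        (fun x => ![1 / 10 * ev (u14 0) x,
          ((√2 : ℝ) : ℂ) * ev (u14 1) x - ((√2 : ℝ) : ℂ) * ev (u14 0) x ^ 3,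
          14 * ev (u14 0) x ^ 5 - 20 * ev (u14 1) x * ev (u14 0) x ^ 2 + ev (u14 2) x]) ∧
      Yields G (u14 0) (dualField u14 2 10) (fun x => -(1 / 10 * ev (u14 0) x)) .H3d := by
  obtain ⟨α, hα⟩ := exists_root 20 (n := 5) (by norm_num)
  have hα0 : α ≠ 0 := by rintro rfl; norm_num at hα
  constructor
  · refine yieldsFlat_of_charts hG hmin critPoly_u14_ne_zero (coordField_invariant hu 2)
      (const_mul_invariant (hu 0) _) fun p hp => ⟨_, _, _, hp, chart_H3_u14 hα,
      diagonal ![1 / (10 * α), -(((√2 : ℝ) : ℂ) / α ^ 3), 1], ?_, fun x hx => ?_⟩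
    · rw [Matrix.det_diagonal, Fin.prod_univ_three]
      simp [hα0]
    · ext i
      rw [Matrix.mulVec_diagonal]
      fin_cases i <;> simp <;> field_simp
      ring
  · refine yields_of_charts hG hmin critPoly_u14_ne_zero (dualField_invariant hu 2 10)
      (neg_const_mul_invariant (hu 0) _) fun p hp => ⟨_, _, _, hp, (chart_H3_u14 hα).dual_H3
      hα0 (u := ev (u14 0)) (fun x _ => rfl) fun x hx => ?_⟩
    rw [Set.mem_ofPred_eq, ev_critPoly] at hx
    exact right_ne_zero_of_mul hx

end

/-! ### Hessian metrics that are not flat -/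

/-- The derivative of the Hessian in direction `i`. -/
def thirdDeriv (f : Poly) (i : Fin 3) (x : V3) : Mat3 :=
  Matrix.of fun a b => ev (pderiv i (pderiv a (pderiv b f))) x

theorem pderiv_comm (f : Poly) (i j : Fin 3) :
    pderiv i (pderiv j f) = pderiv j (pderiv i f) := by
  refine ev_injective fun x => ?_
  rw [← pd_ev_fun, ← pd_ev_fun, ← pd_ev_fun, ← pd_ev_fun]
  exact pd_comm (analyticAt_ev f x) i j

theorem mpd_hessian (f : Poly) (i : Fin 3) (x : V3) : mpd i (hessian f) x = thirdDeriv f i x := by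
  ext a b
  exact pd_ev _ _ _

theorem MAn.hessian (f : Poly) (x : V3) : MAn (hessian f) x := fun _ _ => analyticAt_ev _ _

theorem hessian_isSymm (f : Poly) (x : V3) : (hessian f x).IsSymm := by
  ext i j
  simp only [hessian, Matrix.transpose_apply, Matrix.of_apply, pderiv_comm f i j]

theorem thirdDeriv_isSymm (f : Poly) (i : Fin 3) (x : V3) : (thirdDeriv f i x)ᵀ = thirdDeriv f i x := by
  ext a b
  simp only [thirdDeriv, Matrix.transpose_apply, Matrix.of_apply, pderiv_comm f a b]

/-- The derivatives of a Hessian metric are totally symmetric, so two of the three terms of the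
Christoffel symbol cancel and half of H⁻¹∂ᵢH is left. -/
theorem chrM_hessian {f : Poly} {x : V3} (hd : (hessian f x).det ≠ 0) (i : Fin 3) :
    chrM (hessian f) i x = (1 / 2 : ℂ) • ((hessian f x)⁻¹ * thirdDeriv f i x) := by
  refine chrM_eq (B := fun i => (1 / 2 : ℂ) • ((hessian f x)⁻¹ * thirdDeriv f i x))
    (hessian_isSymm f x) hd (fun i j k => ?_) (fun i => ?_) i
  · simp only [Matrix.smul_apply, Matrix.mul_apply, thirdDeriv, Matrix.of_apply]
    refine congrArg _ (Finset.sum_congr rfl fun l _ => ?_)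
    rw [pderiv_comm f l j, pderiv_comm f l i, pderiv_comm (pderiv l f) i j]
  · rw [mpd_hessian, Matrix.transpose_smul, Matrix.transpose_mul, Matrix.transpose_nonsing_inv,
      hessian_isSymm, thirdDeriv_isSymm, Matrix.smul_mul, Matrix.mul_smul, mul_assoc,
      inv_mul_self_of hd, mul_one, ← mul_assoc, self_mul_inv_of hd, one_mul, ← add_smul]
    norm_num

/-- Flatness of a Hessian metric is an algebraic condition on third derivatives. -/
theorem commute_of_flat {f : Poly} {U : Set V3} (hU : IsOpen U)
    (hf : IsFlatContravariantMetric U (hessMetric f)) {x : V3} (hx : x ∈ U) (i j : Fin 3) :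
    thirdDeriv f i x * (hessian f x).adjugate * thirdDeriv f j x
      = thirdDeriv f j x * (hessian f x).adjugate * thirdDeriv f i x := by
  have hdet : ∀ y ∈ U, (hessian f y).det ≠ 0 := fun y hy h0 => hf.nondeg y hy (by
    rw [hessMetric, Matrix.det_nonsing_inv, h0]; simp)
  have hd := hdet x hx
  have hlow : lower (hessMetric f) =ᶠ[𝓝 x] hessian f :=
    Filter.eventuallyEq_of_mem (hU.mem_nhds hx) fun y hy =>
      Matrix.nonsing_inv_nonsing_inv _ (isUnit_iff_ne_zero.2 (hdet y hy))
  have hc : ∀ i, chrM (lower (hessMetric f)) i =ᶠ[𝓝 x]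
      fun y => (1 / 2 : ℂ) • ((hessian f y)⁻¹ * thirdDeriv f i y) := fun i => by
    filter_upwards [hlow.eventuallyEq_nhds, hU.mem_nhds hx] with y hy hyU
    rw [← chrM_hessian (hdet y hyU)]
    ext k j
    simp only [chrM, Matrix.of_apply, christoffel, hy.eq_of_nhds]
    congr 1
    refine Finset.sum_congr rfl fun l _ => ?_
    have e : ∀ a b c, pd a (fun y => lower (hessMetric f) y b c) y = pd a (fun y => hessian f y b c) y :=
      fun a b c => pd_congr (hy.mono fun z hz => by simp only [hz]) a
    rw [e, e, e]
  have hA : ∀ i, MAn (thirdDeriv f i) x := fun i _ _ => analyticAt_ev _ _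
  have hT : ∀ i j, mpd i (thirdDeriv f j) x = mpd j (thirdDeriv f i) x := fun i j => by
    ext a b
    simp only [mpd, thirdDeriv, Matrix.of_apply]
    rw [pd_ev, pd_ev, pderiv_comm]
  have hm : ∀ i j, mpd i (chrM (lower (hessMetric f)) j) x = (1 / 2 : ℂ) •
      (-((hessian f x)⁻¹ * thirdDeriv f i x * (hessian f x)⁻¹) * thirdDeriv f j x
        + (hessian f x)⁻¹ * mpd i (thirdDeriv f j) x) := fun i j => by
    have hi := (MAn.hessian f x).inv hd
    rw [mpd_congr (hc j), mpd_const_smul _ (hi.mul (hA j)), mpd_mul hi (hA j),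
      mpd_inv (MAn.hessian f x) hd, mpd_hessian]
  -- The fourth derivatives of f are symmetric and drop out. Differentiating H⁻¹ contributes -1/2 of
  -- the commutator and the quadratic term of the curvature +1/4, so flatness leaves the commutator
  -- itself equal to zero.
  have key : (hessian f x)⁻¹ * thirdDeriv f i x * (hessian f x)⁻¹ * thirdDeriv f j x
      = (hessian f x)⁻¹ * thirdDeriv f j x * (hessian f x)⁻¹ * thirdDeriv f i x := by
    have h0 : mpd i (chrM (lower (hessMetric f)) j) x - mpd j (chrM (lower (hessMetric f)) i) x
        + (chrM (lower (hessMetric f)) i x * chrM (lower (hessMetric f)) j x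
          - chrM (lower (hessMetric f)) j x * chrM (lower (hessMetric f)) i x) = 0 := by
      ext l k
      rw [← curvature_eq]
      exact hf.flat x hx l k i j
    rw [hm, hm, hT j i, (hc i).eq_of_nhds, (hc j).eq_of_nhds] at h0
    simp only [Matrix.smul_mul, Matrix.mul_smul, smul_smul, ← mul_assoc, neg_mul] at h0
    have h1 : (1 / 4 : ℂ) • ((hessian f x)⁻¹ * thirdDeriv f i x * (hessian f x)⁻¹ * thirdDeriv f j x
        - (hessian f x)⁻¹ * thirdDeriv f j x * (hessian f x)⁻¹ * thirdDeriv f i x) = 0 := by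
      rw [← neg_eq_zero, ← h0]
      module
    exact sub_eq_zero.1 ((smul_eq_zero.1 h1).resolve_left (by norm_num))
  -- Multiplication by H and by its determinant replaces the inverse by the adjugate and makes the
  -- condition polynomial in x.
  have := congrArg (fun M => (hessian f x).det • (hessian f x * M)) key
  simp only [← mul_assoc, self_mul_inv_of hd, one_mul] at this
  have hadj : (hessian f x).adjugate = (hessian f x).det • (hessian f x)⁻¹ := by
    rw [Matrix.inv_def, Ring.inverse_eq_inv', smul_smul, mul_inv_cancel₀ hd, one_smul]
  rw [hadj]
  simpa only [Matrix.mul_smul, Matrix.smul_mul] using this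

theorem exists_mem_ne_zero {U : Set V3} (hU : IsOpen U) (hne : U.Nonempty) :
    ∃ x ∈ U, ∀ i, x i ≠ 0 := by
  obtain ⟨x, hx, hxU⟩ := (dense_ev_ne_zero xyz_ne_zero).exists_mem_open hU hne
  refine ⟨x, hxU, fun i => ?_⟩
  rw [Set.mem_ofPred_eq, ev_xyz] at hx
  have := left_ne_zero_of_mul hx
  fin_cases i
  · exact left_ne_zero_of_mul this
  · exact right_ne_zero_of_mul this
  · exact right_ne_zero_of_mul hx

/-- The Hessian of `f` is invertible with flat inverse on a nonempty open set. -/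
def IsFlatHessian (f : Poly) : Prop :=
  ∃ U : Set V3, IsOpen U ∧ U.Nonempty ∧ IsFlatContravariantMetric U (hessMetric f)

theorem not_isFlatHessian_power (c : ℂ) (n : ℕ) : ¬ IsFlatHessian (c • (X 2 ^ n : Poly)) := by
  rintro ⟨U, _, ⟨x, hx⟩, h⟩
  refine h.nondeg x hx ?_
  rw [hessMetric, Matrix.det_nonsing_inv, Matrix.det_eq_zero_of_row_eq_zero 0]
  · simp
  · intro j
    fin_cases j <;> simp [hessian, pderiv_pow, pderiv_X, Pi.single_apply, Derivation.leibniz]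

theorem not_isFlatHessian_xyz {c : ℂ} (hc : c ≠ 0) : ¬ IsFlatHessian (c • xyz) := by
  rintro ⟨U, hU, hne, h⟩
  obtain ⟨x, hx, h0⟩ := exists_mem_ne_zero hU hne
  have hH : hessian (c • xyz) x = c • !![0, x 2, x 1; x 2, 0, x 0; x 1, x 0, 0] := by
    ext i j
    fin_cases i <;> fin_cases j <;> simp [hessian, xyz, pderiv_X, Pi.single_apply,
      Derivation.leibniz, smul_eq_C_mul]
  have hT : thirdDeriv (c • xyz) 0 x = c • !![0, 0, 0; 0, 0, 1; 0, 1, 0] ∧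
      thirdDeriv (c • xyz) 1 x = c • !![0, 0, 1; 0, 0, 0; 1, 0, 0] := by
    constructor <;> ext i j <;>
    fin_cases i <;> fin_cases j <;> simp [thirdDeriv, xyz, pderiv_X, Pi.single_apply,
      Derivation.leibniz, smul_eq_C_mul]
  -- At entry (1,0) one side is a nonzero multiple of z² and the other is zero, because row 1 of the
  -- derivative of the Hessian by y vanishes.
  have := congrFun (congrFun (commute_of_flat hU h hx 0 1) 1) 0
  rw [hH, hT.1, hT.2, Matrix.adjugate_smul] at this
  simp [Matrix.adjugate_fin_three, Matrix.mul_apply, Fin.sum_univ_three, hc, h0] at this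

/-- The pure power z⁶ cannot repair the obstruction of (xyz)²: in the tested entry of the commutator
a cancels and 64b⁴x⁴y⁴z⁶ remains up to sign. The combination with z⁶ is needed because both have
degree six in family (18) with q = 3. -/
theorem not_isFlatHessian_sextic {a b : ℂ} (hb : b ≠ 0) :
    ¬ IsFlatHessian (a • (X 2 ^ 6 : Poly) + b • xyz ^ 2) := by
  rintro ⟨U, hU, hne, h⟩
  obtain ⟨x, hx, h0⟩ := exists_mem_ne_zero hU hne
  have hH : hessian (a • (X 2 ^ 6 : Poly) + b • xyz ^ 2) x =
      !![2 * b * (x 1 * x 2) ^ 2, 4 * b * x 0 * x 1 * x 2 ^ 2, 4 * b * x 0 * x 1 ^ 2 * x 2;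
        4 * b * x 0 * x 1 * x 2 ^ 2, 2 * b * (x 0 * x 2) ^ 2, 4 * b * x 0 ^ 2 * x 1 * x 2;
        4 * b * x 0 * x 1 ^ 2 * x 2, 4 * b * x 0 ^ 2 * x 1 * x 2,
          2 * b * (x 0 * x 1) ^ 2 + 30 * a * x 2 ^ 4] := by
    ext i j
    fin_cases i <;> fin_cases j <;> simp [hessian, xyz, pderiv_ofNat, pderiv_pow, pderiv_X,
      Pi.single_apply, Derivation.leibniz, smul_eq_C_mul] <;> ring
  have hT : thirdDeriv (a • (X 2 ^ 6 : Poly) + b • xyz ^ 2) 0 x =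
      !![0, 4 * b * x 1 * x 2 ^ 2, 4 * b * x 1 ^ 2 * x 2;
        4 * b * x 1 * x 2 ^ 2, 4 * b * x 0 * x 2 ^ 2, 8 * b * x 0 * x 1 * x 2;
        4 * b * x 1 ^ 2 * x 2, 8 * b * x 0 * x 1 * x 2, 4 * b * x 0 * x 1 ^ 2] ∧
      thirdDeriv (a • (X 2 ^ 6 : Poly) + b • xyz ^ 2) 1 x =
      !![4 * b * x 1 * x 2 ^ 2, 4 * b * x 0 * x 2 ^ 2, 8 * b * x 0 * x 1 * x 2;
        4 * b * x 0 * x 2 ^ 2, 0, 4 * b * x 0 ^ 2 * x 2;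
        8 * b * x 0 * x 1 * x 2, 4 * b * x 0 ^ 2 * x 2, 4 * b * x 0 ^ 2 * x 1] := by
    constructor <;> ext i j <;>
    fin_cases i <;> fin_cases j <;> simp [thirdDeriv, xyz, pderiv_ofNat, pderiv_pow, pderiv_X,
      Pi.single_apply, Derivation.leibniz, smul_eq_C_mul] <;> ring
  have := congrFun (congrFun (commute_of_flat hU h hx 0 1) 1) 0
  rw [hH, hT.1, hT.2] at this
  simp [Matrix.adjugate_fin_three, Matrix.mul_apply, Fin.sum_univ_three] at this
  have hne : (64 * b ^ 4 * x 0 ^ 4 * x 1 ^ 4 * x 2 ^ 6 : ℂ) ≠ 0 := by simp [hb, h0]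
  refine hne ?_
  linear_combination -this

/-! ### Invariants of minimal degree -/

/-- Elements of a graded algebra with generators of degree at least `n`, modulo higher degree. -/
theorem adjoin_low_degree {S T : Set Poly} {n : ℕ} (hn : 0 < n)
    (hT : ∀ t ∈ T, t.IsHomogeneous n)
    (hS : ∀ s ∈ S, s ∈ T ∨ ∃ k, n < k ∧ s.IsHomogeneous k) {h : Poly}
    (hh : h ∈ Algebra.adjoin ℂ S) :
    ∃ c, ∃ w ∈ Submodule.span ℂ T, ∃ r ∈ idealOfVars (Fin 3) ℂ ^ (n + 1), h = C c + w + r := by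
  have hom : ∀ (p : Poly) (k l : ℕ), p.IsHomogeneous k → l ≤ k → p ∈ idealOfVars (Fin 3) ℂ ^ l :=
    fun p k l hp hl => (mem_pow_idealOfVars_iff' _ _).2 fun d hd => by
      exact hp.coeff_eq_zero (by omega)
  have hw : ∀ w ∈ Submodule.span ℂ T, w ∈ idealOfVars (Fin 3) ℂ ^ n := fun w hw => by
    induction hw using Submodule.span_induction with
    | mem t ht => exact hom t n n (hT t ht) le_rfl
    | zero => exact zero_mem _
    | add _ _ _ _ h1 h2 => exact add_mem h1 h2
    | smul c _ _ h1 => rw [smul_eq_C_mul]; exact Ideal.mul_mem_left _ _ h1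
  induction hh using Algebra.adjoin_induction with
  | mem s hs =>
    rcases hS s hs with h | ⟨k, hk, h⟩
    · exact ⟨0, s, Submodule.subset_span h, 0, zero_mem _, by simp⟩
    · exact ⟨0, 0, zero_mem _, s, hom s k _ h hk, by simp⟩
  | algebraMap c => exact ⟨c, 0, zero_mem _, 0, zero_mem _, by simp [algebraMap_eq]⟩
  | add p q _ _ hp hq =>
    obtain ⟨c, w, hw, r, hr, rfl⟩ := hp
    obtain ⟨c', w', hw', r', hr', rfl⟩ := hq
    exact ⟨c + c', w + w', add_mem hw hw', r + r', add_mem hr hr', by rw [C_add]; ring⟩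
  | mul p q _ _ hp hq =>
    obtain ⟨c, w, hw1, r, hr, rfl⟩ := hp
    obtain ⟨c', w', hw2, r', hr', rfl⟩ := hq
    refine ⟨c * c', c • w' + c' • w, add_mem (Submodule.smul_mem _ _ hw2)
      (Submodule.smul_mem _ _ hw1), C c * r' + C c' * r + (w + r) * (w' + r'), ?_, ?_⟩
    · have hle : idealOfVars (Fin 3) ℂ ^ (n + 1) ≤ idealOfVars (Fin 3) ℂ ^ n :=
        Ideal.pow_le_pow_right (by omega)
      refine add_mem (add_mem (Ideal.mul_mem_left _ _ hr') (Ideal.mul_mem_left _ _ hr)) ?_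
      -- The product of two parts without constant term lies in the power 2n of the ideal, hence in
      -- the power n + 1 because n > 0.
      have := Ideal.mul_mem_mul (add_mem (hw _ hw1) (hle hr)) (add_mem (hw _ hw2) (hle hr'))
      rw [← pow_add] at this
      exact Ideal.pow_le_pow_right (by omega) this
    · rw [smul_eq_C_mul, smul_eq_C_mul, C_mul]; ring

section
variable {G : Subgroup SL3} {S T : Set Poly} (hGS : FiniteWithInvariants G S) {n : ℕ} (hn : 0 < n)
  (hT : ∀ t ∈ T, t.IsHomogeneous n) (hS : ∀ s ∈ S, s ∈ T ∨ ∃ k, n < k ∧ s.IsHomogeneous k)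
include hGS hn hT hS

theorem eq_zero_of_degree_lt {h : Poly} (hh : h ∈ invariantRing G) {k : ℕ} (hk : 0 < k)
    (hkn : k < n) (hom : h.IsHomogeneous k) : h = 0 := by
  rw [hGS.2] at hh
  obtain ⟨c, w, hw, r, hr, e⟩ := adjoin_low_degree hn hT hS hh
  have hw' : w.IsHomogeneous n := (homogeneousSubmodule (Fin 3) ℂ n).span_le.2 hT hw
  ext d
  rw [coeff_zero]
  by_cases hd : d.degree = k
  swap
  · exact hom.coeff_eq_zero hd
  rw [e, coeff_add, coeff_add, (mem_pow_idealOfVars_iff' _ _).1 hr d (by omega),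
    hw'.coeff_eq_zero (by omega), coeff_C, if_neg]
  · simp
  · rintro rfl; simp at hd; omega

theorem mem_span_of_degree {h : Poly} (hh : h ∈ invariantRing G) (hom : h.IsHomogeneous n) :
    h ∈ Submodule.span ℂ T := by
  rw [hGS.2] at hh
  obtain ⟨c, w, hw, r, hr, e⟩ := adjoin_low_degree hn hT hS hh
  have hw' : w.IsHomogeneous n := (homogeneousSubmodule (Fin 3) ℂ n).span_le.2 hT hw
  suffices h = w by rwa [this]
  have hd' : (h - w).IsHomogeneous n := hom.sub hw'
  rw [← sub_eq_zero]
  ext d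
  rw [coeff_zero]
  by_cases hd : d.degree = n
  swap
  · exact hd'.coeff_eq_zero hd
  rw [e, add_right_comm, add_sub_cancel_right, coeff_add,
    (mem_pow_idealOfVars_iff' _ _).1 hr d (by omega), coeff_C, if_neg]
  · simp
  · rintro rfl; simp at hd; omega

theorem isMinimal_of_degree {f : Poly} (hf : f ∈ invariantRing G) (h0 : f ≠ 0)
    (hom : f.IsHomogeneous n) : IsMinimalDegreeInvariant G f :=
  ⟨h0, hf, n, hn, hom, fun _ _ hk h0 hh hom => not_lt.1 fun hlt =>
    h0 (eq_zero_of_degree_lt hGS hn hT hS hh hk hlt hom)⟩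

theorem mem_span_of_isMinimal {f t : Poly} (ht : t ∈ S) (h0 : t ≠ 0) (hom : t.IsHomogeneous n)
    (hf : IsMinimalDegreeInvariant G f) : f ∈ Submodule.span ℂ T := by
  obtain ⟨hf0, hfi, k, hk, hfk, hmin⟩ := hf
  have hkn : k ≤ n := hmin n t hn h0 (by rw [hGS.2]; exact Algebra.subset_adjoin ht) hom
  rcases hkn.lt_or_eq with h | rfl
  · exact absurd (eq_zero_of_degree_lt hGS hn hT hS hfi hk h hfk) hf0
  · exact mem_span_of_degree hGS hn hT hS hfi hfk

end

/-! ### The individual groups -/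

theorem hom_pow (i : Fin 3) (m : ℕ) : (X i ^ m : Poly).IsHomogeneous m := by
  simpa using (isHomogeneous_X ℂ i).pow m

theorem hom_xyz : xyz.IsHomogeneous 3 :=
  ((isHomogeneous_X ℂ 0).mul (isHomogeneous_X ℂ 1)).mul (isHomogeneous_X ℂ 2)

theorem hom_e1 (m : ℕ) : (e1 m).IsHomogeneous m :=
  ((hom_pow 0 m).add (hom_pow 1 m)).add (hom_pow 2 m)

theorem hom_e2 (m : ℕ) : (e2 m).IsHomogeneous (m + m) :=
  (((hom_pow 0 m).mul (hom_pow 1 m)).add ((hom_pow 1 m).mul (hom_pow 2 m))).add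
    ((hom_pow 2 m).mul (hom_pow 0 m))

theorem hom_vdm (m : ℕ) : (vdm m).IsHomogeneous (m + m + m) :=
  (((hom_pow 0 m).sub (hom_pow 1 m)).mul ((hom_pow 2 m).sub (hom_pow 0 m))).mul
    ((hom_pow 1 m).sub (hom_pow 2 m))

theorem hom_ofNat (n : ℕ) [n.AtLeastTwo] : (ofNat(n) : Poly).IsHomogeneous 0 := by
  rw [← map_ofNat C n]; exact isHomogeneous_C _ _

theorem FiniteWithInvariants.mem {G : Subgroup SL3} {S : Set Poly} (h : FiniteWithInvariants G S)
    {s : Poly} (hs : s ∈ S) : s ∈ invariantRing G := by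
  rw [h.2]; exact Algebra.subset_adjoin hs

theorem FiniteWithInvariants.isMinimal {G : Subgroup SL3} {S : Set Poly}
    (h : FiniteWithInvariants G S) {n : ℕ} (hn : 0 < n)
    (hS : ∀ s ∈ S, ∃ k, n ≤ k ∧ s.IsHomogeneous k) {f : Poly} (hf : f ∈ invariantRing G)
    (h0 : f ≠ 0) (hom : f.IsHomogeneous n) : IsMinimalDegreeInvariant G f :=
  isMinimal_of_degree h hn (T := {t | t.IsHomogeneous n}) (fun _ ht => ht) (fun s hs => by
    obtain ⟨k, hk, hsk⟩ := hS s hs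
    rcases hk.lt_or_eq with h | rfl
    · exact .inr ⟨k, h, hsk⟩
    · exact .inl hsk) hf h0 hom

/-- If the only generator of minimal degree has no flat Hessian, then (F) fails. -/
theorem FiniteWithInvariants.not_hasFlatHessian {G : Subgroup SL3} {S : Set Poly}
    (h : FiniteWithInvariants G S) {n : ℕ} (hn : 0 < n) {t : Poly} (ht : t ∈ S) (h0 : t ≠ 0)
    (hom : t.IsHomogeneous n) (hS : ∀ s ∈ S, s = t ∨ ∃ k, n < k ∧ s.IsHomogeneous k)
    (hflat : ∀ c : ℂ, c ≠ 0 → ¬ IsFlatHessian (c • t)) : ¬ HasFlatHessian G := by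
  rintro ⟨f, hmin, hf⟩
  obtain ⟨c, rfl⟩ := Submodule.mem_span_singleton.1 (mem_span_of_isMinimal h hn
    (T := {t}) (by rintro _ rfl; exact hom) hS ht h0 hom hmin)
  exact hflat c (fun hc => hmin.1 (by rw [hc, zero_smul])) hf

theorem not_isFlatHessian_xyz_sq {c : ℂ} (hc : c ≠ 0) : ¬ IsFlatHessian (c • xyz ^ 2) := by
  simpa using not_isFlatHessian_sextic (a := 0) hc

variable {G : Subgroup SL3}

theorem family_one {m : ℕ} (hm : 1 < m) (h : FiniteWithInvariants G (gens1 m)) :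
    (HasFlatHessian G ↔ m ≤ 3) ∧
      (m ≤ 3 → (∀ i, symm3 m i ∈ invariantRing G) ∧ FiveStructures G m) ∧
      (m = 2 → TrivialStructure G) := by
  have hx : ∀ i, (X i ^ m : Poly) ∈ invariantRing G := fun i => h.mem (by
    fin_cases i <;> simp [gens1])
  have h3 : xyz ∈ invariantRing G := h.mem (by simp [gens1])
  have hu : ∀ i, symm3 m i ∈ invariantRing G := by
    intro i; fin_cases i
    · exact add_mem (add_mem (hx 0) (hx 1)) (hx 2)
    · exact add_mem (add_mem (mul_mem (hx 0) (hx 1)) (mul_mem (hx 1) (hx 2)))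
        (mul_mem (hx 2) (hx 0))
    · exact pow_mem h3 m
  have hmin : m ≤ 3 → IsMinimalDegreeInvariant G (e1 m) := fun hm3 =>
    h.isMinimal (by omega) (by
      rintro s (rfl | rfl | rfl | rfl)
      exacts [⟨m, le_rfl, hom_pow _ _⟩, ⟨m, le_rfl, hom_pow _ _⟩, ⟨m, le_rfl, hom_pow _ _⟩,
        ⟨3, hm3, hom_xyz⟩]) (hu 0) (e1_ne_zero m (by omega)) (hom_e1 m)
  have hfive : m ≤ 3 → FiveStructures G m := fun hm3 => fiveStructures h.1 hm (hmin hm3) hu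
  refine ⟨⟨fun hF => ?_, fun hm3 => (hfive hm3).2.1.hasFlatHessian⟩, fun hm3 => ⟨hu, hfive hm3⟩, ?_⟩
  -- For m > 3 the invariant xyz is, up to scalars, the only one of minimal degree. For m ≤ 3 the
  -- power sum p_m is among the minimal ones, and one flat choice of f suffices.
  · by_contra! hm3
    refine h.not_hasFlatHessian (n := 3) (by norm_num) (t := xyz) (by simp [gens1]) xyz_ne_zero
      hom_xyz ?_ (fun c hc => not_isFlatHessian_xyz hc) hF
    rintro s (rfl | rfl | rfl | rfl)
    exacts [.inr ⟨m, hm3, hom_pow _ _⟩, .inr ⟨m, hm3, hom_pow _ _⟩, .inr ⟨m, hm3, hom_pow _ _⟩,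
      .inl rfl]
  · rintro rfl
    exact trivialStructure h.1 (hmin (by norm_num)) (hx 2) (mul_mem (hx 0) (hx 1))

theorem family_two {m : ℕ} (hm : 1 ≤ m) (h : FiniteWithInvariants G (gens2 m)) :
    (HasFlatHessian G ↔ m = 1) ∧ (m = 1 → TrivialStructure G) := by
  have hz : (X 2 ^ 2 : Poly) ∈ invariantRing G := h.mem (by simp [gens2])
  have hxy : ((X 0 * X 1) ^ 2 : Poly) ∈ invariantRing G := h.mem (by simp [gens2])
  have hs : ∀ m, (X 0 ^ (2 * m) + X 1 ^ (2 * m) : Poly).IsHomogeneous (2 * m) := fun m =>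
    (hom_pow 0 _).add (hom_pow 1 _)
  have hd : (xyz * (X 0 ^ (2 * m) - X 1 ^ (2 * m)) : Poly).IsHomogeneous (3 + 2 * m) :=
    hom_xyz.mul ((hom_pow 0 _).sub (hom_pow 1 _))
  have h4 : ((X 0 * X 1) ^ 2 : Poly).IsHomogeneous ((1 + 1) * 2) :=
    ((isHomogeneous_X ℂ 0).mul (isHomogeneous_X ℂ 1)).pow 2
  have htriv : m = 1 → TrivialStructure G := by
    rintro rfl
    have he : e1 2 ∈ invariantRing G :=
      add_mem (h.mem (s := X 0 ^ 2 + X 1 ^ 2) (by simp [gens2])) hz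
    refine trivialStructure h.1 (h.isMinimal (n := 2) (by norm_num) ?_ he
      (e1_ne_zero 2 (by norm_num)) (hom_e1 2)) hz (by rwa [← mul_pow])
    rintro s (rfl | rfl | rfl | rfl)
    exacts [⟨_, by norm_num, hs 1⟩, ⟨_, by norm_num, h4⟩, ⟨_, by norm_num, hd⟩,
      ⟨2, le_rfl, hom_pow _ _⟩]
  refine ⟨⟨fun hF => ?_, fun h1 => (htriv h1).yields.hasFlatHessian⟩, htriv⟩
  -- For m > 1 the only minimal invariants are multiples of z², whose Hessian has rank one.
  by_contra hm1
  refine h.not_hasFlatHessian (n := 2) (by norm_num) (t := X 2 ^ 2) (by simp [gens2])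
    (pow_ne_zero _ (X_ne_zero _)) (hom_pow _ _) ?_ (fun c _ => not_isFlatHessian_power c 2) hF
  rintro s (rfl | rfl | rfl | rfl)
  exacts [.inr ⟨_, by omega, hs m⟩, .inr ⟨_, by norm_num, h4⟩, .inr ⟨_, by omega, hd⟩, .inl rfl]

theorem family_nine {m : ℕ} (hm : 1 < m) (h : FiniteWithInvariants G (gens9 m)) :
    (HasFlatHessian G ↔ m ≤ 3) ∧
      (m ≤ 3 → (∀ i, symm3 m i ∈ invariantRing G) ∧ FiveStructures G m) := by
  have h3 : xyz ∈ invariantRing G := h.mem (by simp [gens9])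
  have hu : ∀ i, symm3 m i ∈ invariantRing G := by
    intro i; fin_cases i
    · exact h.mem (by simp [gens9, symm3])
    · exact h.mem (by simp [gens9, symm3])
    · exact pow_mem h3 m
  have hfive : m ≤ 3 → FiveStructures G m := fun hm3 => fiveStructures h.1 hm
    (h.isMinimal (by omega) (by
      rintro s (rfl | rfl | rfl | rfl)
      exacts [⟨3, hm3, hom_xyz⟩, ⟨m, le_rfl, hom_e1 m⟩, ⟨_, by omega, hom_e2 m⟩,
        ⟨_, by omega, hom_vdm m⟩]) (hu 0) (e1_ne_zero m (by omega)) (hom_e1 m)) hu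
  refine ⟨⟨fun hF => ?_, fun hm3 => (hfive hm3).2.1.hasFlatHessian⟩, fun hm3 => ⟨hu, hfive hm3⟩⟩
  by_contra! hm3
  refine h.not_hasFlatHessian (n := 3) (by norm_num) (t := xyz) (by simp [gens9]) xyz_ne_zero
    hom_xyz ?_ (fun c hc => not_isFlatHessian_xyz hc) hF
  rintro s (rfl | rfl | rfl | rfl)
  exacts [.inl rfl, .inr ⟨m, hm3, hom_e1 m⟩, .inr ⟨_, by omega, hom_e2 m⟩,
    .inr ⟨_, by omega, hom_vdm m⟩]

theorem family_eleven {m : ℕ} (hm : 1 < m) (h : FiniteWithInvariants G (gens11 m)) :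
    (HasFlatHessian G ↔ m ≤ 6) ∧
      (m = 2 → (∀ i, symm3 m i ∈ invariantRing G) ∧ FiveStructures G m) ∧
      (3 ≤ m → m ≤ 6 →
        YieldsFlatLog G (e1 m) (coordField ![e1 m, xyz ^ 2, e2 m] 2)
          (fun x => ((m : ℂ) - 1) / (2 * m) * ev (e1 m) x) .A3 (xyz ^ 2)
          (fun x l => ![((m : ℂ) - 1) / (2 * m) * ev (e1 m) x, Complex.exp ((m : ℂ) / 4 * l),
            ev (e2 m) x - 1 / 8 * ev (e1 m) x ^ 2]) ∧
        Yields G (e1 m) (dualField ![e1 m, xyz ^ 2, e2 m] 2 4)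
          (fun x => -(((m : ℂ) - 1) / (2 * m) * ev (e1 m) x)) .A3d ∧
        YieldsFlatLog G (e1 m) (coordField ![e1 m, xyz ^ 2, e2 m] 0)
          (fun x => ((m : ℂ) - 1) / m * ev (e1 m) x) .B31 (xyz ^ 2)
          (fun x l => ![ev (e1 m) x, Complex.exp ((m : ℂ) / 8 * l),
            ev (e2 m) x * Complex.exp (-(m : ℂ) / 8 * l)])) := by
  have h1 : e1 m ∈ invariantRing G := h.mem (by simp [gens11])
  have h2 : e2 m ∈ invariantRing G := h.mem (by simp [gens11])
  have h3 : xyz ^ 2 ∈ invariantRing G := h.mem (by simp [gens11])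
  have hx2 : (xyz ^ 2).IsHomogeneous (3 * 2) := hom_xyz.pow 2
  have hv : (xyz * vdm m).IsHomogeneous (3 + (m + m + m)) := hom_xyz.mul (hom_vdm m)
  have hmin : m ≤ 6 → IsMinimalDegreeInvariant G (e1 m) := fun hm6 =>
    h.isMinimal (by omega) (by
      rintro s (rfl | rfl | rfl | rfl)
      exacts [⟨m, le_rfl, hom_e1 m⟩, ⟨_, hm6, hx2⟩, ⟨_, by omega, hom_e2 m⟩, ⟨_, by omega, hv⟩])
      h1 (e1_ne_zero m (by omega)) (hom_e1 m)
  have hu : ∀ i, (![e1 m, xyz ^ 2, e2 m] : Fin 3 → Poly) i ∈ invariantRing G := by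
    intro i; fin_cases i
    exacts [h1, h3, h2]
  have hA3d : m ≤ 6 → Yields G (e1 m) (dualField ![e1 m, xyz ^ 2, e2 m] 2 4)
      (fun x => -(((m : ℂ) - 1) / (2 * m) * ev (e1 m) x)) .A3d := fun hm6 =>
    yields_A3d_triple h.1 hm (hmin hm6) hu (a := 1) (b := 0) one_ne_zero rfl rfl (fun y => by simp)
  refine ⟨⟨fun hF => ?_, fun hm6 => (hA3d hm6).hasFlatHessian⟩, ?_, fun _ hm6 =>
    ⟨?_, hA3d hm6, ?_⟩⟩
  -- For m > 6 the minimal invariants are the multiples of (xyz)², of degree six.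
  · by_contra! hm6
    refine h.not_hasFlatHessian (n := 6) (by norm_num) (t := xyz ^ 2) (by simp [gens11])
      (pow_ne_zero _ xyz_ne_zero) hx2 ?_ (fun c hc => not_isFlatHessian_xyz_sq hc) hF
    rintro s (rfl | rfl | rfl | rfl)
    exacts [.inr ⟨m, hm6, hom_e1 m⟩, .inl rfl, .inr ⟨_, by omega, hom_e2 m⟩,
      .inr ⟨_, by omega, hv⟩]
  · rintro rfl
    have hu' : ∀ i, symm3 2 i ∈ invariantRing G := by
      intro i; fin_cases i
      exacts [h1, h2, h3]
    exact ⟨hu', fiveStructures h.1 hm (hmin (by norm_num)) hu'⟩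
  · refine yieldsFlatLog_A3_triple h.1 hm (hmin hm6) hu (a := 1) (b := 0) one_ne_zero rfl rfl
      (fun y => by simp) (fun x => rfl) one_ne_zero (fun x l => rfl) (fun x l => ?_) (fun x l => ?_)
    · simp only [Matrix.cons_val_one, Matrix.cons_val_zero, one_mul]
      congr 1; ring
    · simp
  · refine yieldsFlatLog_B31_triple h.1 hm (hmin hm6) hu one_ne_zero one_ne_zero (fun y => by simp)
      rfl (fun y => by simp) (fun x => rfl) (n := 2) (fun x => ev_pow _ _ _) one_ne_zero one_ne_zero
      (fun x l => by simp) (fun x l => ?_) (fun x l => ?_)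
    · simp only [Matrix.cons_val_one, Matrix.cons_val_zero]
      congr 1; push_cast; ring
    · simp only [Matrix.cons_val, one_mul]
      congr 2; push_cast; ring

theorem group_twelve (h : FiniteWithInvariants G gens12) :
    HasFlatHessian G ∧
      YieldsFlat G (u12 0) (coordField u12 2) (fun x => 5 / 12 * ev (u12 0) x) .A3
        (fun x => ![5 / 12 * ev (u12 0) x, 4 * ((√10 : ℝ) : ℂ) * Complex.I * ev (u12 1) x,
          ev (u12 2) x - 5 / 8 * ev (u12 0) x ^ 2]) ∧
      Yields G (u12 0) (dualField u12 2 4) (fun x => -(5 / 12 * ev (u12 0) x)) .A3d := by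
  have hu : ∀ i, u12 i ∈ invariantRing G := fun i => h.mem (by fin_cases i <;> simp [gens12])
  have d0 : (u12 0).IsHomogeneous 6 :=
    ((hom_e1 3).pow 2).sub (by simpa using (hom_ofNat 12).mul (hom_e2 3))
  have d1 : (u12 1).IsHomogeneous (3 + 3 + 3) :=
    (((hom_pow 0 3).sub (hom_pow 1 3)).mul ((hom_pow 1 3).sub (hom_pow 2 3))).mul
      ((hom_pow 2 3).sub (hom_pow 0 3))
  have d2 : (u12 2).IsHomogeneous 12 := ((hom_e1 3).pow 4).add (by
    simpa using ((hom_ofNat 216).mul (hom_xyz.pow 3)).mul (hom_e1 3))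
  have d3 : ((e1 3 ^ 2 - 6 * xyz * e1 3 - 18 * xyz ^ 2) ^ 2 : Poly).IsHomogeneous (6 * 2) := by
    refine IsHomogeneous.pow ((((hom_e1 3).pow 2).sub ?_).sub ?_) 2
    · simpa using ((hom_ofNat 6).mul hom_xyz).mul (hom_e1 3)
    · simpa using (hom_ofNat 18).mul (hom_xyz.pow 2)
  have h0 : u12 0 ≠ 0 := ne_zero_of_ev (x := ![1, 0, 0]) (by simp [u12, ev_e1, ev_e2])
  have hmin : IsMinimalDegreeInvariant G (u12 0) := h.isMinimal (n := 6) (by norm_num) (by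
    rintro s (rfl | rfl | rfl | rfl)
    exacts [⟨_, le_rfl, d0⟩, ⟨_, by norm_num, d1⟩, ⟨_, by norm_num, d2⟩, ⟨_, by norm_num, d3⟩])
    (hu 0) h0 d0
  have := yieldsFlat_A3_u12 h.1 hu hmin
  exact ⟨this.2.hasFlatHessian, this⟩

theorem group_fourteen (h : FiniteWithInvariants G gens14) :
    HasFlatHessian G ∧
      YieldsFlat G (u14 0) (coordField u14 2) (fun x => 1 / 10 * ev (u14 0) x) .H3
        (fun x => ![1 / 10 * ev (u14 0) x,
          ((√2 : ℝ) : ℂ) * ev (u14 1) x - ((√2 : ℝ) : ℂ) * ev (u14 0) x ^ 3,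
          14 * ev (u14 0) x ^ 5 - 20 * ev (u14 1) x * ev (u14 0) x ^ 2 + ev (u14 2) x]) ∧
      Yields G (u14 0) (dualField u14 2 10) (fun x => -(1 / 10 * ev (u14 0) x)) .H3d := by
  have hu : ∀ i, u14 i ∈ invariantRing G := fun i => h.mem (by fin_cases i <;> simp [gens14])
  have x : ∀ i, (X i : Poly).IsHomogeneous 1 := isHomogeneous_X ℂ
  have p : ∀ i n, (X i ^ n : Poly).IsHomogeneous n := hom_pow
  have d0 : (u14 0).IsHomogeneous 2 := (p 0 2).add ((x 1).mul (x 2))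
  have d1 : (u14 1).IsHomogeneous 6 := by
    refine IsHomogeneous.add (IsHomogeneous.sub (IsHomogeneous.sub ?_ ?_) ?_) ?_
    · exact (((hom_ofNat 8).mul (x 1)).mul (x 2)).mul (p 0 4)
    · exact (((hom_ofNat 2).mul (p 1 2)).mul (p 2 2)).mul (p 0 2)
    · exact ((p 1 5).add (p 2 5)).mul (x 0)
    · exact (p 1 3).mul (p 2 3)
  have d2 : (u14 2).IsHomogeneous 10 := by
    refine IsHomogeneous.sub (IsHomogeneous.add (IsHomogeneous.add (IsHomogeneous.sub
      (IsHomogeneous.add (IsHomogeneous.add ?_ ?_) ?_) ?_) ?_) ?_) ?_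
    · exact p 1 10
    · exact ((hom_ofNat 6).mul (p 2 5)).mul (p 1 5)
    · exact (((hom_ofNat 20).mul (p 0 2)).mul (p 2 4)).mul (p 1 4)
    · exact (((hom_ofNat 160).mul (p 0 4)).mul (p 2 3)).mul (p 1 3)
    · exact (((hom_ofNat 320).mul (p 0 6)).mul (p 2 2)).mul (p 1 2)
    · exact p 2 10
    · refine IsHomogeneous.mul (m := 6) (n := 4)
        (((hom_ofNat 4).mul (x 0)).mul ((p 1 5).add (p 2 5))) (IsHomogeneous.add
        (IsHomogeneous.sub ((hom_ofNat 32).mul (p 0 4)) ?_) ?_)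
      · exact (((hom_ofNat 20).mul (x 1)).mul (x 2)).mul (p 0 2)
      · exact ((hom_ofNat 5).mul (p 1 2)).mul (p 2 2)
  have d3 : ((Matrix.of fun i j => pderiv j (u14 i)).det : Poly).IsHomogeneous 15 := by
    have e0 : ∀ j, (pderiv j (u14 0)).IsHomogeneous 1 := fun j => d0.pderiv
    have e1 : ∀ j, (pderiv j (u14 1)).IsHomogeneous 5 := fun j => d1.pderiv
    have e2 : ∀ j, (pderiv j (u14 2)).IsHomogeneous 9 := fun j => d2.pderiv
    have e : ∀ i j k, (pderiv i (u14 0) * pderiv j (u14 1) * pderiv k (u14 2)).IsHomogeneous 15 :=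
      fun i j k => ((e0 i).mul (e1 j)).mul (e2 k)
    rw [Matrix.det_fin_three]
    refine IsHomogeneous.sub (IsHomogeneous.add (IsHomogeneous.add (IsHomogeneous.sub
      (IsHomogeneous.sub ?_ ?_) ?_) ?_) ?_) ?_ <;> exact e _ _ _
  have h0 : u14 0 ≠ 0 := ne_zero_of_ev (x := ![1, 0, 0]) (by simp [u14])
  have hmin : IsMinimalDegreeInvariant G (u14 0) := h.isMinimal (n := 2) (by norm_num) (by
    rintro s (rfl | rfl | rfl | rfl)
    exacts [⟨_, le_rfl, d0⟩, ⟨_, by norm_num, d1⟩, ⟨_, by norm_num, d2⟩, ⟨_, by norm_num, d3⟩])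
    (hu 0) h0 d0
  have := yieldsFlat_H3_u14 h.1 hu hmin
  exact ⟨this.2.hasFlatHessian, this⟩

/-- Three cases according to degrees: for q ≥ 4 the minimal invariants are multiples of (xyz)². When
q ≤ 3 and p ≥ 2, they are multiples of z⁴ for q = 2 and combinations of z⁶ and (xyz)² for q = 3. -/
theorem not_hasFlatHessian_eighteen {p q : ℕ} (hp : 1 ≤ p) (hq : 2 ≤ q)
    (h : FiniteWithInvariants G (gens18 p q)) (hpq : ¬ (p = 1 ∧ q ≤ 3)) : ¬ HasFlatHessian G := by
  have d0 : (X 0 ^ (2 * p * q) + X 1 ^ (2 * p * q) : Poly).IsHomogeneous (2 * p * q) :=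
    (hom_pow _ _).add (hom_pow _ _)
  have d1 : ((X 0 * X 1) ^ (2 * q) : Poly).IsHomogeneous ((1 + 1) * (2 * q)) :=
    ((isHomogeneous_X ℂ 0).mul (isHomogeneous_X ℂ 1)).pow _
  have d2 : (xyz ^ 2).IsHomogeneous (3 * 2) := hom_xyz.pow 2
  have d3 : ((X 0 ^ (2 * p * q) - X 1 ^ (2 * p * q)) * xyz : Poly).IsHomogeneous (2 * p * q + 3) :=
    ((hom_pow _ _).sub (hom_pow _ _)).mul hom_xyz
  have hle : 2 * q ≤ 2 * p * q := Nat.mul_le_mul_right q (by omega)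
  have hle2 : p ≠ 1 → 4 * q ≤ 2 * p * q := fun h => Nat.mul_le_mul_right q (by omega)
  by_cases h4 : 4 ≤ q
  · refine h.not_hasFlatHessian (n := 6) (by norm_num) (t := xyz ^ 2) (by simp [gens18])
      (pow_ne_zero _ xyz_ne_zero) d2 ?_ (fun c hc => not_isFlatHessian_xyz_sq hc)
    rintro s (rfl | rfl | rfl | rfl | rfl)
    exacts [.inr ⟨_, by omega, d0⟩, .inr ⟨_, by omega, d1⟩, .inl rfl, .inr ⟨_, by omega, d3⟩,
      .inr ⟨_, by omega, hom_pow _ _⟩]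
  have hp1 : p ≠ 1 := fun h1 => hpq ⟨h1, by omega⟩
  have hle2 := hle2 hp1
  obtain rfl | rfl : q = 2 ∨ q = 3 := by omega
  · refine h.not_hasFlatHessian (n := 4) (by norm_num) (t := X 2 ^ 4) (by simp [gens18])
      (pow_ne_zero _ (X_ne_zero _)) (hom_pow _ _) ?_ (fun c _ => not_isFlatHessian_power c 4)
    rintro s (rfl | rfl | rfl | rfl | rfl)
    exacts [.inr ⟨_, by omega, d0⟩, .inr ⟨_, by omega, d1⟩, .inr ⟨_, by omega, d2⟩,
      .inr ⟨_, by omega, d3⟩, .inl rfl]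
  · rintro ⟨f, hmin, hf⟩
    obtain ⟨a, b, rfl⟩ := Submodule.mem_span_pair.1 (mem_span_of_isMinimal h (n := 6) (by norm_num)
      (T := {X 2 ^ 6, xyz ^ 2}) (by rintro _ (rfl | rfl); exacts [hom_pow _ _, d2]) (by
        rintro s (rfl | rfl | rfl | rfl | rfl)
        exacts [.inr ⟨_, by omega, d0⟩, .inr ⟨_, by omega, d1⟩, .inl (by simp),
          .inr ⟨_, by omega, d3⟩, .inl (by simp)]) (t := xyz ^ 2) (by simp [gens18])
      (pow_ne_zero _ xyz_ne_zero) d2 hmin)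
    by_cases hb : b = 0
    · rw [hb, zero_smul, add_zero] at hf
      exact not_isFlatHessian_power a 6 hf
    · exact not_isFlatHessian_sextic hb hf

theorem family_eighteen {p q : ℕ} (hp : 1 ≤ p) (hq : 2 ≤ q)
    (h : FiniteWithInvariants G (gens18 p q)) :
    (HasFlatHessian G ↔ p = 1 ∧ q ≤ 3) ∧
      (p = 1 → q ≤ 3 →
        (∀ i, symm3 (2 * q) i ∈ invariantRing G) ∧
        YieldsFlat G (e1 (2 * q))
          (coordField ![C ((2 * (q : ℂ) - 1) / (2 * q)) * e1 (2 * q), C (1 / 2) * X 2 ^ (2 * q),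
            (X 0 * X 1) ^ (2 * q)] 1)
          (fun x => (2 * (q : ℂ) - 1) / (2 * q) * ev (e1 (2 * q)) x) .T3
          (fun x => ![(2 * (q : ℂ) - 1) / (2 * q) * ev (e1 (2 * q)) x, 1 / 2 * x 2 ^ (2 * q),
            (x 0 * x 1) ^ q]) ∧
        YieldsFlatLog G (e1 (2 * q))
          (coordField ![C ((2 * (q : ℂ) - 1) / (2 * q)) * e1 (2 * q), xyz ^ 2, -2 * e2 (2 * q)] 0)
          (fun x => (2 * (q : ℂ) - 1) / (2 * q) * ev (e1 (2 * q)) x) .B31 (xyz ^ 2)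
          (fun x l => ![(2 * (q : ℂ) - 1) / (2 * q) * ev (e1 (2 * q)) x,
            Complex.exp ((q : ℂ) / 4 * l),
            -2 * ev (e2 (2 * q)) x * Complex.exp (-(q : ℂ) / 4 * l)]) ∧
        YieldsFlatLog G (e1 (2 * q))
          (coordField ![e1 (2 * q), xyz ^ 2, -2 * e2 (2 * q)] 2)
          (fun x => (2 * (q : ℂ) - 1) / (4 * q) * ev (e1 (2 * q)) x) .A3 (xyz ^ 2)
          (fun x l => ![(2 * (q : ℂ) - 1) / (4 * q) * ev (e1 (2 * q)) x,
            2 * ((√(2 * (q : ℝ) - 1) / √(q : ℝ) : ℝ) : ℂ) * Complex.exp ((q : ℂ) / 2 * l),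
            -2 * ev (e2 (2 * q)) x + 1 / 4 * ev (e1 (2 * q)) x ^ 2]) ∧
        Yields G (e1 (2 * q)) (dualField ![e1 (2 * q), xyz ^ 2, -2 * e2 (2 * q)] 2 4)
          (fun x => -((2 * (q : ℂ) - 1) / (4 * q) * ev (e1 (2 * q)) x)) .A3d) := by
  suffices hmain : p = 1 → q ≤ 3 → _ from
    ⟨⟨fun hF => by_contra fun hpq => not_hasFlatHessian_eighteen hp hq h hpq hF,
      fun hpq => (hmain hpq.1 hpq.2).2.2.2.2.hasFlatHessian⟩, hmain⟩
  rintro rfl hq3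
  have hm : 1 < 2 * q := by omega
  have hz : (X 2 ^ (2 * q) : Poly) ∈ invariantRing G := h.mem (by simp [gens18])
  have hs : (X 0 ^ (2 * q) + X 1 ^ (2 * q) : Poly) ∈ invariantRing G := h.mem (by simp [gens18])
  have hxy : ((X 0 * X 1) ^ (2 * q) : Poly) ∈ invariantRing G := h.mem (by simp [gens18])
  have h3 : xyz ^ 2 ∈ invariantRing G := h.mem (by simp [gens18])
  have h1 : e1 (2 * q) ∈ invariantRing G := add_mem hs hz
  have h2 : e2 (2 * q) ∈ invariantRing G := by
    -- For p = 1 the generators separate z from x and y; together they recover all symmetric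
    -- functions of the powers 2q.
    have : e2 (2 * q) = (X 0 * X 1) ^ (2 * q) + X 2 ^ (2 * q) * (X 0 ^ (2 * q) + X 1 ^ (2 * q)) := by
      rw [e2, mul_pow]; ring
    rw [this]
    exact add_mem hxy (mul_mem hz hs)
  have hC : ∀ c : ℂ, (C c : Poly) ∈ invariantRing G := fun c =>
    (invariantRing G).algebraMap_mem c
  have h2' : -2 * e2 (2 * q) ∈ invariantRing G := by
    rw [show -2 * e2 (2 * q) = -(e2 (2 * q) + e2 (2 * q)) by ring]
    exact neg_mem (add_mem h2 h2)
  have hmin : IsMinimalDegreeInvariant G (e1 (2 * q)) := h.isMinimal (by omega) (by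
    rintro s (rfl | rfl | rfl | rfl | rfl)
    · exact ⟨2 * 1 * q, by omega, (hom_pow _ _).add (hom_pow _ _)⟩
    · exact ⟨(1 + 1) * (2 * q), by omega,
        ((isHomogeneous_X ℂ 0).mul (isHomogeneous_X ℂ 1)).pow _⟩
    · exact ⟨3 * 2, by omega, hom_xyz.pow 2⟩
    · exact ⟨2 * 1 * q + 3, by omega, ((hom_pow _ _).sub (hom_pow _ _)).mul hom_xyz⟩
    · exact ⟨2 * q, le_rfl, hom_pow _ _⟩) h1 (e1_ne_zero _ (by omega)) (hom_e1 _)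
  have q0 : (q : ℂ) ≠ 0 := by norm_cast; omega
  have q1 : 2 * (q : ℂ) - 1 ≠ 0 := by
    rw [sub_ne_zero]; norm_cast; omega
  have hc : (2 * (q : ℂ) - 1) / (2 * q) ≠ 0 := div_ne_zero q1 (mul_ne_zero two_ne_zero q0)
  refine ⟨fun i => ?_, ?_, ?_, ?_, ?_⟩
  · fin_cases i
    · exact h1
    · exact h2
    · show xyz ^ (2 * q) ∈ _
      rw [pow_mul]; exact pow_mem h3 q
  · refine yieldsFlat_T3 h.1 hm hmin (fun i => ?_) hc (one_div_ne_zero two_ne_zero)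
      (fun y => by simp) (fun y => by simp) (fun y => by simp) (fun x => by push_cast; rfl) rfl
      (c := ![(2 * (q : ℂ) - 1) / (2 * q), 1 / 2, 1]) (fun i => ?_) (fun x => rfl) (fun x => rfl)
      (fun x => by simp)
    · fin_cases i
      exacts [mul_mem (hC _) h1, mul_mem (hC _) hz, hxy]
    · fin_cases i
      exacts [hc, one_div_ne_zero two_ne_zero, one_ne_zero]
  · refine yieldsFlatLog_B31_triple h.1 hm hmin (fun i => ?_) hc (a := -2) (by norm_num)
      (fun y => by simp) rfl (fun y => by simp) (fun x => by push_cast; rfl) (n := 2)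
      (fun x => ev_pow _ _ _) hc (b2 := -2) (by norm_num) (fun x l => rfl) (fun x l => ?_)
      (fun x l => ?_)
    · fin_cases i
      exacts [mul_mem (hC _) h1, h3, h2']
    · simp only [Matrix.cons_val_one, Matrix.cons_val_zero]
      congr 1; push_cast; ring
    · simp only [Matrix.cons_val, mul_assoc]
      congr 3; push_cast; ring
  · have hr : 2 * ((√(2 * (q : ℝ) - 1) / √(q : ℝ) : ℝ) : ℂ) ≠ 0 := by
      have : (2 : ℝ) ≤ q := by exact_mod_cast hq
      refine mul_ne_zero two_ne_zero (Complex.ofReal_ne_zero.2 (div_ne_zero ?_ ?_)) <;>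
        exact (Real.sqrt_pos.2 (by linarith)).ne'
    refine yieldsFlatLog_A3_triple h.1 hm hmin (fun i => ?_) (a := -2) (b := 0) (by norm_num) rfl rfl
      (fun y => by simp) (fun x => ?_) hr (fun x l => ?_) (fun x l => ?_) (fun x l => ?_)
    · fin_cases i
      exacts [h1, h3, h2']
    · push_cast; ring
    · simp only [Matrix.cons_val_zero]; push_cast; ring
    · simp only [Matrix.cons_val_one, Matrix.cons_val_zero]
      congr 2; push_cast; ring
    · simp only [Matrix.cons_val]; ring
  · have := yields_A3d_triple h.1 hm hmin (u := ![e1 (2 * q), xyz ^ 2, -2 * e2 (2 * q)])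
      (fun i => by
        fin_cases i
        exacts [h1, h3, h2']) (a := -2) (b := 0) (by norm_num) rfl rfl
      (fun y => by simp)
    convert this using 3
    push_cast; ring

/-- With exponent 6 the square root of e₃ is (xyz)³, a polynomial, so the flat coordinates need no
branch. The value ρ⁴ = -2 is the coefficient of e₂ in p₁₂ - (3/4)p₆² = -2e₂ + (1/4)e₁². -/
theorem yieldsFlat_A3_twelve {G : Subgroup SL3} (hG : (G : Set SL3).Finite)
    (hmin : IsMinimalDegreeInvariant G (e1 6)) {u : Fin 3 → Poly}
    (hu : ∀ i, u i ∈ invariantRing G) (h0 : u 0 = e1 6) (h1 : u 1 = xyz ^ 2)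
    (h2 : ∀ y, ev (u 2) y = -2 * ev (e2 6) y + 1 / 4 * ev (e1 6) y ^ 2) {t : V3 → V3} {c : ℂ}
    (hc : c ≠ 0)
    (ht : ∀ x, t x = ![5 / 12 * ev (e1 6) x, c * ev xyz x ^ 3, ev (u 2) x]) :
    YieldsFlat G (e1 6) (coordField u 2) (fun x => 5 / 12 * ev (e1 6) x) .A3 t := by
  obtain ⟨ρ, hρ⟩ := exists_root (-2) (n := 4) (by norm_num)
  have hρ0 : ρ ≠ 0 := by rintro rfl; norm_num at hρ
  refine yieldsFlat_of_symNhd hG (m := 6) (by norm_num) hmin (coordField_invariant hu 2)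
    (const_mul_invariant hmin.2.1 _) fun N s hs => ⟨_, _, hs.chart_A3 (by norm_num) hρ0
    (fun x hx => by
      rw [hρ]
      exact hs.coordField_triple_two (by norm_num) hx one_ne_zero (by norm_num) (by simp [h0]) h1 h2)
    (fun x _ => by norm_num), diagonal ![5 / (6 * ρ ^ 2), c / (2 * ρ ^ 3), 1], ?_, fun x hx => ?_⟩
  · rw [Matrix.det_diagonal, Fin.prod_univ_three]
    simp [hρ0, hc]
  · have hE : Complex.exp ((6 : ℕ) / 2 * s x) = ev xyz x ^ 3 := by
      rw [← hs.exp_nsmul hx]; congr 1; norm_num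
    ext i
    rw [ht, Matrix.mulVec_diagonal]
    fin_cases i
    · simp [flatA3]; field_simp; ring
    · simp only [flatA3, hE]
      simp; field_simp
    · simp [flatA3, hρ, h2]; ring

/-- In the squares of the variables, with elementary symmetric functions a, b, c, the discriminant
a²b² - 4b³ - 4a³c + 18abc - 27c² is a generator and expresses b³. The sum sought is b³ - 3abc + 3c².
-/
theorem e2_six_mem {S : Subalgebra ℂ Poly} (h1 : e1 6 ∈ S) (h3 : xyz ^ 2 ∈ S)
    (hQ : (X 0 ^ 4 * X 1 ^ 2 + X 0 ^ 2 * X 1 ^ 4 + X 1 ^ 4 * X 2 ^ 2 + X 1 ^ 2 * X 2 ^ 4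
      + X 2 ^ 4 * X 0 ^ 2 + X 2 ^ 2 * X 0 ^ 4 : Poly) ∈ S) (hv : vdm 2 ^ 2 ∈ S) : e2 6 ∈ S := by
  have hC : ∀ c : ℂ, (C c : Poly) ∈ S := fun c => S.algebraMap_mem c
  generalize hq : (X 0 ^ 4 * X 1 ^ 2 + X 0 ^ 2 * X 1 ^ 4 + X 1 ^ 4 * X 2 ^ 2 + X 1 ^ 2 * X 2 ^ 4
      + X 2 ^ 4 * X 0 ^ 2 + X 2 ^ 2 * X 0 ^ 4 : Poly) = q at hQ
  -- Substituting ab = q + 3c and a³ = p₆ + 3q + 6c, with c = (xyz)², collects the coefficients.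
  -- They are left as sums: each summand comes from one of the terms a²b², -4a³c, 18abc, -27c²,
  -- -12abc, 12c².
  have e : e2 6 = C (1 / 4) * (q * q + C (6 - 12 + 18 - 12) * (q * xyz ^ 2)
      + C (9 - 24 + 54 - 27 - 36 + 12) * (xyz ^ 2 * xyz ^ 2) - C 4 * (e1 6 * xyz ^ 2) - vdm 2 ^ 2) := by
    refine ev_injective fun x => ?_
    rw [← hq]
    simp [e1, e2, xyz, vdm]
    ring
  rw [e]
  exact mul_mem (hC _) (sub_mem (sub_mem (add_mem (add_mem (mul_mem hQ hQ)
    (mul_mem (hC _) (mul_mem hQ h3))) (mul_mem (hC _) (mul_mem h3 h3)))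
    (mul_mem (hC _) (mul_mem h1 h3))) hv)

theorem family_twentysix {m : ℕ} (hm : 2 ≤ m) (hev : Even m)
    (h : FiniteWithInvariants G (gens26 m)) :
    (HasFlatHessian G ↔ m = 2) ∧
      (m = 2 →
        (∀ i, symm3 6 i ∈ invariantRing G) ∧
        YieldsFlat G (e1 6) (coordField ![e1 6, xyz ^ 2, e1 12 - C (3 / 4) * e1 6 ^ 2] 2)
          (fun x => 5 / 12 * ev (e1 6) x) .A3
          (fun x => ![5 / 12 * ev (e1 6) x, ((√(20 / 3) : ℝ) : ℂ) * ev xyz x ^ 3,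
            ev (e1 12) x - 3 / 4 * ev (e1 6) x ^ 2]) ∧
        Yields G (e1 6) (dualField ![e1 6, xyz ^ 2, e1 12 - C (3 / 4) * e1 6 ^ 2] 2 4)
          (fun x => -(5 / 12 * ev (e1 6) x)) .A3d ∧
        YieldsFlatLog G (e1 6) (coordField ![C (5 / 6) * e1 6, xyz ^ 2, e1 12 - e1 6 ^ 2] 0)
          (fun x => 5 / 6 * ev (e1 6) x) .B31 xyz
          (fun x l => ![5 / 6 * ev (e1 6) x, Complex.exp (3 / 2 * l),
            -5 / 6 * Complex.exp (-3 / 2 * l) * (ev (e1 12) x - ev (e1 6) x ^ 2)])) := by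
  have d1 : (xyz ^ 2).IsHomogeneous (3 * 2) := hom_xyz.pow 2
  have d2 : (X 0 ^ (2 * m) * X 1 ^ m + X 0 ^ m * X 1 ^ (2 * m) + X 1 ^ (2 * m) * X 2 ^ m
      + X 1 ^ m * X 2 ^ (2 * m) + X 2 ^ (2 * m) * X 0 ^ m + X 2 ^ m * X 0 ^ (2 * m)
      : Poly).IsHomogeneous (2 * m + m) := by
    have a : ∀ i j, (X i ^ (2 * m) * X j ^ m : Poly).IsHomogeneous (2 * m + m) := fun i j =>
      (hom_pow _ _).mul (hom_pow _ _)
    have b : ∀ i j, (X i ^ m * X j ^ (2 * m) : Poly).IsHomogeneous (2 * m + m) := fun i j => by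
      rw [mul_comm]; exact a j i
    exact (((((a 0 1).add (b 0 1)).add (a 1 2)).add (b 1 2)).add (a 2 0)).add (b 2 0)
  have d3 : (xyz * vdm m).IsHomogeneous (3 + (m + m + m)) := hom_xyz.mul (hom_vdm m)
  have d4 : (vdm m ^ 2).IsHomogeneous ((m + m + m) * 2) := (hom_vdm m).pow 2
  suffices hmain : m = 2 → _ from ⟨⟨fun hF => ?_, fun h2 => (hmain h2).2.2.1.hasFlatHessian⟩, hmain⟩
  · by_contra hm2
    -- Parity excludes m = 3, so p_{3m} and the other generators have degree above six and only
    -- (xyz)² is minimal.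
    have : 4 ≤ m := by obtain ⟨k, rfl⟩ := hev; omega
    refine h.not_hasFlatHessian (n := 6) (by norm_num) (t := xyz ^ 2) (by simp [gens26])
      (pow_ne_zero _ xyz_ne_zero) d1 ?_ (fun c hc => not_isFlatHessian_xyz_sq hc) hF
    rintro s (rfl | rfl | rfl | rfl | rfl)
    exacts [.inr ⟨_, by omega, hom_e1 _⟩, .inl rfl, .inr ⟨_, by omega, d2⟩,
      .inr ⟨_, by omega, d3⟩, .inr ⟨_, by omega, d4⟩]
  rintro rfl
  have h1 : e1 6 ∈ invariantRing G := h.mem (by simp [gens26])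
  have h3 : xyz ^ 2 ∈ invariantRing G := h.mem (by simp [gens26])
  have h2 : e2 6 ∈ invariantRing G := e2_six_mem h1 h3 (h.mem (by simp [gens26]))
    (h.mem (by simp [gens26]))
  have hC : ∀ c : ℂ, (C c : Poly) ∈ invariantRing G := fun c =>
    (invariantRing G).algebraMap_mem c
  have e12 : e1 12 = e1 6 ^ 2 - (e2 6 + e2 6) := by rw [e1, e1, e2]; ring
  have ev12 : ∀ y, ev (e1 12) y = ev (e1 6) y ^ 2 - 2 * ev (e2 6) y := fun y => by
    rw [e12, ev_sub, ev_add, ev_pow]; ring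
  have h12 : e1 12 ∈ invariantRing G := by
    rw [e12]; exact sub_mem (pow_mem h1 2) (add_mem h2 h2)
  have hmin : IsMinimalDegreeInvariant G (e1 6) := h.isMinimal (n := 6) (by norm_num) (by
    rintro s (rfl | rfl | rfl | rfl | rfl)
    exacts [⟨_, by norm_num, hom_e1 _⟩, ⟨_, by norm_num, d1⟩, ⟨_, by norm_num, d2⟩,
      ⟨_, by norm_num, d3⟩, ⟨_, by norm_num, d4⟩]) h1 (e1_ne_zero 6 (by norm_num)) (hom_e1 6)
  have hu : ∀ i, (![e1 6, xyz ^ 2, e1 12 - C (3 / 4) * e1 6 ^ 2] : Fin 3 → Poly) i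
      ∈ invariantRing G := by
    intro i; fin_cases i
    exacts [h1, h3, sub_mem h12 (mul_mem (hC _) (pow_mem h1 2))]
  have hev2 : ∀ y, ev (e1 12 - C (3 / 4) * e1 6 ^ 2) y
      = -2 * ev (e2 6) y + 1 / 4 * ev (e1 6) y ^ 2 := fun y => by
    simp only [ev_sub, ev_mul, ev_C, ev_pow, ev12]; ring
  refine ⟨fun i => ?_, ?_, ?_, ?_⟩
  · fin_cases i
    · exact h1
    · exact h2
    · show xyz ^ (2 * 3) ∈ _
      rw [pow_mul]; exact pow_mem h3 3
  · refine yieldsFlat_A3_twelve h.1 hmin hu rfl rfl hev2 (c := ((√(20 / 3) : ℝ) : ℂ)) ?_ fun x => ?_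
    · exact Complex.ofReal_ne_zero.2 (Real.sqrt_pos.2 (by norm_num)).ne'
    · simp
  · have := yields_A3d_triple h.1 (m := 6) (by norm_num) hmin hu (a := -2) (b := 1 / 4)
      (by norm_num) rfl rfl hev2
    convert this using 3
    norm_num
  -- Since p₁₂ - p₆² = -2e₂, the listed factor -5/6 becomes 5/3 in front of e₂.
  · refine yieldsFlatLog_B31_triple h.1 (m := 6) (by norm_num) hmin (fun i => ?_) (c := 5 / 6)
      (a := -2) (by norm_num) (by norm_num) (fun y => by simp) rfl (fun y => ?_)
      (fun x => by norm_num) (n := 1)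
      (fun x => (pow_one _).symm) (b0 := 5 / 6) (b2 := 5 / 3) (by norm_num) (by norm_num)
      (fun x l => rfl) (fun x l => ?_) (fun x l => ?_)
    · fin_cases i
      exacts [mul_mem (hC _) h1, h3, sub_mem h12 (pow_mem h1 2)]
    · simp only [Matrix.cons_val, ev_sub, ev_pow, ev12]; ring
    · simp only [Matrix.cons_val_one, Matrix.cons_val_zero]
      congr 1; push_cast; ring
    · simp only [Matrix.cons_val, ev12]
      rw [show (-3 / 2 * ((1 : ℕ) * l) : ℂ) = -((6 : ℕ) / 4) * l by push_cast; ring]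
      ring

/-! ### Inequivalence of the types -/

theorem IsEquivalenceOn.mul_mulM {U : Set V3} {φ : V3 → V3} {c : ℂ} {M M' : FrobData}
    (h : IsEquivalenceOn U φ c M M') {x : V3} (hx : x ∈ U) (i : Fin 3) :
    jac φ x * M.mulM i x = (∑ a, jac φ x a i • M'.mulM a (φ x)) * jac φ x := by
  ext k j
  have := (h.2.2.2 x hx).2.2 i j k
  rw [Matrix.mul_apply, Finset.sum_mul, Matrix.sum_apply]
  refine this.trans (Finset.sum_congr rfl fun a _ => ?_)
  rw [Matrix.smul_mul, Matrix.smul_apply, Matrix.mul_apply, smul_eq_mul, Finset.mul_sum]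
  exact Finset.sum_congr rfl fun b _ => by simp only [FrobData.mulM, Matrix.of_apply]; ring

namespace FrobType

/-- The matrix of the trace form of the algebras on the tangent spaces. -/
def traceForm (T : FrobType) (t : V3) : Mat3 :=
  Matrix.of fun i j => (T.mulMat i t * T.mulMat j t).trace

/-- The trace of the trace form with respect to the flat metric. -/
def traceInv (T : FrobType) (t : V3) : ℂ := (T.etaInv * T.traceForm t).trace

/-- The function `α t₀ᵐ + β t₀ᵏ t₁`, with parameters `(α, m, β, k)` depending on the type. -/
def param : FrobType → ℂ × ℤ × ℂ × ℤ
  | .A3 => (6, 1, 0, 0)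
  | .A3d => (-6, -3, 0, 0)
  | .B3 => (7, 2, 6, 0)
  | .B3d => (7, -4, -6, -3)
  | .H3 => (4, 4, 12, 1)
  | .H3d => (4, -6, 12, -4)
  | .B31 => (0, 0, 0, 0)
  | .T3 => (-6, 0, 0, 0)

/-- This function is an invariant of a local equivalence up to the factor c². It depends on t₀ and,
at most linearly, on t₁, which leaves its exponents to compare. B₃¹ is excluded since the length of
its unity field already sets it apart. -/
theorem traceInv_eq {T : FrobType} (hT : T ≠ .B31) {t : V3} (ht : t ∈ T.domain) (h0 : t 0 ≠ 0) :
    T.traceInv t = T.param.1 * t 0 ^ T.param.2.1 + T.param.2.2.1 * (t 0 ^ T.param.2.2.2 * t 1) := by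
  have hu := T.mulMat_unit ht
  -- For the antidiagonal η with unity ∂₂, the pairs (0,2) and (2,0) contribute tr C₀ each and the
  -- pair (1,1) contributes tr C₁².
  have std : ∀ C : Fin 3 → Mat3, C 2 = 1 → (!![0, 0, 1; 0, 1, 0; 1, 0, 0] *
      (Matrix.of fun i j => (C i * C j).trace : Mat3)).trace
        = 2 * (C 0).trace + (C 1 * C 1).trace := fun C hC => by
    rw [Matrix.trace_fin_three]
    simp [Matrix.mul_apply (M := !![_, _, _; _, _, _; _, _, _]), Fin.sum_univ_three, hC]
    ring
  cases T
  case B31 => exact absurd rfl hT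
  case T3 =>
    have h1 : mulMat .T3 1 t = 1 := hu
    have key : traceInv .T3 t = 2 * (mulMat .T3 0 t).trace + 6
        - 1 / 2 * (mulMat .T3 2 t * mulMat .T3 2 t).trace := by
      rw [traceInv, traceForm, Matrix.trace_fin_three]
      simp [Matrix.mul_apply (M := !![_, _, _; _, _, _; _, _, _]), Fin.sum_univ_three, h1, etaInv]
      ring
    rw [key, mulMat_T3_0, mulMat_T3_2]
    simp [param, Matrix.trace_fin_three, Matrix.mul_apply, Fin.sum_univ_three]
    norm_num
  all_goals refine (std _ hu).trans ?_
  case A3 | B3 | H3 =>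
    first
      | rw [mulMat_A3_0, mulMat_A3_1]
      | rw [mulMat_B3_0, mulMat_B3_1]
      | rw [mulMat_H3_0, mulMat_H3_1]
    simp [param, Matrix.trace_fin_three, Matrix.mul_apply, Fin.sum_univ_three]
    norm_cast
    ring
  case A3d | B3d | H3d =>
    first
      | rw [mulMat_A3d_0 h0, mulMat_A3d_1 h0]
      | rw [mulMat_B3d_0 h0, mulMat_B3d_1 h0]
      | rw [mulMat_H3d_0 h0, mulMat_H3d_1 h0]
    simp [param, Matrix.trace_fin_three, Matrix.mul_apply, Fin.sum_univ_three]
    simp only [_root_.zpow_neg, ← zpow_natCast]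
    field_simp
    norm_cast
    ring

end FrobType

/-! ### What a local equivalence preserves. -/

section
variable {S T : FrobType} {U : Set V3} {φ : V3 → V3} {c : ℂ} (hUS : U ⊆ S.domain)
  (hφ : Set.MapsTo φ U T.domain) (h : IsEquivalenceOn U φ c S.model T.model) {x : V3} (hx : x ∈ U)
include hUS hφ h hx

theorem equiv_metric : (jac φ x)ᵀ * T.eta * jac φ x = c ^ 2 • S.eta := by
  have := (h.2.2.2 x hx).2.1
  rwa [T.metric_eq_eta _ (hφ hx), S.metric_eq_eta _ (hUS hx)] at this

theorem equiv_coMetric : jac φ x * S.etaInv * (jac φ x)ᵀ = c ^ 2 • T.etaInv := by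
  have hJ := (h.2.2.2 x hx).1
  have hJt : ((jac φ x)ᵀ).det ≠ 0 := by rwa [Matrix.det_transpose]
  have hc : c ^ 2 ≠ 0 := pow_ne_zero 2 h.2.2.1
  have e := congrArg (fun M => jac φ x * M⁻¹ * (jac φ x)ᵀ) (equiv_metric hUS hφ h hx)
  have hS : (c ^ 2 • S.eta)⁻¹ = (c ^ 2)⁻¹ • S.etaInv := Matrix.inv_eq_left_inv (by
    rw [Matrix.smul_mul, Matrix.mul_smul, smul_smul, inv_mul_cancel₀ hc, one_smul, S.etaInv_mul])
  simp only [hS, Matrix.mul_inv_rev, ← T.eta_inv] at e ⊢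
  rw [mul_assoc, mul_assoc, mul_assoc, inv_mul_self_of hJt, mul_one, ← mul_assoc,
    self_mul_inv_of hJ, one_mul] at e
  rw [e, Matrix.mul_smul, Matrix.smul_mul, smul_smul, mul_inv_cancel₀ hc, one_smul]

/-- An isomorphism of algebras preserves the unit: the image of the unity field multiplies as the
identity, and applied to the other unity field it returns that field. -/
theorem equiv_unity (k : Fin 3) :
    jac φ x k S.unityIndex = (1 : Mat3) k T.unityIndex := by
  have hJ := (h.2.2.2 x hx).1
  have e : S.model.mulM S.unityIndex x = 1 := S.mulMat_unit (hUS hx)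
  have h1 := h.mul_mulM hx S.unityIndex
  rw [e, mul_one] at h1
  have h2 := congrArg (fun M => M * (jac φ x)⁻¹) h1
  simp only [mul_assoc, self_mul_inv_of hJ, mul_one] at h2
  have hu : ∀ a, T.model.mulM a (φ x) k T.unityIndex = (1 : Mat3) k a := fun a => by
    have e1 : T.model.mulM a (φ x) k T.unityIndex = T.model.mulM T.unityIndex (φ x) k a :=
      T.flatFrob.comm _ (hφ hx) _ _ _
    have e2 : T.model.mulM T.unityIndex (φ x) = 1 := T.mulMat_unit (hφ hx)
    rw [e1, e2]
  rw [h2, Matrix.sum_apply]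
  simp only [Matrix.smul_apply, hu, Matrix.one_apply, smul_eq_mul, mul_ite, mul_one, mul_zero,
    Finset.sum_ite_eq, Finset.mem_univ, if_true]

theorem equiv_eta_unity (j : Fin 3) :
    ∑ k, jac φ x k j * T.eta k T.unityIndex = c ^ 2 * S.eta j S.unityIndex := by
  have := congrFun (congrFun (equiv_metric hUS hφ h hx) j) S.unityIndex
  rw [mul_assoc, Matrix.mul_apply, Matrix.smul_apply, smul_eq_mul] at this
  rw [← this]
  refine Finset.sum_congr rfl fun k _ => ?_
  rw [Matrix.transpose_apply, Matrix.mul_apply]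
  simp only [equiv_unity hUS hφ h hx, Matrix.one_apply, mul_ite, mul_one, mul_zero,
    Finset.sum_ite_eq', Finset.mem_univ, if_true]

/-- The number η(e,e) is preserved up to c² ≠ 0 and is nonzero for B₃¹ only. -/
theorem equiv_B31 : (S = .B31 ↔ T = .B31) := by
  have hc : c ^ 2 ≠ 0 := pow_ne_zero 2 h.2.2.1
  have e := equiv_eta_unity hUS hφ h hx S.unityIndex
  simp only [equiv_unity hUS hφ h hx, Matrix.one_apply, ite_mul, one_mul, zero_mul,
    Finset.sum_ite_eq', Finset.mem_univ, if_true] at e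
  cases S <;> cases T <;> simp [FrobType.eta, FrobType.unityIndex, hc] at e ⊢

/-- For these types lowering the unity field gives exactly dt₀, so the pullback of dt₀ is c²dt₀. -/
theorem equiv_row (hS : S ≠ .B31) (hT : T ≠ .B31) : jac φ x 0 0 = c ^ 2 := by
  have e := equiv_eta_unity hUS hφ h hx 0
  cases S <;> cases T <;>
    simp [FrobType.eta, FrobType.unityIndex, Fin.sum_univ_three] at e hS hT ⊢ <;> exact e

/-- The trace form depends on the algebras only and is pulled back exactly, while the inverse metric
scales by c². -/
theorem equiv_traceInv : S.traceInv x = c ^ 2 * T.traceInv (φ x) := by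
  have hJ := (h.2.2.2 x hx).1
  have e : S.traceForm x = (jac φ x)ᵀ * T.traceForm (φ x) * jac φ x := by
    ext i j
    have hc : ∀ i, S.mulMat i x
        = (jac φ x)⁻¹ * (∑ a, jac φ x a i • T.mulMat a (φ x)) * jac φ x := fun i => by
      have := congrArg (fun M => (jac φ x)⁻¹ * M) (h.mul_mulM hx i)
      rwa [← mul_assoc, inv_mul_self_of hJ, one_mul, ← mul_assoc] at this
    rw [FrobType.traceForm, Matrix.of_apply, hc, hc]
    rw [show ∀ A B : Mat3, (jac φ x)⁻¹ * A * jac φ x * ((jac φ x)⁻¹ * B * jac φ x)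
      = (jac φ x)⁻¹ * (A * B * jac φ x) from fun A B => by
        rw [mul_assoc (jac φ x)⁻¹ B, mul_assoc ((jac φ x)⁻¹ * A), ← mul_assoc (jac φ x) (jac φ x)⁻¹,
          self_mul_inv_of hJ, one_mul, mul_assoc, mul_assoc],
      Matrix.trace_mul_comm, mul_assoc, self_mul_inv_of hJ, mul_one, mul_assoc, Matrix.mul_apply,
      Finset.sum_mul, Matrix.trace_sum]
    refine Finset.sum_congr rfl fun a _ => ?_
    rw [Finset.mul_sum, Matrix.trace_sum, Matrix.mul_apply, Finset.mul_sum]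
    refine Finset.sum_congr rfl fun b _ => ?_
    rw [Matrix.smul_mul, Matrix.mul_smul, Matrix.trace_smul, Matrix.trace_smul,
      Matrix.transpose_apply, FrobType.traceForm, Matrix.of_apply, smul_eq_mul, smul_eq_mul]
    ring
  rw [FrobType.traceInv, e, ← mul_assoc, Matrix.trace_mul_comm, ← mul_assoc, ← mul_assoc,
    equiv_coMetric hUS hφ h hx, Matrix.smul_mul, Matrix.trace_smul, smul_eq_mul,
    FrobType.traceInv]

end

/-- The parameters as a function. -/
def paramFun (P : ℂ × ℤ × ℂ × ℤ) (t : V3) : ℂ :=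
  P.1 * t 0 ^ P.2.1 + P.2.2.1 * (t 0 ^ P.2.2.2 * t 1)

theorem paramFun_deriv (P : ℂ × ℤ × ℂ × ℤ) {t : V3} (h0 : t 0 ≠ 0) :
    DifferentiableAt ℂ (paramFun P) t ∧ pd 1 (paramFun P) t = P.2.2.1 * t 0 ^ P.2.2.2 ∧
      pd 2 (paramFun P) t = 0 := by
  have hc : ∀ i : Fin 3, DifferentiableAt ℂ (fun y : V3 => y i) t := fun i =>
    differentiableAt_apply i t
  have hz : ∀ m : ℤ, DifferentiableAt ℂ (fun y : V3 => y 0 ^ m) t := fun m =>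
    (hc 0).zpow (.inl h0)
  have hzd : ∀ (m : ℤ) (i : Fin 3), i ≠ 0 → pd i (fun y : V3 => y 0 ^ m) t = 0 := fun m i hi => by
    rw [pd_comp₁ (h := fun y : V3 => y 0) (hasDerivAt_zpow m (t 0) (.inl h0)) (hc 0), pd_coord,
      if_neg hi.symm, mul_zero]
  have h1 : DifferentiableAt ℂ (fun y : V3 => P.1 * y 0 ^ P.2.1) t :=
    (differentiableAt_const P.1).mul (hz P.2.1)
  have h2 : DifferentiableAt ℂ (fun y : V3 => y 0 ^ P.2.2.2 * y 1) t := (hz P.2.2.2).mul (hc 1)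
  have h3 : DifferentiableAt ℂ (fun y : V3 => P.2.2.1 * (y 0 ^ P.2.2.2 * y 1)) t :=
    (differentiableAt_const _).mul h2
  refine ⟨h1.add h3, ?_, ?_⟩
  · unfold paramFun
    rw [pd_add h1 h3, pd_const_mul (hz _), pd_const_mul h2,
      pd_mul (hz _) (hc 1), hzd _ _ (by decide), hzd _ _ (by decide), pd_coord]
    simp
  · unfold paramFun
    rw [pd_add h1 h3, pd_const_mul (hz _), pd_const_mul h2,
      pd_mul (hz _) (hc 1), hzd _ _ (by decide), hzd _ _ (by decide), pd_coord]
    simp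

/-- Monomials related by a map with constant nonzero derivative have equal exponents. -/
theorem exponent_eq {U : Set V3} (hU : IsOpen U) (hne : U.Nonempty) {u : V3 → ℂ} {a b c : ℂ}
    {m n : ℤ} (hc : c ≠ 0) (ha : a ≠ 0) (hx0 : ∀ x ∈ U, x 0 ≠ 0) (hu0 : ∀ x ∈ U, u x ≠ 0)
    (hd : ∀ x ∈ U, DifferentiableAt ℂ u x) (hp : ∀ x ∈ U, pd 0 u x = c)
    (h : ∀ x ∈ U, a * x 0 ^ n = b * u x ^ m) : n = m := by
  have hcd : ∀ x : V3, DifferentiableAt ℂ (fun y : V3 => y 0) x := differentiableAt_apply 0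
  have key : ∀ x ∈ U, n * u x = m * c * x 0 := fun x hx => by
    have h0 := hx0 x hx
    have h1 := hu0 x hx
    have e := pd_congr (Filter.eventuallyEq_of_mem (hU.mem_nhds hx) h) 0
    rw [pd_const_mul ((hcd x).zpow (.inl h0)), pd_const_mul ((hd x hx).zpow (.inl h1)),
      pd_comp₁ (h := fun y : V3 => y 0) (hasDerivAt_zpow n (x 0) (.inl h0)) (hcd x), pd_coord,
      pd_comp₁ (h := u) (hasDerivAt_zpow m (u x) (.inl h1)) (hd x hx), hp x hx, if_pos rfl,
      zpow_sub_one₀ h0, zpow_sub_one₀ h1] at e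
    have e' := h x hx
    have hz : a * x 0 ^ n ≠ 0 := mul_ne_zero ha (zpow_ne_zero _ h0)
    refine mul_left_cancel₀ hz ?_
    field_simp at e
    linear_combination e - (m * c * x 0) * e'
  obtain ⟨x, hx⟩ := hne
  have e := pd_congr (Filter.eventuallyEq_of_mem (hU.mem_nhds hx) key) 0
  rw [pd_const_mul (hd x hx), pd_const_mul (hcd x), pd_coord, hp x hx, if_pos rfl, mul_one] at e
  exact_mod_cast mul_right_cancel₀ hc e

/-- For the standard inverse metric a covector without third component has norm given by its middle
component alone. In type T₃ the middle component has to vanish as well. -/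
theorem eta_form {T : FrobType} (hT : T ≠ .B31) {g : V3} (h2 : g 2 = 0) (h1 : T = .T3 → g 1 = 0) :
    g ⬝ᵥ (T.etaInv *ᵥ g) = g 1 ^ 2 := by
  cases T
  case B31 => exact absurd rfl hT
  case T3 =>
    simp [FrobType.etaInv, dotProduct, Matrix.mulVec, Fin.sum_univ_three, h2, h1 rfl]
  all_goals
    simp [FrobType.etaInv, dotProduct, Matrix.mulVec, Fin.sum_univ_three, h2]
    ring

/-- Let H = αt₀ᵐ + βt₀ᵏt₁ be the contracted trace form. An equivalence multiplies H by c², and the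
squared norm (βt₀ᵏ)² of dH by c⁶. As φ₀ has constant derivative c² along t₀, matching powers must
have equal exponents: k is determined if β ≠ 0, and m if β = 0. -/
theorem not_locallyEquivalent {S T : FrobType} (hST : S ≠ T) :
    ¬ LocallyEquivalent S.domain S.model T.domain T.model := by
  rintro ⟨U, φ, c, hU, hne, hUS, hφ, h⟩
  have hc : c ≠ 0 := h.2.2.1
  have hdφ : ∀ x ∈ U, DifferentiableAt ℂ φ x := fun x hx => h.1.differentiableAt (hU.mem_nhds hx)
  have hd : ∀ x ∈ U, DifferentiableAt ℂ (fun y => φ y 0) x := fun x hx =>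
    differentiableAt_pi.1 (hdφ x hx) 0
  have hB : S ≠ .B31 ∧ T ≠ .B31 := by
    obtain ⟨x, hx⟩ := hne
    have := equiv_B31 hUS hφ h hx
    constructor <;> rintro rfl <;> simp_all
  obtain ⟨hS, hT⟩ := hB
  have hp : ∀ x ∈ U, pd 0 (fun y => φ y 0) x = c ^ 2 := fun x hx => equiv_row hUS hφ h hx hS hT
  obtain ⟨V, hVU, hV, hVne, hx0, hu0⟩ : ∃ V ⊆ U, IsOpen V ∧ V.Nonempty ∧ (∀ x ∈ V, x 0 ≠ 0) ∧
      ∀ x ∈ V, φ x 0 ≠ 0 := by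
    obtain ⟨y, hy0, hyU⟩ := (dense_ev_ne_zero (X_ne_zero (R := ℂ) (0 : Fin 3))).exists_mem_open hU hne
    have hU' : IsOpen (U ∩ {x | x 0 ≠ 0}) :=
      hU.inter (isOpen_ne_fun (continuous_apply 0) continuous_const)
    -- If φ₀ vanished on an open set, its derivative c² would be zero.
    obtain ⟨z, hz, hz0⟩ : ∃ z ∈ U ∩ {x | x 0 ≠ 0}, φ z 0 ≠ 0 := by
      by_contra! hcon
      have hy : y ∈ U ∩ {x : V3 | x 0 ≠ 0} := ⟨hyU, by simpa using hy0⟩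
      have e := pd_congr (k := fun _ => 0) (Filter.eventuallyEq_of_mem (hU'.mem_nhds hy) hcon) 0
      rw [hp y hyU, pd_const] at e
      exact pow_ne_zero 2 hc e
    refine ⟨(U ∩ {x | x 0 ≠ 0}) ∩ (fun x => φ x 0) ⁻¹' {0}ᶜ, fun x hx => hx.1.1,
      ContinuousOn.isOpen_inter_preimage (fun x hx => (hd x hx.1).continuousAt.continuousWithinAt)
      hU' isOpen_compl_singleton, ⟨z, hz, hz0⟩, fun x hx => hx.1.2, fun x hx => hx.2⟩
  have hH : ∀ x ∈ V, paramFun S.param x = c ^ 2 * paramFun T.param (φ x) := fun x hx => by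
    have := equiv_traceInv hUS hφ h (hVU hx)
    rwa [FrobType.traceInv_eq hS (hUS (hVU hx)) (hx0 x hx),
      FrobType.traceInv_eq hT (hφ (hVU hx)) (hu0 x hx)] at this
  have hT3 : ∀ T : FrobType, T = .T3 → T.param.2.2.1 = 0 := by rintro _ rfl; rfl
  have hD : ∀ x ∈ V, (S.param.2.2.1 * x 0 ^ S.param.2.2.2) ^ 2
      = c ^ 6 * (T.param.2.2.1 * φ x 0 ^ T.param.2.2.2) ^ 2 := fun x hx => by
    obtain ⟨-, s1, s2⟩ := paramFun_deriv S.param (hx0 x hx)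
    obtain ⟨dT, t1, t2⟩ := paramFun_deriv T.param (hu0 x hx)
    -- By the chain rule dH scales by c²; its norm, being quadratic, picks up c⁴ from this and a
    -- further c² from the inverse metric.
    have e : (fun i => pd i (paramFun S.param) x)
        = c ^ 2 • ((jac φ x)ᵀ *ᵥ fun a => pd a (paramFun T.param) (φ x)) := by
      ext i
      rw [pd_congr (Filter.eventuallyEq_of_mem (hV.mem_nhds hx) hH) i,
        pd_const_mul (h := fun y => paramFun T.param (φ y)) (dT.comp x (hdφ x (hVU hx))), pd_comp dT (hdφ x (hVU hx))]
      rfl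
    rw [← s1, ← t1, ← eta_form hS (g := fun i => pd i (paramFun S.param) x) s2
      (fun h => by rw [s1, hT3 S h, zero_mul]), ← eta_form hT (g := fun i =>
      pd i (paramFun T.param) (φ x)) t2 (fun h => by rw [t1, hT3 T h, zero_mul]), e]
    generalize (fun a => pd a (paramFun T.param) (φ x)) = g
    have hm : g ⬝ᵥ ((jac φ x * S.etaInv * (jac φ x)ᵀ) *ᵥ g) = c ^ 2 * (g ⬝ᵥ (T.etaInv *ᵥ g)) := by
      rw [equiv_coMetric hUS hφ h (hVU hx), Matrix.smul_mulVec, dotProduct_smul, smul_eq_mul]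
    rw [smul_dotProduct, Matrix.mulVec_smul, dotProduct_smul, smul_eq_mul, smul_eq_mul,
      Matrix.mulVec_transpose, ← Matrix.dotProduct_mulVec, ← Matrix.mulVec_transpose,
      Matrix.mulVec_mulVec, Matrix.mulVec_mulVec, hm]
    ring
  have hβ : S.param.2.2.1 = 0 ↔ T.param.2.2.1 = 0 := by
    obtain ⟨x, hx⟩ := hVne
    have := hD x hx
    have hz := zpow_ne_zero S.param.2.2.2 (hx0 x hx)
    have hw := zpow_ne_zero T.param.2.2.2 (hu0 x hx)
    constructor
    · intro h0
      simpa [h0, hc, hw] using this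
    · intro h0
      simpa [h0, hz] using this
  -- Only the square of βt₀ᵏ is preserved, so the exponents are compared after doubling.
  have hk : S.param.2.2.1 ≠ 0 → S.param.2.2.2 = T.param.2.2.2 := fun h0 => by
    have := exponent_eq hV hVne (m := T.param.2.2.2 * 2) (n := S.param.2.2.2 * 2)
      (b := c ^ 6 * T.param.2.2.1 ^ 2) (pow_ne_zero 2 hc) (pow_ne_zero 2 h0) hx0 hu0
      (fun x hx => hd x (hVU hx)) (fun x hx => hp x (hVU hx)) (fun x hx => by
        have := hD x hx
        rw [_root_.zpow_mul, _root_.zpow_mul, zpow_ofNat, zpow_ofNat]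
        linear_combination this)
    omega
  have hm : S.param.2.2.1 = 0 → S.param.1 ≠ 0 → S.param.2.1 = T.param.2.1 := fun h0 ha =>
    exponent_eq hV hVne (b := c ^ 2 * T.param.1) (pow_ne_zero 2 hc) ha hx0 hu0
      (fun x hx => hd x (hVU hx)) (fun x hx => hp x (hVU hx)) (fun x hx => by
        have := hH x hx
        rw [paramFun, paramFun, h0, hβ.1 h0] at this
        linear_combination this)
  -- With β = 0 there are A₃, its dual and T₃, with m = 1, -3, 0; with β ≠ 0 there are B₃, its dual,
  -- H₃ and its dual, with k = 0, -3, 1, -4. No two types agree.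
  cases S <;> cases T <;> simp [FrobType.param] at hS hT hST hβ hk hm

end FrobOrbit

end

theorem mainTheorem9 :
    -- the eight types are Frobenius manifolds and pairwise inequivalent
    (∀ T : FrobType, IsFrobeniusManifold T.domain T.model) ∧
    (∀ S T : FrobType, S ≠ T → ¬ LocallyEquivalent S.domain S.model T.domain T.model) ∧
    -- the families are labelled as in the Watanabe-Rotillon list; (1)
    (∀ (m : ℕ) (G : Subgroup SL3), 1 < m → FiniteWithInvariants G (gens1 m) →
      (HasFlatHessian G ↔ m ≤ 3) ∧
      (m ≤ 3 → (∀ i, symm3 m i ∈ invariantRing G) ∧ FiveStructures G m) ∧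
      (m = 2 → TrivialStructure G)) ∧
    -- (2)
    (∀ (m : ℕ) (G : Subgroup SL3), 1 ≤ m → FiniteWithInvariants G (gens2 m) →
      (HasFlatHessian G ↔ m = 1) ∧
      (m = 1 → TrivialStructure G)) ∧
    -- (9)
    (∀ (m : ℕ) (G : Subgroup SL3), 1 < m → FiniteWithInvariants G (gens9 m) →
      (HasFlatHessian G ↔ m ≤ 3) ∧
      (m ≤ 3 → (∀ i, symm3 m i ∈ invariantRing G) ∧ FiveStructures G m)) ∧
    -- (11)
    (∀ (m : ℕ) (G : Subgroup SL3), 1 < m → FiniteWithInvariants G (gens11 m) →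
      (HasFlatHessian G ↔ m ≤ 6) ∧
      (m = 2 → (∀ i, symm3 m i ∈ invariantRing G) ∧ FiveStructures G m) ∧
      (3 ≤ m → m ≤ 6 →
        YieldsFlatLog G (e1 m) (coordField ![e1 m, xyz ^ 2, e2 m] 2)
          (fun x => ((m : ℂ) - 1) / (2 * m) * ev (e1 m) x) .A3 (xyz ^ 2)
          (fun x l => ![((m : ℂ) - 1) / (2 * m) * ev (e1 m) x, Complex.exp ((m : ℂ) / 4 * l),
            ev (e2 m) x - 1 / 8 * ev (e1 m) x ^ 2]) ∧
        Yields G (e1 m) (dualField ![e1 m, xyz ^ 2, e2 m] 2 4)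
          (fun x => -(((m : ℂ) - 1) / (2 * m) * ev (e1 m) x)) .A3d ∧
        YieldsFlatLog G (e1 m) (coordField ![e1 m, xyz ^ 2, e2 m] 0)
          (fun x => ((m : ℂ) - 1) / m * ev (e1 m) x) .B31 (xyz ^ 2)
          (fun x l => ![ev (e1 m) x, Complex.exp ((m : ℂ) / 8 * l),
            ev (e2 m) x * Complex.exp (-(m : ℂ) / 8 * l)]))) ∧
    -- (12)
    (∀ G : Subgroup SL3, FiniteWithInvariants G gens12 →
      HasFlatHessian G ∧
      YieldsFlat G (u12 0) (coordField u12 2) (fun x => 5 / 12 * ev (u12 0) x) .A3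
        (fun x => ![5 / 12 * ev (u12 0) x, 4 * ((√10 : ℝ) : ℂ) * Complex.I * ev (u12 1) x,
          ev (u12 2) x - 5 / 8 * ev (u12 0) x ^ 2]) ∧
      Yields G (u12 0) (dualField u12 2 4) (fun x => -(5 / 12 * ev (u12 0) x)) .A3d) ∧
    -- (14)
    (∀ G : Subgroup SL3, FiniteWithInvariants G gens14 →
      HasFlatHessian G ∧
      YieldsFlat G (u14 0) (coordField u14 2) (fun x => 1 / 10 * ev (u14 0) x) .H3
        (fun x => ![1 / 10 * ev (u14 0) x,
          ((√2 : ℝ) : ℂ) * ev (u14 1) x - ((√2 : ℝ) : ℂ) * ev (u14 0) x ^ 3,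
          14 * ev (u14 0) x ^ 5 - 20 * ev (u14 1) x * ev (u14 0) x ^ 2 + ev (u14 2) x]) ∧
      Yields G (u14 0) (dualField u14 2 10) (fun x => -(1 / 10 * ev (u14 0) x)) .H3d) ∧
    -- (18)
    (∀ (p q : ℕ) (G : Subgroup SL3), 1 ≤ p → 2 ≤ q → FiniteWithInvariants G (gens18 p q) →
      (HasFlatHessian G ↔ p = 1 ∧ q ≤ 3) ∧
      (p = 1 → q ≤ 3 →
        (∀ i, symm3 (2 * q) i ∈ invariantRing G) ∧
        YieldsFlat G (e1 (2 * q))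
          (coordField ![C ((2 * (q : ℂ) - 1) / (2 * q)) * e1 (2 * q), C (1 / 2) * X 2 ^ (2 * q),
            (X 0 * X 1) ^ (2 * q)] 1)
          (fun x => (2 * (q : ℂ) - 1) / (2 * q) * ev (e1 (2 * q)) x) .T3
          (fun x => ![(2 * (q : ℂ) - 1) / (2 * q) * ev (e1 (2 * q)) x, 1 / 2 * x 2 ^ (2 * q),
            (x 0 * x 1) ^ q]) ∧
        YieldsFlatLog G (e1 (2 * q))
          (coordField ![C ((2 * (q : ℂ) - 1) / (2 * q)) * e1 (2 * q), xyz ^ 2, -2 * e2 (2 * q)] 0)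
          (fun x => (2 * (q : ℂ) - 1) / (2 * q) * ev (e1 (2 * q)) x) .B31 (xyz ^ 2)
          (fun x l => ![(2 * (q : ℂ) - 1) / (2 * q) * ev (e1 (2 * q)) x,
            Complex.exp ((q : ℂ) / 4 * l),
            -2 * ev (e2 (2 * q)) x * Complex.exp (-(q : ℂ) / 4 * l)]) ∧
        YieldsFlatLog G (e1 (2 * q))
          (coordField ![e1 (2 * q), xyz ^ 2, -2 * e2 (2 * q)] 2)
          (fun x => (2 * (q : ℂ) - 1) / (4 * q) * ev (e1 (2 * q)) x) .A3 (xyz ^ 2)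
          (fun x l => ![(2 * (q : ℂ) - 1) / (4 * q) * ev (e1 (2 * q)) x,
            2 * ((√(2 * (q : ℝ) - 1) / √(q : ℝ) : ℝ) : ℂ) * Complex.exp ((q : ℂ) / 2 * l),
            -2 * ev (e2 (2 * q)) x + 1 / 4 * ev (e1 (2 * q)) x ^ 2]) ∧
        Yields G (e1 (2 * q)) (dualField ![e1 (2 * q), xyz ^ 2, -2 * e2 (2 * q)] 2 4)
          (fun x => -((2 * (q : ℂ) - 1) / (4 * q) * ev (e1 (2 * q)) x)) .A3d)) ∧
    -- (26)
    (∀ (m : ℕ) (G : Subgroup SL3), 2 ≤ m → Even m → FiniteWithInvariants G (gens26 m) →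
      (HasFlatHessian G ↔ m = 2) ∧
      (m = 2 →
        (∀ i, symm3 6 i ∈ invariantRing G) ∧
        YieldsFlat G (e1 6) (coordField ![e1 6, xyz ^ 2, e1 12 - C (3 / 4) * e1 6 ^ 2] 2)
          (fun x => 5 / 12 * ev (e1 6) x) .A3
          (fun x => ![5 / 12 * ev (e1 6) x, ((√(20 / 3) : ℝ) : ℂ) * ev xyz x ^ 3,
            ev (e1 12) x - 3 / 4 * ev (e1 6) x ^ 2]) ∧
        Yields G (e1 6) (dualField ![e1 6, xyz ^ 2, e1 12 - C (3 / 4) * e1 6 ^ 2] 2 4)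
          (fun x => -(5 / 12 * ev (e1 6) x)) .A3d ∧
        YieldsFlatLog G (e1 6) (coordField ![C (5 / 6) * e1 6, xyz ^ 2, e1 12 - e1 6 ^ 2] 0)
          (fun x => 5 / 6 * ev (e1 6) x) .B31 xyz
          (fun x l => ![5 / 6 * ev (e1 6) x, Complex.exp (3 / 2 * l),
            -5 / 6 * Complex.exp (-3 / 2 * l) * (ev (e1 12) x - ev (e1 6) x ^ 2)]))) := by
  refine ⟨FrobType.isFrobeniusManifold, fun S T => not_locallyEquivalent,
    fun m G hm h => family_one hm h, fun m G hm h => family_two hm h,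
    fun m G hm h => family_nine hm h, fun m G hm h => family_eleven hm h,
    fun G h => group_twelve h, fun G h => group_fourteen h,
    fun p q G hp hq h => family_eighteen hp hq h,
    fun m G hm he h => family_twentysix hm he h⟩
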